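/- Let $M=G/H$ be one of the Hermitian symmetric spaces $\mathbb{C}^2=(U(2)\ltimes\mathbb{C}^2)/U(2)$, $\mathbb{CP}^2=SU(3)/S(U(2)\times U(1))$, its dual $\mathbb{CD}^2=SU(2,1)/S(U(2)\times U(1))$, $\mathbb{CP}^1\times\mathbb{CP}^1=(SU(2)\times SU(2))/(U(1)\times U(1))$, or its dual $(SU(1,1)\times SU(1,1))/(U(1)\times U(1))$ (in the two products both factors carry the same metric). Let $p_0\in M$ be the base point, $\mathfrak g=\mathfrak h\oplus\mathfrak m$ the symmetric splitting with $\mathfrak m\simeq T_{p_0}M$, let $\tau$ be the order four automorphism of $G$ (and of $\mathfrak g$) whose square is the symmetry of $M$ at $p_0$, such that the $(-1)$-eigenspace of $\tau$ in $\mathfrak g$ is $\mathbb{R}Y$, where $\operatorname{ad}Y$ is the complex structure of $\mathfrak m$; let $\mathfrak g^{\mathbb C}_k$ be the $i^k$-eigenspace of $\tau$ ($k=-1,0,1,2$), and let $(\epsilon_1,\epsilon_2)$ be a unitary frame of $\mathfrak m$ with $\epsilon_1-i\epsilon_2\in\mathfrak g^{\mathbb C}_{-1}$. An immersion $f$ of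 an open set $L\subset\mathbb{C}$ into $M$ is *Hamiltonian stationary Lagrangian* if it is Lagrangian and is a critical point of the area for all compactly supported variations in $M$ whose variation field $V$ is Hamiltonian along $f$, i.e. $\omega(V,df)=d\varphi$ with $\varphi\in C_c^\infty(L)$. For $f$ conformal, a *Lagrangian lift* of $f$ is a smooth $F:L\to G$ with $F\cdot p_0=f$ whose frame $(F_*\epsilon_1,F_*\epsilon_2)$ is equivalent modulo $SU(2)$ to the oriented orthonormal tangent frame $e^{-\rho}(\partial_xf,\partial_yf)$, where $e^{\rho}=|\partial_x f|=|\partial_y f|$. Put $\alpha=F^{-1}dF$ and, for $\lambda\in S^1$, $$\alpha_\lambda=\lambda^{-2}\alpha_2'+\lambda^{-1}\alpha_{-1}'+\alpha_0+\lambda\alpha_1''+\lambda^2\alpha_2'',$$ where $\alpha_k$ is the $\mathfrak g^{\mathbb C}_k$-component of $\alpha$, and $'$, $''$ denote $(1,0)$- and $(0,1)$-parts. **Local families.** Let $f:L\to M$ be a smooth conformal Hamiltonian stationary Lagrangian immersion of an open set $L\subset\mathbb{C}$. Every point of $L$ has a simply connected open neighbourhood in $L$ on which $f$ has a Lagrangian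 lift. If $U\subset L$ is open and simply connected and $F:U\to G$ is a Lagrangian lift of $f|_U$, then for all $\lambda\in S^1$, $z_0\in U$, $g_0\in G$ there is a unique smooth $F_\lambda:U\to G$ with $$dF_\lambda=F_\lambda\alpha_\lambda,\qquad F_\lambda(z_0)=g_0 .$$ The map $f_\lambda=F_\lambda\cdot p_0:U\to M$ is again a conformal Hamiltonian stationary Lagrangian immersion, and $F_\lambda$ is a Lagrangian lift of it. For $\lambda=1$ and $g_0=F(z_0)$ one has $F_1=F$ (so $f_1=f$ on $U$). **Period problems for global surfaces.** In each of the five spaces $M$ there is a conformal Hamiltonian stationary Lagrangian immersion $f:\mathbb{C}\to M$, periodic with respect to two $\mathbb{R}$-linearly independent periods $\omega_1,\omega_2$, with a Lagrangian lift $F:\mathbb{C}\to G$, such that for all but countably many $\lambda\in S^1$ no smooth solution $F_\lambda:\mathbb{C}\to G$ of $dF_\lambda=F_\lambda\alpha_\lambda$ gives a map $f_\lambda=F_\lambda\cdot p_0$ that is periodic with respect to $\omega_1$ and $\omega_2$. -/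

import Mathlib

open scoped ContDiff TensorProduct Matrix
open Complex Set MeasureTheory

attribute [local instance] Matrix.linftyOpNormedRing Matrix.linftyOpNormedAlgebra

noncomputable section

/-! ### Hermitian symmetric spaces of complex dimension two

`M = G / H` is realised as the orbit of the base point `p₀ = Y` under the adjoint action
`g ↦ g Y g⁻¹` of a matrix group `G`; here `Y` spans the centre direction of the Lie algebra of the
isotropy group `H`, `H` is exactly the stabiliser of `Y`, and `ad Y` is the complex structure on
`𝔪 = T_{p₀} M`. -/

/-- The matrix data describing `M = G / H`. -/
structure SymmetricModel where
  /-- index set of the matrices -/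
  ι : Type
  [fintypeι : Fintype ι]
  [decEqι : DecidableEq ι]
  /-- the matrix group `G` -/
  G : Set (Matrix ι ι ℂ)
  /-- the differential at the identity of the automorphism of order four of `G` -/
  τ : Matrix ι ι ℂ →ₗ[ℝ] Matrix ι ι ℂ
  /-- the base point `p₀ = Y`, such that `ad Y` is the complex structure on `𝔪` -/
  Y : Matrix ι ι ℂ
  /-- the reference unitary frame `(ε₁, ε₂)` of `𝔪`; it satisfies `τ ε₁ = - ε₂`,
  that is, `ε₁ - i ε₂` lies in the `i⁻¹`-eigenspace of `τ` -/
  ε : Fin 2 → Matrix ι ι ℂ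
  /-- the `Ad G`-invariant pairing inducing the Riemannian metric on the orbit of `Y` -/
  metric : Matrix ι ι ℂ → Matrix ι ι ℂ → ℝ

attribute [instance] SymmetricModel.fintypeι SymmetricModel.decEqι

/-- The real orthogonal matrix with blocks `(0, 1; -1, 0)` and `1`. -/
def quarterTurn : Matrix (Fin 2 ⊕ Fin 1) (Fin 2 ⊕ Fin 1) ℂ :=
  Matrix.fromBlocks !![0, 1; -1, 0] 0 0 1

/-- The real orthogonal matrix `T` which exchanges the two blocks of size two. -/
def blockSwap : Matrix (Fin 2 ⊕ Fin 2) (Fin 2 ⊕ Fin 2) ℂ :=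
  Matrix.fromBlocks 0 !![0, -1; 1, 0] !![0, 1; 1, 0] 0

/-- `X ↦ S X̄ S⁻¹`, the differential of `g ↦ S ḡ S⁻¹`. -/
def tauConj : Matrix (Fin 2 ⊕ Fin 1) (Fin 2 ⊕ Fin 1) ℂ →ₗ[ℝ]
    Matrix (Fin 2 ⊕ Fin 1) (Fin 2 ⊕ Fin 1) ℂ where
  toFun X := quarterTurn * X.map (starRingEnd ℂ) * quarterTurnᵀ
  map_add' X Z := by
    rw [Matrix.map_add _ (map_add _), mul_add, add_mul]
  map_smul' c X := by
    have h : (c • X).map (starRingEnd ℂ) = c • X.map (starRingEnd ℂ) := by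
      ext i j; simp
    rw [h]; simp

/-- `X ↦ - S Xᵀ S⁻¹`, the differential of `g ↦ S (gᵀ)⁻¹ S⁻¹`. -/
def tauTranspose : Matrix (Fin 2 ⊕ Fin 1) (Fin 2 ⊕ Fin 1) ℂ →ₗ[ℝ]
    Matrix (Fin 2 ⊕ Fin 1) (Fin 2 ⊕ Fin 1) ℂ where
  toFun X := -(quarterTurn * Xᵀ * quarterTurnᵀ)
  map_add' X Z := by
    rw [Matrix.transpose_add, mul_add, add_mul, neg_add]
  map_smul' c X := by
    rw [Matrix.transpose_smul]; simp

/-- `X ↦ T X T⁻¹`, the differential of `g ↦ T g T⁻¹`. -/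
def tauSwap : Matrix (Fin 2 ⊕ Fin 2) (Fin 2 ⊕ Fin 2) ℂ →ₗ[ℝ]
    Matrix (Fin 2 ⊕ Fin 2) (Fin 2 ⊕ Fin 2) ℂ where
  toFun X := blockSwap * X * blockSwapᵀ
  map_add' X Z := by rw [mul_add, add_mul]
  map_smul' c X := by simp

/-- `ℂ² = (U(2) ⋉ ℂ²) / U(2)`, with affine transformations written as `3 × 3` matrices. -/
def euclideanModel : SymmetricModel where
  ι := Fin 2 ⊕ Fin 1
  G := {g | ∃ A ∈ Matrix.unitaryGroup (Fin 2) ℂ, ∃ u : Matrix (Fin 2) (Fin 1) ℂ,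
    g = Matrix.fromBlocks A u 0 1}
  τ := tauConj
  Y := Matrix.fromBlocks (I • 1) 0 0 0
  ε := ![Matrix.fromBlocks 0 !![1; 0] 0 0, Matrix.fromBlocks 0 !![0; 1] 0 0]
  metric V W := (Matrix.trace (Vᴴ * W)).re

/-- `ℂP² = SU(3) / S(U(2) × U(1))`. -/
def projectiveModel : SymmetricModel where
  ι := Fin 2 ⊕ Fin 1
  G := {g | g ∈ Matrix.specialUnitaryGroup (Fin 2 ⊕ Fin 1) ℂ}
  τ := tauTranspose
  Y := (I / 3) • Matrix.fromBlocks 1 0 0 (-2)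
  ε := ![Matrix.fromBlocks 0 !![1; 0] !![-1, 0] 0, Matrix.fromBlocks 0 !![0; 1] !![0, -1] 0]
  metric V W := -(1 / 2) * (Matrix.trace (V * W)).re

/-- `ℂD² = SU(2,1) / S(U(2) × U(1))`, the complex hyperbolic plane. -/
def hyperbolicModel : SymmetricModel where
  ι := Fin 2 ⊕ Fin 1
  G := {g | g * Matrix.fromBlocks 1 0 0 (-1) * gᴴ = Matrix.fromBlocks 1 0 0 (-1) ∧ g.det = 1}
  τ := tauTranspose
  Y := (I / 3) • Matrix.fromBlocks 1 0 0 (-2)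
  ε := ![Matrix.fromBlocks 0 !![1; 0] !![1, 0] 0, Matrix.fromBlocks 0 !![0; -1] !![0, -1] 0]
  metric V W := (1 / 2) * (Matrix.trace (V * W)).re

/-- `ℂP¹ × ℂP¹ = (SU(2) × SU(2)) / (U(1) × U(1))`. -/
def biProjectiveModel : SymmetricModel where
  ι := Fin 2 ⊕ Fin 2
  G := {g | ∃ A ∈ Matrix.specialUnitaryGroup (Fin 2) ℂ,
    ∃ D ∈ Matrix.specialUnitaryGroup (Fin 2) ℂ, g = Matrix.fromBlocks A 0 0 D}
  τ := tauSwap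
  Y := (1 / 2 : ℂ) • Matrix.fromBlocks !![-I, 0; 0, I] 0 0 !![-I, 0; 0, I]
  ε := ![Matrix.fromBlocks !![0, 1; -1, 0] 0 0 0, Matrix.fromBlocks 0 0 0 !![0, 1; -1, 0]]
  metric V W := -(1 / 2) * (Matrix.trace (V * W)).re

/-- The group `SU(1,1)`. -/
def su11 : Set (Matrix (Fin 2) (Fin 2) ℂ) :=
  {A | A * !![1, 0; 0, -1] * Aᴴ = !![1, 0; 0, -1] ∧ A.det = 1}

/-- The noncompact dual `(SU(1,1) × SU(1,1)) / (U(1) × U(1))` of `ℂP¹ × ℂP¹`. -/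
def biHyperbolicModel : SymmetricModel where
  ι := Fin 2 ⊕ Fin 2
  G := {g | ∃ A ∈ su11, ∃ D ∈ su11, g = Matrix.fromBlocks A 0 0 D}
  τ := tauSwap
  Y := (1 / 2 : ℂ) • Matrix.fromBlocks !![-I, 0; 0, I] 0 0 !![-I, 0; 0, I]
  ε := ![Matrix.fromBlocks !![0, 1; 1, 0] 0 0 0, Matrix.fromBlocks 0 0 0 !![0, -1; -1, 0]]
  metric V W := (1 / 2) * (Matrix.trace (V * W)).re

/-- The five types of target spaces. -/
inductive TargetSpace
  | euclidean
  | projective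
  | hyperbolic
  | biProjective
  | biHyperbolic

/-- The matrix model of a target space. -/
def TargetSpace.model : TargetSpace → SymmetricModel
  | .euclidean => euclideanModel
  | .projective => projectiveModel
  | .hyperbolic => hyperbolicModel
  | .biProjective => biProjectiveModel
  | .biHyperbolic => biHyperbolicModel

namespace SymmetricModel

variable (S : SymmetricModel)

/-- The matrices of the model. -/
abbrev Mat : Type := Matrix S.ι S.ι ℂ

/-- The action of `g` on the point `p` of `M`. -/
def act (g p : S.Mat) : S.Mat := g * p * g⁻¹

/-- The symmetric space `M`, the orbit `G · p₀` of the base point `p₀ = Y`. -/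
def space : Set S.Mat := {p | ∃ g ∈ S.G, p = S.act g S.Y}

/-- The complex structure of `T_p M`. -/
def J (p V : S.Mat) : S.Mat := p * V - V * p

/-- The Kähler form of `M` at `p`. -/
def kahler (p V W : S.Mat) : ℝ := S.metric (S.J p V) W

/-! ### Hamiltonian stationary Lagrangian surfaces -/

/-- `f : L → M` is a smooth conformal immersion, `z = x + i y` being the coordinate on `L`. -/
def IsConformalImmersion (f : ℂ → S.Mat) (L : Set ℂ) : Prop :=
  ContDiffOn ℝ ∞ f L ∧ (∀ z ∈ L, f z ∈ S.space) ∧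
  ∀ z ∈ L, 0 < S.metric (fderiv ℝ f z 1) (fderiv ℝ f z 1) ∧
    S.metric (fderiv ℝ f z 1) (fderiv ℝ f z 1) = S.metric (fderiv ℝ f z I) (fderiv ℝ f z I) ∧
    S.metric (fderiv ℝ f z 1) (fderiv ℝ f z I) = 0

/-- `f` is Lagrangian: the pull-back of the Kähler form vanishes. -/
def IsLagrangian (f : ℂ → S.Mat) (L : Set ℂ) : Prop :=
  ∀ z ∈ L, ∀ v w : ℂ, S.kahler (f z) (fderiv ℝ f z v) (fderiv ℝ f z w) = 0

/-- The density, with respect to `dx dy`, of the area induced by a map into `M`. -/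
def areaDensity (f : ℂ → S.Mat) (z : ℂ) : ℝ :=
  Real.sqrt (S.metric (fderiv ℝ f z 1) (fderiv ℝ f z 1)
      * S.metric (fderiv ℝ f z I) (fderiv ℝ f z I)
    - S.metric (fderiv ℝ f z 1) (fderiv ℝ f z I) ^ 2)

/-- `f` is a critical point of the area among smooth variations `γ` of `f` in `M`, supported in a
compact set `K ⊆ L`, whose variation field `V` is Hamiltonian along `f`:
`ω(V, df) = dφ` for a smooth function `φ` supported in `K`. -/
def IsHamiltonianStationary (f : ℂ → S.Mat) (L : Set ℂ) : Prop :=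
  ∀ (γ : ℝ → ℂ → S.Mat) (K : Set ℂ) (φ : ℂ → ℝ),
    ContDiffOn ℝ ∞ (fun q : ℝ × ℂ => γ q.1 q.2) (univ ×ˢ L) →
    (∀ t, ∀ z ∈ L, γ t z ∈ S.space) →
    (∀ z ∈ L, γ 0 z = f z) →
    IsCompact K → K ⊆ L →
    (∀ t, ∀ z ∈ L \ K, γ t z = f z) →
    ContDiff ℝ ∞ φ → tsupport φ ⊆ K →
    (∀ z ∈ L, ∀ v : ℂ,
      S.kahler (f z) (deriv (fun t => γ t z) 0) (fderiv ℝ f z v) = fderiv ℝ φ z v) →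
    HasDerivAt (fun t => ∫ z in K, S.areaDensity (γ t) z) 0 0

/-- `f : L → M` is a conformal Hamiltonian stationary Lagrangian immersion. -/
def IsHSL (f : ℂ → S.Mat) (L : Set ℂ) : Prop :=
  S.IsConformalImmersion f L ∧ S.IsLagrangian f L ∧ S.IsHamiltonianStationary f L

/-! ### Lagrangian lifts -/

/-- The Maurer-Cartan form `α = F⁻¹ dF`. -/
def maurerCartan (F : ℂ → S.Mat) (z v : ℂ) : S.Mat := (F z)⁻¹ * fderiv ℝ F z v

/-- The projection of the Lie algebra onto `𝔪`, the `(-1)`-eigenspace of `σ = τ²`. -/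
def projM (A : S.Mat) : S.Mat := (1 / 2 : ℝ) • (A - S.τ (S.τ A))

/-- Multiplication by the complex number `c` on `𝔪`, for the complex structure `ad Y`. -/
def cmul (c : ℂ) (A : S.Mat) : S.Mat := c.re • A + c.im • S.J S.Y A

/-- `F : L → G` is a smooth lift of `f`, that is `F · p₀ = f`. -/
def IsLift (F f : ℂ → S.Mat) (L : Set ℂ) : Prop :=
  ContDiffOn ℝ ∞ F L ∧ (∀ z ∈ L, F z ∈ S.G) ∧ ∀ z ∈ L, S.act (F z) S.Y = f z

/-- `F` is a Lagrangian lift of the conformal map `f`: the frame `(ε₁, ε₂)` transported by `F`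
is equivalent modulo `SU(2)` to the oriented orthonormal tangent frame `e^{-ρ}(∂f/∂x, ∂f/∂y)`;
in other words `α_𝔪 = e^ρ k (ε₁ dx + ε₂ dy)` with `k ∈ SU(𝔪)`. -/
def IsLagrangianLift (F f : ℂ → S.Mat) (L : Set ℂ) : Prop :=
  S.IsLift F f L ∧
  ∀ z ∈ L, ∃ ρ : ℝ, ∃ k ∈ Matrix.specialUnitaryGroup (Fin 2) ℂ, ∀ j : Fin 2,
    S.projM (S.maurerCartan F z (![1, I] j)) =
      Real.exp ρ • ∑ i : Fin 2, S.cmul (k i j) (S.ε i)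

/-! ### The extended Maurer-Cartan form -/

/-- The component in the `i ^ k`-eigenspace of `τ` on the complexification, of a real element. -/
def eigenComponent (k : ℤ) (A : S.Mat) : ℂ ⊗[ℝ] S.Mat :=
  (1 / 4 : ℂ) • ∑ j ∈ Finset.range 4, I ^ (-(k * (j : ℤ))) • ((1 : ℂ) ⊗ₜ[ℝ] ((S.τ ^ j) A))

variable {S} in
/-- The `(1,0)` part of a one-form at a point. -/
def partOneZero (θ : ℂ → ℂ ⊗[ℝ] S.Mat) (v : ℂ) : ℂ ⊗[ℝ] S.Mat :=
  (1 / 2 : ℂ) • (θ v - I • θ (I * v))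

variable {S} in
/-- The `(0,1)` part of a one-form at a point. -/
def partZeroOne (θ : ℂ → ℂ ⊗[ℝ] S.Mat) (v : ℂ) : ℂ ⊗[ℝ] S.Mat :=
  (1 / 2 : ℂ) • (θ v + I • θ (I * v))

/-- The extended form `α_l = l⁻² α₂′ + l⁻¹ α₋₁′ + α₀ + l α₁″ + l² α₂″` of a one-form `α` (at a
point), where `′` and `″` are the `(1,0)` and `(0,1)` parts. -/
def extendedForm (α : ℂ → S.Mat) (l : Circle) (v : ℂ) : ℂ ⊗[ℝ] S.Mat :=
  (l : ℂ) ^ (-2 : ℤ) • partOneZero (fun w => S.eigenComponent 2 (α w)) v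
  + (l : ℂ) ^ (-1 : ℤ) • partOneZero (fun w => S.eigenComponent (-1) (α w)) v
  + S.eigenComponent 0 (α v)
  + (l : ℂ) • partZeroOne (fun w => S.eigenComponent 1 (α w)) v
  + (l : ℂ) ^ 2 • partZeroOne (fun w => S.eigenComponent 2 (α w)) v

/-- `F_l : L → G` is a smooth solution of `dF_l = F_l α_l`, where `α = F⁻¹ dF`. -/
def IsExtendedSolution (F : ℂ → S.Mat) (l : Circle) (Fl : ℂ → S.Mat) (L : Set ℂ) : Prop :=
  ContDiffOn ℝ ∞ Fl L ∧ (∀ z ∈ L, Fl z ∈ S.G) ∧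
  ∀ z ∈ L, ∀ v : ℂ,
    (1 : ℂ) ⊗ₜ[ℝ] S.maurerCartan Fl z v = S.extendedForm (S.maurerCartan F z) l v

/-- The map `z ↦ F(z) · p₀` into `M` of which `F` is a lift. -/
def proj (F : ℂ → S.Mat) (z : ℂ) : S.Mat := S.act (F z) S.Y

/-- `f` is periodic with respect to `ω₁` and `ω₂`. -/
def IsBiperiodic (f : ℂ → S.Mat) (ω₁ ω₂ : ℂ) : Prop :=
  ∀ z, f (z + ω₁) = f z ∧ f (z + ω₂) = f z

end SymmetricModel

end

open Filter Topology Metric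

/-! ### Flat connections -/

section Frobenius

variable {E R : Type*} [NormedAddCommGroup E] [NormedSpace ℝ E]
  [NormedRing R] [NormedAlgebra ℝ R] [CompleteSpace R]

theorem Convex.norm_sub_sub_fderiv_le {G : Type*} [NormedAddCommGroup G] [NormedSpace ℝ G]
    {f : E → G} {s : Set E} (hs : Convex ℝ s) (hf : ∀ x ∈ s, DifferentiableAt ℝ f x) {M : ℝ}
    (hM : 0 ≤ M) (hL : ∀ x ∈ s, ∀ y ∈ s, ‖fderiv ℝ f x - fderiv ℝ f y‖ ≤ M * ‖x - y‖) {x y : E}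
    (hx : x ∈ s) (hy : y ∈ s) : ‖f y - f x - fderiv ℝ f x (y - x)‖ ≤ M * ‖y - x‖ ^ 2 := by
  have h := (convex_segment (𝕜 := ℝ) x y).norm_image_sub_le_of_norm_hasFDerivWithin_le'
    (f := f) (f' := fderiv ℝ f) (φ := fderiv ℝ f x) (C := M * ‖y - x‖)
    (fun z hz => (hf z (hs.segment_subset hx hy hz)).hasFDerivAt.hasFDerivWithinAt)
    (fun z hz => by
      refine (hL z (hs.segment_subset hx hy hz) x hx).trans ?_
      gcongr
      simpa [norm_sub_rev] using norm_sub_le_of_mem_segment hz)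
    (left_mem_segment ℝ x y) (right_mem_segment ℝ x y)
  simpa [pow_two, mul_assoc] using h

theorem Convex.norm_sub_le_of_fderiv_le {G : Type*} [NormedAddCommGroup G] [NormedSpace ℝ G]
    {f : E → G} {s : Set E} (hs : Convex ℝ s) (hf : ∀ x ∈ s, DifferentiableAt ℝ f x) {M : ℝ}
    (hM : ∀ x ∈ s, ‖fderiv ℝ f x‖ ≤ M) {x y : E} (hx : x ∈ s) (hy : y ∈ s) :
    ‖f y - f x‖ ≤ M * ‖y - x‖ :=
  hs.norm_image_sub_le_of_norm_fderiv_le hf hM hx hy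

/-- Solutions on the unit interval of a linear equation with small coefficients. -/
theorem exists_linear_ode_solution (a : ℝ → R) (ha : ContinuousOn a (Icc 0 1))
    (hb : ∀ t ∈ Icc (0 : ℝ) 1, (‖(1 : R)‖ + 1) * ‖a t‖ ≤ 1) :
    ∃ y : ℝ → R, y 0 = 1 ∧ (∀ t ∈ Icc (0 : ℝ) 1, HasDerivWithinAt y (y t * a t) (Icc 0 1) t) ∧
      ∀ t ∈ Icc (0 : ℝ) 1, ‖y t‖ ≤ ‖(1 : R)‖ * Real.exp 1 := by
  have h1 : ∀ t ∈ Icc (0 : ℝ) 1, ‖a t‖ ≤ 1 := fun t ht => by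
    nlinarith [hb t ht, norm_nonneg (1 : R), norm_nonneg (a t)]
  have hPL : IsPicardLindelof (fun t (x : R) => x * a t) (tmin := 0) (tmax := 1)
      ⟨0, by simp⟩ (1 : R) 1 0 1 1 := by
    refine ⟨fun t ht => ?_, fun x _ => continuousOn_const.mul ha, fun t ht x hx => ?_, by simp⟩
    · refine LipschitzOnWith.of_dist_le_mul fun x _ z _ => ?_
      rw [dist_eq_norm, dist_eq_norm, ← sub_mul]
      refine (norm_mul_le _ _).trans ?_
      nlinarith [h1 t ht, norm_nonneg (x - z), NNReal.coe_one]
    · have : ‖x‖ ≤ ‖(1 : R)‖ + 1 := by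
        have h := norm_le_norm_add_norm_sub (1 : R) x
        rw [mem_closedBall, dist_eq_norm, norm_sub_rev] at hx
        exact h.trans (by simpa using hx)
      refine (norm_mul_le _ _).trans (le_trans ?_ (hb t ht))
      gcongr
  obtain ⟨y, hy0, hy⟩ := hPL.exists_eq_forall_mem_Icc_hasDerivWithinAt₀
  refine ⟨y, hy0, hy, ?_⟩
  have hc : ContinuousOn y (Icc 0 1) := fun t ht => (hy t ht).continuousWithinAt
  intro t ht
  have h := norm_le_gronwallBound_of_norm_deriv_right_le (δ := ‖(1 : R)‖) (K := 1) (ε := 0) hc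
    (fun x hx => (hy x ⟨hx.1, hx.2.le⟩).mono_of_mem_nhdsWithin (Icc_mem_nhdsGE_of_mem hx))
    (by simp [hy0]) (fun x hx => by
      have := h1 x ⟨hx.1, hx.2.le⟩
      refine (norm_mul_le _ _).trans ?_
      nlinarith [norm_nonneg (y x)]) t ht
  rw [gronwallBound_ε0] at h
  refine h.trans ?_
  gcongr
  linarith [ht.2]

theorem exists_local_parallel_section (A : E → E →L[ℝ] R) (z₀ : E) (hA : ContDiffAt ℝ 2 A z₀)
    (hflat : ∀ᶠ z in 𝓝 z₀, ∀ v w, fderiv ℝ A z v w - fderiv ℝ A z w v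
      + (A z v * A z w - A z w * A z v) = 0) :
    ∃ r > 0, ∃ F : E → R, F z₀ = 1 ∧
      ∀ z ∈ ball z₀ r, HasFDerivAt F ((ContinuousLinearMap.mul ℝ R (F z)).comp (A z)) z := by
  obtain ⟨K, s, hs, hK⟩ := (hA.fderiv_right (m := 1) (by norm_num)).exists_lipschitzOnWith
  have hA1 : ∀ᶠ z in 𝓝 z₀, DifferentiableAt ℝ A z :=
    (hA.eventually (by simp)).mono fun z hz => hz.differentiableAt (by simp)
  have hA2 : ∀ᶠ z in 𝓝 z₀, ‖A z‖ < ‖A z₀‖ + 1 :=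
    hA.continuousAt.norm.eventually_lt continuousAt_const (by simp)
  have hA3 : ∀ᶠ z in 𝓝 z₀, ‖fderiv ℝ A z‖ < ‖fderiv ℝ A z₀‖ + 1 :=
    (hA.fderiv_right (m := 1) (by norm_num)).continuousAt.norm.eventually_lt
      continuousAt_const (by simp)
  obtain ⟨ρ, hρ, hB⟩ := Metric.eventually_nhds_iff_ball.1
    ((((hflat.and hA1).and hA2).and hA3).and hs)
  set M : ℝ := max (max (‖A z₀‖ + 1) (‖fderiv ℝ A z₀‖ + 1)) K with hM
  have hM0 : 0 < M := lt_of_lt_of_le (by positivity : 0 < ‖A z₀‖ + 1)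
    ((le_max_left _ _).trans (le_max_left _ _))
  set r : ℝ := min ρ (1 / ((‖(1 : R)‖ + 1) * M)) with hr
  have hr0 : 0 < r := lt_min hρ (by positivity)
  set c : ℝ := ‖(1 : R)‖ * Real.exp 1 with hc
  have hc0 : 0 ≤ c := by positivity
  have hS : ∀ z ∈ ball z₀ r, z ∈ ball z₀ ρ := fun z hz => ball_subset_ball (min_le_left _ _) hz
  have bA : ∀ z ∈ ball z₀ r, ‖A z‖ ≤ M := fun z hz =>
    ((hB z (hS z hz)).1.1.2.le.trans (le_max_left _ _)).trans (le_max_left _ _)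
  have bD : ∀ z ∈ ball z₀ r, ‖fderiv ℝ A z‖ ≤ M := fun z hz =>
    ((hB z (hS z hz)).1.2.le.trans (le_max_right _ _)).trans (le_max_left _ _)
  have dA : ∀ z ∈ ball z₀ r, DifferentiableAt ℝ A z := fun z hz => (hB z (hS z hz)).1.1.1.2
  have fl : ∀ z ∈ ball z₀ r, ∀ v w, fderiv ℝ A z v w - fderiv ℝ A z w v
      + (A z v * A z w - A z w * A z v) = 0 := fun z hz => (hB z (hS z hz)).1.1.1.1
  have LD : ∀ x ∈ ball z₀ r, ∀ y ∈ ball z₀ r,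
      ‖fderiv ℝ A x - fderiv ℝ A y‖ ≤ M * ‖x - y‖ := fun x hx y hy => by
    have := hK.dist_le_mul x (hB x (hS x hx)).2 y (hB y (hS y hy)).2
    rw [dist_eq_norm, dist_eq_norm] at this
    exact this.trans (by gcongr; exact le_max_right _ _)
  have hseg : ∀ w : E, ‖w‖ < r → ∀ t ∈ Icc (0 : ℝ) 1, z₀ + t • w ∈ ball z₀ r := by
    intro w hw t ht
    rw [mem_ball, dist_eq_norm, add_sub_cancel_left, norm_smul, Real.norm_of_nonneg ht.1]
    nlinarith [norm_nonneg w, ht.2]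
  have hsm : ∀ w : E, ‖w‖ < r → ∀ t ∈ Icc (0 : ℝ) 1,
      (‖(1 : R)‖ + 1) * ‖A (z₀ + t • w) w‖ ≤ 1 := by
    intro w hw t ht
    have h1 : ‖A (z₀ + t • w) w‖ ≤ M * (1 / ((‖(1 : R)‖ + 1) * M)) :=
      ((A _).le_opNorm w).trans (mul_le_mul (bA _ (hseg w hw t ht))
        (hw.le.trans (min_le_right _ _)) (norm_nonneg _) hM0.le)
    calc (‖(1 : R)‖ + 1) * ‖A (z₀ + t • w) w‖
        ≤ (‖(1 : R)‖ + 1) * (M * (1 / ((‖(1 : R)‖ + 1) * M))) := by gcongr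
      _ = 1 := by field_simp
  have hsm1 : ∀ w : E, ‖w‖ < r → ∀ t ∈ Icc (0 : ℝ) 1, ‖A (z₀ + t • w) w‖ ≤ 1 :=
    fun w hw t ht => by
      nlinarith [hsm w hw t ht, norm_nonneg (1 : R), norm_nonneg (A (z₀ + t • w) w)]
  have hline : ∀ (w : E) (t : ℝ), HasDerivAt (fun t : ℝ => z₀ + t • w) w t := fun w t => by
    simpa using ((hasDerivAt_id t).smul_const w).const_add z₀
  have hAline : ∀ w : E, ‖w‖ < r → ∀ t ∈ Icc (0 : ℝ) 1,
      HasDerivAt (fun t : ℝ => A (z₀ + t • w)) (fderiv ℝ A (z₀ + t • w) w) t :=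
    fun w hw t ht => (dA _ (hseg w hw t ht)).hasFDerivAt.comp_hasDerivAt t (hline w t)
  have hex : ∀ w : E, ∃ y : ℝ → R, ‖w‖ < r → y 0 = 1 ∧
      (∀ t ∈ Icc (0 : ℝ) 1, HasDerivWithinAt y (y t * A (z₀ + t • w) w) (Icc 0 1) t) ∧
      ∀ t ∈ Icc (0 : ℝ) 1, ‖y t‖ ≤ c := by
    intro w
    by_cases hw : ‖w‖ < r
    · obtain ⟨y, h⟩ := exists_linear_ode_solution (fun t => A (z₀ + t • w) w)
        (fun t ht => (((hAline w hw t ht).clm_apply (hasDerivAt_const t w)).continuousAt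
          ).continuousWithinAt) (hsm w hw)
      exact ⟨y, fun _ => h⟩
    · exact ⟨0, fun h => absurd h hw⟩
  choose y hy using hex
  refine ⟨r, hr0, fun z => y (z - z₀) 1, ?_, ?_⟩
  · have h := hy 0 (by simpa using hr0)
    simp only [sub_self]
    rw [← h.1]
    exact constant_of_derivWithin_zero (f := y 0)
      (fun t ht => (h.2.1 t ht).differentiableWithinAt)
      (fun t ht => by
        have := h.2.1 t ⟨ht.1, ht.2.le⟩
        rw [map_zero, mul_zero] at this
        exact this.derivWithin (uniqueDiffOn_Icc zero_lt_one t ⟨ht.1, ht.2.le⟩)) 1 (by simp)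
  intro z hz
  set w := z - z₀ with hwdef
  have hw : ‖w‖ < r := by simpa [dist_eq_norm] using hz
  have hzw : z = z₀ + w := by simp [hwdef]
  set C : ℝ := c * (M * (2 * r) + M + M * M * (2 * r) + M * M)
  have key : ∀ h : E, ‖w + h‖ < r →
      ‖y (w + h) 1 - y w 1 - y w 1 * A z h‖ ≤ (C * ‖h‖ ^ 2) * (Real.exp 1 - 1) := by
    intro h hwh
    obtain ⟨y0, yd, yb⟩ := hy w hw
    obtain ⟨x0, xd, xb⟩ := hy (w + h) hwh
    set Q : ℝ → R := fun t => y w t * (1 + A (z₀ + t • w) (t • h)) with hQ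
    set Q' : ℝ → R := fun t => y w t * A (z₀ + t • w) w * (1 + A (z₀ + t • w) (t • h))
      + y w t * (fderiv ℝ A (z₀ + t • w) w (t • h) + A (z₀ + t • w) h) with hQ'
    have hQd : ∀ t ∈ Icc (0 : ℝ) 1, HasDerivWithinAt Q (Q' t) (Icc 0 1) t := by
      intro t ht
      have h2 : HasDerivAt (fun t : ℝ => t • h) h t := by
        simpa using (hasDerivAt_id t).smul_const h
      have h1 := ((hAline w hw t ht).clm_apply h2).const_add (1 : R)
      exact (yd t ht).mul h1.hasDerivWithinAt
    have hIci : ∀ t ∈ Ico (0 : ℝ) 1, Icc (0 : ℝ) 1 ∈ 𝓝[≥] t := fun t ht =>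
      Icc_mem_nhdsGE_of_mem ht
    have hG := dist_le_of_approx_trajectories_ODE_of_mem (a := 0) (b := 1) (K := 1) (δ := 0)
      (εf := C * ‖h‖ ^ 2) (εg := 0) (s := fun _ => univ)
      (v := fun t x => x * A (z₀ + t • (w + h)) (w + h)) (f := Q) (f' := Q')
      (g := y (w + h)) (g' := fun t => y (w + h) t * A (z₀ + t • (w + h)) (w + h))
      (fun t ht => LipschitzOnWith.of_dist_le_mul fun a _ b _ => by
        rw [dist_eq_norm, dist_eq_norm, ← sub_mul]
        refine (norm_mul_le _ _).trans ?_
        have := hsm1 (w + h) hwh t ⟨ht.1, ht.2.le⟩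
        nlinarith [norm_nonneg (a - b), NNReal.coe_one])
      (fun t ht => (hQd t ht).continuousWithinAt)
      (fun t ht => (hQd t ⟨ht.1, ht.2.le⟩).mono_of_mem_nhdsWithin (hIci t ht))
      (fun t ht' => by
        have ht : t ∈ Icc (0 : ℝ) 1 := ⟨ht'.1, ht'.2.le⟩
        set p := z₀ + t • w with hp
        have hp1 : z₀ + t • (w + h) = p + t • h := by rw [smul_add, hp]; abel
        have hpb := hseg w hw t ht
        have hqb := hseg (w + h) hwh t ht
        rw [hp1] at hqb
        have e1 : Q' t - Q t * A (z₀ + t • (w + h)) (w + h) = y w t *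
            (-(A (p + t • h) - A p - fderiv ℝ A p (p + t • h - p)) (w + h)
              - t • fderiv ℝ A p h h
              - t • (A p h * (A (p + t • h) - A p) (w + h)) - t • (A p h * A p h)) := by
          have hf := fl p hpb w h
          have hf' : fderiv ℝ A p w h = fderiv ℝ A p h w - (A p w * A p h - A p h * A p w) := by
            rw [← sub_eq_zero, ← hf]; abel
          simp only [hQ, hQ', hp1, map_smul, map_add, add_sub_cancel_left,
            sub_apply, smul_apply, hf', ← hp]
          simp only [mul_add, add_mul, mul_sub, mul_one, smul_add, smul_sub,
            mul_smul_comm, smul_mul_assoc, mul_neg, mul_assoc]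
          abel
        rw [dist_eq_norm, e1]
        have ht1 : ‖t‖ ≤ 1 := by rw [Real.norm_of_nonneg ht.1]; exact ht.2
        have hth : ‖t • h‖ ≤ ‖h‖ := by
          rw [norm_smul]; nlinarith [norm_nonneg h, norm_nonneg t]
        have hwh2 : ‖w + h‖ ≤ 2 * r := by linarith
        have n1 : ‖(A (p + t • h) - A p - fderiv ℝ A p (p + t • h - p)) (w + h)‖
            ≤ M * (2 * r) * ‖h‖ ^ 2 := by
          refine (ContinuousLinearMap.le_opNorm _ _).trans ?_
          have := (convex_ball z₀ r).norm_sub_sub_fderiv_le dA hM0.le LD hpb hqb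
          rw [add_sub_cancel_left] at this ⊢
          calc _ ≤ M * ‖t • h‖ ^ 2 * (2 * r) := by gcongr
            _ ≤ M * ‖h‖ ^ 2 * (2 * r) := by gcongr
            _ = _ := by ring
        have nh : ‖A p h‖ ≤ M * ‖h‖ := ((A p).le_opNorm h).trans (by gcongr; exact bA p hpb)
        have n2 : ‖t • fderiv ℝ A p h h‖ ≤ M * ‖h‖ ^ 2 := by
          rw [norm_smul]
          have : ‖fderiv ℝ A p h h‖ ≤ M * ‖h‖ * ‖h‖ :=
            ((fderiv ℝ A p).le_opNorm₂ h h).trans (by gcongr; exact bD p hpb)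
          calc _ ≤ 1 * (M * ‖h‖ * ‖h‖) := by gcongr
            _ = _ := by ring
        have n3 : ‖t • (A p h * (A (p + t • h) - A p) (w + h))‖ ≤ M * M * (2 * r) * ‖h‖ ^ 2 := by
          rw [norm_smul]
          have h3 : ‖(A (p + t • h) - A p) (w + h)‖ ≤ M * ‖h‖ * (2 * r) := by
            refine (ContinuousLinearMap.le_opNorm _ _).trans ?_
            have := (convex_ball z₀ r).norm_sub_le_of_fderiv_le dA bD hpb hqb
            rw [add_sub_cancel_left] at this
            calc _ ≤ M * ‖t • h‖ * (2 * r) := by gcongr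
              _ ≤ M * ‖h‖ * (2 * r) := by gcongr
          calc _ ≤ 1 * ((M * ‖h‖) * (M * ‖h‖ * (2 * r))) := by
                gcongr
                exact (norm_mul_le _ _).trans (by gcongr)
            _ = _ := by ring
        have n4 : ‖t • (A p h * A p h)‖ ≤ M * M * ‖h‖ ^ 2 := by
          rw [norm_smul]
          calc _ ≤ 1 * ((M * ‖h‖) * (M * ‖h‖)) := by
                gcongr
                exact (norm_mul_le _ _).trans (by gcongr)
            _ = _ := by ring
        calc _ ≤ c * (M * (2 * r) * ‖h‖ ^ 2 + M * ‖h‖ ^ 2 + M * M * (2 * r) * ‖h‖ ^ 2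
              + M * M * ‖h‖ ^ 2) := by
              refine (norm_mul_le _ _).trans ?_
              gcongr
              · exact yb t ht
              · refine (norm_sub_le _ _).trans (add_le_add ((norm_sub_le _ _).trans (add_le_add
                  ((norm_sub_le _ _).trans (add_le_add ?_ n2)) n3)) n4)
                rwa [norm_neg]
          _ = C * ‖h‖ ^ 2 := by ring)
      (fun _ _ => mem_univ _)
      (fun t ht => (xd t ht).continuousWithinAt)
      (fun t ht => (xd t ⟨ht.1, ht.2.le⟩).mono_of_mem_nhdsWithin (hIci t ht))
      (fun t ht => by simp) (fun _ _ => mem_univ _)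
      (by simp [hQ, y0, x0]) 1 (by simp)
    rw [NNReal.coe_one, gronwallBound_of_K_ne_0 one_ne_zero] at hG
    have e2 : Q 1 = y w 1 + y w 1 * A z h := by simp [hQ, mul_add, hzw]
    rw [dist_comm, dist_eq_norm, e2] at hG
    rw [← sub_sub] at hG
    simpa using hG
  rw [hasFDerivAt_iff_isLittleO_nhds_zero]
  refine Asymptotics.IsBigO.trans_isLittleO ?_ (Asymptotics.isLittleO_norm_pow_id one_lt_two)
  refine Asymptotics.IsBigO.of_bound (C * (Real.exp 1 - 1)) ?_
  have hnear : ∀ᶠ h : E in 𝓝 0, ‖w + h‖ < r :=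
    (continuousAt_const.add continuousAt_id).norm.eventually_lt continuousAt_const (by simpa using hw)
  filter_upwards [hnear] with h hh
  have e3 : z + h - z₀ = w + h := by rw [hwdef]; abel
  simp only [e3, ContinuousLinearMap.comp_apply, ContinuousLinearMap.mul_apply']
  rw [Real.norm_of_nonneg (by positivity : (0 : ℝ) ≤ ‖h‖ ^ 2)]
  exact (key h hh).trans (le_of_eq (by ring))

end Frobenius

section GlobalFrobenius

variable {E R : Type*} [NormedAddCommGroup E] [NormedSpace ℝ E]
  [NormedRing R] [NormedAlgebra ℝ R]

/-- `dF = F A` at the point `z`. -/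
def IsParallelAt (A : E → E →L[ℝ] R) (F : E → R) (z : E) : Prop :=
  HasFDerivAt F ((ContinuousLinearMap.mul ℝ R (F z)).comp (A z)) z

theorem IsParallelAt.const_mul {A : E → E →L[ℝ] R} {F : E → R} {z : E}
    (h : IsParallelAt A F z) (c : R) : IsParallelAt A (fun x => c * F x) z := by
  have h' := ((ContinuousLinearMap.mul ℝ R c).hasFDerivAt (x := F z)).comp z h
  refine HasFDerivAt.congr_fderiv h' ?_
  ext v
  simp [mul_assoc]

theorem IsParallelAt.congr {A : E → E →L[ℝ] R} {F G : E → R} {z : E}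
    (h : IsParallelAt A F z) (hG : G =ᶠ[𝓝 z] F) : IsParallelAt A G z := by
  rw [IsParallelAt, hG.eq_of_nhds]
  exact HasFDerivAt.congr_of_eventuallyEq h hG

theorem ContDiffOn.of_isParallelAt {A : E → E →L[ℝ] R} {F : E → R} {U : Set E} (hU : IsOpen U)
    (hA : ContDiffOn ℝ ∞ A U) (hF : ∀ z ∈ U, IsParallelAt A F z) : ContDiffOn ℝ ∞ F U := by
  rw [contDiffOn_infty]
  intro n
  induction n with
  | zero => exact contDiffOn_zero.2 fun z hz => (hF z hz).continuousAt.continuousWithinAt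
  | succ n ih =>
    rw [Nat.cast_add, Nat.cast_one, contDiffOn_succ_iff_fderiv_of_isOpen hU]
    refine ⟨fun z hz => (hF z hz).differentiableAt.differentiableWithinAt, by simp, ?_⟩
    have h : ContDiffOn ℝ n (fun z => (ContinuousLinearMap.mul ℝ R (F z)).comp (A z)) U :=
      ((ContinuousLinearMap.mul ℝ R).contDiff.comp_contDiffOn ih).clm_comp (hA.of_le (by
        exact_mod_cast le_top))
    exact h.congr fun z hz => (hF z hz).fderiv

variable [CompleteSpace R]

/-- The quotient of two solutions of `dF = F A` has vanishing derivative. -/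
theorem IsParallelAt.hasFDerivAt_mul_inverse {A : E → E →L[ℝ] R} {F G : E → R} {z : E}
    (hF : IsParallelAt A F z) (hG : IsParallelAt A G z) (hu : IsUnit (G z)) :
    HasFDerivAt (fun x => F x * Ring.inverse (G x)) (0 : E →L[ℝ] R) z := by
  obtain ⟨u, hu⟩ := hu
  have h1 := hasFDerivAt_ringInverse (𝕜 := ℝ) u
  rw [hu] at h1
  have h2 := h1.comp z hG
  refine (HasFDerivAt.mul' hF h2).congr_fderiv ?_
  ext v
  simp [← hu, mul_assoc]

theorem IsParallelAt.mul_inverse_eqOn {A : E → E →L[ℝ] R} {F G : E → R} {U : Set E}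
    (hU : IsOpen U) (hc : IsPreconnected U) (hF : ∀ z ∈ U, IsParallelAt A F z)
    (hG : ∀ z ∈ U, IsParallelAt A G z) (hu : ∀ z ∈ U, IsUnit (G z)) {x y : E}
    (hx : x ∈ U) (hy : y ∈ U) : F x * Ring.inverse (G x) = F y * Ring.inverse (G y) :=
  hU.is_const_of_fderiv_eq_zero (𝕜 := ℝ) hc
    (fun z hz => ((hF z hz).hasFDerivAt_mul_inverse (hG z hz)
      (hu z hz)).differentiableAt.differentiableWithinAt)
    (fun z hz => ((hF z hz).hasFDerivAt_mul_inverse (hG z hz) (hu z hz)).fderiv) hx hy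

theorem IsParallelAt.eqOn {A : E → E →L[ℝ] R} {F G : E → R} {U : Set E}
    (hU : IsOpen U) (hc : IsPreconnected U) (hF : ∀ z ∈ U, IsParallelAt A F z)
    (hG : ∀ z ∈ U, IsParallelAt A G z) (hu : ∀ z ∈ U, IsUnit (G z)) {x : E}
    (hx : x ∈ U) (h : F x = G x) : EqOn F G U := fun y hy => by
  have := IsParallelAt.mul_inverse_eqOn hU hc hF hG hu hx hy
  rw [h, Ring.mul_inverse_cancel _ (hu x hx)] at this
  calc F y = F y * Ring.inverse (G y) * G y := by
        rw [mul_assoc, Ring.inverse_mul_cancel _ (hu y hy), mul_one]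
    _ = G y := by rw [← this, one_mul]

/-- A copy of a type, with the discrete topology. -/
def DiscreteCopy (X : Type*) := X

instance (X : Type*) : TopologicalSpace (DiscreteCopy X) := ⊥

instance (X : Type*) : DiscreteTopology (DiscreteCopy X) := ⟨rfl⟩

/-- A flat connection over a simply connected open set admits a parallel section. -/
theorem exists_parallel_section {A : E → E →L[ℝ] R} {U : Set E} (hU : IsOpen U)
    [SimplyConnectedSpace U] (hA : ContDiffOn ℝ 2 A U)
    (hflat : ∀ z ∈ U, ∀ v w, fderiv ℝ A z v w - fderiv ℝ A z w v
      + (A z v * A z w - A z w * A z v) = 0) {z₀ : E} (hz₀ : z₀ ∈ U) (c : R) :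
    ∃ F : E → R, F z₀ = c ∧ ∀ z ∈ U, IsParallelAt A F z := by
  have hloc : ∀ i : U, ∃ r > 0, ball (i : E) r ⊆ U ∧ ∃ F : E → R,
      ∀ z ∈ ball (i : E) r, IsParallelAt A F z ∧ IsUnit (F z) := by
    intro i
    have hi : U ∈ 𝓝 (i : E) := hU.mem_nhds i.2
    obtain ⟨r, hr, F, hF1, hF⟩ := exists_local_parallel_section A i (hA.contDiffAt hi)
      (by filter_upwards [hi] with z hz using hflat z hz)
    have hu : ∀ᶠ z in 𝓝 (i : E), IsUnit (F z) := by
      refine (hF i (mem_ball_self hr)).continuousAt.eventually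
        (Units.isOpen.mem_nhds (x := F i) ?_)
      rw [hF1]; exact isUnit_one
    obtain ⟨s, hs, hs'⟩ := Metric.eventually_nhds_iff_ball.1 (hu.and hi)
    exact ⟨min r s, lt_min hr hs, fun z hz => (hs' z (ball_subset_ball (min_le_right _ _) hz)).2, F,
      fun z hz => ⟨hF z (ball_subset_ball (min_le_left _ _) hz),
        (hs' z (ball_subset_ball (min_le_right _ _) hz)).1⟩⟩
  choose r hr hrU F hF using hloc
  let Z : FiberBundleCore U U (DiscreteCopy R) :=
    { baseSet := fun i => Subtype.val ⁻¹' ball (i : E) (r i)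
      isOpen_baseSet := fun i => isOpen_ball.preimage continuous_subtype_val
      indexAt := id
      mem_baseSet_at := fun x => mem_ball_self (hr x)
      coordChange := fun i j x (g : R) => (g * (F i x * Ring.inverse (F j x)) : R)
      coordChange_self := fun i x hx (g : R) => by
        change g * (F i x * Ring.inverse (F i x)) = g
        rw [Ring.mul_inverse_cancel _ (hF i x hx).2, mul_one]
      continuousOn_coordChange := fun i j => by
        rintro ⟨x, g⟩ ⟨hx, -⟩
        have hev : ∀ᶠ p : U × DiscreteCopy R in 𝓝[((Subtype.val ⁻¹' ball (i : E) (r i)) ∩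
            (Subtype.val ⁻¹' ball (j : E) (r j))) ×ˢ univ] (x, g), p.2 = g :=
          nhdsWithin_le_nhds (continuous_snd.continuousAt.eventually
            ((isOpen_discrete {g}).mem_nhds (mem_singleton g)))
        refine tendsto_nhds_of_eventually_eq ?_
        filter_upwards [hev, self_mem_nhdsWithin] with p hp hp'
        have hc : IsPreconnected (ball (i : E) (r i) ∩ ball (j : E) (r j)) :=
          ((convex_ball _ _).inter (convex_ball _ _)).isPreconnected
        have := IsParallelAt.mul_inverse_eqOn (isOpen_ball.inter isOpen_ball) hc
          (fun z hz => (hF i z hz.1).1) (fun z hz => (hF j z hz.2).1)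
          (fun z hz => (hF j z hz.2).2) hp'.1 hx
        change (show R from p.2) * (F i p.1 * Ring.inverse (F j p.1))
          = (show R from g) * (F i x * Ring.inverse (F j x))
        rw [this, hp]
      coordChange_comp := fun i j k x hx (g : R) => by
        change g * (F i x * Ring.inverse (F j x)) * (F j x * Ring.inverse (F k x))
          = g * (F i x * Ring.inverse (F k x))
        have := Ring.inverse_mul_cancel _ (hF j x hx.1.2).2
        simp only [mul_assoc]
        rw [← mul_assoc (Ring.inverse (F j x)), this, one_mul] }
  have hcov : IsCoveringMap Z.proj := FiberBundle.isCoveringMap (E := Z.Fiber)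
  have : LocallyPathConnectedSpace U := hU.locallyPathConnectedSpace
  obtain ⟨s, ⟨hs0, hs⟩, -⟩ := hcov.existsUnique_continuousMap_lifts (ContinuousMap.id U) ⟨z₀, hz₀⟩
    (⟨⟨z₀, hz₀⟩, (c * Ring.inverse (F ⟨z₀, hz₀⟩ z₀) : R)⟩ : Z.TotalSpace) rfl
  have hs1 : ∀ x, (s x).1 = x := fun x => congrFun hs x
  classical
  let g : E → R := fun x => if hx : x ∈ U then
    (show R from (s ⟨x, hx⟩).2) * F ⟨x, hx⟩ x else 0
  have hg : ∀ x : U, ∀ y : E, ∀ hy : y ∈ U, y ∈ ball (x : E) (r x) →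
      g y = (show R from (Z.localTriv x (s ⟨y, hy⟩)).2) * F x y := by
    intro x y hy hyx
    have e1 : (show R from (Z.localTriv x (s ⟨y, hy⟩)).2)
        = (show R from (s ⟨y, hy⟩).2) * (F (s ⟨y, hy⟩).1 (s ⟨y, hy⟩).1
          * Ring.inverse (F x (s ⟨y, hy⟩).1)) := rfl
    rw [e1, hs1, mul_assoc, mul_assoc, Ring.inverse_mul_cancel _ (hF x y hyx).2, mul_one]
    simp [g, hy]
  refine ⟨g, ?_, fun z hz => ?_⟩
  · simp only [g, hz₀, dif_pos]
    rw [hs0]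
    change c * Ring.inverse (F ⟨z₀, hz₀⟩ z₀) * F ⟨z₀, hz₀⟩ z₀ = c
    rw [mul_assoc, Ring.inverse_mul_cancel _ (hF ⟨z₀, hz₀⟩ z₀ (mem_ball_self (hr _))).2, mul_one]
  · set x : U := ⟨z, hz⟩
    have hcont : ContinuousAt (fun y : U => (Z.localTriv x (s y)).2) x := by
      have hmem : s x ∈ (Z.localTriv x).source := by
        rw [Bundle.Trivialization.mem_source, show Z.proj (s x) = x from hs1 x]
        exact mem_ball_self (hr x)
      have h1 : ContinuousAt (Z.localTriv x) (s x) :=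
        (Z.localTriv x).continuousOn_toFun.continuousAt ((Z.localTriv x).open_source.mem_nhds hmem)
      exact continuous_snd.continuousAt.comp (h1.comp s.continuous.continuousAt)
    have hev : ∀ᶠ y : U in 𝓝 x, (Z.localTriv x (s y)).2 = (Z.localTriv x (s x)).2 :=
      hcont.eventually ((isOpen_discrete {(Z.localTriv x (s x)).2}).mem_nhds rfl)
    have hev' : ∀ᶠ y in 𝓝 z, ∃ hy : y ∈ U,
        (Z.localTriv x (s ⟨y, hy⟩)).2 = (Z.localTriv x (s x)).2 := by
      rw [nhds_subtype_eq_comap, eventually_comap] at hev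
      filter_upwards [hev, hU.mem_nhds hz] with y hy hyU
      exact ⟨hyU, hy ⟨y, hyU⟩ rfl⟩
    refine ((hF x z (mem_ball_self (hr x))).1.const_mul
      (show R from (Z.localTriv x (s x)).2)).congr ?_
    filter_upwards [hev', isOpen_ball.mem_nhds (mem_ball_self (hr x) : z ∈ ball z (r x))]
      with y hy hyb
    obtain ⟨hyU, hy⟩ := hy
    rw [hg x y hyU hyb, hy]

end GlobalFrobenius

/-! ### Calculus of variations -/

section Variations

theorem hasDerivAt_setIntegral_of_contDiffOn {g : ℝ × ℂ → ℝ} {Ω : Set (ℝ × ℂ)} (hΩ : IsOpen Ω)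
    (hg : ContDiffOn ℝ 1 g Ω) {K : Set ℂ} (hK : IsCompact K) (hKΩ : ∀ z ∈ K, ((0 : ℝ), z) ∈ Ω) :
    HasDerivAt (fun t : ℝ => ∫ z in K, g (t, z)) (∫ z in K, fderiv ℝ g (0, z) (1, 0)) 0 := by
  obtain ⟨u, v, hu, hv, h0u, hKv, huv⟩ := generalized_tube_lemma (isCompact_singleton (x := (0 : ℝ)))
    hK hΩ (by rintro ⟨t, z⟩ ⟨rfl, hz⟩; exact hKΩ z hz)
  obtain ⟨ε, hε, hεu⟩ := Metric.nhds_basis_closedBall.mem_iff.1 (hu.mem_nhds (h0u rfl))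
  have hsub : closedBall (0 : ℝ) ε ×ˢ K ⊆ Ω := (prod_mono hεu hKv).trans huv
  have hcd : ContinuousOn (fun q => fderiv ℝ g q (1, 0)) Ω :=
    (hg.continuousOn_fderiv_of_isOpen hΩ le_rfl).clm_apply continuousOn_const
  obtain ⟨C, hC⟩ := ((isCompact_closedBall (0 : ℝ) ε).prod hK).exists_bound_of_continuousOn
    (hcd.mono hsub)
  have hslice : ∀ t ∈ closedBall (0 : ℝ) ε, ContinuousOn (fun z => g (t, z)) K := fun t ht =>
    hg.continuousOn.comp (by fun_prop) fun z hz => hsub ⟨ht, hz⟩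
  have h0 : (0 : ℝ) ∈ closedBall (0 : ℝ) ε := mem_closedBall_self hε.le
  refine (hasDerivAt_integral_of_dominated_loc_of_deriv_le (μ := volume.restrict K)
    (F := fun t z => g (t, z)) (F' := fun t z => fderiv ℝ g (t, z) (1, 0)) (bound := fun _ => C)
    (closedBall_mem_nhds 0 hε) ?_ ?_ ?_ ?_ ?_ ?_).2
  · filter_upwards [closedBall_mem_nhds 0 hε] with t ht
    exact (hslice t ht).aestronglyMeasurable hK.measurableSet
  · exact (hslice 0 h0).integrableOn_compact hK
  · exact ContinuousOn.aestronglyMeasurable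
      (hcd.comp (by fun_prop) fun z hz => hsub ⟨h0, hz⟩) hK.measurableSet
  · exact (ae_restrict_iff' hK.measurableSet).2 (.of_forall fun z hz t ht => hC (t, z) ⟨ht, hz⟩)
  · exact integrableOn_const (hK.measure_lt_top.ne)
  · refine (ae_restrict_iff' hK.measurableSet).2 (.of_forall fun z hz t ht => ?_)
    have h1 : HasFDerivAt g (fderiv ℝ g (t, z)) (t, z) :=
      ((hg.contDiffAt (hΩ.mem_nhds (hsub ⟨ht, hz⟩))).differentiableAt (by simp)).hasFDerivAt
    exact h1.comp_hasDerivAt t ((hasDerivAt_id t).prodMk (hasDerivAt_const t z))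

theorem setIntegral_fderiv_eq_zero {W : ℂ → ℝ} {U K : Set ℂ} (hU : IsOpen U) (hK : IsCompact K)
    (hKU : K ⊆ U) (hW : ContDiffOn ℝ 1 W U) (h0 : ∀ z ∈ U \ K, W z = 0) (v : ℂ) :
    IntegrableOn (fun z => fderiv ℝ W z v) K ∧ ∫ z in K, fderiv ℝ W z v = 0 := by
  have hint : IntegrableOn (fun z => fderiv ℝ W z v) K :=
    (((hW.continuousOn_fderiv_of_isOpen hU le_rfl).clm_apply continuousOn_const).mono
      hKU).integrableOn_compact hK
  refine ⟨hint, ?_⟩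
  set G : ℂ → ℝ := K.indicator W
  have hGU : ∀ z ∈ U, G z = W z := fun z hz => by
    by_cases hzK : z ∈ K
    · exact indicator_of_mem hzK W
    · rw [show G z = 0 from indicator_of_notMem hzK W, h0 z ⟨hz, hzK⟩]
  have hG1 : ∀ z ∈ U, G =ᶠ[𝓝 z] W := fun z hz => by
    filter_upwards [hU.mem_nhds hz] with x hx using hGU x hx
  have hG2 : ∀ z ∉ K, G =ᶠ[𝓝 z] fun _ => 0 := fun z hz => by
    filter_upwards [hK.isClosed.isOpen_compl.mem_nhds hz] with x hx
      using indicator_of_notMem hx W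
  have hG : ContDiff ℝ 1 G := contDiff_iff_contDiffAt.2 fun z => by
    by_cases hz : z ∈ K
    · exact (hW.contDiffAt (hU.mem_nhds (hKU hz))).congr_of_eventuallyEq (hG1 z (hKU hz))
    · exact contDiffAt_const.congr_of_eventuallyEq (hG2 z hz)
  have hsupp : HasCompactSupport G := HasCompactSupport.intro hK fun z hz => indicator_of_notMem hz W
  have e1 : ∫ z in K, fderiv ℝ W z v = ∫ z, fderiv ℝ G z v := by
    have h1 : ∫ z in K, fderiv ℝ G z v = ∫ z, fderiv ℝ G z v :=
      setIntegral_eq_integral_of_forall_compl_eq_zero fun z hz => by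
        rw [(hG2 z hz).fderiv_eq]; simp
    rw [← h1]
    exact setIntegral_congr_fun hK.measurableSet fun z hz => by
      simp only [(hG1 z (hKU hz)).fderiv_eq]
  have hi : Integrable (fun z => fderiv ℝ G z v) :=
    ((hG.continuous_fderiv (by simp)).clm_apply continuous_const).integrable_of_hasCompactSupport
      (hsupp.fderiv_apply ℝ v)
  have hi' : Integrable G := hG.continuous.integrable_of_hasCompactSupport hsupp
  have := integral_mul_fderiv_eq_neg_fderiv_mul_of_integrable (μ := (volume : Measure ℂ))
    (f := fun _ => (1 : ℝ)) (g := G) (v := v) (by simp) (by simpa using hi) (by simpa using hi')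
    (fun _ _ => differentiableAt_const _) (fun z _ => hG.differentiable (by simp) z)
  rw [e1]
  simpa using this

theorem setIntegral_divergence_eq_zero {W₁ W₂ : ℂ → ℝ} {U K : Set ℂ} (hU : IsOpen U)
    (hK : IsCompact K) (hKU : K ⊆ U) (hW₁ : ContDiffOn ℝ 1 W₁ U) (hW₂ : ContDiffOn ℝ 1 W₂ U)
    (h₁ : ∀ z ∈ U \ K, W₁ z = 0) (h₂ : ∀ z ∈ U \ K, W₂ z = 0) :
    ∫ z in K, (fderiv ℝ W₁ z 1 + fderiv ℝ W₂ z I) = 0 := by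
  obtain ⟨i1, e1⟩ := setIntegral_fderiv_eq_zero hU hK hKU hW₁ h₁ 1
  obtain ⟨i2, e2⟩ := setIntegral_fderiv_eq_zero hU hK hKU hW₂ h₂ I
  rw [integral_add i1 i2, e1, e2, add_zero]

variable {V : Type*} [NormedAddCommGroup V] [NormedSpace ℝ V]

theorem fderiv_slice {Γ : ℝ × ℂ → V} {t : ℝ} {z : ℂ} (h : DifferentiableAt ℝ Γ (t, z)) (v : ℂ) :
    fderiv ℝ (fun w => Γ (t, w)) z v = fderiv ℝ Γ (t, z) (0, v) := by
  have h1 : HasFDerivAt (fun w : ℂ => Γ (t, w)) ((fderiv ℝ Γ (t, z)).comp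
      ((0 : ℂ →L[ℝ] ℝ).prod (ContinuousLinearMap.id ℝ ℂ))) z :=
    h.hasFDerivAt.comp z ((hasFDerivAt_const t z).prodMk (hasFDerivAt_id z))
  rw [h1.fderiv]; simp

theorem deriv_slice {Γ : ℝ × ℂ → V} {t : ℝ} {z : ℂ} (h : DifferentiableAt ℝ Γ (t, z)) :
    deriv (fun s => Γ (s, z)) t = fderiv ℝ Γ (t, z) (1, 0) :=
  (h.hasFDerivAt.comp_hasDerivAt t ((hasDerivAt_id t).prodMk (hasDerivAt_const t z))).deriv

/-- The Laplacian in the coordinate `z = x + i y`. -/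
noncomputable def flatLaplacian (f : ℂ → V) (z : ℂ) : V :=
  fderiv ℝ (fun w => fderiv ℝ f w 1) z 1 + fderiv ℝ (fun w => fderiv ℝ f w I) z I

variable (B : V →L[ℝ] V →L[ℝ] ℝ)

/-- First variation of the area at a conformal map. -/
theorem hasDerivAt_area_of_conformal (hB : ∀ v w, B v w = B w v) {γ : ℝ → ℂ → V} {L K : Set ℂ}
    (hL : IsOpen L) (hK : IsCompact K) (hKL : K ⊆ L)
    (hγ : ContDiffOn ℝ ∞ (fun q : ℝ × ℂ => γ q.1 q.2) (univ ×ˢ L))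
    (hoff : ∀ t, ∀ z ∈ L \ K, γ t z = γ 0 z)
    (hpos : ∀ z ∈ L, 0 < B (fderiv ℝ (γ 0) z 1) (fderiv ℝ (γ 0) z 1))
    (hconf : ∀ z ∈ L, B (fderiv ℝ (γ 0) z 1) (fderiv ℝ (γ 0) z 1)
      = B (fderiv ℝ (γ 0) z I) (fderiv ℝ (γ 0) z I))
    (horth : ∀ z ∈ L, B (fderiv ℝ (γ 0) z 1) (fderiv ℝ (γ 0) z I) = 0) :
    HasDerivAt (fun t => ∫ z in K, Real.sqrt (B (fderiv ℝ (γ t) z 1) (fderiv ℝ (γ t) z 1)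
        * B (fderiv ℝ (γ t) z I) (fderiv ℝ (γ t) z I) - B (fderiv ℝ (γ t) z 1) (fderiv ℝ (γ t) z I) ^ 2))
      (-∫ z in K, B (deriv (fun t => γ t z) 0) (flatLaplacian (γ 0) z)) 0 := by
  set Γ : ℝ × ℂ → V := fun q => γ q.1 q.2 with hΓ
  have hO : IsOpen ((univ : Set ℝ) ×ˢ L) := isOpen_univ.prod hL
  have hmem : ∀ (t : ℝ) (z : ℂ), z ∈ L → (t, z) ∈ (univ : Set ℝ) ×ˢ L := fun t z hz => ⟨trivial, hz⟩
  have hd : ∀ (t : ℝ) (z : ℂ), z ∈ L → ContDiffAt ℝ ∞ Γ (t, z) := fun t z hz =>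
    hγ.contDiffAt (hO.mem_nhds (hmem t z hz))
  have hdd : ∀ (t : ℝ) (z : ℂ), z ∈ L → DifferentiableAt ℝ Γ (t, z) := fun t z hz =>
    (hd t z hz).differentiableAt (by simp)
  have hΓ1 : ContDiffOn ℝ ∞ (fderiv ℝ Γ) (univ ×ˢ L) := hγ.fderiv_of_isOpen hO (by simp)
  have hdir : ∀ v : ℝ × ℂ, ContDiffOn ℝ ∞ (fun q => fderiv ℝ Γ q v) (univ ×ˢ L) := fun v =>
    hΓ1.clm_apply contDiffOn_const
  have hsl : ∀ (t : ℝ) (z : ℂ), z ∈ L → ∀ v, fderiv ℝ (γ t) z v = fderiv ℝ Γ (t, z) (0, v) :=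
    fun t z hz v => fderiv_slice (hdd t z hz) v
  set X : ℝ × ℂ → V := fun q => fderiv ℝ Γ q (0, 1) with hX
  set Y : ℝ × ℂ → V := fun q => fderiv ℝ Γ q (0, I) with hY
  set T : ℝ × ℂ → V := fun q => fderiv ℝ Γ q (1, 0) with hT
  have hBB : ∀ {P Q : ℝ × ℂ → V}, ContDiffOn ℝ ∞ P (univ ×ˢ L) → ContDiffOn ℝ ∞ Q (univ ×ˢ L) →
      ContDiffOn ℝ ∞ (fun q => B (P q) (Q q)) (univ ×ˢ L) := fun hP hQ =>
    (B.contDiff.comp_contDiffOn hP).clm_apply hQ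
  set D : ℝ × ℂ → ℝ := fun q => B (X q) (X q) * B (Y q) (Y q) - B (X q) (Y q) ^ 2 with hD
  have hDs : ContDiffOn ℝ ∞ D (univ ×ˢ L) :=
    ((hBB (hdir _) (hdir _)).mul (hBB (hdir _) (hdir _))).sub ((hBB (hdir _) (hdir _)).pow 2)
  set Ω : Set (ℝ × ℂ) := (univ ×ˢ L) ∩ D ⁻¹' Ioi 0 with hΩ
  have hΩo : IsOpen Ω := hDs.continuousOn.isOpen_inter_preimage hO isOpen_Ioi
  have hD0 : ∀ z ∈ L, D (0, z) = B (X (0, z)) (X (0, z)) ^ 2 := fun z hz => by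
    have h1 := hconf z hz
    have h2 := horth z hz
    rw [hsl 0 z hz, hsl 0 z hz] at h1 h2
    simp only [hD, hX, hY, h2, ← h1]; ring
  have hX0 : ∀ z ∈ L, 0 < B (X (0, z)) (X (0, z)) := fun z hz => by
    have := hpos z hz
    rwa [hsl 0 z hz] at this
  have hKΩ : ∀ z ∈ K, ((0 : ℝ), z) ∈ Ω := fun z hz => ⟨hmem 0 z (hKL hz), by
    rw [mem_preimage, hD0 z (hKL hz)]; exact pow_pos (hX0 z (hKL hz)) 2⟩
  have hgs : ContDiffOn ℝ 1 (fun q => Real.sqrt (D q)) Ω :=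
    ((hDs.of_le (by exact_mod_cast le_top)).mono inter_subset_left).sqrt fun q hq => (ne_of_gt hq.2)
  have main := hasDerivAt_setIntegral_of_contDiffOn hΩo hgs hK hKΩ
  have e1 : ∀ t : ℝ, ∫ z in K, Real.sqrt (D (t, z)) = ∫ z in K,
      Real.sqrt (B (fderiv ℝ (γ t) z 1) (fderiv ℝ (γ t) z 1)
        * B (fderiv ℝ (γ t) z I) (fderiv ℝ (γ t) z I)
        - B (fderiv ℝ (γ t) z 1) (fderiv ℝ (γ t) z I) ^ 2) := fun t =>
    setIntegral_congr_fun hK.measurableSet fun z hz => by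
      simp only [hD, hX, hY, hsl t z (hKL hz)]
  simp only [e1] at main
  refine main.congr_deriv ?_
  -- the integrand
  have hTz : ∀ z ∈ L, deriv (fun t => γ t z) 0 = T (0, z) := fun z hz => deriv_slice (hdd 0 z hz)
  have hdiff : ∀ {P : ℝ × ℂ → V}, ContDiffOn ℝ ∞ P (univ ×ˢ L) → ∀ z ∈ L,
      DifferentiableAt ℝ P (0, z) := fun hP z hz =>
    (hP.contDiffAt (hO.mem_nhds (hmem 0 z hz))).differentiableAt (by simp)
  have hsym : ∀ z ∈ L, ∀ u v, fderiv ℝ (fun q => fderiv ℝ Γ q u) (0, z) v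
      = fderiv ℝ (fun q => fderiv ℝ Γ q v) (0, z) u := fun z hz u v => by
    have hs := (hd 0 z hz).isSymmSndFDerivAt (by
      simp only [minSmoothness_of_isRCLikeNormedField]; exact WithTop.coe_le_coe.2 le_top) u v
    have hd1 : DifferentiableAt ℝ (fderiv ℝ Γ) (0, z) :=
      (hΓ1.contDiffAt (hO.mem_nhds (hmem 0 z hz))).differentiableAt (by simp)
    rw [fderiv_clm_apply hd1 (differentiableAt_const _), fderiv_clm_apply hd1 (differentiableAt_const _)]
    simpa using hs.symm
  have hslice : ∀ {P : ℝ × ℂ → V}, ContDiffOn ℝ ∞ P (univ ×ˢ L) →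
      ContDiffOn ℝ ∞ (fun z => P (0, z)) L := fun hP =>
    hP.comp (by fun_prop) fun z hz => hmem 0 z hz
  have hBs : ∀ {P Q : ℝ × ℂ → V}, ContDiffOn ℝ ∞ P (univ ×ˢ L) → ContDiffOn ℝ ∞ Q (univ ×ˢ L) →
      ContDiffOn ℝ 1 (fun z => B (P (0, z)) (Q (0, z))) L := fun hP hQ =>
    ((hBB hP hQ).comp (by fun_prop) fun z hz => hmem 0 z hz).of_le (by exact_mod_cast le_top)
  have hT0 : ∀ z ∈ L \ K, T (0, z) = 0 := fun z hz => by
    rw [← hTz z hz.1, show (fun t => γ t z) = fun _ => γ 0 z from funext fun t => hoff t z hz]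
    simp
  have hdiv := setIntegral_divergence_eq_zero hL hK hKL (hBs (hdir (1, 0)) (hdir (0, 1)))
    (hBs (hdir (1, 0)) (hdir (0, I))) (fun z hz => by simp [show fderiv ℝ Γ (0, z) (1, 0) = 0 from hT0 z hz])
    (fun z hz => by simp [show fderiv ℝ Γ (0, z) (1, 0) = 0 from hT0 z hz])
  have hfd : ∀ {P Q : ℝ × ℂ → V}, ContDiffOn ℝ ∞ P (univ ×ˢ L) → ContDiffOn ℝ ∞ Q (univ ×ˢ L) →
      ∀ z ∈ L, ∀ v : ℂ, fderiv ℝ (fun w => B (P (0, w)) (Q (0, w))) z v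
        = B (fderiv ℝ P (0, z) (0, v)) (Q (0, z)) + B (P (0, z)) (fderiv ℝ Q (0, z) (0, v)) := by
    intro P Q hP hQ z hz v
    have hP' := hdiff hP z hz
    have hQ' := hdiff hQ z hz
    rw [← fderiv_slice hP', ← fderiv_slice hQ']
    have hP2 : DifferentiableAt ℝ (fun w => P (0, w)) z :=
      ((hslice hP).contDiffAt (hL.mem_nhds hz)).differentiableAt (by simp)
    have hQ2 : DifferentiableAt ℝ (fun w => Q (0, w)) z :=
      ((hslice hQ).contDiffAt (hL.mem_nhds hz)).differentiableAt (by simp)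
    have := B.hasFDerivAt_of_bilinear hP2.hasFDerivAt hQ2.hasFDerivAt
    rw [this.fderiv]
    simp [add_comm]
  have hlap : ∀ z ∈ L, flatLaplacian (γ 0) z
      = fderiv ℝ X (0, z) (0, 1) + fderiv ℝ Y (0, z) (0, I) := fun z hz => by
    have : ∀ v : ℂ, (fun w => fderiv ℝ (γ 0) w v) =ᶠ[𝓝 z] fun w => fderiv ℝ Γ (0, w) (0, v) :=
      fun v => by filter_upwards [hL.mem_nhds hz] with w hw using hsl 0 w hw v
    rw [flatLaplacian, (this 1).fderiv_eq, (this I).fderiv_eq, fderiv_slice (hdiff (hdir _) z hz),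
      fderiv_slice (hdiff (hdir _) z hz)]
  have hDd : ∀ z ∈ L, fderiv ℝ (fun q => Real.sqrt (D q)) (0, z) (1, 0)
      = B (fderiv ℝ T (0, z) (0, 1)) (X (0, z)) + B (fderiv ℝ T (0, z) (0, I)) (Y (0, z)) := by
    intro z hz
    have hXd := (hdiff (hdir (0, 1)) z hz).hasFDerivAt
    have hYd := (hdiff (hdir (0, I)) z hz).hasFDerivAt
    have b1 := B.hasFDerivAt_of_bilinear hXd hXd
    have b2 := B.hasFDerivAt_of_bilinear hYd hYd
    have b3 := B.hasFDerivAt_of_bilinear hXd hYd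
    have hDf := (b1.mul b2).sub (b3.pow 2)
    have hne : D (0, z) ≠ 0 := by rw [hD0 z hz]; exact (pow_pos (hX0 z hz) 2).ne'
    have hDf' : HasFDerivAt D _ (0, z) := hDf
    have hsq := hDf'.sqrt hne
    have h1 := hconf z hz
    have h2 := horth z hz
    rw [hsl 0 z hz, hsl 0 z hz] at h1 h2
    have hs : Real.sqrt (D (0, z)) = B (X (0, z)) (X (0, z)) := by
      rw [hD0 z hz, Real.sqrt_sq (hX0 z hz).le]
    have hx := hX0 z hz
    rw [hsq.fderiv, hs]
    have e1 := hsym z hz (0, 1) (1, 0)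
    have e2 := hsym z hz (0, I) (1, 0)
    simp only [hX, hY, hT] at *
    simp only [_root_.smul_apply, _root_.sub_apply, _root_.add_apply, ContinuousLinearMap.precompR_apply,
      ContinuousLinearMap.precompL_apply, ContinuousLinearMap.compL_apply,
      ContinuousLinearMap.comp_apply, e1, e2, h2, ← h1, smul_eq_mul]
    rw [hB (fderiv ℝ Γ (0, z) (0, 1)) (fderiv ℝ (fun q => fderiv ℝ Γ q (1, 0)) (0, z) (0, 1)),
      hB (fderiv ℝ Γ (0, z) (0, I)) (fderiv ℝ (fun q => fderiv ℝ Γ q (1, 0)) (0, z) (0, I))]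
    field_simp
    ring
  have hcont : ∀ {P Q : ℝ × ℂ → V}, ContDiffOn ℝ ∞ P (univ ×ˢ L) → ContDiffOn ℝ ∞ Q (univ ×ˢ L) →
      IntegrableOn (fun z => B (P (0, z)) (Q (0, z))) K := fun hP hQ =>
    ((hBs hP hQ).continuousOn.mono hKL).integrableOn_compact hK
  have hdX : ∀ u v, ContDiffOn ℝ ∞ (fun q => fderiv ℝ (fun q => fderiv ℝ Γ q u) q v) (univ ×ˢ L) :=
    fun u v => ((hdir u).fderiv_of_isOpen hO (by simp)).clm_apply contDiffOn_const
  have e3 : ∫ z in K, fderiv ℝ (fun q => Real.sqrt (D q)) (0, z) (1, 0) = ∫ z in K,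
      ((fderiv ℝ (fun w => B (T (0, w)) (X (0, w))) z 1
        + fderiv ℝ (fun w => B (T (0, w)) (Y (0, w))) z I)
      - (B (T (0, z)) (fderiv ℝ X (0, z) (0, 1)) + B (T (0, z)) (fderiv ℝ Y (0, z) (0, I)))) :=
    setIntegral_congr_fun hK.measurableSet fun z hz => by
      simp only [hDd z (hKL hz), hfd (hdir (1, 0)) (hdir (0, 1)) z (hKL hz),
        hfd (hdir (1, 0)) (hdir (0, I)) z (hKL hz), hT, hX, hY]
      ring
  have i1 : ∀ u v : ℂ, IntegrableOn
      (fun z => fderiv ℝ (fun w => B (T (0, w)) (fderiv ℝ Γ (0, w) (0, u))) z v) K := fun u v =>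
    (((hBs (hdir (1, 0)) (hdir (0, u))).continuousOn_fderiv_of_isOpen hL le_rfl).clm_apply
      continuousOn_const |>.mono hKL).integrableOn_compact hK
  rw [e3, integral_sub, hdiv, zero_sub]
  · congr 1
    refine setIntegral_congr_fun hK.measurableSet fun z hz => ?_
    simp only [hTz z (hKL hz), hlap z (hKL hz), map_add]
  · exact (i1 1 1).add (i1 I I)
  · exact (hcont (hdir (1, 0)) (hdX (0, 1) (0, 1))).add (hcont (hdir (1, 0)) (hdX (0, I) (0, I)))

end Variations

noncomputable section

/-! ### Hermitian symmetric structures in a normed algebra -/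

/-- A Hermitian symmetric space of complex dimension two, realised as the orbit of `Y` under
conjugation by a group `G` in a normed algebra, with Lie algebra `𝔤` and automorphism `τ` of order
four. -/
structure HermitianModel (R : Type) [NormedRing R] [NormedAlgebra ℝ R] where
  /-- the group -/
  G : Set R
  /-- its Lie algebra -/
  𝔤 : Submodule ℝ R
  /-- the automorphism of order four -/
  τ : R →L[ℝ] R
  /-- the base point -/
  Y : R
  /-- the reference unitary frame -/
  ε : Fin 2 → R
  /-- the invariant pairing -/
  metric : R → R → ℝ
  /-- the inversion of the algebra -/
  inv : R → R
  /-- the pairing as a bounded bilinear map -/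
  B : R →L[ℝ] R →L[ℝ] ℝ
  metric_eq : ∀ V W, metric V W = B V W
  inv_eq : ∀ g, inv g = Ring.inverse g
  one_mem : 1 ∈ G
  mul_mem : ∀ {g h : R}, g ∈ G → h ∈ G → g * h ∈ G
  inv_mem : ∀ {g : R}, g ∈ G → inv g ∈ G
  isUnit : ∀ {g : R}, g ∈ G → IsUnit g
  lie_mem : ∀ {X Z : R}, X ∈ 𝔤 → Z ∈ 𝔤 → X * Z - Z * X ∈ 𝔤
  mem_of_isParallelAt : ∀ {E : Type} [NormedAddCommGroup E] [NormedSpace ℝ E]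
    {A : E → E →L[ℝ] R} {F : E → R} {U : Set E}, IsOpen U → IsPreconnected U →
    (∀ z ∈ U, IsParallelAt A F z) → (∀ z ∈ U, ∀ v, A z v ∈ 𝔤) → ∀ {z₀ : E}, z₀ ∈ U →
    F z₀ ∈ G → ∀ z ∈ U, F z ∈ G
  mem_of_hasDerivAt : ∀ {γ : ℝ → R} {a : R}, HasDerivAt γ (γ 0 * a) 0 →
    (∀ᶠ t in 𝓝 0, γ t ∈ G) → a ∈ 𝔤
  τ_four : ∀ X, τ (τ (τ (τ X))) = X
  τ_lie : ∀ X Z : R, τ (X * Z - Z * X) = τ X * τ Z - τ Z * τ X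
  τ_mem : ∀ {X}, X ∈ 𝔤 → τ X ∈ 𝔤
  Y_mem : Y ∈ 𝔤
  τ_Y : τ Y = -Y
  exists_section : ∃ s : R → R, ∀ᶠ p in 𝓝 Y, ContDiffAt ℝ ∞ s p ∧
    ((∃ g ∈ G, p = g * Y * inv g) → s p ∈ G ∧ s p * Y * inv (s p) = p)
  lie_Y : ∀ {X}, X ∈ 𝔤 → τ X = X → Y * X - X * Y = 0
  eq_smul_Y : ∀ {X}, X ∈ 𝔤 → τ X = -X → ∃ r : ℝ, X = r • Y
  eq_frame : ∀ {X}, X ∈ 𝔤 → τ (τ X) = -X → ∃ c : Fin 2 → ℂ,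
    X = ∑ i, ((c i).re • ε i + (c i).im • (Y * ε i - ε i * Y))
  ε_mem : ∀ i, ε i ∈ 𝔤
  τ_ε_zero : τ (ε 0) = -ε 1
  τ_ε_one : τ (ε 1) = ε 0
  lie_lie_ε : ∀ i, Y * (Y * ε i - ε i * Y) - (Y * ε i - ε i * Y) * Y = -ε i
  metric_symm : ∀ V W, metric V W = metric W V
  metric_frame : ∀ c d : Fin 2 → ℂ,
    metric (∑ i, ((c i).re • ε i + (c i).im • (Y * ε i - ε i * Y)))
        (∑ i, ((d i).re • ε i + (d i).im • (Y * ε i - ε i * Y)))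
      = ∑ i, ((c i).re * (d i).re + (c i).im * (d i).im)
  metric_act : ∀ {g v w : R}, g ∈ G → v ∈ 𝔤 → τ (τ v) = -v → w ∈ 𝔤 →
    τ (τ w) = -w → metric (g * v * inv g) (g * w * inv g) = metric v w
  metric_act_lie : ∀ {g u v w : R}, g ∈ G → u ∈ 𝔤 → τ (τ u) = -u →
    v ∈ 𝔤 → τ (τ v) = -v → w ∈ 𝔤 → τ (τ w) = -w →
    metric (g * u * inv g) (g * (v * w - w * v) * inv g) = 0

namespace HermitianModel

variable {R : Type} [NormedRing R] [NormedAlgebra ℝ R] (S : HermitianModel R)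

/-- The action on `M`. -/
def act (g p : R) : R := g * p * S.inv g

/-- The symmetric space `M`, the orbit `G · p₀` of the base point `p₀ = Y`. -/
def space : Set R := {p | ∃ g ∈ S.G, p = S.act g S.Y}

/-- The complex structure of `T_p M`. -/
def J (_S : HermitianModel R) (p V : R) : R := p * V - V * p

/-- The Kähler form of `M` at `p`. -/
def kahler (p V W : R) : ℝ := S.metric (S.J p V) W

/-- Multiplication by a complex number on `𝔪`. -/
def cmul (c : ℂ) (A : R) : R := c.re • A + c.im • S.J S.Y A

/-- The projection onto the fixed points of `τ`. -/
def projZero : R →L[ℝ] R :=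
  (1 / 4 : ℝ) • (.id ℝ _ + S.τ + S.τ.comp S.τ + S.τ.comp (S.τ.comp S.τ))

/-- The projection onto the `(-1)`-eigenspace of `τ`. -/
def projTwo : R →L[ℝ] R :=
  (1 / 4 : ℝ) • (.id ℝ _ - S.τ + S.τ.comp S.τ - S.τ.comp (S.τ.comp S.τ))

/-- The projection onto the `(-1)`-eigenspace of `τ²`. -/
def projML : R →L[ℝ] R := (1 / 2 : ℝ) • (.id ℝ _ - S.τ.comp S.τ)

theorem τ_J (X Z : R) : S.τ (S.J X Z) = S.J (S.τ X) (S.τ Z) := S.τ_lie X Z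

theorem J_mem {X Z : R} (hX : X ∈ S.𝔤) (hZ : Z ∈ S.𝔤) : S.J X Z ∈ S.𝔤 := S.lie_mem hX hZ

theorem J_Y {X : R} (hX : X ∈ S.𝔤) (h : S.τ X = X) : S.J S.Y X = 0 := S.lie_Y hX h

theorem J_J_ε (i : Fin 2) : S.J S.Y (S.J S.Y (S.ε i)) = -S.ε i := S.lie_lie_ε i

section Brackets

variable {S}

theorem J_add (X Z W : R) : S.J X (Z + W) = S.J X Z + S.J X W := by
  simp only [J]; noncomm_ring

theorem add_J (X Z W : R) : S.J (X + Z) W = S.J X W + S.J Z W := by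
  simp only [J]; noncomm_ring

theorem J_sub (X Z W : R) : S.J X (Z - W) = S.J X Z - S.J X W := by
  simp only [J]; noncomm_ring

theorem sub_J (X Z W : R) : S.J (X - Z) W = S.J X W - S.J Z W := by
  simp only [J]; noncomm_ring

theorem J_neg (X Z : R) : S.J X (-Z) = -S.J X Z := by
  simp only [J]; noncomm_ring

theorem neg_J (X Z : R) : S.J (-X) Z = -S.J X Z := by
  simp only [J]; noncomm_ring

theorem J_smul (c : ℝ) (X Z : R) : S.J X (c • Z) = c • S.J X Z := by
  simp only [J, mul_smul_comm, smul_mul_assoc, smul_sub]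

theorem smul_J (c : ℝ) (X Z : R) : S.J (c • X) Z = c • S.J X Z := by
  simp only [J, mul_smul_comm, smul_mul_assoc, smul_sub]

theorem J_self (X : R) : S.J X X = 0 := sub_self _

theorem J_zero (X : R) : S.J X 0 = 0 := by simp [J]

theorem zero_J (X : R) : S.J 0 X = 0 := by simp [J]

theorem neg_J_swap (X Z : R) : -S.J Z X = S.J X Z := neg_sub _ _

theorem J_J (X Z W : R) : S.J X (S.J Z W) = S.J (S.J X Z) W + S.J Z (S.J X W) := by
  simp only [J]; noncomm_ring

end Brackets

section Projections

variable {S}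

theorem projZero_apply (X : R) :
    S.projZero X = (1 / 4 : ℝ) • (X + S.τ X + S.τ (S.τ X) + S.τ (S.τ (S.τ X))) := rfl

theorem projTwo_apply (X : R) :
    S.projTwo X = (1 / 4 : ℝ) • (X - S.τ X + S.τ (S.τ X) - S.τ (S.τ (S.τ X))) := rfl

theorem projML_apply (X : R) : S.projML X = (1 / 2 : ℝ) • (X - S.τ (S.τ X)) := rfl

theorem proj_sum (X : R) : S.projZero X + S.projML X + S.projTwo X = X := by
  rw [projZero_apply, projTwo_apply, projML_apply]; module

theorem projZero_of_fixed {X : R} (h : S.τ X = X) : S.projZero X = X := by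
  rw [projZero_apply, h, h, h]; module

theorem projTwo_of_fixed {X : R} (h : S.τ X = X) : S.projTwo X = 0 := by
  rw [projTwo_apply, h, h, h]; module

theorem projML_of_fixed {X : R} (h : S.τ X = X) : S.projML X = 0 := by
  rw [projML_apply, h, h]; module

theorem projZero_of_neg {X : R} (h : S.τ X = -X) : S.projZero X = 0 := by
  rw [projZero_apply, h, map_neg, h, neg_neg, h]; module

theorem projTwo_of_neg {X : R} (h : S.τ X = -X) : S.projTwo X = X := by
  rw [projTwo_apply, h, map_neg, h, neg_neg, h]; module

theorem projML_of_neg {X : R} (h : S.τ X = -X) : S.projML X = 0 := by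
  rw [projML_apply, h, map_neg, h]; module

theorem projZero_of_mem {X : R} (h : S.τ (S.τ X) = -X) : S.projZero X = 0 := by
  rw [projZero_apply, h, map_neg]; module

theorem projTwo_of_mem {X : R} (h : S.τ (S.τ X) = -X) : S.projTwo X = 0 := by
  rw [projTwo_apply, h, map_neg]; module

theorem projML_of_mem {X : R} (h : S.τ (S.τ X) = -X) : S.projML X = X := by
  rw [projML_apply, h]; module

end Projections

theorem τ_projZero (X : R) : S.τ (S.projZero X) = S.projZero X := by
  rw [projZero_apply, map_smul, map_add, map_add, map_add, S.τ_four]; module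

theorem τ_projTwo (X : R) : S.τ (S.projTwo X) = -S.projTwo X := by
  rw [projTwo_apply, map_smul, map_sub, map_add, map_sub, S.τ_four]; module

theorem τ_τ_projML (X : R) : S.τ (S.τ (S.projML X)) = -S.projML X := by
  rw [projML_apply, map_smul, map_smul, map_sub, map_sub, S.τ_four]; module

theorem projZero_mem {X : R} (hX : X ∈ S.𝔤) : S.projZero X ∈ S.𝔤 :=
  S.𝔤.smul_mem _ (S.𝔤.add_mem (S.𝔤.add_mem (S.𝔤.add_mem hX (S.τ_mem hX)) (S.τ_mem (S.τ_mem hX)))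
    (S.τ_mem (S.τ_mem (S.τ_mem hX))))

theorem projTwo_mem {X : R} (hX : X ∈ S.𝔤) : S.projTwo X ∈ S.𝔤 :=
  S.𝔤.smul_mem _ (S.𝔤.sub_mem (S.𝔤.add_mem (S.𝔤.sub_mem hX (S.τ_mem hX)) (S.τ_mem (S.τ_mem hX)))
    (S.τ_mem (S.τ_mem (S.τ_mem hX))))

theorem projML_mem {X : R} (hX : X ∈ S.𝔤) : S.projML X ∈ S.𝔤 :=
  S.𝔤.smul_mem _ (S.𝔤.sub_mem hX (S.τ_mem (S.τ_mem hX)))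

theorem exists_frame {X : R} (hX : X ∈ S.𝔤) (h : S.τ (S.τ X) = -X) :
    ∃ c : Fin 2 → ℂ, X = ∑ i, S.cmul (c i) (S.ε i) := S.eq_frame hX h

theorem metric_cmul (c d : Fin 2 → ℂ) :
    S.metric (∑ i, S.cmul (c i) (S.ε i)) (∑ i, S.cmul (d i) (S.ε i))
      = ∑ i, ((c i).re * (d i).re + (c i).im * (d i).im) := S.metric_frame c d

theorem ε_ne_zero (i : Fin 2) : S.ε i ≠ 0 := fun h0 => by
  have h1 := S.metric_cmul (Pi.single i 1) (Pi.single i 1)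
  have h2 : ∑ j, S.cmul ((Pi.single i 1 : Fin 2 → ℂ) j) (S.ε j) = 0 :=
    Finset.sum_eq_zero fun j _ => by
      by_cases hj : j = i
      · subst hj; simp [cmul, J, h0]
      · simp [cmul, Pi.single_eq_of_ne hj]
  rw [h2, S.metric_eq] at h1
  fin_cases i <;> simp at h1

theorem Y_ne_zero : S.Y ≠ 0 := fun h0 => by
  have := S.J_J_ε 0
  rw [h0, zero_J, eq_comm, neg_eq_zero] at this
  exact S.ε_ne_zero 0 this

theorem exists_beta : ∃ β : R →L[ℝ] ℝ, (∀ X ∈ S.𝔤, S.projTwo X = β X • S.Y) ∧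
    (∀ X, S.projTwo X = 0 → β X = 0) ∧ β S.Y = 1 := by
  obtain ⟨ℓ, hℓ⟩ := exists_dual_vector ℝ S.Y (norm_ne_zero_iff.2 S.Y_ne_zero)
  have hY : ‖S.Y‖ ≠ 0 := norm_ne_zero_iff.2 S.Y_ne_zero
  have hℓY : (‖S.Y‖⁻¹ • ℓ) S.Y = 1 := by
    have := hℓ.2
    simp only [_root_.smul_apply, smul_eq_mul]
    rw [this]; simp [hY]
  refine ⟨(‖S.Y‖⁻¹ • ℓ).comp S.projTwo, fun X hX => ?_, fun X hX => ?_, ?_⟩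
  · obtain ⟨r, hr⟩ := S.eq_smul_Y (S.projTwo_mem hX) (S.τ_projTwo X)
    rw [ContinuousLinearMap.comp_apply, hr, map_smul, hℓY, smul_eq_mul, mul_one]
  · rw [ContinuousLinearMap.comp_apply, hX, map_zero]
  · rw [ContinuousLinearMap.comp_apply, projTwo_of_neg S.τ_Y, hℓY]

/-- A real functional reading off the component along `Y`. -/
def β : R →L[ℝ] ℝ := S.exists_beta.choose

theorem projTwo_eq {X : R} (hX : X ∈ S.𝔤) : S.projTwo X = S.β X • S.Y :=
  S.exists_beta.choose_spec.1 X hX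

theorem β_of_projTwo {X : R} (hX : S.projTwo X = 0) : S.β X = 0 :=
  S.exists_beta.choose_spec.2.1 X hX

theorem β_Y : S.β S.Y = 1 := S.exists_beta.choose_spec.2.2

theorem eq_sum {X : R} (hX : X ∈ S.𝔤) : X = S.projZero X + S.projML X + S.β X • S.Y := by
  rw [← S.projTwo_eq hX, proj_sum]

theorem τ_τ_lie_Y {X : R} (hX : S.τ (S.τ X) = -X) :
    S.τ (S.τ (S.J S.Y X)) = -S.J S.Y X := by
  rw [S.τ_J, S.τ_J, S.τ_Y, map_neg, S.τ_Y, neg_neg, hX, J_neg]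

theorem lie_Y_lie_Y {X : R} (hX : X ∈ S.𝔤) (hX' : S.τ (S.τ X) = -X) :
    S.J S.Y (S.J S.Y X) = -X := by
  obtain ⟨c, rfl⟩ := S.exists_frame hX hX'
  simp only [cmul, Fin.sum_univ_two, J_add, J_smul, S.J_J_ε, J_neg]
  module

theorem lie_projZero_Y {X : R} (hX : X ∈ S.𝔤) : S.J S.Y (S.projZero X) = 0 :=
  S.J_Y (S.projZero_mem hX) (S.τ_projZero X)

/-- `S.J Y (·)` commutes with the adjoint action of the fixed points of `τ`. -/
theorem lie_Y_lie_projZero {X Z : R} (hX : X ∈ S.𝔤) :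
    S.J S.Y (S.J (S.projZero X) Z) = S.J (S.projZero X) (S.J S.Y Z) := by
  rw [J_J, S.lie_projZero_Y hX, zero_J, zero_add]

/-! The components of the flatness equation. -/

/-- The bracket of two elements whose `𝔪`-components are related by `-τ`. -/
theorem lie_eq {a b : R} (ha : a ∈ S.𝔤) (hb : b ∈ S.𝔤) :
    S.J a b = (S.J (S.projZero a) (S.projZero b) + S.J (S.projML a) (S.projML b))
      + (S.J (S.projZero a) (S.projML b) - S.J (S.projZero b) (S.projML a)
        + S.β a • S.J S.Y (S.projML b) - S.β b • S.J S.Y (S.projML a)) := by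
  have e1 := S.lie_projZero_Y ha
  have e2 := S.lie_projZero_Y hb
  have e3 : S.J (S.projZero a) S.Y = 0 := by rw [← neg_J_swap, e1, neg_zero]
  conv_lhs => rw [S.eq_sum ha, S.eq_sum hb]
  simp only [add_J, J_add, J_smul, smul_J, e2, e3, J_self, smul_zero, add_zero]
  rw [← neg_J_swap (S.projZero b) (S.projML a), ← neg_J_swap S.Y (S.projML a)]
  module

theorem lie_zero_part {a b : R} (hab : S.projML b = -S.τ (S.projML a)) :
    S.τ (S.J (S.projZero a) (S.projZero b) + S.J (S.projML a) (S.projML b))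
      = S.J (S.projZero a) (S.projZero b) + S.J (S.projML a) (S.projML b) := by
  rw [map_add, S.τ_J, S.τ_J, S.τ_projZero, S.τ_projZero, hab, map_neg, S.τ_τ_projML, neg_neg,
    J_neg, neg_J_swap]

theorem lie_m_part (a b : R) :
    S.τ (S.τ (S.J (S.projZero a) (S.projML b) - S.J (S.projZero b) (S.projML a)
        + S.β a • S.J S.Y (S.projML b) - S.β b • S.J S.Y (S.projML a)))
      = -(S.J (S.projZero a) (S.projML b) - S.J (S.projZero b) (S.projML a)
        + S.β a • S.J S.Y (S.projML b) - S.β b • S.J S.Y (S.projML a)) := by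
  simp only [map_sub, map_add, map_smul, S.τ_J, S.τ_projZero, S.τ_τ_projML, S.τ_Y, map_neg,
    J_neg, neg_J, neg_neg]
  module

variable {a b D₁a D₂a D₁b D₂b : R}

theorem flat_β (ha : a ∈ S.𝔤) (hb : b ∈ S.𝔤) (hab : S.projML b = -S.τ (S.projML a))
    (hflat : D₁b - D₂a + S.J a b = 0) : S.β D₁b - S.β D₂a = 0 := by
  have := congrArg S.β hflat
  rw [S.lie_eq ha hb, map_add, map_add, S.β_of_projTwo (projTwo_of_fixed (S.lie_zero_part hab)),
    S.β_of_projTwo (projTwo_of_mem (S.lie_m_part a b)), map_sub, map_zero] at this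
  simpa using this

theorem flat_projZero (ha : a ∈ S.𝔤) (hb : b ∈ S.𝔤) (hab : S.projML b = -S.τ (S.projML a))
    (hflat : D₁b - D₂a + S.J a b = 0) : S.projZero D₁b - S.projZero D₂a
      + (S.J (S.projZero a) (S.projZero b) + S.J (S.projML a) (S.projML b)) = 0 := by
  have := congrArg S.projZero hflat
  rw [S.lie_eq ha hb, map_add, map_add, projZero_of_fixed (S.lie_zero_part hab),
    projZero_of_mem (S.lie_m_part a b), map_sub, map_zero, add_zero] at this
  exact this

theorem flat_projML (ha : a ∈ S.𝔤) (hb : b ∈ S.𝔤) (hab : S.projML b = -S.τ (S.projML a))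
    (hflat : D₁b - D₂a + S.J a b = 0) : S.projML D₁b - S.projML D₂a
      + (S.J (S.projZero a) (S.projML b) - S.J (S.projZero b) (S.projML a)
        + S.β a • S.J S.Y (S.projML b) - S.β b • S.J S.Y (S.projML a)) = 0 := by
  have := congrArg S.projML hflat
  rw [S.lie_eq ha hb, map_add, map_add, projML_of_fixed (S.lie_zero_part hab),
    projML_of_mem (S.lie_m_part a b), map_sub, map_zero, zero_add] at this
  exact this

/-- The `𝔪`-component of the flatness equation, after applying `τ`. -/
theorem flat_coclosed (ha : a ∈ S.𝔤) (hb : b ∈ S.𝔤) (hab : S.projML b = -S.τ (S.projML a))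
    (h₁ : S.projML D₁b = -S.τ (S.projML D₁a)) (h₂ : S.projML D₂b = -S.τ (S.projML D₂a))
    (hflat : D₁b - D₂a + S.J a b = 0) : S.projML D₁a + S.projML D₂b
      + S.J (S.projZero a) (S.projML a) + S.J (S.projZero b) (S.projML b)
      - S.β a • S.J S.Y (S.projML a) - S.β b • S.J S.Y (S.projML b) = 0 := by
  have := congrArg S.τ (S.flat_projML ha hb hab hflat)
  simp only [map_sub, map_add, map_smul, map_zero, S.τ_J, S.τ_projZero, S.τ_Y, h₁, hab, map_neg,
    S.τ_τ_projML, neg_neg, neg_J] at this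
  rw [h₂, hab, ← this]
  simp only [J_neg]
  module

/-- The value `α_l(v)` in terms of `a = α(v)` and `b = α(i v)`, where `l = c + i s`. -/
def extend (c s : ℝ) (a b : R) : R :=
  S.projZero a + c • S.projML a - s • S.projML b
    + ((c ^ 2 - s ^ 2) * S.β a - (2 * c * s) * S.β b) • S.Y

theorem flat_extend {c s : ℝ} (hcs : c ^ 2 + s ^ 2 = 1) (ha : a ∈ S.𝔤) (hb : b ∈ S.𝔤)
    (hab : S.projML b = -S.τ (S.projML a))
    (h₁ : S.projML D₁b = -S.τ (S.projML D₁a)) (h₂ : S.projML D₂b = -S.τ (S.projML D₂a))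
    (hflat : D₁b - D₂a + S.J a b = 0) (hdiv : S.β D₁a + S.β D₂b = 0) :
    S.extend c s D₁b (-D₁a) - S.extend c s D₂a D₂b
      + S.J (S.extend c s a b) (S.extend c s b (-a)) = 0 := by
  have f0 := S.flat_projZero ha hb hab hflat
  have f1 := S.flat_β ha hb hab hflat
  have f2 := S.flat_projML ha hb hab hflat
  have f3 := S.flat_coclosed ha hb hab h₁ h₂ hflat
  have e1 := S.lie_projZero_Y ha
  have e2 := S.lie_projZero_Y hb
  have e3 : S.J (S.projZero a) S.Y = 0 := by rw [← neg_J_swap, e1, neg_zero]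
  simp only [extend, map_neg, add_J, J_add, sub_J, J_smul, smul_J, smul_neg, e2, e3,
    J_self, smul_zero, sub_neg_eq_add, add_zero]
  rw [← neg_J_swap (S.projML a) (S.projZero b), ← neg_J_swap (S.projML a) S.Y,
    ← neg_J_swap (S.projML b) (S.projZero b), ← neg_J_swap (S.projML b) S.Y,
    ← neg_J_swap (S.projML b) (S.projML a)]
  linear_combination (norm := module) f0 + c • f2 + s • f3 + (c ^ 2 - s ^ 2) • f1 • S.Y
    + (2 * c * s) • hdiv • S.Y
    + hcs • (S.J (S.projML a) (S.projML b) + (c * S.β a - s * S.β b) • S.J S.Y (S.projML b)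
      - (s * S.β a + c * S.β b) • S.J S.Y (S.projML a))

end HermitianModel

end

noncomputable section

section ParallelSections

variable {E R : Type*} [NormedAddCommGroup E] [NormedSpace ℝ E]
  [NormedRing R] [NormedAlgebra ℝ R]

/-- The left logarithmic derivative `F⁻¹ dF`. -/
def logFDeriv (F : E → R) (z : E) : E →L[ℝ] R :=
  (ContinuousLinearMap.mul ℝ R (Ring.inverse (F z))).comp (fderiv ℝ F z)

theorem logFDeriv_apply (F : E → R) (z v : E) :
    logFDeriv F z v = Ring.inverse (F z) * fderiv ℝ F z v := rfl

theorem isParallelAt_logFDeriv {F : E → R} {z : E} (h : DifferentiableAt ℝ F z)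
    (hu : IsUnit (F z)) : IsParallelAt (logFDeriv F) F z := by
  refine h.hasFDerivAt.congr_fderiv ?_
  ext v
  simp [logFDeriv_apply, ← mul_assoc, Ring.mul_inverse_cancel _ hu]

theorem IsParallelAt.logFDeriv_eq {A : E → E →L[ℝ] R} {F : E → R} {z : E}
    (h : IsParallelAt A F z) (hu : IsUnit (F z)) : logFDeriv F z = A z := by
  ext v
  rw [logFDeriv_apply, h.fderiv]
  simp [← mul_assoc, Ring.inverse_mul_cancel _ hu]

theorem IsParallelAt.congr_left {A A' : E → E →L[ℝ] R} {F : E → R} {z : E}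
    (h : IsParallelAt A F z) (hA : A z = A' z) : IsParallelAt A' F z := by
  rw [IsParallelAt, ← hA]; exact h

/-- The Maurer-Cartan equation. -/
theorem IsParallelAt.flat {A : E → E →L[ℝ] R} {F : E → R} {U : Set E} (hU : IsOpen U)
    (hF : ∀ z ∈ U, IsParallelAt A F z) (hu : ∀ z ∈ U, IsUnit (F z)) (hA : ContDiffOn ℝ ∞ A U)
    {z : E} (hz : z ∈ U) (v w : E) :
    fderiv ℝ A z v w - fderiv ℝ A z w v + (A z v * A z w - A z w * A z v) = 0 := by
  have hAd : HasFDerivAt A (fderiv ℝ A z) z :=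
    ((hA.contDiffAt (hU.mem_nhds hz)).differentiableAt (by simp)).hasFDerivAt
  have hF2 : ContDiffAt ℝ ∞ F z := (ContDiffOn.of_isParallelAt hU hA hF).contDiffAt (hU.mem_nhds hz)
  have hsymm := (hF2.isSymmSndFDerivAt (by
    rw [minSmoothness_of_isRCLikeNormedField]; exact WithTop.coe_le_coe.2 le_top)) v w
  have hev : fderiv ℝ F =ᶠ[𝓝 z] fun x => (ContinuousLinearMap.mul ℝ R (F x)).comp (A x) := by
    filter_upwards [hU.mem_nhds hz] with x hx using (hF x hx).fderiv
  have hd : HasFDerivAt (fun x => (ContinuousLinearMap.mul ℝ R (F x)).comp (A x)) _ z :=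
    (((ContinuousLinearMap.mul ℝ R).hasFDerivAt (x := F z)).comp z (hF z hz)).clm_comp hAd
  rw [hev.fderiv_eq, hd.fderiv] at hsymm
  simp only [_root_.add_apply, ContinuousLinearMap.comp_apply, ContinuousLinearMap.mul_apply',
    ContinuousLinearMap.flip_apply, ContinuousLinearMap.compL_apply,
    Function.comp_apply, mul_assoc, ← mul_add] at hsymm
  have := (hu z hz).mul_left_cancel hsymm
  rw [← sub_eq_zero.2 this]
  abel

variable [CompleteSpace R]

theorem ContDiffOn.ringInverse {F : E → R} {U : Set E} {n : WithTop ℕ∞} (hF : ContDiffOn ℝ n F U)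
    (hu : ∀ z ∈ U, IsUnit (F z)) : ContDiffOn ℝ n (fun z => Ring.inverse (F z)) U := fun z hz => by
  obtain ⟨u, hu⟩ := hu z hz
  have := contDiffAt_ringInverse (n := n) ℝ u
  rw [hu] at this
  exact this.comp_contDiffWithinAt z (hF z hz)

theorem ContDiffOn.logFDeriv {F : E → R} {U : Set E} (hU : IsOpen U) (hF : ContDiffOn ℝ ∞ F U)
    (hu : ∀ z ∈ U, IsUnit (F z)) : ContDiffOn ℝ ∞ (logFDeriv F) U :=
  ((ContinuousLinearMap.mul ℝ R).contDiff.comp_contDiffOn (hF.ringInverse hu)).clm_comp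
    (hF.fderiv_of_isOpen hU (by simp))

theorem IsParallelAt.hasFDerivAt_inverse {A : E → E →L[ℝ] R} {F : E → R} {z : E}
    (hF : IsParallelAt A F z) (hu : IsUnit (F z)) :
    HasFDerivAt (fun x => Ring.inverse (F x))
      (-((ContinuousLinearMap.mul ℝ R).flip (Ring.inverse (F z))).comp (A z)) z := by
  obtain ⟨u, hu⟩ := hu
  have h1 := hasFDerivAt_ringInverse (𝕜 := ℝ) u
  rw [hu] at h1
  refine (h1.comp z hF).congr_fderiv ?_
  ext v
  simp [← hu]

/-- The derivative of a map conjugated by a parallel section. -/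
theorem IsParallelAt.hasFDerivAt_conj {A : E → E →L[ℝ] R} {F X : E → R} {X' : E →L[ℝ] R} {z : E}
    (hF : IsParallelAt A F z) (hu : IsUnit (F z)) (hX : HasFDerivAt X X' z) (v : E) :
    DifferentiableAt ℝ (fun x => F x * X x * Ring.inverse (F x)) z ∧
    fderiv ℝ (fun x => F x * X x * Ring.inverse (F x)) z v
      = F z * (X' v + (A z v * X z - X z * A z v)) * Ring.inverse (F z) := by
  have : HasFDerivAt (fun x => F x * X x * Ring.inverse (F x)) _ z :=
    (HasFDerivAt.mul' hF hX).mul' (hF.hasFDerivAt_inverse hu)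
  refine ⟨this.differentiableAt, ?_⟩
  rw [this.fderiv]
  simp only [_root_.add_apply, _root_.smul_apply, _root_.neg_apply,
    ContinuousLinearMap.comp_apply, ContinuousLinearMap.mul_apply', smul_eq_mul,
    ContinuousLinearMap.flip_apply, MulOpposite.smul_eq_mul_unop, MulOpposite.unop_op, Pi.mul_apply]
  noncomm_ring

end ParallelSections

end

noncomputable section

namespace HermitianModel

variable {R : Type} [NormedRing R] [NormedAlgebra ℝ R] (S : HermitianModel R)

/-- `f : L → M` is a smooth conformal immersion. -/
def IsConformalImmersion (f : ℂ → R) (L : Set ℂ) : Prop :=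
  ContDiffOn ℝ ∞ f L ∧ (∀ z ∈ L, f z ∈ S.space) ∧
  ∀ z ∈ L, 0 < S.metric (fderiv ℝ f z 1) (fderiv ℝ f z 1) ∧
    S.metric (fderiv ℝ f z 1) (fderiv ℝ f z 1) = S.metric (fderiv ℝ f z I) (fderiv ℝ f z I) ∧
    S.metric (fderiv ℝ f z 1) (fderiv ℝ f z I) = 0

/-- The pull-back of the Kähler form by `f` vanishes. -/
def IsLagrangian (f : ℂ → R) (L : Set ℂ) : Prop :=
  ∀ z ∈ L, ∀ v w : ℂ, S.kahler (f z) (fderiv ℝ f z v) (fderiv ℝ f z w) = 0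

/-- The area density. -/
def areaDensity (f : ℂ → R) (z : ℂ) : ℝ :=
  Real.sqrt (S.metric (fderiv ℝ f z 1) (fderiv ℝ f z 1)
      * S.metric (fderiv ℝ f z I) (fderiv ℝ f z I)
    - S.metric (fderiv ℝ f z 1) (fderiv ℝ f z I) ^ 2)

/-- `f` is a critical point of the area among compactly supported Hamiltonian variations. -/
def IsHamiltonianStationary (f : ℂ → R) (L : Set ℂ) : Prop :=
  ∀ (γ : ℝ → ℂ → R) (K : Set ℂ) (φ : ℂ → ℝ),
    ContDiffOn ℝ ∞ (fun q : ℝ × ℂ => γ q.1 q.2) (univ ×ˢ L) →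
    (∀ t, ∀ z ∈ L, γ t z ∈ S.space) →
    (∀ z ∈ L, γ 0 z = f z) →
    IsCompact K → K ⊆ L →
    (∀ t, ∀ z ∈ L \ K, γ t z = f z) →
    ContDiff ℝ ∞ φ → tsupport φ ⊆ K →
    (∀ z ∈ L, ∀ v : ℂ,
      S.kahler (f z) (deriv (fun t => γ t z) 0) (fderiv ℝ f z v) = fderiv ℝ φ z v) →
    HasDerivAt (fun t => ∫ z in K, S.areaDensity (γ t) z) 0 0

/-- `f : L → M` is a conformal Hamiltonian stationary Lagrangian immersion. -/
def IsHSL (f : ℂ → R) (L : Set ℂ) : Prop :=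
  S.IsConformalImmersion f L ∧ S.IsLagrangian f L ∧ S.IsHamiltonianStationary f L

/-- The Maurer-Cartan form. -/
def maurerCartan (F : ℂ → R) (z v : ℂ) : R := S.inv (F z) * fderiv ℝ F z v

/-- The projection onto `𝔪`. -/
def projM (A : R) : R := (1 / 2 : ℝ) • (A - S.τ (S.τ A))

/-- `F : L → G` is a smooth lift of `f`. -/
def IsLift (F f : ℂ → R) (L : Set ℂ) : Prop :=
  ContDiffOn ℝ ∞ F L ∧ (∀ z ∈ L, F z ∈ S.G) ∧ ∀ z ∈ L, S.act (F z) S.Y = f z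

/-- `F : L → G` is a Lagrangian lift of `f`. -/
def IsLagrangianLift (F f : ℂ → R) (L : Set ℂ) : Prop :=
  S.IsLift F f L ∧
  ∀ z ∈ L, ∃ ρ : ℝ, ∃ k ∈ Matrix.specialUnitaryGroup (Fin 2) ℂ, ∀ j : Fin 2,
    S.projM (S.maurerCartan F z (![1, I] j)) =
      Real.exp ρ • ∑ i : Fin 2, S.cmul (k i j) (S.ε i)

/-- `F_l : L → G` is a smooth solution of `dF_l = F_l α_l`. -/
def IsExtendedSolution (F : ℂ → R) (l : Circle) (Fl : ℂ → R) (L : Set ℂ) : Prop :=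
  ContDiffOn ℝ ∞ Fl L ∧ (∀ z ∈ L, Fl z ∈ S.G) ∧
  ∀ z ∈ L, ∀ v : ℂ, S.maurerCartan Fl z v =
    S.extend (l : ℂ).re (l : ℂ).im (S.maurerCartan F z v) (S.maurerCartan F z (I * v))

/-- The map into `M` of which `F` is a lift. -/
def proj (F : ℂ → R) (z : ℂ) : R := S.act (F z) S.Y

variable {S}

theorem maurerCartan_eq (F : ℂ → R) (z v : ℂ) : S.maurerCartan F z v = logFDeriv F z v := by
  rw [maurerCartan, S.inv_eq, logFDeriv_apply]

theorem projM_eq (X : R) : S.projM X = S.projML X := rfl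

theorem act_eq (g X : R) : S.act g X = g * X * Ring.inverse g := by rw [act, S.inv_eq]

theorem inv_mul_cancel {g : R} (hg : g ∈ S.G) : S.inv g * g = 1 := by
  rw [S.inv_eq, Ring.inverse_mul_cancel _ (S.isUnit hg)]

theorem mul_inv_cancel {g : R} (hg : g ∈ S.G) : g * S.inv g = 1 := by
  rw [S.inv_eq, Ring.mul_inverse_cancel _ (S.isUnit hg)]

theorem inv_mul {g h : R} (hg : g ∈ S.G) (hh : h ∈ S.G) : S.inv (g * h) = S.inv h * S.inv g := by
  obtain ⟨u, rfl⟩ := S.isUnit hg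
  obtain ⟨v, rfl⟩ := S.isUnit hh
  rw [S.inv_eq, S.inv_eq, S.inv_eq, ← Units.val_mul, Ring.inverse_unit, Ring.inverse_unit,
    Ring.inverse_unit, mul_inv_rev, Units.val_mul]

theorem act_mul {g h : R} (hg : g ∈ S.G) (hh : h ∈ S.G) (X : R) :
    S.act (g * h) X = S.act g (S.act h X) := by
  rw [act, act, act, inv_mul hg hh]; noncomm_ring

theorem act_inv {g : R} (hg : g ∈ S.G) (X : R) : S.act (S.inv g) (S.act g X) = X := by
  obtain ⟨u, rfl⟩ := S.isUnit hg
  simp [act, S.inv_eq, mul_assoc]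

theorem inv_inv {g : R} (hg : g ∈ S.G) : S.inv (S.inv g) = g := by
  obtain ⟨u, rfl⟩ := S.isUnit hg
  simp [S.inv_eq]

theorem act_act_inv {g : R} (hg : g ∈ S.G) (X : R) : S.act g (S.act (S.inv g) X) = X := by
  have := act_inv (S.inv_mem hg) X
  rwa [inv_inv hg] at this

theorem act_one (X : R) : S.act 1 X = X := by simp [act, S.inv_eq]

theorem act_J {g : R} (hg : g ∈ S.G) (X Z : R) :
    S.J (S.act g X) (S.act g Z) = S.act g (S.J X Z) := by
  obtain ⟨u, rfl⟩ := S.isUnit hg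
  simp [act, J, S.inv_eq, mul_assoc, mul_sub, sub_mul]

theorem act_add (g X Z : R) : S.act g (X + Z) = S.act g X + S.act g Z := by
  simp only [act]; noncomm_ring

theorem act_sub (g X Z : R) : S.act g (X - Z) = S.act g X - S.act g Z := by
  simp only [act]; noncomm_ring

theorem act_smul (g : R) (c : ℝ) (X : R) : S.act g (c • X) = c • S.act g X := by
  simp only [act, mul_smul_comm, smul_mul_assoc]

theorem metric_neg_neg (V W : R) : S.metric (-V) (-W) = S.metric V W := by
  simp [S.metric_eq]

theorem act_mem_space {g : R} (hg : g ∈ S.G) : S.act g S.Y ∈ S.space := ⟨g, hg, rfl⟩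

/-! ### The subspace `𝔪` -/

variable (S) in
/-- The subspace `𝔪` of the Lie algebra. -/
def M : Submodule ℝ R where
  carrier := {X | X ∈ S.𝔤 ∧ S.τ (S.τ X) = -X}
  add_mem' h h' := ⟨S.𝔤.add_mem h.1 h'.1, by rw [map_add, map_add, h.2, h'.2, neg_add]⟩
  zero_mem' := ⟨S.𝔤.zero_mem, by simp⟩
  smul_mem' c X h := ⟨S.𝔤.smul_mem c h.1, by rw [map_smul, map_smul, h.2, smul_neg]⟩

theorem projML_mem_M {X : R} (hX : X ∈ S.𝔤) : S.projML X ∈ S.M :=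
  ⟨S.projML_mem hX, S.τ_τ_projML X⟩

theorem J_Y_mem_M {X : R} (hX : X ∈ S.M) : S.J S.Y X ∈ S.M :=
  ⟨S.J_mem S.Y_mem hX.1, S.τ_τ_lie_Y hX.2⟩

theorem τ_mem_M {X : R} (hX : X ∈ S.M) : S.τ X ∈ S.M :=
  ⟨S.τ_mem hX.1, by rw [hX.2, map_neg]⟩

theorem J_Y_J_Y {X : R} (hX : X ∈ S.M) : S.J S.Y (S.J S.Y X) = -X := S.lie_Y_lie_Y hX.1 hX.2

theorem metric_act_M {g v w : R} (hg : g ∈ S.G) (hv : v ∈ S.M) (hw : w ∈ S.M) :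
    S.metric (S.act g v) (S.act g w) = S.metric v w :=
  S.metric_act hg hv.1 hv.2 hw.1 hw.2

theorem metric_act_lie_M {g u v w : R} (hg : g ∈ S.G) (hu : u ∈ S.M) (hv : v ∈ S.M)
    (hw : w ∈ S.M) : S.metric (S.act g u) (S.act g (S.J v w)) = 0 :=
  S.metric_act_lie hg hu.1 hu.2 hv.1 hv.2 hw.1 hw.2

theorem ε_mem_M (i : Fin 2) : S.ε i ∈ S.M := by
  refine ⟨S.ε_mem i, ?_⟩
  fin_cases i
  · simp [S.τ_ε_zero, S.τ_ε_one]
  · simp [S.τ_ε_zero, S.τ_ε_one]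

theorem cmul_mem_M {X : R} (hX : X ∈ S.M) (c : ℂ) : S.cmul c X ∈ S.M :=
  S.M.add_mem (S.M.smul_mem _ hX) (S.M.smul_mem _ (J_Y_mem_M hX))

theorem J_Y_cmul {X : R} (hX : X ∈ S.M) (c : ℂ) : S.J S.Y (S.cmul c X) = S.cmul (I * c) X := by
  simp only [cmul, J_add, J_smul, J_Y_J_Y hX, mul_re, mul_im, I_re, I_im]
  module

theorem τ_cmul (X : R) (c : ℂ) : S.τ (S.cmul c X) = S.cmul (starRingEnd ℂ c) (S.τ X) := by
  simp only [cmul, map_add, map_smul, S.τ_J, S.τ_Y, neg_J, conj_re, conj_im]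
  module

theorem smul_cmul (r : ℝ) (c : ℂ) (X : R) : r • S.cmul c X = S.cmul (r * c) X := by
  simp only [cmul, mul_re, mul_im, ofReal_re, ofReal_im]
  module

theorem cmul_neg (c : ℂ) (X : R) : S.cmul c (-X) = S.cmul (-c) X := by
  simp only [cmul, J_neg, neg_re, neg_im]
  module

variable (S) in
/-- The element of `𝔪` with complex coordinates `c` in the frame `ε`. -/
def vec (c d : ℂ) : R := S.cmul c (S.ε 0) + S.cmul d (S.ε 1)

theorem exists_vec {X : R} (hX : X ∈ S.M) : ∃ c d, X = S.vec c d := by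
  obtain ⟨c, hc⟩ := S.exists_frame hX.1 hX.2
  exact ⟨c 0, c 1, by rw [hc, Fin.sum_univ_two, vec]⟩

theorem metric_vec (c d c' d' : ℂ) : S.metric (S.vec c d) (S.vec c' d')
    = (c * starRingEnd ℂ c' + d * starRingEnd ℂ d').re := by
  have := S.metric_cmul ![c, d] ![c', d']
  simp only [Fin.sum_univ_two, Matrix.cons_val_zero, Matrix.cons_val_one] at this
  rw [vec, vec, this]
  simp

theorem J_Y_vec (c d : ℂ) : S.J S.Y (S.vec c d) = S.vec (I * c) (I * d) := by
  rw [vec, J_add, J_Y_cmul (ε_mem_M 0), J_Y_cmul (ε_mem_M 1), vec]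

theorem τ_vec (c d : ℂ) :
    S.τ (S.vec c d) = S.vec (starRingEnd ℂ d) (-starRingEnd ℂ c) := by
  rw [vec, map_add, τ_cmul, τ_cmul, S.τ_ε_zero, S.τ_ε_one, cmul_neg, vec, add_comm]

theorem smul_vec (r : ℝ) (c d : ℂ) : r • S.vec c d = S.vec (r * c) (r * d) := by
  rw [vec, smul_add, smul_cmul, smul_cmul, vec]

theorem vec_add (c d c' d' : ℂ) : S.vec c d + S.vec c' d' = S.vec (c + c') (d + d') := by
  simp only [vec, cmul, Complex.add_re, Complex.add_im]; module

theorem vec_neg (c d : ℂ) : -S.vec c d = S.vec (-c) (-d) := by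
  simp only [vec, cmul, neg_re, neg_im]; module

theorem vec_inj {c d c' d' : ℂ} (h : S.vec c d = S.vec c' d') : c = c' ∧ d = d' := by
  have h0 : S.vec (c - c') (d - d') = 0 := by
    rw [sub_eq_add_neg, sub_eq_add_neg, ← vec_add, ← vec_neg, h, add_neg_cancel]
  have := S.metric_vec (c - c') (d - d') (c - c') (d - d')
  rw [h0, S.metric_eq, map_zero, mul_conj, mul_conj, ← ofReal_add, ofReal_re] at this
  have h1 := normSq_nonneg (c - c')
  have h2 := normSq_nonneg (d - d')
  rw [← sub_eq_zero, ← sub_eq_zero (a := d), ← normSq_eq_zero, ← normSq_eq_zero (z := d - d')]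
  constructor <;> linarith

theorem metric_J_J {v w : R} (hv : v ∈ S.M) (hw : w ∈ S.M) :
    S.metric (S.J S.Y v) (S.J S.Y w) = S.metric v w := by
  obtain ⟨c, d, rfl⟩ := exists_vec hv
  obtain ⟨c', d', rfl⟩ := exists_vec hw
  rw [J_Y_vec, J_Y_vec, metric_vec, metric_vec]
  simp

theorem metric_τ_τ {v w : R} (hv : v ∈ S.M) (hw : w ∈ S.M) :
    S.metric (S.τ v) (S.τ w) = S.metric v w := by
  obtain ⟨c, d, rfl⟩ := exists_vec hv
  obtain ⟨c', d', rfl⟩ := exists_vec hw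
  rw [τ_vec, τ_vec, metric_vec, metric_vec]
  simp; ring

theorem metric_self_τ {v : R} (hv : v ∈ S.M) : S.metric v (S.τ v) = 0 := by
  obtain ⟨c, d, rfl⟩ := exists_vec hv
  rw [τ_vec, metric_vec]
  simp
  ring

theorem metric_J_τ {v : R} (hv : v ∈ S.M) : S.metric (S.J S.Y v) (S.τ v) = 0 := by
  obtain ⟨c, d, rfl⟩ := exists_vec hv
  rw [τ_vec, J_Y_vec, metric_vec]
  simp
  ring

theorem metric_J_self {v : R} (hv : v ∈ S.M) : S.metric (S.J S.Y v) v = 0 := by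
  obtain ⟨c, d, rfl⟩ := exists_vec hv
  rw [J_Y_vec, metric_vec]
  simp; ring

theorem metric_pos {v : R} (hv : v ∈ S.M) (h : v ≠ 0) : 0 < S.metric v v := by
  obtain ⟨c, d, rfl⟩ := exists_vec hv
  rw [metric_vec, mul_conj, mul_conj, ← ofReal_add, ofReal_re]
  by_contra! h'
  have h1 := normSq_nonneg c
  have h2 := normSq_nonneg d
  have hc : c = 0 := normSq_eq_zero.1 (by linarith)
  have hd : d = 0 := normSq_eq_zero.1 (by linarith)
  subst hc hd
  simp [vec, cmul] at h

/-- The relation between the two components of the Maurer-Cartan form of a Lagrangian lift. -/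
theorem exists_specialUnitary_iff {A B : R} (hA : A ∈ S.M) :
    (∃ ρ : ℝ, ∃ k ∈ Matrix.specialUnitaryGroup (Fin 2) ℂ, ∀ j : Fin 2,
      ![A, B] j = Real.exp ρ • ∑ i : Fin 2, S.cmul (k i j) (S.ε i)) ↔ B = -S.τ A ∧ A ≠ 0 := by
  constructor
  · rintro ⟨ρ, k, hk, h⟩
    rw [Matrix.mem_specialUnitaryGroup_iff, Matrix.mem_unitaryGroup_iff'] at hk
    obtain ⟨hk, hdet⟩ := hk
    have hadj := Matrix.star_eq_conjTranspose k ▸ congrArg (· * k.adjugate) hk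
    simp only [mul_assoc, Matrix.mul_adjugate, hdet, one_smul, mul_one, one_mul] at hadj
    have e1 : k 0 1 = -starRingEnd ℂ (k 1 0) := by
      have := congrFun (congrFun hadj 0) 1
      simp [Matrix.adjugate_fin_two] at this
      rw [this, neg_neg]
    have e2 : k 1 1 = starRingEnd ℂ (k 0 0) := by
      have := congrFun (congrFun hadj 0) 0
      simp [Matrix.adjugate_fin_two] at this
      rw [this]
    have h0 : A = S.vec (Real.exp ρ * k 0 0) (Real.exp ρ * k 1 0) := by
      rw [← smul_vec]; simpa [vec] using h 0
    have h1 : B = S.vec (Real.exp ρ * k 0 1) (Real.exp ρ * k 1 1) := by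
      rw [← smul_vec]; simpa [vec] using h 1
    refine ⟨?_, fun hA0 => ?_⟩
    · rw [h0, h1, τ_vec, vec_neg, e1, e2]
      simp only [map_mul, conj_ofReal, mul_neg, neg_neg]
    · have hz : S.vec 0 0 = 0 := by simp [vec, cmul]
      rw [hA0, ← hz] at h0
      obtain ⟨h2, h3⟩ := vec_inj h0
      have he : (Real.exp ρ : ℂ) ≠ 0 := by exact_mod_cast (Real.exp_pos ρ).ne'
      rw [eq_comm, mul_eq_zero, or_iff_right he] at h2 h3
      rw [Matrix.det_fin_two, h2, h3] at hdet
      simp at hdet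
  · rintro ⟨rfl, h0⟩
    have hpos := metric_pos hA h0
    obtain ⟨c, d, rfl⟩ := exists_vec hA
    rw [metric_vec, mul_conj, mul_conj, ← ofReal_add, ofReal_re] at hpos
    set r : ℝ := normSq c + normSq d with hr
    have hs : Real.sqrt r ≠ 0 := (Real.sqrt_pos.2 hpos).ne'
    have hs' : (Real.sqrt r : ℂ) ≠ 0 := by exact_mod_cast hs
    have hsq : (Real.sqrt r : ℂ) * Real.sqrt r = c * starRingEnd ℂ c + d * starRingEnd ℂ d := by
      rw [mul_conj, mul_conj, ← ofReal_add, ← hr, ← ofReal_mul, Real.mul_self_sqrt hpos.le]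
    refine ⟨Real.log (Real.sqrt r), (Real.sqrt r : ℂ)⁻¹ • !![c, -starRingEnd ℂ d;
      d, starRingEnd ℂ c], ?_, ?_⟩
    · rw [Matrix.mem_specialUnitaryGroup_iff, Matrix.mem_unitaryGroup_iff]
      constructor
      · ext i j
        fin_cases i <;> fin_cases j <;> simp [Matrix.mul_apply, Fin.sum_univ_two, conj_ofReal] <;>
          field_simp <;> first | ring1 | linear_combination (-1 : ℂ) * hsq
      · simp [Matrix.det_fin_two]
        field_simp
        linear_combination (-1 : ℂ) * hsq
    · rw [Real.exp_log (Real.sqrt_pos.2 hpos)]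
      intro j
      rw [Fin.sum_univ_two, ← vec, smul_vec]
      fin_cases j
      · simp [mul_inv_cancel_left₀ hs']
      · simp [mul_inv_cancel_left₀ hs', τ_vec, vec_neg]

end HermitianModel

end

noncomputable section

namespace HermitianModel

variable {R : Type} [NormedRing R] [NormedAlgebra ℝ R]
  {S : HermitianModel R} {F f : ℂ → R} {U : Set ℂ} {z : ℂ}

theorem IsLift.isUnit (h : S.IsLift F f U) (hz : z ∈ U) : IsUnit (F z) := S.isUnit (h.2.1 z hz)

theorem IsLift.eqOn (h : S.IsLift F f U) :
    EqOn f (fun z => F z * S.Y * Ring.inverse (F z)) U := fun z hz => by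
  rw [← h.2.2 z hz, act_eq]

theorem J_Y_projML {X : R} (hX : X ∈ S.𝔤) : S.J S.Y (S.projML X) = S.J S.Y X := by
  conv_rhs => rw [S.eq_sum hX]
  rw [J_add, J_add, S.lie_projZero_Y hX, J_smul, J_self]; simp

theorem IsLift.isParallelAt (hU : IsOpen U) (h : S.IsLift F f U) (hz : z ∈ U) :
    IsParallelAt (logFDeriv F) F z :=
  isParallelAt_logFDeriv ((h.1.contDiffAt (hU.mem_nhds hz)).differentiableAt (by simp))
    (h.isUnit hz)

theorem IsLift.mem (hU : IsOpen U) (h : S.IsLift F f U) (hz : z ∈ U) (v : ℂ) :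
    logFDeriv F z v ∈ S.𝔤 := by
  have hd : HasDerivAt (fun t : ℝ => z + t • v) v 0 := by
    simpa using ((hasDerivAt_id (0 : ℝ)).smul_const v).const_add z
  have h1 : HasFDerivAt F ((ContinuousLinearMap.mul ℝ R (F z)).comp (logFDeriv F z))
      (z + (0 : ℝ) • v) := by
    rw [zero_smul, add_zero]; exact h.isParallelAt hU hz
  refine S.mem_of_hasDerivAt (γ := fun t => F (z + t • v)) ?_ ?_
  · have := h1.comp_hasDerivAt 0 hd
    simpa using! this
  · have hc : ContinuousAt (fun t : ℝ => z + t • v) 0 := hd.continuousAt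
    have : ∀ᶠ t : ℝ in 𝓝 0, z + t • v ∈ U := hc.eventually (by simpa using hU.mem_nhds hz)
    filter_upwards [this] with t ht using h.2.1 _ ht

variable [CompleteSpace R]

theorem IsLift.contDiffOn_logFDeriv (hU : IsOpen U) (h : S.IsLift F f U) :
    ContDiffOn ℝ ∞ (logFDeriv F) U :=
  h.1.logFDeriv hU fun _ hz => h.isUnit hz

theorem IsLift.contDiffOn_apply (hU : IsOpen U) (h : S.IsLift F f U) (v : ℂ) :
    ContDiffOn ℝ ∞ (fun z => logFDeriv F z v) U :=
  (h.contDiffOn_logFDeriv hU).clm_apply contDiffOn_const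

theorem IsLift.hasFDerivAt_apply (hU : IsOpen U) (h : S.IsLift F f U) (hz : z ∈ U) (v : ℂ) :
    HasFDerivAt (fun z => logFDeriv F z v) ((fderiv ℝ (logFDeriv F) z).flip v) z :=
  ((((h.contDiffOn_logFDeriv hU).contDiffAt (hU.mem_nhds hz)).differentiableAt
    (by simp)).hasFDerivAt.clm_apply (hasFDerivAt_const v z)).congr_fderiv (by ext; simp)

/-- The components of the Maurer-Cartan form of `F` are related as for a Lagrangian lift. -/
def IsTwisted (S : HermitianModel R) (F : ℂ → R) (U : Set ℂ) : Prop :=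
  ∀ z ∈ U, S.projML (logFDeriv F z I) = -S.τ (S.projML (logFDeriv F z 1))

omit [CompleteSpace R] in
theorem isLagrangianLift_iff (hU : IsOpen U) : S.IsLagrangianLift F f U ↔
    S.IsLift F f U ∧ IsTwisted S F U ∧ ∀ z ∈ U, S.projML (logFDeriv F z 1) ≠ 0 := by
  have key : ∀ h : S.IsLift F f U, ∀ z ∈ U,
      (∃ ρ : ℝ, ∃ k ∈ Matrix.specialUnitaryGroup (Fin 2) ℂ, ∀ j : Fin 2,
        S.projM (S.maurerCartan F z (![1, I] j)) =
          Real.exp ρ • ∑ i : Fin 2, S.cmul (k i j) (S.ε i)) ↔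
      S.projML (logFDeriv F z I) = -S.τ (S.projML (logFDeriv F z 1)) ∧
        S.projML (logFDeriv F z 1) ≠ 0 := fun h z hz => by
    rw [← exists_specialUnitary_iff (projML_mem_M (h.mem hU hz 1))]
    refine exists_congr fun ρ => exists_congr fun k => and_congr_right fun _ =>
      forall_congr' fun j => ?_
    rw [maurerCartan_eq, projM_eq]
    fin_cases j <;> rfl
  constructor
  · rintro ⟨h, h'⟩
    exact ⟨h, fun z hz => ((key h z hz).1 (h' z hz)).1, fun z hz => ((key h z hz).1 (h' z hz)).2⟩
  · rintro ⟨h, h1, h2⟩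
    exact ⟨h, fun z hz => (key h z hz).2 ⟨h1 z hz, h2 z hz⟩⟩

theorem IsLift.fderiv_eq (hU : IsOpen U) (h : S.IsLift F f U) (hz : z ∈ U) (v : ℂ) :
    fderiv ℝ f z v = S.act (F z) (-S.J S.Y (S.projML (logFDeriv F z v))) := by
  rw [(h.eqOn.eventuallyEq_of_mem (hU.mem_nhds hz)).fderiv_eq,
    ((h.isParallelAt hU hz).hasFDerivAt_conj (h.isUnit hz) (hasFDerivAt_const S.Y z) v).2, act_eq,
    J_Y_projML (h.mem hU hz v), neg_J_swap, J]
  simp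

theorem IsLift.contDiffOn (h : S.IsLift F f U) : ContDiffOn ℝ ∞ f U :=
  ((h.1.mul contDiffOn_const).mul (h.1.ringInverse fun _ hz => h.isUnit hz)).congr h.eqOn

omit [CompleteSpace R] in
theorem IsLift.mem_M (hU : IsOpen U) (h : S.IsLift F f U) (hz : z ∈ U) (v : ℂ) :
    S.projML (logFDeriv F z v) ∈ S.M := projML_mem_M (h.mem hU hz v)

theorem IsLift.metric_fderiv (hU : IsOpen U) (h : S.IsLift F f U) (hz : z ∈ U) (v w : ℂ) :
    S.metric (fderiv ℝ f z v) (fderiv ℝ f z w)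
      = S.metric (S.projML (logFDeriv F z v)) (S.projML (logFDeriv F z w)) := by
  rw [h.fderiv_eq hU hz, h.fderiv_eq hU hz, metric_act_M (h.2.1 z hz)
    (S.M.neg_mem (J_Y_mem_M (h.mem_M hU hz v))) (S.M.neg_mem (J_Y_mem_M (h.mem_M hU hz w))),
    metric_neg_neg, metric_J_J (h.mem_M hU hz v) (h.mem_M hU hz w)]

theorem IsLift.kahler_act (hU : IsOpen U) (h : S.IsLift F f U) (hz : z ∈ U) {u : R} (hu : u ∈ S.M)
    (v : ℂ) : S.kahler (f z) (S.act (F z) u) (fderiv ℝ f z v)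
      = -S.metric u (S.projML (logFDeriv F z v)) := by
  rw [kahler, ← h.2.2 z hz, act_J (h.2.1 z hz), h.fderiv_eq hU hz, metric_act_M (h.2.1 z hz)
    (J_Y_mem_M hu) (S.M.neg_mem (J_Y_mem_M (h.mem_M hU hz v))),
    ← metric_J_J hu (h.mem_M hU hz v)]
  simp [S.metric_eq]

theorem IsLift.kahler_fderiv (hU : IsOpen U) (h : S.IsLift F f U) (hz : z ∈ U) (v w : ℂ) :
    S.kahler (f z) (fderiv ℝ f z v) (fderiv ℝ f z w)
      = S.metric (S.J S.Y (S.projML (logFDeriv F z v))) (S.projML (logFDeriv F z w)) := by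
  rw [h.fderiv_eq hU hz v, h.kahler_act hU hz (S.M.neg_mem (J_Y_mem_M (h.mem_M hU hz v)))]
  simp [S.metric_eq]

theorem IsLagrangianLift.isConformalImmersion (hU : IsOpen U) (h : S.IsLagrangianLift F f U) :
    S.IsConformalImmersion f U := by
  obtain ⟨h, h1, h2⟩ := (isLagrangianLift_iff hU).1 h
  refine ⟨h.contDiffOn, fun z hz => ?_, fun z hz => ?_⟩
  · rw [← h.2.2 z hz]; exact act_mem_space (h.2.1 z hz)
  · have hM := h.mem_M hU hz 1
    rw [h.metric_fderiv hU hz, h.metric_fderiv hU hz, h.metric_fderiv hU hz, h1 z hz,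
      metric_neg_neg, metric_τ_τ hM hM]
    refine ⟨metric_pos hM (h2 z hz), rfl, ?_⟩
    have := metric_self_τ hM
    rw [S.metric_eq] at this ⊢
    rw [map_neg, this, neg_zero]

theorem map_linear {V : Type*} [AddCommGroup V] [Module ℝ V] (T : ℂ →ₗ[ℝ] V) (v : ℂ) :
    T v = v.re • T 1 + v.im • T I := by
  conv_lhs => rw [show v = v.re • (1 : ℂ) + v.im • I by simp [re_add_im]]
  rw [map_add, map_smul, map_smul]

theorem IsLagrangianLift.isLagrangian (hU : IsOpen U) (h : S.IsLagrangianLift F f U) :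
    S.IsLagrangian f U := by
  obtain ⟨h, h1, h2⟩ := (isLagrangianLift_iff hU).1 h
  intro z hz v w
  have hM := h.mem_M hU hz 1
  rw [h.kahler_fderiv hU hz]
  have e : ∀ v : ℂ, S.projML (logFDeriv F z v) = v.re • S.projML (logFDeriv F z 1)
      - v.im • S.τ (S.projML (logFDeriv F z 1)) := fun v => by
    have := map_linear ((S.projML.comp (logFDeriv F z) : ℂ →L[ℝ] R) : ℂ →ₗ[ℝ] R) v
    simp only [ContinuousLinearMap.coe_coe, ContinuousLinearMap.comp_apply] at this
    rw [this, h1 z hz, smul_neg, sub_eq_add_neg]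
  rw [e v, e w]
  set A := S.projML (logFDeriv F z 1)
  have e1 := metric_J_self hM
  have e2 := metric_J_self (τ_mem_M hM)
  have e3 := metric_J_τ hM
  have e4 : S.metric (S.J S.Y (S.τ A)) A = 0 := by
    have := metric_J_τ (τ_mem_M hM)
    rw [hM.2] at this
    rw [S.metric_eq] at this ⊢
    simpa using this
  rw [S.metric_eq] at e1 e2 e3 e4 ⊢
  simp only [J_sub, J_smul, map_sub, map_smul, _root_.sub_apply, _root_.smul_apply, e1, e2, e3, e4,
    smul_zero, sub_zero]

theorem IsTwisted.fderiv (hU : IsOpen U) (h : S.IsLift F f U) (ht : IsTwisted S F U) (hz : z ∈ U)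
    (v : ℂ) : S.projML (fderiv ℝ (logFDeriv F) z v I)
      = -S.τ (S.projML (fderiv ℝ (logFDeriv F) z v 1)) := by
  have h1 : HasFDerivAt (fun z => S.projML (logFDeriv F z I)) _ z :=
    S.projML.hasFDerivAt.comp z (h.hasFDerivAt_apply hU hz I)
  have h2 : HasFDerivAt (fun z => -S.τ (S.projML (logFDeriv F z 1))) _ z :=
    ((S.τ.comp S.projML).hasFDerivAt.comp z (h.hasFDerivAt_apply hU hz 1)).neg
  have h3 := h2.congr_of_eventuallyEq (by
    filter_upwards [hU.mem_nhds hz] with x hx using ht x hx)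
  simpa using congrArg (· v) (h1.unique h3)

theorem IsLift.flat (hU : IsOpen U) (h : S.IsLift F f U) (hz : z ∈ U) :
    fderiv ℝ (logFDeriv F) z 1 I - fderiv ℝ (logFDeriv F) z I 1
      + S.J (logFDeriv F z 1) (logFDeriv F z I) = 0 :=
  IsParallelAt.flat hU (fun _ hx => h.isParallelAt hU hx) (fun _ hx => h.isUnit hx)
    (h.contDiffOn_logFDeriv hU) hz 1 I

/-- The divergence of the component of the Maurer-Cartan form along `Y`. -/
def divβ (S : HermitianModel R) (F : ℂ → R) (z : ℂ) : ℝ :=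
  S.β (fderiv ℝ (logFDeriv F) z 1 1) + S.β (fderiv ℝ (logFDeriv F) z I I)

theorem IsLift.fderiv_fderiv (hU : IsOpen U) (h : S.IsLift F f U) (hz : z ∈ U) (v : ℂ) :
    fderiv ℝ (fun w => fderiv ℝ f w v) z v = S.act (F z)
      (-S.J S.Y (S.projML (fderiv ℝ (logFDeriv F) z v v))
        - S.J (logFDeriv F z v) (S.J S.Y (S.projML (logFDeriv F z v)))) := by
  have hev : (fun w => fderiv ℝ f w v) =ᶠ[𝓝 z] fun w =>
      F w * (-S.J S.Y (S.projML (logFDeriv F w v))) * Ring.inverse (F w) := by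
    filter_upwards [hU.mem_nhds hz] with x hx
    rw [h.fderiv_eq hU hx, act_eq]
  let T : R →L[ℝ] R := ContinuousLinearMap.mul ℝ R S.Y - (ContinuousLinearMap.mul ℝ R).flip S.Y
  have hT : ∀ X, T X = S.J S.Y X := fun X => by simp [T, J]
  have hX : HasFDerivAt (fun w => -S.J S.Y (S.projML (logFDeriv F w v)))
      (-(T.comp S.projML).comp ((fderiv ℝ (logFDeriv F) z).flip v)) z := by
    simp only [← hT]
    exact ((T.comp S.projML).hasFDerivAt.comp z (h.hasFDerivAt_apply hU hz v)).neg
  rw [hev.fderiv_eq, ((h.isParallelAt hU hz).hasFDerivAt_conj (h.isUnit hz) hX v).2, act_eq]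
  congr 2
  simp [hT, J, sub_eq_add_neg]
  noncomm_ring

theorem IsLift.flatLaplacian_eq (hU : IsOpen U) (h : S.IsLift F f U) (ht : IsTwisted S F U)
    (hz : z ∈ U) : flatLaplacian f z = S.act (F z)
      ((2 * S.β (logFDeriv F z 1)) • S.projML (logFDeriv F z 1)
        + (2 * S.β (logFDeriv F z I)) • S.projML (logFDeriv F z I)
        - S.J (S.projML (logFDeriv F z 1)) (S.J S.Y (S.projML (logFDeriv F z 1)))
        - S.J (S.projML (logFDeriv F z I)) (S.J S.Y (S.projML (logFDeriv F z I)))) := by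
  rw [flatLaplacian, h.fderiv_fderiv hU hz, h.fderiv_fderiv hU hz, ← act_add]
  congr 1
  set a := logFDeriv F z 1
  set b := logFDeriv F z I
  have ha : a ∈ S.𝔤 := h.mem hU hz 1
  have hb : b ∈ S.𝔤 := h.mem hU hz I
  have hco := congrArg (S.J S.Y) (S.flat_coclosed ha hb (ht z hz) (ht.fderiv hU h hz 1)
    (ht.fderiv hU h hz I) (h.flat hU hz))
  simp only [J_add, J_sub, J_smul, S.lie_Y_lie_projZero ha, S.lie_Y_lie_projZero hb,
    J_Y_J_Y (projML_mem_M ha), J_Y_J_Y (projML_mem_M hb), J_zero] at hco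
  have e : ∀ x ∈ S.𝔤, S.J x (S.J S.Y (S.projML x)) = S.J (S.projZero x) (S.J S.Y (S.projML x))
      + S.J (S.projML x) (S.J S.Y (S.projML x)) - S.β x • S.projML x := fun x hx => by
    conv_lhs => enter [2]; rw [S.eq_sum hx]
    rw [add_J, add_J, smul_J, J_Y_J_Y (projML_mem_M hx)]
    module
  rw [e a ha, e b hb]
  linear_combination (norm := module) -hco

end HermitianModel

end

noncomputable section

namespace HermitianModel

variable {R : Type} [NormedRing R] [NormedAlgebra ℝ R] [CompleteSpace R]
  {S : HermitianModel R} {F f : ℂ → R} {U : Set ℂ} {z : ℂ}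

omit [CompleteSpace R] in
variable (S) in
theorem exists_section_one : ∃ s : R → R, s S.Y = 1 ∧ ∀ᶠ p in 𝓝 S.Y,
    ContDiffAt ℝ ∞ s p ∧ (p ∈ S.space → s p ∈ S.G ∧ S.act (s p) S.Y = p) := by
  obtain ⟨s, hs'⟩ := S.exists_section
  have hY : S.Y ∈ S.space := ⟨1, S.one_mem, (act_one _).symm⟩
  obtain ⟨h1, h2⟩ := hs'.self_of_nhds.2 hY
  have h3 : S.act (S.inv (s S.Y)) S.Y = S.Y := by
    have := act_inv h1 S.Y
    rwa [show S.act (s S.Y) S.Y = S.Y from h2] at this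
  refine ⟨fun p => s p * S.inv (s S.Y), mul_inv_cancel h1, ?_⟩
  filter_upwards [hs'] with p hp
  refine ⟨hp.1.mul contDiffAt_const, fun hpS => ?_⟩
  obtain ⟨h4, h5⟩ := hp.2 hpS
  exact ⟨S.mul_mem h4 (S.inv_mem h1), by rw [act_mul h4 (S.inv_mem h1), h3]; exact h5⟩

/-- Velocities of curves in `M` are tangent to `M`. -/
theorem exists_tangent {γ : ℝ → R} {g : R} (hg : g ∈ S.G) (hγ : DifferentiableAt ℝ γ 0)
    (h0 : γ 0 = S.act g S.Y) (hS : ∀ t, γ t ∈ S.space) :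
    ∃ v ∈ S.M, deriv γ 0 = S.act g v := by
  obtain ⟨s, hs1, hs'⟩ := S.exists_section_one
  have hs := hs'.self_of_nhds.1
  set X : ℝ → R := fun t => S.act (S.inv g) (γ t) with hX
  have hX0 : X 0 = S.Y := by rw [hX]; simp only [h0]; exact act_inv hg _
  have hXd : DifferentiableAt ℝ X 0 := (hγ.const_mul _).mul_const _
  have hσd : DifferentiableAt ℝ (fun t => s (X t)) 0 := by
    rw [← hX0] at hs
    exact (hs.differentiableAt (by simp)).comp 0 hXd
  have hev : ∀ᶠ t in 𝓝 0, s (X t) ∈ S.G ∧ S.act (s (X t)) S.Y = X t := by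
    have hc := hXd.continuousAt
    rw [ContinuousAt, hX0] at hc
    filter_upwards [hc.eventually hs'] with t ht
    refine ht.2 ?_
    obtain ⟨h, hh, e⟩ := hS t
    exact ⟨S.inv g * h, S.mul_mem (S.inv_mem hg) hh, by
      rw [act_mul (S.inv_mem hg) hh, ← e]⟩
  have hσ0 : s (X 0) = 1 := by rw [hX0, hs1]
  set a := deriv (fun t => s (X t)) 0 with ha
  have ha𝔤 : a ∈ S.𝔤 := by
    refine S.mem_of_hasDerivAt (γ := fun t => s (X t)) ?_ (hev.mono fun t ht => ht.1)
    simp only [hσ0, one_mul]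
    exact hσd.hasDerivAt
  have hu : IsUnit (s (X 0)) := by rw [hσ0]; exact isUnit_one
  have hXe : X =ᶠ[𝓝 0] fun t => s (X t) * S.Y * Ring.inverse (s (X t)) := by
    filter_upwards [hev] with t ht
    conv_lhs => rw [← ht.2, act_eq]
  have hX' : deriv X 0 = -S.J S.Y (S.projML a) := by
    have := ((isParallelAt_logFDeriv hσd hu).hasFDerivAt_conj hu
      (hasFDerivAt_const S.Y (0 : ℝ)) 1).2
    rw [hXe.deriv_eq, ← fderiv_apply_one_eq_deriv, this, J_Y_projML ha𝔤, logFDeriv_apply,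
      fderiv_apply_one_eq_deriv, ← ha, hσ0, neg_J_swap]
    simp [J]
  refine ⟨-S.J S.Y (S.projML a), S.M.neg_mem (J_Y_mem_M (projML_mem_M ha𝔤)), ?_⟩
  rw [← hX']
  have e : γ = fun t => S.act g (X t) := by
    funext t; exact (act_act_inv hg _).symm
  conv_lhs => rw [e]
  exact ((hXd.hasDerivAt.const_mul g).mul_const (S.inv g)).deriv

/-- First variation of the area along a Hamiltonian variation. -/
theorem IsLagrangianLift.hasDerivAt_area (hU : IsOpen U) (h : S.IsLagrangianLift F f U)
    {γ : ℝ → ℂ → R} {K : Set ℂ} {φ : ℂ → ℝ}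
    (hγ : ContDiffOn ℝ ∞ (fun q : ℝ × ℂ => γ q.1 q.2) (univ ×ˢ U))
    (hγS : ∀ t, ∀ z ∈ U, γ t z ∈ S.space) (hγ0 : ∀ z ∈ U, γ 0 z = f z) (hK : IsCompact K)
    (hKU : K ⊆ U) (hoff : ∀ t, ∀ z ∈ U \ K, γ t z = f z) (hφ : ContDiff ℝ ∞ φ)
    (hφK : tsupport φ ⊆ K)
    (hham : ∀ z ∈ U, ∀ v : ℂ,
      S.kahler (f z) (deriv (fun t => γ t z) 0) (fderiv ℝ f z v) = fderiv ℝ φ z v) :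
    HasDerivAt (fun t => ∫ z in K, S.areaDensity (γ t) z) (-2 * ∫ z in K, φ z * divβ S F z) 0 := by
  obtain ⟨-, -, hci⟩ := h.isConformalImmersion hU
  obtain ⟨h, ht, -⟩ := (isLagrangianLift_iff hU).1 h
  have hev : ∀ z ∈ U, γ 0 =ᶠ[𝓝 z] f := fun z hz => by
    filter_upwards [hU.mem_nhds hz] with x hx using hγ0 x hx
  have hfd : ∀ z ∈ U, fderiv ℝ (γ 0) z = fderiv ℝ f z := fun z hz => (hev z hz).fderiv_eq
  have key := hasDerivAt_area_of_conformal S.B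
    (fun v w => by rw [← S.metric_eq, ← S.metric_eq, S.metric_symm]) hU hK hKU hγ
    (fun t z hz => by rw [hoff t z hz, hγ0 z hz.1])
    (fun z hz => by rw [hfd z hz, ← S.metric_eq]; exact (hci z hz).1)
    (fun z hz => by rw [hfd z hz, ← S.metric_eq, ← S.metric_eq]; exact (hci z hz).2.1)
    (fun z hz => by rw [hfd z hz, ← S.metric_eq]; exact (hci z hz).2.2)
  simp only [areaDensity, S.metric_eq]
  refine key.congr_deriv ?_
  set p : ℂ → ℝ := fun z => S.β (logFDeriv F z 1) with hp
  set q : ℂ → ℝ := fun z => S.β (logFDeriv F z I) with hq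
  have hpd : ∀ z ∈ U, HasFDerivAt p (S.β.comp ((fderiv ℝ (logFDeriv F) z).flip 1)) z :=
    fun z hz => S.β.hasFDerivAt.comp z (h.hasFDerivAt_apply hU hz 1)
  have hqd : ∀ z ∈ U, HasFDerivAt q (S.β.comp ((fderiv ℝ (logFDeriv F) z).flip I)) z :=
    fun z hz => S.β.hasFDerivAt.comp z (h.hasFDerivAt_apply hU hz I)
  have hφd : ∀ z, HasFDerivAt φ (fderiv ℝ φ z) z := fun z =>
    ((hφ.contDiffAt).differentiableAt (by simp)).hasFDerivAt
  have hpC : ContDiffOn ℝ ∞ p U := S.β.contDiff.comp_contDiffOn (h.contDiffOn_apply hU 1)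
  have hqC : ContDiffOn ℝ ∞ q U := S.β.contDiff.comp_contDiffOn (h.contDiffOn_apply hU I)
  have hW₁ : ContDiffOn ℝ 1 (fun z => φ z * p z) U :=
    (hφ.contDiffOn.mul hpC).of_le (by exact_mod_cast le_top)
  have hW₂ : ContDiffOn ℝ 1 (fun z => φ z * q z) U :=
    (hφ.contDiffOn.mul hqC).of_le (by exact_mod_cast le_top)
  have hφ0 : ∀ z ∈ U \ K, φ z = 0 := fun z hz =>
    image_eq_zero_of_notMem_tsupport fun hz' => hz.2 (hφK hz')
  have hdiv := setIntegral_divergence_eq_zero hU hK hKU hW₁ hW₂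
    (fun z hz => by simp only [hφ0 z hz, zero_mul]) (fun z hz => by simp only [hφ0 z hz, zero_mul])
  set D : ℂ → ℝ := fun z => fderiv ℝ (fun z => φ z * p z) z 1 + fderiv ℝ (fun z => φ z * q z) z I
    with hD
  have hDval : ∀ z ∈ U, D z = φ z * divβ S F z + (p z * fderiv ℝ φ z 1 + q z * fderiv ℝ φ z I) :=
    fun z hz => by
      rw [hD]
      simp only []
      rw [((hφd z).fun_mul (hpd z hz)).fderiv, ((hφd z).fun_mul (hqd z hz)).fderiv, divβ]
      simp
      ring
  have hpt : ∀ z ∈ K, S.B (deriv (fun t => γ t z) 0) (flatLaplacian (γ 0) z)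
      = (-2) * D z + 2 * (φ z * divβ S F z) := fun z hzK => by
    have hz := hKU hzK
    have hγz : DifferentiableAt ℝ (fun t => γ t z) 0 := by
      have h1 : DifferentiableAt ℝ (fun q : ℝ × ℂ => γ q.1 q.2) ((0 : ℝ), z) :=
        (hγ.contDiffAt ((isOpen_univ.prod hU).mem_nhds ⟨mem_univ _, hz⟩)).differentiableAt (by simp)
      exact h1.comp (0 : ℝ) (f := fun t : ℝ => (t, z))
        (differentiableAt_id.prodMk (differentiableAt_const z))
    obtain ⟨v, hv, hv'⟩ := exists_tangent (h.2.1 z hz) hγz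
      (by rw [hγ0 z hz, h.2.2 z hz]) (fun t => hγS t z hz)
    have hlap : flatLaplacian (γ 0) z = flatLaplacian f z := by
      have h1 : ∀ w : ℂ, (fun x => fderiv ℝ (γ 0) x w) =ᶠ[𝓝 z] fun x => fderiv ℝ f x w :=
        fun w => by filter_upwards [hU.mem_nhds hz] with x hx using by rw [hfd x hx]
      rw [flatLaplacian, flatLaplacian, (h1 1).fderiv_eq, (h1 I).fderiv_eq]
    have e1 := hham z hz 1
    have e2 := hham z hz I
    rw [hv', h.kahler_act hU hz hv] at e1 e2
    have hA := h.mem_M hU hz 1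
    have hB := h.mem_M hU hz I
    have e3 := metric_act_M (h.2.1 z hz) hv hA
    have e4 := metric_act_M (h.2.1 z hz) hv hB
    have e5 := metric_act_lie_M (h.2.1 z hz) hv hA (J_Y_mem_M hA)
    have e6 := metric_act_lie_M (h.2.1 z hz) hv hB (J_Y_mem_M hB)
    rw [S.metric_eq] at e1 e2 e5 e6
    rw [S.metric_eq, S.metric_eq] at e3 e4
    rw [hlap, h.flatLaplacian_eq hU ht hz, hv', act_sub, act_sub, act_add, act_smul, act_smul,
      map_sub, map_sub, map_add, map_smul, map_smul, e3, e4, e5, e6, hDval z hz, ← e1, ← e2]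
    simp only [hp, hq, smul_eq_mul]
    ring
  rw [setIntegral_congr_fun hK.measurableSet hpt, integral_add, integral_const_mul,
    integral_const_mul, hdiv]
  · ring
  · refine Integrable.const_mul ?_ _
    refine ContinuousOn.integrableOn_compact hK (ContinuousOn.mono ?_ hKU)
    exact ((hW₁.continuousOn_fderiv_of_isOpen hU le_rfl).clm_apply continuousOn_const).add
      ((hW₂.continuousOn_fderiv_of_isOpen hU le_rfl).clm_apply continuousOn_const)
  · refine Integrable.const_mul ?_ _
    refine ContinuousOn.integrableOn_compact hK (ContinuousOn.mono ?_ hKU)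
    have hc := (h.contDiffOn_logFDeriv hU).continuousOn_fderiv_of_isOpen hU (by simp)
    refine hφ.continuous.continuousOn.mul (ContinuousOn.add ?_ ?_)
    · exact S.β.continuous.comp_continuousOn
        ((hc.clm_apply continuousOn_const).clm_apply continuousOn_const)
    · exact S.β.continuous.comp_continuousOn
        ((hc.clm_apply continuousOn_const).clm_apply continuousOn_const)

end HermitianModel

end

noncomputable section

namespace HermitianModel

variable {R : Type} [NormedRing R] [NormedAlgebra ℝ R]
  {S : HermitianModel R} {F f : ℂ → R} {U L : Set ℂ} {z : ℂ}

theorem IsHamiltonianStationary.mono (h : S.IsHamiltonianStationary f L) (hf : ContDiffOn ℝ ∞ f L)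
    (hfS : ∀ z ∈ L, f z ∈ S.space) (hL : IsOpen L) (hU : IsOpen U) (hUL : U ⊆ L) :
    S.IsHamiltonianStationary f U := by
  classical
  intro γ K φ hγ hγS hγ0 hK hKU hoff hφ hφK hham
  let γ' : ℝ → ℂ → R := fun t z => if z ∈ K then γ t z else f z
  have hγ'U : ∀ t, ∀ z ∈ U, γ' t z = γ t z := fun t z hz => by
    by_cases hzK : z ∈ K
    · simp [γ', hzK]
    · simp [γ', hzK, hoff t z ⟨hz, hzK⟩]
  have hγ'K : ∀ t, ∀ z ∉ K, γ' t z = f z := fun t z hz => by simp [γ', hz]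
  have key := h γ' K φ ?_ ?_ ?_ hK (hKU.trans hUL) (fun t z hz => hγ'K t z hz.2) hφ hφK ?_
  · convert! key using 2 with t
    refine setIntegral_congr_fun hK.measurableSet fun z hz => ?_
    have : γ' t =ᶠ[𝓝 z] γ t := by
      filter_upwards [hU.mem_nhds (hKU hz)] with x hx using hγ'U t x hx
    simp only [areaDensity, this.fderiv_eq]
  · rintro ⟨t, z⟩ ⟨-, hz⟩
    by_cases hzK : z ∈ K
    · have h1 := hγ.contDiffAt ((isOpen_univ.prod hU).mem_nhds
        (⟨mem_univ t, hKU hzK⟩ : (t, z) ∈ univ ×ˢ U))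
      refine (h1.congr_of_eventuallyEq ?_).contDiffWithinAt
      filter_upwards [(isOpen_univ.prod hU).mem_nhds
        (⟨mem_univ t, hKU hzK⟩ : (t, z) ∈ univ ×ˢ U)] with q hq using hγ'U q.1 q.2 hq.2
    · have h1 : ContDiffAt ℝ ∞ (fun q : ℝ × ℂ => f q.2) (t, z) :=
        ContDiffAt.comp (t, z) (hf.contDiffAt (hL.mem_nhds hz)) contDiffAt_snd
      refine (h1.congr_of_eventuallyEq ?_).contDiffWithinAt
      filter_upwards [(isOpen_univ.prod hK.isClosed.isOpen_compl).mem_nhds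
        (⟨mem_univ t, hzK⟩ : (t, z) ∈ univ ×ˢ Kᶜ)] with q hq using hγ'K q.1 q.2 hq.2
  · intro t z hz
    by_cases hzK : z ∈ K
    · rw [hγ'U t z (hKU hzK)]; exact hγS t z (hKU hzK)
    · rw [hγ'K t z hzK]; exact hfS z hz
  · intro z hz
    by_cases hzK : z ∈ K
    · rw [hγ'U 0 z (hKU hzK)]; exact hγ0 z (hKU hzK)
    · exact hγ'K 0 z hzK
  · intro z hz v
    by_cases hzK : z ∈ K
    · simp only [hγ'U _ z (hKU hzK)]
      exact hham z (hKU hzK) v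
    · have h1 : (fun t => γ' t z) = fun _ => f z := funext fun t => hγ'K t z hzK
      have h2 : fderiv ℝ φ z = 0 := by
        have h3 : z ∉ tsupport φ := fun h' => hzK (hφK h')
        exact image_eq_zero_of_notMem_tsupport fun h' => h3 (tsupport_fderiv_subset ℝ h')
      rw [h1, h2]
      simp [kahler, S.metric_eq, J]

variable [CompleteSpace R]

theorem exp_mem {X : R} (hX : X ∈ S.𝔤) : NormedSpace.exp X ∈ S.G := by
  have hp : ∀ t ∈ (univ : Set ℝ), IsParallelAt (fun _ => (1 : ℝ →L[ℝ] ℝ).smulRight X)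
      (fun t : ℝ => NormedSpace.exp (t • X)) t := fun t _ => by
    refine (hasDerivAt_exp_smul_const X t).hasFDerivAt.congr_fderiv ?_
    ext; simp
  have := S.mem_of_isParallelAt isOpen_univ isPreconnected_univ hp
    (fun _ _ v => by simpa using S.𝔤.smul_mem v hX) (mem_univ 0)
    (by simpa using S.one_mem) 1 (mem_univ 1)
  simpa using this

theorem contDiff_exp : ContDiff ℝ ∞ (NormedSpace.exp : R → R) :=
  contDiff_iff_contDiffAt.2 fun x => (NormedSpace.exp_analytic x).contDiffAt

theorem IsLagrangianLift.isHSL (hU : IsOpen U) (h : S.IsLagrangianLift F f U)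
    (hdiv : ∀ z ∈ U, divβ S F z = 0) : S.IsHSL f U := by
  refine ⟨h.isConformalImmersion hU, h.isLagrangian hU, ?_⟩
  intro γ K φ hγ hγS hγ0 hK hKU hoff hφ hφK hham
  refine (h.hasDerivAt_area hU hγ hγS hγ0 hK hKU hoff hφ hφK hham).congr_deriv ?_
  rw [setIntegral_congr_fun (g := fun _ => 0) hK.measurableSet fun z hz => by
    simp [hdiv z (hKU hz)]]
  simp

theorem continuousOn_divβ (hU : IsOpen U) (h : S.IsLift F f U) : ContinuousOn (divβ S F) U := by
  have hc := (h.contDiffOn_logFDeriv hU).continuousOn_fderiv_of_isOpen hU (by simp)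
  exact (S.β.continuous.comp_continuousOn
      ((hc.clm_apply continuousOn_const).clm_apply continuousOn_const)).add
    (S.β.continuous.comp_continuousOn
      ((hc.clm_apply continuousOn_const).clm_apply continuousOn_const))

theorem IsLagrangianLift.divβ_eq_zero (hU : IsOpen U) (h : S.IsLagrangianLift F f U)
    (hs : S.IsHamiltonianStationary f U) (hz : z ∈ U) : divβ S F z = 0 := by
  have hL := h
  obtain ⟨h, ht, h0⟩ := (isLagrangianLift_iff hU).1 h
  have hcont := continuousOn_divβ hU h
  have key : ∀ᵐ x, x ∈ U → divβ S F x = 0 := by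
    refine hU.ae_eq_zero_of_integral_contDiff_smul_eq_zero
      (hcont.locallyIntegrableOn hU.measurableSet) fun φ hφ hφc hφU => ?_
    set A : ℂ → R := fun z => S.projML (logFDeriv F z 1) with hA
    set B : ℂ → R := fun z => S.projML (logFDeriv F z I) with hB
    have hAM : ∀ z ∈ U, A z ∈ S.M := fun z hz => h.mem_M hU hz 1
    have hBM : ∀ z ∈ U, B z ∈ S.M := fun z hz => h.mem_M hU hz I
    have hAC : ContDiffOn ℝ ∞ A U := S.projML.contDiff.comp_contDiffOn (h.contDiffOn_apply hU 1)
    have hBC : ContDiffOn ℝ ∞ B U := S.projML.contDiff.comp_contDiffOn (h.contDiffOn_apply hU I)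
    have hn : ContDiffOn ℝ ∞ (fun z => S.B (A z) (A z)) U :=
      (S.B.contDiff.comp_contDiffOn hAC).clm_apply hAC
    have hnpos : ∀ z ∈ U, 0 < S.B (A z) (A z) := fun z hz => by
      rw [← S.metric_eq]; exact metric_pos (hAM z hz) (h0 z hz)
    have hφd : ∀ v : ℂ, ContDiff ℝ ∞ fun z => fderiv ℝ φ z v := fun v =>
      (hφ.fderiv_right (m := ∞) (by simp)).clm_apply contDiff_const
    set u : ℂ → R := fun z => -(S.B (A z) (A z))⁻¹ • (fderiv ℝ φ z 1 • A z + fderiv ℝ φ z I • B z)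
      with hu
    have huC : ContDiffOn ℝ ∞ u U :=
      ((hn.inv fun z hz => (hnpos z hz).ne').neg).smul
        (((hφd 1).contDiffOn.smul hAC).add ((hφd I).contDiffOn.smul hBC))
    have huM : ∀ z ∈ U, u z ∈ S.M := fun z hz =>
      S.M.smul_mem _ (S.M.add_mem (S.M.smul_mem _ (hAM z hz)) (S.M.smul_mem _ (hBM z hz)))
    have hu0 : ∀ z ∉ tsupport φ, u z = 0 := fun z hz => by
      have h2 : fderiv ℝ φ z = 0 :=
        image_eq_zero_of_notMem_tsupport fun h' => hz (tsupport_fderiv_subset ℝ h')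
      simp [hu, h2]
    set γ : ℝ → ℂ → R := fun t z => S.act (F z * NormedSpace.exp (t • S.J S.Y (u z))) S.Y with hγ
    have hGm : ∀ t, ∀ z ∈ U, F z * NormedSpace.exp (t • S.J S.Y (u z)) ∈ S.G := fun t z hz =>
      S.mul_mem (h.2.1 z hz) (exp_mem (S.𝔤.smul_mem _ (J_Y_mem_M (huM z hz)).1))
    have hγf : ∀ t, ∀ z ∈ U, u z = 0 → γ t z = f z := fun t z hz h0 => by
      simp [hγ, h0, J_zero, h.2.2 z hz]
    have hder : ∀ z ∈ U, deriv (fun t => γ t z) 0 = S.act (F z) (u z) := fun z hz => by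
      have h1 : HasDerivAt (fun t : ℝ => NormedSpace.exp (t • S.J S.Y (u z))) (S.J S.Y (u z)) 0 := by
        simpa using hasDerivAt_exp_smul_const (𝕂 := ℝ) (S.J S.Y (u z)) 0
      have hd : DifferentiableAt ℝ (fun t : ℝ => NormedSpace.exp (t • S.J S.Y (u z))) 0 :=
        h1.differentiableAt
      have hun : IsUnit (NormedSpace.exp ((0 : ℝ) • S.J S.Y (u z))) := by simp
      have h2 := (isParallelAt_logFDeriv hd hun).hasFDerivAt_conj hun
        (hasFDerivAt_const S.Y (0 : ℝ)) 1
      set e : ℝ → R := fun t => NormedSpace.exp (t • S.J S.Y (u z)) with he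
      have h3 : (fun t => γ t z) = fun t => F z * (e t * S.Y * Ring.inverse (e t)) * S.inv (F z) := by
        funext t
        rw [hγ]
        simp only []
        rw [act_mul (h.2.1 z hz) (exp_mem (S.𝔤.smul_mem _ (J_Y_mem_M (huM z hz)).1)), act_eq _ S.Y]
        rfl
      have h4 := (h2.1.hasDerivAt.const_mul (F z)).mul_const (S.inv (F z))
      rw [← h3] at h4
      rw [h4.deriv, ← fderiv_apply_one_eq_deriv, h2.2, logFDeriv_apply, fderiv_apply_one_eq_deriv,
        h1.deriv]
      have h5 : S.J S.Y (u z) * S.Y - S.Y * S.J S.Y (u z) = u z :=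
        (neg_J_swap (S := S) _ _).symm.trans (by rw [J_Y_J_Y (huM z hz), neg_neg])
      have he0 : e 0 = 1 := by simp [he]
      simp only [he0, Ring.inverse_one, one_mul, _root_.zero_apply, zero_add]
      rw [h5, act]
      simp
    have hγC : ContDiffOn ℝ ∞ (fun q : ℝ × ℂ => γ q.1 q.2) (univ ×ˢ U) := by
      let T : R →L[ℝ] R := ContinuousLinearMap.mul ℝ R S.Y - (ContinuousLinearMap.mul ℝ R).flip S.Y
      have hT : ∀ X, T X = S.J S.Y X := fun X => by simp [T, J]
      have h1 : ContDiffOn ℝ ∞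
          (fun q : ℝ × ℂ => F q.2 * NormedSpace.exp (q.1 • S.J S.Y (u q.2))) (univ ×ˢ U) := by
        simp only [← hT]
        exact (h.1.comp contDiffOn_snd fun q hq => hq.2).mul (contDiff_exp.comp_contDiffOn
          (contDiffOn_fst.smul (T.contDiff.comp_contDiffOn
            (huC.comp contDiffOn_snd fun q hq => hq.2))))
      refine ((h1.mul contDiffOn_const).mul (h1.ringInverse fun q hq =>
        S.isUnit (hGm q.1 q.2 hq.2))).congr fun q hq => act_eq _ _
    have hγ0 : ∀ z ∈ U, γ 0 z = f z := fun z hz => by simp [hγ, h.2.2 z hz]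
    have hham : ∀ z ∈ U, ∀ v : ℂ,
        S.kahler (f z) (deriv (fun t => γ t z) 0) (fderiv ℝ f z v) = fderiv ℝ φ z v := by
      intro z hz v
      rw [hder z hz, h.kahler_act hU hz (huM z hz)]
      have e1 := map_linear ((S.projML.comp (logFDeriv F z) : ℂ →L[ℝ] R) : ℂ →ₗ[ℝ] R) v
      have e2 := map_linear ((fderiv ℝ φ z : ℂ →L[ℝ] ℝ) : ℂ →ₗ[ℝ] ℝ) v
      simp only [ContinuousLinearMap.coe_coe, ContinuousLinearMap.comp_apply, smul_eq_mul] at e1 e2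
      have e3 := metric_self_τ (hAM z hz)
      have e4 := metric_τ_τ (hAM z hz) (hAM z hz)
      have hBA : B z = -S.τ (A z) := ht z hz
      rw [S.metric_symm] at e3
      rw [S.metric_eq] at e3 e4 ⊢
      rw [S.metric_eq] at e4
      have e5 : S.B (A z) (S.τ (A z)) = 0 := by
        rw [← S.metric_eq, S.metric_symm, S.metric_eq, e3]
      have hne := (hnpos z hz).ne'
      change -S.B (-(S.B (A z) (A z))⁻¹ • (fderiv ℝ φ z 1 • A z + fderiv ℝ φ z I • B z)) _ = _
      rw [e1, e2]
      change -S.B _ (v.re • A z + v.im • B z) = _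
      rw [hBA]
      simp only [map_add, map_smul, map_neg, _root_.add_apply, _root_.smul_apply,
        _root_.neg_apply, smul_eq_mul, e3, e4, e5]
      field_simp
      ring
    have hS : ∀ t, ∀ z ∈ U, γ t z ∈ S.space := fun t z hz => act_mem_space (hGm t z hz)
    have hoff : ∀ t, ∀ z ∈ U \ tsupport φ, γ t z = f z := fun t z hz =>
      hγf t z hz.1 (hu0 z hz.2)
    have h1 := hs γ (tsupport φ) φ hγC hS hγ0 hφc hφU hoff hφ subset_rfl hham
    have h3 := (hL.hasDerivAt_area hU hγC hS hγ0 hφc hφU hoff hφ subset_rfl hham).unique h1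
    rw [mul_eq_zero, or_iff_right (by norm_num)] at h3
    rw [← h3]
    refine (setIntegral_eq_integral_of_forall_compl_eq_zero fun z hz => ?_).symm
    rw [image_eq_zero_of_notMem_tsupport hz, zero_smul]
  exact Measure.eqOn_open_of_ae_eq ((ae_restrict_iff' hU.measurableSet).2 key) hU hcont
    continuousOn_const hz

end HermitianModel

end

noncomputable section

namespace HermitianModel

variable {R : Type} [NormedRing R] [NormedAlgebra ℝ R]
  {S : HermitianModel R} {F Fl f : ℂ → R} {U L : Set ℂ} {z : ℂ}

theorem extend_eq (c s : ℝ) (a b : R) : S.extend c s a b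
    = S.projZero a + c • S.projML a - s • S.projML b
      + ((c ^ 2 - s ^ 2) * S.β a - (2 * c * s) * S.β b) • S.Y := rfl

theorem extend_mem (c s : ℝ) {a b : R} (ha : a ∈ S.𝔤) (hb : b ∈ S.𝔤) : S.extend c s a b ∈ S.𝔤 :=
  S.𝔤.add_mem (S.𝔤.sub_mem (S.𝔤.add_mem (S.projZero_mem ha) (S.𝔤.smul_mem _ (S.projML_mem ha)))
    (S.𝔤.smul_mem _ (S.projML_mem hb))) (S.𝔤.smul_mem _ S.Y_mem)

theorem projML_extend (c s : ℝ) {a b : R} (ha : a ∈ S.𝔤) (hb : b ∈ S.𝔤) :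
    S.projML (S.extend c s a b) = c • S.projML a - s • S.projML b := by
  rw [extend_eq, map_add, map_sub, map_add, map_smul, map_smul, map_smul,
    projML_of_fixed (S.τ_projZero a), projML_of_mem (projML_mem_M ha).2,
    projML_of_mem (projML_mem_M hb).2, projML_of_neg S.τ_Y]
  module

theorem β_extend (c s : ℝ) (a b : R) :
    S.β (S.extend c s a b) = (c ^ 2 - s ^ 2) * S.β a - (2 * c * s) * S.β b := by
  rw [extend_eq, map_add, map_sub, map_add, map_smul, map_smul, map_smul, S.β_Y,
    S.β_of_projTwo (projTwo_of_fixed (S.τ_projZero a)),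
    S.β_of_projTwo (projTwo_of_mem (S.τ_τ_projML a)),
    S.β_of_projTwo (projTwo_of_mem (S.τ_τ_projML b))]
  simp

theorem extend_one_zero {a : R} (ha : a ∈ S.𝔤) (b : R) : S.extend 1 0 a b = a := by
  conv_rhs => rw [S.eq_sum ha]
  rw [extend_eq]
  module

variable (S) in
/-- `S.extend` as an operator on one-forms. -/
def extendForm (c s : ℝ) : (ℂ →L[ℝ] R) →L[ℝ] (ℂ →L[ℝ] R) :=
  ContinuousLinearMap.compL ℝ ℂ R R
      (S.projZero + c • S.projML + (c ^ 2 - s ^ 2) • S.β.smulRight S.Y)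
    - (ContinuousLinearMap.compL ℝ ℂ R R (s • S.projML + (2 * c * s) • S.β.smulRight S.Y)).comp
      ((ContinuousLinearMap.compL ℝ ℂ ℂ R).flip (ContinuousLinearMap.mul ℝ ℂ I))

theorem extendForm_apply (c s : ℝ) (α : ℂ →L[ℝ] R) (v : ℂ) :
    S.extendForm c s α v = S.extend c s (α v) (α (I * v)) := by
  rw [extend_eq]
  simp [extendForm]
  module

theorem flat_of_flat {D : ℂ →L[ℝ] ℂ →L[ℝ] R} {α : ℂ →L[ℝ] R}
    (h : D 1 I - D I 1 + S.J (α 1) (α I) = 0) (v w : ℂ) :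
    D v w - D w v + (α v * α w - α w * α v) = 0 := by
  have e : ∀ v : ℂ, α v = v.re • α 1 + v.im • α I := map_linear (α : ℂ →ₗ[ℝ] R)
  have e' : ∀ v w : ℂ, D v w = v.re • D 1 w + v.im • D I w := fun v w => by
    have := map_linear (D : ℂ →ₗ[ℝ] ℂ →L[ℝ] R) v
    simpa using congrArg (· w) this
  have e'' : ∀ v w : ℂ, D v w = w.re • D v 1 + w.im • D v I := fun v w =>
    map_linear (D v : ℂ →ₗ[ℝ] R) w
  change D v w - D w v + S.J (α v) (α w) = 0
  rw [e v, e w, e' v w, e' w v, e'' 1 w, e'' 1 v, e'' I w, e'' I v]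
  simp only [add_J, J_add, smul_J, J_smul, J_self]
  rw [← neg_J_swap (α I) (α 1)]
  linear_combination (norm := module) (v.re * w.im - v.im * w.re) • h

theorem isExtendedSolution_iff (hU : IsOpen U) {l : Circle} :
    S.IsExtendedSolution F l Fl U ↔ ContDiffOn ℝ ∞ Fl U ∧ (∀ z ∈ U, Fl z ∈ S.G) ∧
      ∀ z ∈ U, IsParallelAt (fun z => S.extendForm (l : ℂ).re (l : ℂ).im (logFDeriv F z)) Fl z := by
  refine and_congr_right fun h1 => and_congr_right fun h2 => forall₂_congr fun z hz => ?_
  have hd : DifferentiableAt ℝ Fl z := (h1.contDiffAt (hU.mem_nhds hz)).differentiableAt (by simp)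
  have hu := S.isUnit (h2 z hz)
  simp only [maurerCartan_eq, ← extendForm_apply]
  constructor
  · intro h
    exact (isParallelAt_logFDeriv hd hu).congr_left (ContinuousLinearMap.ext h)
  · intro h v
    rw [h.logFDeriv_eq hu]

theorem circle_sq (l : Circle) : (l : ℂ).re ^ 2 + (l : ℂ).im ^ 2 = 1 := by
  have := Circle.normSq_coe l
  rw [normSq_apply] at this
  linarith

theorem IsExtendedSolution.isLift {l : Circle} (h : S.IsExtendedSolution F l Fl U) :
    S.IsLift Fl (S.proj Fl) U := ⟨h.1, h.2.1, fun _ _ => rfl⟩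

theorem IsExtendedSolution.logFDeriv_eq (h : S.IsExtendedSolution F l Fl U) (hz : z ∈ U) :
    logFDeriv Fl z = S.extendForm (l : ℂ).re (l : ℂ).im (logFDeriv F z) := by
  ext v
  rw [extendForm_apply, ← maurerCartan_eq (S := S), ← maurerCartan_eq (S := S),
    ← maurerCartan_eq (S := S)]
  exact h.2.2 z hz v

variable [CompleteSpace R]

theorem IsLift.flat_extendForm (hU : IsOpen U) (h : S.IsLift F f U) (ht : IsTwisted S F U)
    (hdiv : ∀ z ∈ U, divβ S F z = 0) {c s : ℝ} (hcs : c ^ 2 + s ^ 2 = 1) (hz : z ∈ U) (v w : ℂ) :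
    fderiv ℝ (fun z => S.extendForm c s (logFDeriv F z)) z v w
      - fderiv ℝ (fun z => S.extendForm c s (logFDeriv F z)) z w v
      + (S.extendForm c s (logFDeriv F z) v * S.extendForm c s (logFDeriv F z) w
        - S.extendForm c s (logFDeriv F z) w * S.extendForm c s (logFDeriv F z) v) = 0 := by
  refine flat_of_flat (S := S) ?_ v w
  have hd : HasFDerivAt (fun z => S.extendForm c s (logFDeriv F z))
      ((S.extendForm c s).comp (fderiv ℝ (logFDeriv F) z)) z :=
    (S.extendForm c s).hasFDerivAt.comp z (((h.contDiffOn_logFDeriv hU).contDiffAt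
      (hU.mem_nhds hz)).differentiableAt (by simp)).hasFDerivAt
  rw [hd.fderiv]
  simp only [ContinuousLinearMap.comp_apply, extendForm_apply, I_mul_I, mul_one, map_neg]
  exact S.flat_extend hcs (h.mem hU hz 1) (h.mem hU hz I) (ht z hz) (ht.fderiv hU h hz 1)
    (ht.fderiv hU h hz I) (h.flat hU hz) (hdiv z hz)

omit [CompleteSpace R] in
theorem IsExtendedSolution.isLagrangianLift (hU : IsOpen U) {l : Circle}
    (h : S.IsLagrangianLift F f U) (hl : S.IsExtendedSolution F l Fl U) :
    S.IsLagrangianLift Fl (S.proj Fl) U := by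
  obtain ⟨h, ht, h0⟩ := (isLagrangianLift_iff hU).1 h
  have hcs := circle_sq l
  set c := (l : ℂ).re
  set s := (l : ℂ).im
  have e1 : ∀ z ∈ U, S.projML (logFDeriv Fl z 1)
      = c • S.projML (logFDeriv F z 1) - s • S.projML (logFDeriv F z I) := fun z hz => by
    rw [hl.logFDeriv_eq hz, extendForm_apply, mul_one,
      projML_extend _ _ (h.mem hU hz 1) (h.mem hU hz I)]
  have e2 : ∀ z ∈ U, S.projML (logFDeriv Fl z I)
      = c • S.projML (logFDeriv F z I) + s • S.projML (logFDeriv F z 1) := fun z hz => by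
    rw [hl.logFDeriv_eq hz, extendForm_apply, I_mul_I, map_neg,
      projML_extend _ _ (h.mem hU hz I) (S.𝔤.neg_mem (h.mem hU hz 1)), map_neg]
    module
  have e3 : IsTwisted S Fl U := fun z hz => by
    rw [e1 z hz, e2 z hz, ht z hz, map_sub, map_smul, map_smul, map_neg,
      (h.mem_M hU hz 1).2]
    module
  refine (isLagrangianLift_iff hU).2 ⟨hl.isLift, e3, fun z hz he => h0 z hz ?_⟩
  have h4 := e3 z hz
  rw [he, map_zero, neg_zero, e2 z hz] at h4
  rw [e1 z hz] at he
  linear_combination (norm := module) c • he + s • h4 - hcs • S.projML (logFDeriv F z 1)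

theorem IsExtendedSolution.divβ_eq_zero (hU : IsOpen U) {l : Circle}
    (h : S.IsLagrangianLift F f U) (hdiv : ∀ z ∈ U, divβ S F z = 0)
    (hl : S.IsExtendedSolution F l Fl U) (hz : z ∈ U) : divβ S Fl z = 0 := by
  obtain ⟨h, ht, h0⟩ := (isLagrangianLift_iff hU).1 h
  have hd : HasFDerivAt (logFDeriv Fl) ((S.extendForm (l : ℂ).re (l : ℂ).im).comp
      (fderiv ℝ (logFDeriv F) z)) z := by
    refine HasFDerivAt.congr_of_eventuallyEq ((S.extendForm _ _).hasFDerivAt.comp z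
      (((h.contDiffOn_logFDeriv hU).contDiffAt
      (hU.mem_nhds hz)).differentiableAt (by simp)).hasFDerivAt) ?_
    filter_upwards [hU.mem_nhds hz] with x hx using hl.logFDeriv_eq hx
  have h1 := S.flat_β (h.mem hU hz 1) (h.mem hU hz I) (ht z hz) (h.flat hU hz)
  have h2 := hdiv z hz
  rw [divβ] at h2 ⊢
  rw [hd.fderiv]
  simp only [ContinuousLinearMap.comp_apply, extendForm_apply, I_mul_I, mul_one, map_neg, β_extend]
  linear_combination ((l : ℂ).re ^ 2 - (l : ℂ).im ^ 2) * h2 - 2 * (l : ℂ).re * (l : ℂ).im * h1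

/-- Existence, uniqueness and properties of the associated family. -/
theorem IsLagrangianLift.exists_extendedSolution (hU : IsOpen U) [SimplyConnectedSpace U]
    (h : S.IsLagrangianLift F f U) (hs : S.IsHamiltonianStationary f U) (l : Circle) {z₀ : ℂ}
    {g₀ : R} (hz₀ : z₀ ∈ U) (hg₀ : g₀ ∈ S.G) :
    ∃ Fl : ℂ → R, S.IsExtendedSolution F l Fl U ∧ Fl z₀ = g₀ ∧
      (∀ F' : ℂ → R, S.IsExtendedSolution F l F' U → F' z₀ = g₀ → EqOn F' Fl U) ∧
      S.IsLagrangianLift Fl (S.proj Fl) U ∧ S.IsHSL (S.proj Fl) U ∧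
      (l = 1 → g₀ = F z₀ → EqOn Fl F U) := by
  obtain ⟨hl, ht, h0⟩ := (isLagrangianLift_iff hU).1 h
  have hdiv : ∀ z ∈ U, divβ S F z = 0 := fun z hz => h.divβ_eq_zero hU hs hz
  have hc : IsPreconnected U := isPreconnected_iff_preconnectedSpace.2 inferInstance
  set A : ℂ → ℂ →L[ℝ] R := fun z => S.extendForm (l : ℂ).re (l : ℂ).im (logFDeriv F z) with hA
  have hAC : ContDiffOn ℝ ∞ A U :=
    (S.extendForm _ _).contDiff.comp_contDiffOn (hl.contDiffOn_logFDeriv hU)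
  obtain ⟨Fl, hFl0, hFl⟩ := exists_parallel_section hU
    (hAC.of_le (WithTop.coe_le_coe.2 le_top))
    (fun z hz v w => hl.flat_extendForm hU ht hdiv (circle_sq l) hz v w) hz₀ g₀
  have hG : ∀ z ∈ U, Fl z ∈ S.G := S.mem_of_isParallelAt hU hc hFl (fun z hz v => by
    rw [hA, extendForm_apply]
    exact extend_mem _ _ (hl.mem hU hz _) (hl.mem hU hz _)) hz₀ (by rwa [hFl0])
  have hext : S.IsExtendedSolution F l Fl U :=
    (isExtendedSolution_iff hU).2 ⟨ContDiffOn.of_isParallelAt hU hAC hFl, hG, hFl⟩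
  have huniq : ∀ F' : ℂ → R, S.IsExtendedSolution F l F' U → F' z₀ = g₀ → EqOn F' Fl U :=
    fun F' hF' h' => IsParallelAt.eqOn hU hc ((isExtendedSolution_iff hU).1 hF').2.2 hFl
      (fun z hz => S.isUnit (hG z hz)) hz₀ (by rw [h', hFl0])
  have hLL := hext.isLagrangianLift hU h
  refine ⟨Fl, hext, hFl0, huniq, hLL, hLL.isHSL hU fun z hz => hext.divβ_eq_zero hU h hdiv hz,
    fun h1 hg => (huniq F ⟨hl.1, hl.2.1, fun z hz v => ?_⟩ hg.symm).symm⟩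
  subst h1
  simp only [maurerCartan_eq, Circle.coe_one, one_re, one_im]
  rw [extend_one_zero (hl.mem hU hz _)]

end HermitianModel

end

noncomputable section

/-- A smooth map to the unit circle has local smooth square roots. -/
theorem exists_smooth_half_arg {μ : ℂ → ℂ} {V : Set ℂ} (hV : IsOpen V) (hμ : ContDiffOn ℝ ∞ μ V)
    (h1 : ∀ z ∈ V, ‖μ z‖ = 1) {z₀ : ℂ} (hz₀ : z₀ ∈ V) :
    ∃ r > 0, ball z₀ r ⊆ V ∧ ∃ t : ℂ → ℝ, ContDiffOn ℝ ∞ t (ball z₀ r) ∧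
      ∀ z ∈ ball z₀ r, exp (2 * t z * I) = μ z := by
  have hne : ∀ z ∈ V, μ z ≠ 0 := fun z hz h0 => by simpa [h0] using h1 z hz
  have hcont : ContinuousAt (fun z => μ z / μ z₀) z₀ :=
    ((hμ.continuousOn.continuousAt (hV.mem_nhds hz₀))).div_const _
  have hev : ∀ᶠ z in 𝓝 z₀, μ z / μ z₀ ∈ slitPlane :=
    hcont.eventually (isOpen_slitPlane.mem_nhds (by simp [hne z₀ hz₀]))
  obtain ⟨r, hr, hball⟩ := Metric.eventually_nhds_iff_ball.1 (hev.and (hV.mem_nhds hz₀))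
  refine ⟨r, hr, fun z hz => (hball z hz).2,
    fun z => (arg (μ z₀) + (log (μ z / μ z₀)).im) / 2, ?_, fun z hz => ?_⟩
  · intro z hz
    have h2 : ContDiffAt ℝ ∞ (fun z => log (μ z / μ z₀)) z :=
      ContDiffAt.comp (g := log) z ((contDiffAt_log (n := ∞) (hball z hz).1).restrict_scalars ℝ)
        ((hμ.contDiffAt (hV.mem_nhds (hball z hz).2)).div_const _)
    have h3 : ContDiffAt ℝ ∞ (fun z => (log (μ z / μ z₀)).im) z :=
      imCLM.contDiff.contDiffAt.comp z h2
    exact ((contDiffAt_const.add h3).div_const _).contDiffWithinAt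
  · have hz' := (hball z hz).2
    have e1 : exp (arg (μ z₀) * I) = μ z₀ := by
      have := norm_mul_exp_arg_mul_I (μ z₀)
      rwa [h1 z₀ hz₀, ofReal_one, one_mul] at this
    have e2 : exp ((log (μ z / μ z₀)).im * I) = μ z / μ z₀ := by
      have := norm_mul_exp_arg_mul_I (μ z / μ z₀)
      rwa [norm_div, h1 z₀ hz₀, h1 z hz', div_one, ofReal_one, one_mul, ← log_im] at this
    push_cast
    rw [show (2 : ℂ) * ((arg (μ z₀) + (log (μ z / μ z₀)).im) / 2) * I
      = arg (μ z₀) * I + (log (μ z / μ z₀)).im * I by ring, exp_add, e1, e2,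
      mul_div_cancel₀ _ (hne z₀ hz₀)]

namespace HermitianModel

variable {R : Type} [NormedRing R] [NormedAlgebra ℝ R]
  {S : HermitianModel R} {F f : ℂ → R} {U L : Set ℂ} {z : ℂ}

theorem cmul_cmul {X : R} (hX : X ∈ S.M) (c d : ℂ) : S.cmul c (S.cmul d X) = S.cmul (c * d) X := by
  rw [cmul, J_Y_cmul hX]
  simp only [cmul, mul_re, mul_im, I_re, I_im]
  module

theorem cmul_one (X : R) : S.cmul 1 X = X := by simp [cmul]

/-- The phase relating the two components of the differential of a conformal Lagrangian map. -/
theorem exists_phase {A B : R} (hA : A ∈ S.M) (hB : B ∈ S.M) (hpos : 0 < S.metric A A)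
    (heq : S.metric A A = S.metric B B) (horth : S.metric A B = 0)
    (hlag : S.metric (S.J S.Y A) B = 0) {μ : ℂ}
    (hμ : μ = ((-S.metric (S.τ A) B / S.metric A A : ℝ) : ℂ)
      + ((-S.metric (S.J S.Y (S.τ A)) B / S.metric A A : ℝ) : ℂ) * I) :
    ‖μ‖ = 1 ∧ B = S.cmul μ (-S.τ A) := by
  obtain ⟨c, d, rfl⟩ := exists_vec hA
  obtain ⟨e, h, rfl⟩ := exists_vec hB
  rw [τ_vec, J_Y_vec] at hμ
  rw [J_Y_vec] at hlag
  simp only [metric_vec] at hμ heq horth hlag hpos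
  have hz : c * starRingEnd ℂ e + d * starRingEnd ℂ h = 0 := by
    apply Complex.ext
    · exact horth
    · rw [mul_assoc, mul_assoc, ← mul_add, I_mul_re, neg_eq_zero] at hlag
      exact hlag
  have hz' : starRingEnd ℂ c * e + starRingEnd ℂ d * h = 0 := by
    simpa using congrArg (starRingEnd ℂ) hz
  have hn : (((c * starRingEnd ℂ c + d * starRingEnd ℂ d).re : ℝ) : ℂ)
      = c * starRingEnd ℂ c + d * starRingEnd ℂ d := by
    simp only [mul_conj, ← ofReal_add, ofReal_re]
  have hne : (((c * starRingEnd ℂ c + d * starRingEnd ℂ d).re : ℝ) : ℂ) ≠ 0 :=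
    ofReal_ne_zero.2 hpos.ne'
  set n := (c * starRingEnd ℂ c + d * starRingEnd ℂ d).re with hn'
  have hμn : (n : ℂ) * μ = c * h - d * e := by
    have hnr := hpos.ne'
    rw [hμ]
    apply Complex.ext
    · simp only [add_re, ofReal_re, mul_re, I_re, I_im, ofReal_im]
      field_simp
      simp
      ring
    · simp only [add_im, ofReal_re, mul_im, I_re, I_im, ofReal_im]
      field_simp
      simp
      ring
  have e1 : e = -(μ * starRingEnd ℂ d) := by
    apply mul_left_cancel₀ hne
    linear_combination e * hn + (starRingEnd ℂ d) * hμn + c * hz'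
  have e2 : h = μ * starRingEnd ℂ c := by
    apply mul_left_cancel₀ hne
    linear_combination h * hn - (starRingEnd ℂ c) * hμn + d * hz'
  refine ⟨?_, ?_⟩
  · have h1 : n = normSq μ * n := by
      conv_lhs => rw [heq, e1, e2]
      rw [hn']
      simp only [mul_conj, ← ofReal_add, ofReal_re, normSq_neg, normSq_mul, normSq_conj]
      ring
    have h2 : normSq μ = 1 := by
      rw [eq_comm, mul_eq_right₀ hpos.ne'] at h1
      exact h1
    rw [← sq_eq_sq₀ (norm_nonneg _) zero_le_one, ← normSq_eq_norm_sq, h2, one_pow]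
  · rw [τ_vec, vec_neg, e1, e2]
    simp only [vec, cmul, J_add, J_smul, J_J_ε, neg_neg, neg_re, neg_im, mul_re, mul_im]
    module

/-- Maps into `M` lift locally to `G`. -/
theorem exists_local_lift (hL : IsOpen L) (hf : ContDiffOn ℝ ∞ f L) (hfS : ∀ z ∈ L, f z ∈ S.space)
    (hz : z ∈ L) : ∃ V, IsOpen V ∧ z ∈ V ∧ V ⊆ L ∧ ∃ F, S.IsLift F f V := by
  obtain ⟨g, hg, hgf⟩ := hfS z hz
  obtain ⟨s, -, hs⟩ := S.exists_section_one
  obtain ⟨W, hW, hWo, hYW⟩ := _root_.eventually_nhds_iff.1 hs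
  set X : ℂ → R := fun z => S.act (S.inv g) (f z) with hX
  have hXC : ContDiffOn ℝ ∞ X L := (contDiffOn_const.mul hf).mul contDiffOn_const
  have hXz : X z = S.Y := by rw [hX]; simp only [hgf]; exact act_inv hg _
  have hXS : ∀ w ∈ L, X w ∈ S.space := fun w hw => by
    obtain ⟨h, hh, e⟩ := hfS w hw
    exact ⟨S.inv g * h, S.mul_mem (S.inv_mem hg) hh, by
      rw [act_mul (S.inv_mem hg) hh, ← e]⟩
  refine ⟨L ∩ X ⁻¹' W, hXC.continuousOn.isOpen_inter_preimage hL hWo,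
    ⟨hz, by rw [mem_preimage, hXz]; exact hYW⟩, inter_subset_left, fun w => g * s (X w), ?_, ?_, ?_⟩
  · refine contDiffOn_const.mul fun w hw => ?_
    exact (hW _ hw.2).1.comp_contDiffWithinAt w ((hXC w hw.1).mono inter_subset_left)
  · exact fun w hw => S.mul_mem hg ((hW _ hw.2).2 (hXS w hw.1)).1
  · intro w hw
    obtain ⟨h1, h2⟩ := (hW _ hw.2).2 (hXS w hw.1)
    rw [act_mul hg h1, h2]
    exact act_act_inv hg _

variable [CompleteSpace R]

theorem act_exp_cmul {A : R} (hA : A ∈ S.M) (t : ℝ) :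
    S.act (NormedSpace.exp (t • S.Y)) (S.cmul (exp (-(t * I))) A) = A := by
  have hd : ∀ t : ℝ, HasDerivAt (fun t : ℝ => S.act (NormedSpace.exp (t • S.Y))
      (Real.cos t • A - Real.sin t • S.J S.Y A)) 0 t := fun t => by
    have h1 := hasDerivAt_exp_smul_const (𝕂 := ℝ) S.Y t
    have hu : ∀ t : ℝ, IsUnit (NormedSpace.exp (t • S.Y)) := fun t =>
      S.isUnit (exp_mem (S.𝔤.smul_mem t S.Y_mem))
    have h2 : HasDerivAt (fun t : ℝ => Real.cos t • A - Real.sin t • S.J S.Y A)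
        ((-Real.sin t) • A - Real.cos t • S.J S.Y A) t :=
      ((Real.hasDerivAt_cos t).smul_const A).sub ((Real.hasDerivAt_sin t).smul_const _)
    have h3 := (isParallelAt_logFDeriv h1.differentiableAt (hu t)).hasFDerivAt_conj (hu t)
      h2.hasFDerivAt 1
    simp only [act_eq]
    have h4 := h3.1.hasDerivAt
    rw [← fderiv_apply_one_eq_deriv, h3.2, logFDeriv_apply, fderiv_apply_one_eq_deriv, h1.deriv,
      ← mul_assoc, Ring.inverse_mul_cancel _ (hu t), one_mul] at h4
    have h5 : S.Y * (Real.cos t • A - Real.sin t • S.J S.Y A)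
        - (Real.cos t • A - Real.sin t • S.J S.Y A) * S.Y
        = Real.cos t • S.J S.Y A - Real.sin t • S.J S.Y (S.J S.Y A) := by
      change S.J S.Y (Real.cos t • A - Real.sin t • S.J S.Y A) = _
      rw [J_sub, J_smul, J_smul]
    rw [h5, J_Y_J_Y hA] at h4
    have h6 : -Real.sin t • A - Real.cos t • S.J S.Y A
        + (Real.cos t • S.J S.Y A - Real.sin t • -A) = 0 := by module
    rw [ContinuousLinearMap.toSpanSingleton_apply, one_smul, h6, mul_zero, zero_mul] at h4
    exact h4
  have h0 := is_const_of_deriv_eq_zero (fun t => (hd t).differentiableAt)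
    (fun t => (hd t).deriv) t 0
  simp only [zero_smul, NormedSpace.exp_zero, act_one, Real.cos_zero, Real.sin_zero, one_smul,
    sub_zero] at h0
  conv_rhs => rw [← h0]
  congr 1
  rw [show -(t * I : ℂ) = ((-t : ℝ) : ℂ) * I by push_cast; ring, cmul, exp_ofReal_mul_I_re,
    exp_ofReal_mul_I_im, Real.cos_neg, Real.sin_neg]
  module

/-- The adjoint action of `exp (t Y)`. -/
theorem act_inv_exp {X : R} (hX : X ∈ S.𝔤) (t : ℝ) :
    S.act (S.inv (NormedSpace.exp (t • S.Y))) X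
      = S.projZero X + S.cmul (exp (-(t * I))) (S.projML X) + S.β X • S.Y := by
  have hG : NormedSpace.exp (t • S.Y) ∈ S.G := exp_mem (S.𝔤.smul_mem t S.Y_mem)
  have hcomm : ∀ Z : R, S.J S.Y Z = 0 → S.act (NormedSpace.exp (t • S.Y)) Z = Z := fun Z hZ => by
    have hc : Commute (t • S.Y) Z := Commute.smul_left (sub_eq_zero.1 hZ) t
    rw [act, hc.exp_left.eq, mul_assoc, mul_inv_cancel hG, mul_one]
  have h : S.act (NormedSpace.exp (t • S.Y)) (S.projZero X
      + S.cmul (exp (-(t * I))) (S.projML X) + S.β X • S.Y) = X := by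
    rw [act_add, act_add, act_exp_cmul (projML_mem_M hX), hcomm _ (S.lie_projZero_Y hX),
      hcomm _ (by rw [J_smul, J_self, smul_zero]), ← S.eq_sum hX]
  conv_lhs => rw [← h]
  exact act_inv hG _

theorem IsLift.mul_exp (hU : IsOpen U) (h : S.IsLift F f U) {t : ℂ → ℝ} (ht : ContDiffOn ℝ ∞ t U) :
    S.IsLift (fun z => F z * NormedSpace.exp (t z • S.Y)) f U ∧ ∀ z ∈ U, ∀ v,
      S.projML (logFDeriv (fun z => F z * NormedSpace.exp (t z • S.Y)) z v)
        = S.cmul (exp (-(t z * I))) (S.projML (logFDeriv F z v)) := by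
  have hG : ∀ t : ℝ, NormedSpace.exp (t • S.Y) ∈ S.G := fun t => exp_mem (S.𝔤.smul_mem t S.Y_mem)
  have hl : S.IsLift (fun z => F z * NormedSpace.exp (t z • S.Y)) f U := by
    refine ⟨h.1.mul (contDiff_exp.comp_contDiffOn (ht.smul contDiffOn_const)),
      fun z hz => S.mul_mem (h.2.1 z hz) (hG _), fun z hz => ?_⟩
    have hc : Commute (t z • S.Y) S.Y := Commute.smul_left (Commute.refl _) _
    rw [act_mul (h.2.1 z hz) (hG _), ← h.2.2 z hz, act.eq_1 S _ S.Y, hc.exp_left.eq, mul_assoc,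
      mul_inv_cancel (hG _), mul_one]
  refine ⟨hl, fun z hz v => ?_⟩
  have htd : HasFDerivAt t (fderiv ℝ t z) z :=
    ((ht.contDiffAt (hU.mem_nhds hz)).differentiableAt (by simp)).hasFDerivAt
  have h1 : HasFDerivAt (fun z => NormedSpace.exp (t z • S.Y))
      ((fderiv ℝ t z).smulRight (NormedSpace.exp (t z • S.Y) * S.Y)) z :=
    ((hasDerivAt_exp_smul_const (𝕂 := ℝ) S.Y (t z)).hasFDerivAt.comp z htd).congr_fderiv
      (by ext; simp)
  have h2 := (h.isParallelAt hU hz).fun_mul' h1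
  have e1 : logFDeriv (fun z => F z * NormedSpace.exp (t z • S.Y)) z v
      = S.act (S.inv (NormedSpace.exp (t z • S.Y))) (logFDeriv F z v) + fderiv ℝ t z v • S.Y := by
    rw [logFDeriv_apply, h2.fderiv, ← S.inv_eq, inv_mul (h.2.1 z hz) (hG _), act,
      inv_inv (hG _)]
    have e2 := inv_mul_cancel (h.2.1 z hz)
    have e3 := inv_mul_cancel (hG (t z))
    simp only [_root_.add_apply, _root_.smul_apply, ContinuousLinearMap.smulRight_apply,
      ContinuousLinearMap.comp_apply, ContinuousLinearMap.mul_apply', smul_eq_mul,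
      MulOpposite.smul_eq_mul_unop, MulOpposite.unop_op, mul_add, mul_smul_comm]
    simp only [mul_assoc]
    rw [← mul_assoc (S.inv (F z)), e2, one_mul, ← mul_assoc (S.inv (F z)), e2, one_mul,
      ← mul_assoc _ _ S.Y, e3, one_mul, add_comm]
  rw [e1, act_inv_exp (h.mem hU hz v), map_add, map_add, map_add, map_smul, map_smul,
    projML_of_neg S.τ_Y, projML_of_fixed (S.τ_projZero _),
    projML_of_mem (cmul_mem_M (h.mem_M hU hz v) _).2]
  module

/-- Conformal Lagrangian immersions admit local Lagrangian lifts. -/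
theorem exists_local_lagrangianLift (hL : IsOpen L) (hf : S.IsConformalImmersion f L)
    (hlag : S.IsLagrangian f L) (hz : z ∈ L) : ∃ U : Set ℂ, IsOpen U ∧ SimplyConnectedSpace U ∧
      z ∈ U ∧ U ⊆ L ∧ ∃ F : ℂ → R, S.IsLagrangianLift F f U := by
  obtain ⟨V, hV, hzV, hVL, F, hF⟩ := exists_local_lift hL hf.1 hf.2.1 hz
  set A : ℂ → R := fun z => S.projML (logFDeriv F z 1) with hA
  set B : ℂ → R := fun z => S.projML (logFDeriv F z I) with hB
  have hAM : ∀ z ∈ V, A z ∈ S.M := fun z hz => hF.mem_M hV hz 1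
  have hBM : ∀ z ∈ V, B z ∈ S.M := fun z hz => hF.mem_M hV hz I
  have hAC : ContDiffOn ℝ ∞ A V := S.projML.contDiff.comp_contDiffOn (hF.contDiffOn_apply hV 1)
  have hBC : ContDiffOn ℝ ∞ B V := S.projML.contDiff.comp_contDiffOn (hF.contDiffOn_apply hV I)
  let T : R →L[ℝ] R := ContinuousLinearMap.mul ℝ R S.Y - (ContinuousLinearMap.mul ℝ R).flip S.Y
  have hT : ∀ X, T X = S.J S.Y X := fun X => by simp [T, J]
  have hconf : ∀ z ∈ V, 0 < S.metric (A z) (A z) ∧ S.metric (A z) (A z) = S.metric (B z) (B z) ∧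
      S.metric (A z) (B z) = 0 := fun z hz => by
    have := hf.2.2 z (hVL hz)
    simpa only [hF.metric_fderiv hV hz] using this
  set μ : ℂ → ℂ := fun z => ((-S.metric (S.τ (A z)) (B z) / S.metric (A z) (A z) : ℝ) : ℂ)
      + ((-S.metric (S.J S.Y (S.τ (A z))) (B z) / S.metric (A z) (A z) : ℝ) : ℂ) * I with hμ
  have hph : ∀ z ∈ V, ‖μ z‖ = 1 ∧ B z = S.cmul (μ z) (-S.τ (A z)) := fun z hz =>
    exists_phase (hAM z hz) (hBM z hz) (hconf z hz).1 (hconf z hz).2.1 (hconf z hz).2.2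
      (by have := hlag z (hVL hz) 1 I; rwa [hF.kahler_fderiv hV hz] at this) rfl
  have hbil : ∀ {X Z : ℂ → R}, ContDiffOn ℝ ∞ X V → ContDiffOn ℝ ∞ Z V →
      ContDiffOn ℝ ∞ (fun z => S.metric (X z) (Z z)) V := fun hX hZ => by
    simp only [S.metric_eq]
    exact (S.B.contDiff.comp_contDiffOn hX).clm_apply hZ
  have hτC : ContDiffOn ℝ ∞ (fun z => S.τ (A z)) V := S.τ.contDiff.comp_contDiffOn hAC
  have hμC : ContDiffOn ℝ ∞ μ V := by
    have hn := hbil hAC hAC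
    have h1 := (hbil hτC hBC).neg.div hn fun z hz => (hconf z hz).1.ne'
    have h2 := (hbil (T.contDiff.comp_contDiffOn hτC) hBC).neg.div hn
      fun z hz => (hconf z hz).1.ne'
    refine (ofRealCLM.contDiff.comp_contDiffOn h1).add
      (ContDiffOn.mul ?_ contDiffOn_const)
    refine (ofRealCLM.contDiff.comp_contDiffOn h2).congr fun z hz => ?_
    simp [hT]
  obtain ⟨r, hr, hrV, t, ht, htμ⟩ := exists_smooth_half_arg hV hμC (fun z hz => (hph z hz).1) hzV
  have hF' : S.IsLift F f (ball z r) :=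
    ⟨hF.1.mono hrV, fun w hw => hF.2.1 w (hrV hw), fun w hw => hF.2.2 w (hrV hw)⟩
  obtain ⟨h1, h2⟩ := hF'.mul_exp isOpen_ball ht
  have : ContractibleSpace (ball z r) := (convex_ball z r).contractibleSpace ⟨z, mem_ball_self hr⟩
  refine ⟨ball z r, isOpen_ball, inferInstance, mem_ball_self hr, hrV.trans hVL, _,
    (isLagrangianLift_iff isOpen_ball).2 ⟨h1, fun w hw => ?_, fun w hw => ?_⟩⟩
  · rw [h2 w hw, h2 w hw]
    change S.cmul _ (B w) = -S.τ (S.cmul _ (A w))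
    have hτM := τ_mem_M (hAM w (hrV hw))
    rw [(hph w (hrV hw)).2, cmul_cmul (S.M.neg_mem hτM), τ_cmul, ← htμ w hw, ← exp_add,
      ← exp_conj, cmul_neg]
    have e : -S.cmul (exp (starRingEnd ℂ (-(t w * I)))) (S.τ (A w))
        = S.cmul (-exp (starRingEnd ℂ (-(t w * I)))) (S.τ (A w)) := by
      simp only [cmul, neg_re, neg_im]; module
    rw [e]
    congr 3
    simp
    ring
  · rw [h2 w hw]
    intro h0
    have h3 := congrArg (S.cmul (exp (t w * I))) h0
    rw [cmul_cmul (hAM w (hrV hw)), ← exp_add, add_neg_cancel, exp_zero, cmul_one] at h3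
    have h4 := (hconf w (hrV hw)).1
    rw [show A w = S.cmul (exp (t w * I)) 0 from h3] at h4
    simp [cmul, S.metric_eq, J_zero] at h4

end HermitianModel

end

noncomputable section

namespace SymmetricModel

variable (S : SymmetricModel)

/-- A Hermitian structure on the algebra of matrices which induces the model `S`. -/
structure IsModelledOn (H : HermitianModel S.Mat) : Prop where
  G_eq : H.G = S.G
  τ_eq : ∀ X, H.τ X = S.τ X
  Y_eq : H.Y = S.Y
  ε_eq : H.ε = S.ε
  metric_eq : H.metric = S.metric
  inv_eq : H.inv = fun g => g⁻¹

variable {S} {H : HermitianModel S.Mat} (h : S.IsModelledOn H)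

include h

theorem IsModelledOn.act_eq : H.act = S.act := by
  funext g p
  rw [HermitianModel.act, h.inv_eq, act]

theorem IsModelledOn.space_eq : H.space = S.space := by
  rw [HermitianModel.space, h.G_eq, h.act_eq, h.Y_eq, space]

theorem IsModelledOn.kahler_eq : H.kahler = S.kahler := by
  funext p V W
  rw [HermitianModel.kahler, h.metric_eq, kahler, HermitianModel.J, J]

theorem IsModelledOn.proj_eq : H.proj = S.proj := by
  funext F z
  rw [HermitianModel.proj, h.act_eq, h.Y_eq, proj]

theorem IsModelledOn.isConformalImmersion {f : ℂ → S.Mat} {L : Set ℂ} :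
    H.IsConformalImmersion f L ↔ S.IsConformalImmersion f L := by
  rw [HermitianModel.IsConformalImmersion, h.metric_eq, h.space_eq]
  rfl

theorem IsModelledOn.isLagrangian {f : ℂ → S.Mat} {L : Set ℂ} :
    H.IsLagrangian f L ↔ S.IsLagrangian f L := by
  rw [HermitianModel.IsLagrangian, h.kahler_eq]
  rfl

theorem IsModelledOn.isHamiltonianStationary {f : ℂ → S.Mat} {L : Set ℂ} :
    H.IsHamiltonianStationary f L ↔ S.IsHamiltonianStationary f L := by
  simp only [HermitianModel.IsHamiltonianStationary, HermitianModel.areaDensity, h.kahler_eq,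
    h.space_eq, h.metric_eq]
  rfl

theorem IsModelledOn.isHSL {f : ℂ → S.Mat} {L : Set ℂ} : H.IsHSL f L ↔ S.IsHSL f L := by
  rw [HermitianModel.IsHSL, h.isConformalImmersion, h.isLagrangian, h.isHamiltonianStationary]
  rfl

theorem IsModelledOn.maurerCartan_eq {F : ℂ → S.Mat} : H.maurerCartan F = S.maurerCartan F := by
  funext z v
  rw [HermitianModel.maurerCartan, h.inv_eq]
  rfl

theorem IsModelledOn.projM_eq : H.projM = S.projM := by
  funext A
  rw [HermitianModel.projM, h.τ_eq, h.τ_eq]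
  rfl

theorem IsModelledOn.cmul_eq : H.cmul = S.cmul := by
  funext c A
  rw [HermitianModel.cmul, h.Y_eq]
  rfl

theorem IsModelledOn.isLift {F f : ℂ → S.Mat} {L : Set ℂ} :
    H.IsLift F f L ↔ S.IsLift F f L := by
  rw [HermitianModel.IsLift, h.G_eq, h.act_eq, h.Y_eq]
  rfl

theorem IsModelledOn.isLagrangianLift {F f : ℂ → S.Mat} {L : Set ℂ} :
    H.IsLagrangianLift F f L ↔ S.IsLagrangianLift F f L := by
  rw [HermitianModel.IsLagrangianLift, h.isLift, h.projM_eq, h.maurerCartan_eq, h.cmul_eq, h.ε_eq]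
  rfl

omit h

theorem one_tmul_injective : Function.Injective fun X : S.Mat => (1 : ℂ) ⊗ₜ[ℝ] X := by
  intro X Z hXZ
  have := congrArg (TensorProduct.lift ((LinearMap.lsmul ℝ S.Mat).comp reLm)) hXZ
  simpa using this

theorem one_tmul_smul (r : ℝ) (X : S.Mat) :
    (1 : ℂ) ⊗ₜ[ℝ] (r • X) = (r : ℂ) • ((1 : ℂ) ⊗ₜ[ℝ] X) := by
  rw [TensorProduct.tmul_smul, ← algebraMap_smul ℂ r, coe_algebraMap]

theorem eigenComponent_eq (k : ℤ) (X : S.Mat) : S.eigenComponent k X = (1 / 4 : ℂ) •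
    ((1 : ℂ) ⊗ₜ[ℝ] X + I ^ (-k) • ((1 : ℂ) ⊗ₜ[ℝ] S.τ X) + I ^ (-(2 * k)) • ((1 : ℂ) ⊗ₜ[ℝ] S.τ (S.τ X))
      + I ^ (-(3 * k)) • ((1 : ℂ) ⊗ₜ[ℝ] S.τ (S.τ (S.τ X)))) := by
  simp [eigenComponent, Finset.sum_range_succ, pow_succ, mul_comm k]

theorem I_zpow_neg_two : (I ^ (-2 : ℤ)) = -1 := by rw [zpow_neg]; norm_cast; simp

theorem I_zpow_four : (I ^ (4 : ℤ)) = 1 := by norm_cast; simp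

theorem I_zpow_add_four (k : ℤ) : I ^ (k + 4) = I ^ k := by
  rw [zpow_add₀ I_ne_zero, I_zpow_four, mul_one]

/-- The extended form in terms of real data. -/
theorem IsModelledOn.extendedForm_eq (h : S.IsModelledOn H) {α : ℂ → S.Mat} {v : ℂ}
    (hm : ∀ w, α w ∈ H.𝔤) (hα : H.projML (α (I * v)) = -H.τ (H.projML (α v))) (l : Circle) :
    S.extendedForm α l v = (1 : ℂ) ⊗ₜ[ℝ] H.extend (l : ℂ).re (l : ℂ).im (α v) (α (I * v)) := by
  have h0 : ∀ X, S.eigenComponent 0 X = (1 : ℂ) ⊗ₜ[ℝ] H.projZero X := fun X => by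
    rw [eigenComponent_eq, HermitianModel.projZero_apply, one_tmul_smul]
    simp only [TensorProduct.tmul_add, h.τ_eq]
    norm_num
  have h2 : ∀ w, S.eigenComponent 2 (α w) = (H.β (α w) : ℂ) • ((1 : ℂ) ⊗ₜ[ℝ] H.Y) := fun w => by
    have e2 : I ^ (-(2 * 2) : ℤ) = 1 := by rw [← I_zpow_add_four]; norm_num
    have e3 : I ^ (-(3 * 2) : ℤ) = -1 := by rw [← I_zpow_add_four, ← I_zpow_neg_two]; norm_num
    rw [← one_tmul_smul, ← H.projTwo_eq (hm w), HermitianModel.projTwo_apply, eigenComponent_eq,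
      I_zpow_neg_two, e2, e3, one_tmul_smul]
    simp only [TensorProduct.tmul_add, TensorProduct.tmul_sub, h.τ_eq]
    push_cast
    module
  have h1 : ∀ X, S.eigenComponent 1 X = (1 / 2 : ℂ) • ((1 : ℂ) ⊗ₜ[ℝ] H.projML X)
      - (I / 2) • ((1 : ℂ) ⊗ₜ[ℝ] H.τ (H.projML X)) := fun X => by
    have e1 : I ^ (-1 : ℤ) = -I := by simp
    have e3 : I ^ (-(3 * 1) : ℤ) = I := by rw [← I_zpow_add_four]; norm_num
    rw [HermitianModel.projML_apply, map_smul, map_sub, one_tmul_smul, one_tmul_smul,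
      eigenComponent_eq, mul_one, I_zpow_neg_two, e1, e3]
    simp only [TensorProduct.tmul_sub, h.τ_eq]
    push_cast
    module
  have h1' : ∀ X, S.eigenComponent (-1) X = (1 / 2 : ℂ) • ((1 : ℂ) ⊗ₜ[ℝ] H.projML X)
      + (I / 2) • ((1 : ℂ) ⊗ₜ[ℝ] H.τ (H.projML X)) := fun X => by
    have e1 : I ^ (-(-1) : ℤ) = I := by simp
    have e2 : I ^ (-(2 * (-1)) : ℤ) = -1 := by
      rw [← I_zpow_neg_two, ← I_zpow_add_four (-2)]; norm_num
    have e3 : I ^ (-(3 * (-1)) : ℤ) = -I := by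
      rw [show (-(3 * (-1)) : ℤ) = -1 + 4 by norm_num, I_zpow_add_four]; simp
    rw [HermitianModel.projML_apply, map_smul, map_sub, one_tmul_smul, one_tmul_smul,
      eigenComponent_eq, e2, e1, e3]
    simp only [TensorProduct.tmul_sub, h.τ_eq]
    push_cast
    module
  have hτ : H.τ (H.projML (α (I * v))) = H.projML (α v) := by
    rw [hα, map_neg, H.τ_τ_projML, neg_neg]
  have hl : (l : ℂ) = (l : ℂ).re + (l : ℂ).im * I := (re_add_im _).symm
  have hl' : (l : ℂ)⁻¹ = (l : ℂ).re - (l : ℂ).im * I := by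
    rw [← Circle.coe_inv, Circle.coe_inv_eq_conj]
    apply Complex.ext <;> simp
  have hτ' : H.τ (H.projML (α v)) = -H.projML (α (I * v)) := by rw [hα, neg_neg]
  simp only [extendedForm, partOneZero, partZeroOne, h0, h1, h1', h2, HermitianModel.extend, hτ,
    hτ', TensorProduct.tmul_add, TensorProduct.tmul_sub, one_tmul_smul, TensorProduct.tmul_neg]
  rw [zpow_neg, zpow_neg, zpow_one, zpow_ofNat, ← inv_pow, hl']
  generalize (l : ℂ).re = c at hl ⊢
  generalize (l : ℂ).im = s at hl ⊢
  rw [hl]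
  push_cast
  match_scalars
  all_goals apply Complex.ext <;> simp [sq] <;> ring

theorem IsModelledOn.isExtendedSolution (h : S.IsModelledOn H) {F Fl f : ℂ → S.Mat} {U : Set ℂ}
    (hU : IsOpen U) (hF : S.IsLagrangianLift F f U) (l : Circle) :
    H.IsExtendedSolution F l Fl U ↔ S.IsExtendedSolution F l Fl U := by
  obtain ⟨hl, ht, -⟩ := (HermitianModel.isLagrangianLift_iff hU).1 (h.isLagrangianLift.2 hF)
  simp only [HermitianModel.IsExtendedSolution, h.G_eq, h.maurerCartan_eq]
  refine and_congr_right fun _ => and_congr_right fun _ => forall₂_congr fun z hz =>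
    forall_congr' fun v => ?_
  have hα : ∀ v, S.maurerCartan F z v = logFDeriv F z v := fun v => by
    rw [← h.maurerCartan_eq, HermitianModel.maurerCartan_eq]
  have e : S.extendedForm (S.maurerCartan F z) l v = (1 : ℂ) ⊗ₜ[ℝ] H.extend (l : ℂ).re (l : ℂ).im
      (S.maurerCartan F z v) (S.maurerCartan F z (I * v)) := by
    refine h.extendedForm_eq (fun w => ?_) ?_ l
    · rw [hα]; exact hl.mem hU hz w
    · rw [hα, hα]
      have key := HermitianModel.map_linear
        ((H.projML.comp (logFDeriv F z) : ℂ →L[ℝ] S.Mat) : ℂ →ₗ[ℝ] S.Mat)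
      simp only [ContinuousLinearMap.coe_coe, ContinuousLinearMap.comp_apply] at key
      rw [key (I * v), key v, ht z hz, map_add, map_smul, map_smul, map_neg, H.τ_τ_projML]
      simp only [mul_re, mul_im, I_re, I_im]
      module
  rw [e]
  exact one_tmul_injective.eq_iff.symm

theorem IsModelledOn.local_families (h : S.IsModelledOn H) {L : Set ℂ} {f : ℂ → S.Mat}
    (hL : IsOpen L) (hf : S.IsHSL f L) :
    (∀ z ∈ L, ∃ U : Set ℂ, IsOpen U ∧ SimplyConnectedSpace U ∧ z ∈ U ∧ U ⊆ L ∧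
      ∃ F : ℂ → S.Mat, S.IsLagrangianLift F f U) ∧
    (∀ (U : Set ℂ) (F : ℂ → S.Mat), IsOpen U → SimplyConnectedSpace U → U ⊆ L →
      S.IsLagrangianLift F f U →
      ∀ (l : Circle) (z₀ : ℂ) (g₀ : S.Mat), z₀ ∈ U → g₀ ∈ S.G →
        ∃ Fl : ℂ → S.Mat, S.IsExtendedSolution F l Fl U ∧ Fl z₀ = g₀ ∧
          (∀ F' : ℂ → S.Mat, S.IsExtendedSolution F l F' U → F' z₀ = g₀ → Set.EqOn F' Fl U) ∧
          S.IsLagrangianLift Fl (S.proj Fl) U ∧ S.IsHSL (S.proj Fl) U ∧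
          (l = 1 → g₀ = F z₀ → Set.EqOn Fl F U)) := by
  have hf' := h.isHSL.2 hf
  refine ⟨fun z hz => ?_, fun U F hU _ hUL hF l z₀ g₀ hz₀ hg₀ => ?_⟩
  · simp only [← h.isLagrangianLift]
    exact HermitianModel.exists_local_lagrangianLift hL hf'.1 hf'.2.1 hz
  · have := (h.isLagrangianLift.2 hF).exists_extendedSolution hU
      (hf'.2.2.mono hf'.1.1 hf'.1.2.1 hL hU hUL) l hz₀ (by rwa [h.G_eq])
    simpa only [h.isExtendedSolution hU hF, h.isLagrangianLift, h.proj_eq, h.isHSL] using this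

end SymmetricModel

end

noncomputable section

section Conserved

variable {E R : Type*} [NormedAddCommGroup E] [NormedSpace ℝ E] [NormedRing R] [NormedAlgebra ℝ R]
  {A : E → E →L[ℝ] R} {F : E → R} {U : Set E}

theorem IsParallelAt.hasFDerivAt_form {z : E} (h : IsParallelAt A F z) (T : R →L[ℝ] R)
    (hT : ∀ X Z, T (X * Z) = T Z * T X) (K : R) :
    ∃ D : E →L[ℝ] R, HasFDerivAt (fun z => F z * K * T (F z)) D z ∧
      ∀ v, D v = F z * (A z v * K + K * T (A z v)) * T (F z) := by
  have h1 : HasFDerivAt (fun z => T (F z)) _ z := T.hasFDerivAt.comp z h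
  refine ⟨_, (HasFDerivAt.mul_const' h K).fun_mul' h1, fun v => ?_⟩
  simp [hT, mul_add, add_mul, mul_assoc, add_comm]

theorem form_eq_of_isParallelAt (hU : IsOpen U) (hc : IsPreconnected U)
    (hF : ∀ z ∈ U, IsParallelAt A F z) (T : R →L[ℝ] R) (hT : ∀ X Z, T (X * Z) = T Z * T X) {K : R}
    (hA : ∀ z ∈ U, ∀ v, A z v * K + K * T (A z v) = 0) {z₀ z : E} (hz₀ : z₀ ∈ U) (hz : z ∈ U) :
    F z * K * T (F z) = F z₀ * K * T (F z₀) := by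
  have h : ∀ z ∈ U, HasFDerivAt (fun z => F z * K * T (F z)) (0 : E →L[ℝ] R) z := fun z hz => by
    obtain ⟨D, hD, hD'⟩ := (hF z hz).hasFDerivAt_form T hT K
    refine hD.congr_fderiv ?_
    ext1 v
    rw [hD', hA z hz v]
    simp
  exact hU.is_const_of_fderiv_eq_zero (𝕜 := ℝ) hc
    (fun z hz => (h z hz).differentiableAt.differentiableWithinAt)
    (fun z hz => (h z hz).fderiv) hz hz₀

theorem isParallelAt_of_hasDerivAt {γ : ℝ → R} {a : R} (h : HasDerivAt γ (γ 0 * a) 0) :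
    IsParallelAt (fun _ => (1 : ℝ →L[ℝ] ℝ).smulRight a) γ 0 :=
  h.hasFDerivAt.congr_fderiv (by ext; simp)

theorem form_eq_zero_of_hasDerivAt {γ : ℝ → R} {a K : R} (h : HasDerivAt γ (γ 0 * a) 0)
    (T : R →L[ℝ] R) (hT : ∀ X Z, T (X * Z) = T Z * T X) (hu : IsUnit (γ 0))
    (hu' : IsUnit (T (γ 0))) (hγ : ∀ᶠ t in 𝓝 0, γ t * K * T (γ t) = K) : a * K + K * T a = 0 := by
  obtain ⟨D, hD, hD'⟩ := (isParallelAt_of_hasDerivAt h).hasFDerivAt_form T hT K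
  have h0 : HasFDerivAt (fun t => γ t * K * T (γ t)) (0 : ℝ →L[ℝ] R) 0 :=
    (hasFDerivAt_const K (0 : ℝ)).congr_of_eventuallyEq hγ
  have h2 := hD' 1
  rw [hD.unique h0, eq_comm, _root_.zero_apply, hu'.mul_left_eq_zero, hu.mul_right_eq_zero] at h2
  simpa using h2

/-- A function whose logarithmic derivative along right multiplications is linear. -/
structure IsLogLinear (δ : R → ℂ) (tr : R →L[ℝ] ℂ) : Prop where
  differentiable : Differentiable ℝ δ
  hasDerivAt : ∀ g X, HasDerivAt (fun t : ℝ => δ (g + t • (g * X))) (δ g * tr X) 0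

theorem IsLogLinear.hasFDerivAt {δ : R → ℂ} {tr : R →L[ℝ] ℂ} (hδ : IsLogLinear δ tr) {z : E}
    (h : IsParallelAt A F z) : HasFDerivAt (fun z => δ (F z)) (δ (F z) • tr.comp (A z)) z := by
  refine ((hδ.differentiable (F z)).hasFDerivAt.comp z h).congr_fderiv ?_
  ext v
  have h2 : HasDerivAt (fun t : ℝ => F z + t • (F z * A z v)) (F z * A z v) 0 := by
    simpa using! ((hasDerivAt_id (0 : ℝ)).smul_const (F z * A z v)).const_add (F z)
  have h3 : HasFDerivAt δ (fderiv ℝ δ (F z)) (F z + (0 : ℝ) • (F z * A z v)) := by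
    rw [zero_smul, add_zero]; exact (hδ.differentiable (F z)).hasFDerivAt
  simpa using (h3.comp_hasDerivAt 0 h2).unique (hδ.hasDerivAt (F z) (A z v))

theorem IsLogLinear.eq_of_isParallelAt {δ : R → ℂ} {tr : R →L[ℝ] ℂ} (hδ : IsLogLinear δ tr)
    (hU : IsOpen U) (hc : IsPreconnected U) (hF : ∀ z ∈ U, IsParallelAt A F z)
    (hA : ∀ z ∈ U, ∀ v, tr (A z v) = 0) {z₀ z : E} (hz₀ : z₀ ∈ U) (hz : z ∈ U) :
    δ (F z) = δ (F z₀) := by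
  have h : ∀ z ∈ U, HasFDerivAt (fun z => δ (F z)) (0 : E →L[ℝ] ℂ) z := fun z hz => by
    refine (hδ.hasFDerivAt (hF z hz)).congr_fderiv ?_
    ext1 v
    simp [hA z hz v]
  exact hU.is_const_of_fderiv_eq_zero (𝕜 := ℝ) hc
    (fun z hz => (h z hz).differentiableAt.differentiableWithinAt)
    (fun z hz => (h z hz).fderiv) hz hz₀

theorem IsLogLinear.eq_zero_of_hasDerivAt {δ : R → ℂ} {tr : R →L[ℝ] ℂ} (hδ : IsLogLinear δ tr)
    {γ : ℝ → R} {a : R} (h : HasDerivAt γ (γ 0 * a) 0) (hγ : ∀ᶠ t in 𝓝 0, δ (γ t) = 1) :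
    tr a = 0 := by
  have h0 : HasFDerivAt (fun t => δ (γ t)) (0 : ℝ →L[ℝ] ℂ) 0 :=
    (hasFDerivAt_const 1 (0 : ℝ)).congr_of_eventuallyEq hγ
  have h1 := congrArg (· 1) ((hδ.hasFDerivAt (isParallelAt_of_hasDerivAt h)).unique h0)
  simpa [hγ.self_of_nhds] using h1

end Conserved

section MatrixGroups

variable {ι : Type} [Fintype ι] [DecidableEq ι]

/-- A group of matrices together with its Lie algebra. -/
structure IsMatrixGroup (G : Set (Matrix ι ι ℂ)) (𝔤 : Submodule ℝ (Matrix ι ι ℂ)) : Prop where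
  one_mem : 1 ∈ G
  mul_mem : ∀ {g h}, g ∈ G → h ∈ G → g * h ∈ G
  inv_mem : ∀ {g}, g ∈ G → g⁻¹ ∈ G
  isUnit : ∀ {g}, g ∈ G → IsUnit g
  lie_mem : ∀ {X Z}, X ∈ 𝔤 → Z ∈ 𝔤 → X * Z - Z * X ∈ 𝔤
  mem_of_isParallelAt : ∀ {E : Type} [NormedAddCommGroup E] [NormedSpace ℝ E]
    {A : E → E →L[ℝ] Matrix ι ι ℂ} {F : E → Matrix ι ι ℂ} {U : Set E}, IsOpen U →
    IsPreconnected U → (∀ z ∈ U, IsParallelAt A F z) → (∀ z ∈ U, ∀ v, A z v ∈ 𝔤) →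
    ∀ {z₀ : E}, z₀ ∈ U → F z₀ ∈ G → ∀ z ∈ U, F z ∈ G
  mem_of_hasDerivAt : ∀ {γ : ℝ → Matrix ι ι ℂ} {a : Matrix ι ι ℂ}, HasDerivAt γ (γ 0 * a) 0 →
    (∀ᶠ t in 𝓝 0, γ t ∈ G) → a ∈ 𝔤

/-- Conjugate transposition as a bounded operator. -/
def conjTransposeL : Matrix ι ι ℂ →L[ℝ] Matrix ι ι ℂ :=
  LinearMap.toContinuousLinearMap
    { toFun := fun X => Xᴴ
      map_add' := Matrix.conjTranspose_add
      map_smul' := fun c X => by simp }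

/-- The trace as a bounded functional. -/
def traceL : Matrix ι ι ℂ →L[ℝ] ℂ :=
  LinearMap.toContinuousLinearMap (Matrix.traceLinearMap ι ℝ ℂ)

theorem differentiable_det : Differentiable ℝ (Matrix.det : Matrix ι ι ℂ → ℂ) := by
  have hentry : ∀ i j : ι, Differentiable ℝ fun g : Matrix ι ι ℂ => g i j := fun i j =>
    (LinearMap.toContinuousLinearMap (Matrix.entryLinearMap ℝ ℂ i j)).differentiable
  have : (Matrix.det : Matrix ι ι ℂ → ℂ)
      = fun g => ∑ σ : Equiv.Perm ι, ((Equiv.Perm.sign σ : ℤ) : ℂ) * ∏ i, g (σ i) i :=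
    funext fun g => Matrix.det_apply' g
  rw [this]
  fun_prop

theorem hasDerivAt_det_add_smul (g X : Matrix ι ι ℂ) :
    HasDerivAt (fun t : ℝ => (g + t • (g * X)).det) (g.det * X.trace) 0 := by
  have h1 : ∀ t : ℝ, (g + t • (g * X)).det = g.det * (1 + (t : ℂ) • X).det := fun t => by
    rw [← Matrix.det_mul, mul_add, mul_one]
    simp
  set p : Polynomial ℂ := (1 + (Polynomial.X : Polynomial ℂ) • X.map Polynomial.C).det.divX.divX
    with hp
  have h2 : ∀ t : ℝ, (g + t • (g * X)).det
      = g.det * (1 + X.trace * (t : ℂ) + p.eval (t : ℂ) * (t : ℂ) ^ 2) := fun t => by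
    rw [h1, Matrix.det_one_add_smul]
  simp only [h2]
  have h3 : HasDerivAt (fun r : ℂ => g.det * (1 + X.trace * r + p.eval r * r ^ 2))
      (g.det * X.trace) ((0 : ℝ) : ℂ) := by
    have h4 := ((((hasDerivAt_id (0 : ℂ)).const_mul X.trace).const_add 1).add
      ((p.hasDerivAt 0).mul (hasDerivAt_pow 2 (0 : ℂ)))).const_mul g.det
    rw [ofReal_zero]
    convert! h4 using 1
    simp
  exact h3.comp_ofReal

theorem isLogLinear_det : IsLogLinear (Matrix.det : Matrix ι ι ℂ → ℂ) traceL :=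
  ⟨differentiable_det, hasDerivAt_det_add_smul⟩

/-- The infinitesimal isometries of a form. -/
def formLie (K : Matrix ι ι ℂ) : Submodule ℝ (Matrix ι ι ℂ) where
  carrier := {X | X * K + K * Xᴴ = 0}
  add_mem' {X Z} hX hZ := by
    have h : (X + Z) * K + K * (X + Z)ᴴ = (X * K + K * Xᴴ) + (Z * K + K * Zᴴ) := by
      rw [Matrix.conjTranspose_add]; noncomm_ring
    rw [mem_ofPred_eq, h, show X * K + K * Xᴴ = 0 from hX, show Z * K + K * Zᴴ = 0 from hZ, add_zero]
  zero_mem' := by simp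
  smul_mem' c X hX := by
    have h : (c • X) * K + K * (c • X)ᴴ = c • (X * K + K * Xᴴ) := by
      rw [Matrix.conjTranspose_smul]; simp
    rw [mem_ofPred_eq, h, show X * K + K * Xᴴ = 0 from hX, smul_zero]

theorem mem_formLie {K X : Matrix ι ι ℂ} : X ∈ formLie K ↔ X * K + K * Xᴴ = 0 := Iff.rfl

theorem lie_mem_formLie {K X Z : Matrix ι ι ℂ} (hX : X ∈ formLie K) (hZ : Z ∈ formLie K) :
    X * Z - Z * X ∈ formLie K := by
  rw [mem_formLie, ← eq_neg_iff_add_eq_zero] at hX hZ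
  have h : K * (X * Z - Z * X)ᴴ = (K * Zᴴ) * Xᴴ - (K * Xᴴ) * Zᴴ := by
    simp only [Matrix.conjTranspose_sub, Matrix.conjTranspose_mul, mul_sub, mul_assoc]
  have h1 : K * Xᴴ = -(X * K) := by rw [hX, neg_neg]
  have h2 : K * Zᴴ = -(Z * K) := by rw [hZ, neg_neg]
  rw [mem_formLie, h, h1, h2, neg_mul, neg_mul, mul_assoc, mul_assoc, h1, h2]
  noncomm_ring

/-- The special isometry group of a form. -/
def specialFormGroup (K : Matrix ι ι ℂ) : Set (Matrix ι ι ℂ) := {g | g * K * gᴴ = K ∧ g.det = 1}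

/-- The Lie algebra of `specialFormGroup`. -/
def specialFormLie (K : Matrix ι ι ℂ) : Submodule ℝ (Matrix ι ι ℂ) :=
  formLie K ⊓ LinearMap.ker (Matrix.traceLinearMap ι ℝ ℂ)

theorem mem_specialFormLie {K X : Matrix ι ι ℂ} :
    X ∈ specialFormLie K ↔ X * K + K * Xᴴ = 0 ∧ X.trace = 0 := Iff.rfl

theorem isUnit_of_mem_specialFormGroup {K g : Matrix ι ι ℂ} (h : g ∈ specialFormGroup K) :
    IsUnit g := by
  rw [Matrix.isUnit_iff_isUnit_det, h.2]; exact isUnit_one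

theorem isMatrixGroup_specialFormGroup (K : Matrix ι ι ℂ) :
    IsMatrixGroup (specialFormGroup K) (specialFormLie K) where
  one_mem := by simp [specialFormGroup]
  mul_mem {g h} hg hh := by
    refine ⟨?_, by rw [Matrix.det_mul, hg.2, hh.2, one_mul]⟩
    calc g * h * K * (g * h)ᴴ = g * (h * K * hᴴ) * gᴴ := by
          rw [Matrix.conjTranspose_mul]; simp only [mul_assoc]
      _ = K := by rw [hh.1, hg.1]
  inv_mem {g} hg := by
    have hu := (Matrix.isUnit_iff_isUnit_det g).1 (isUnit_of_mem_specialFormGroup hg)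
    refine ⟨?_, by rw [Matrix.det_nonsing_inv, hg.2]; simp⟩
    have hu' : IsUnit gᴴ.det := by rw [Matrix.det_conjTranspose]; exact hu.star
    have h : g⁻¹ * (g * K * gᴴ) * gᴴ⁻¹ = K := by
      rw [mul_assoc, Matrix.mul_nonsing_inv_cancel_right _ _ hu',
        Matrix.nonsing_inv_mul_cancel_left _ _ hu]
    rwa [hg.1, ← Matrix.conjTranspose_nonsing_inv] at h
  isUnit := isUnit_of_mem_specialFormGroup
  lie_mem {X Z} hX hZ := ⟨lie_mem_formLie hX.1 hZ.1, by
    change (X * Z - Z * X).trace = 0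
    rw [Matrix.trace_sub, Matrix.trace_mul_comm, sub_self]⟩
  mem_of_isParallelAt hU hc hF hA _ hz₀ h0 z hz :=
    ⟨(form_eq_of_isParallelAt hU hc hF conjTransposeL Matrix.conjTranspose_mul
        (fun z hz v => (hA z hz v).1) hz₀ hz).trans h0.1,
      (isLogLinear_det.eq_of_isParallelAt hU hc hF (fun z hz v => (hA z hz v).2) hz₀ hz).trans h0.2⟩
  mem_of_hasDerivAt h hγ :=
    have hu := isUnit_of_mem_specialFormGroup hγ.self_of_nhds
    ⟨form_eq_zero_of_hasDerivAt h conjTransposeL Matrix.conjTranspose_mul hu hu.star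
      (hγ.mono fun _ ht => ht.1), isLogLinear_det.eq_zero_of_hasDerivAt h (hγ.mono fun _ ht => ht.2)⟩

end MatrixGroups

end

noncomputable section

section Entries

variable {ι : Type} [Fintype ι] [DecidableEq ι] {E : Type} [NormedAddCommGroup E] [NormedSpace ℝ E]

/-- Reading off an entry, as a bounded functional. -/
def entryL (i j : ι) : Matrix ι ι ℂ →L[ℝ] ℂ :=
  LinearMap.toContinuousLinearMap (Matrix.entryLinearMap ℝ ℂ i j)

theorem contDiff_entry (i j : ι) : ContDiff ℝ ∞ fun X : Matrix ι ι ℂ => X i j :=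
  (entryL i j).contDiff

theorem contDiffAt_matrix {f : E → Matrix ι ι ℂ} {z : E}
    (h : ∀ i j, ContDiffAt ℝ ∞ (fun p => f p i j) z) : ContDiffAt ℝ ∞ f z := by
  let T : (ι → ι → ℂ) →ₗ[ℝ] Matrix ι ι ℂ :=
    { toFun := Matrix.of
      map_add' := fun _ _ => rfl
      map_smul' := fun _ _ => rfl }
  have h1 : ContDiffAt ℝ ∞ (fun p => fun i j => f p i j) z :=
    contDiffAt_pi.2 fun i => contDiffAt_pi.2 fun j => h i j
  exact (LinearMap.toContinuousLinearMap T).contDiff.contDiffAt.comp z h1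

/-- A bilinear form on a finite-dimensional space, as a bounded one. -/
def LinearMap.toBilinL {V : Type} [NormedAddCommGroup V] [NormedSpace ℝ V] [FiniteDimensional ℝ V]
    (b : V →ₗ[ℝ] V →ₗ[ℝ] ℝ) : V →L[ℝ] V →L[ℝ] ℝ :=
  LinearMap.toContinuousLinearMap
    ((LinearMap.toContinuousLinearMap : (V →ₗ[ℝ] ℝ) ≃ₗ[ℝ] (V →L[ℝ] ℝ)).toLinearMap.comp b)

/-- The trace form scaled by `c`. -/
def traceForm (c : ℝ) : Matrix ι ι ℂ →L[ℝ] Matrix ι ι ℂ →L[ℝ] ℝ :=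
  LinearMap.toBilinL (LinearMap.mk₂ ℝ (fun V W => c * (Matrix.trace (V * W)).re)
    (fun V V' W => by rw [add_mul, Matrix.trace_add, add_re, mul_add])
    (fun r V W => by
      rw [show (r • V) * W = r • (V * W) from smul_mul_assoc r V W]
      rw [show (r • (V * W)).trace = r • (V * W).trace from Matrix.trace_smul r (V * W), real_smul,
        re_ofReal_mul, smul_eq_mul]
      ring)
    (fun V W W' => by rw [mul_add, Matrix.trace_add, add_re, mul_add])
    (fun r V W => by
      rw [show V * (r • W) = r • (V * W) from mul_smul_comm r V W]
      rw [show (r • (V * W)).trace = r • (V * W).trace from Matrix.trace_smul r (V * W), real_smul,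
        re_ofReal_mul, smul_eq_mul]
      ring))

theorem traceForm_apply (c : ℝ) (V W : Matrix ι ι ℂ) :
    traceForm c V W = c * (Matrix.trace (V * W)).re := rfl

theorem trace_conj {g : Matrix ι ι ℂ} (hg : IsUnit g) (v w : Matrix ι ι ℂ) :
    Matrix.trace (g * v * g⁻¹ * (g * w * g⁻¹)) = Matrix.trace (v * w) := by
  have hu := (Matrix.isUnit_iff_isUnit_det g).1 hg
  have : g * v * g⁻¹ * (g * w * g⁻¹) = g * (v * w) * g⁻¹ := by
    simp only [mul_assoc, Matrix.nonsing_inv_mul_cancel_left _ _ hu]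
  rw [this, Matrix.trace_mul_comm, Matrix.nonsing_inv_mul_cancel_left _ _ hu]

end Entries

section Mat3

/-- A matrix in block form. -/
def mat3 (a b c d e f g h i : ℂ) : Matrix (Fin 2 ⊕ Fin 1) (Fin 2 ⊕ Fin 1) ℂ :=
  Matrix.fromBlocks !![a, b; d, e] !![c; f] !![g, h] !![i]

theorem exists_mat3 (X : Matrix (Fin 2 ⊕ Fin 1) (Fin 2 ⊕ Fin 1) ℂ) :
    ∃ a b c d e f g h i, X = mat3 a b c d e f g h i := by
  refine ⟨X (.inl 0) (.inl 0), X (.inl 0) (.inl 1), X (.inl 0) (.inr 0), X (.inl 1) (.inl 0),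
    X (.inl 1) (.inl 1), X (.inl 1) (.inr 0), X (.inr 0) (.inl 0), X (.inr 0) (.inl 1),
    X (.inr 0) (.inr 0), ?_⟩
  ext i j
  rcases i with i | i <;> rcases j with j | j <;> fin_cases i <;> fin_cases j <;> rfl

theorem mat3_inj {a b c d e f g h i a' b' c' d' e' f' g' h' i' : ℂ} :
    mat3 a b c d e f g h i = mat3 a' b' c' d' e' f' g' h' i' ↔
    a = a' ∧ b = b' ∧ c = c' ∧ d = d' ∧ e = e' ∧ f = f' ∧ g = g' ∧ h = h' ∧ i = i' := by
  constructor
  · intro H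
    have key := fun i j => congrFun (congrFun H i) j
    exact ⟨key (.inl 0) (.inl 0), key (.inl 0) (.inl 1), key (.inl 0) (.inr 0),
      key (.inl 1) (.inl 0), key (.inl 1) (.inl 1), key (.inl 1) (.inr 0), key (.inr 0) (.inl 0),
      key (.inr 0) (.inl 1), key (.inr 0) (.inr 0)⟩
  · rintro ⟨rfl, rfl, rfl, rfl, rfl, rfl, rfl, rfl, rfl⟩; rfl

theorem mat3_mul (a b c d e f g h i a' b' c' d' e' f' g' h' i' : ℂ) :
    mat3 a b c d e f g h i * mat3 a' b' c' d' e' f' g' h' i' =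
    mat3 (a * a' + b * d' + c * g') (a * b' + b * e' + c * h') (a * c' + b * f' + c * i')
      (d * a' + e * d' + f * g') (d * b' + e * e' + f * h') (d * c' + e * f' + f * i')
      (g * a' + h * d' + i * g') (g * b' + h * e' + i * h') (g * c' + h * f' + i * i') := by
  ext i j
  rcases i with i | i <;> rcases j with j | j <;> fin_cases i <;> fin_cases j <;>
    simp [mat3, Matrix.mul_apply, Fin.sum_univ_two]

theorem mat3_add (a b c d e f g h i a' b' c' d' e' f' g' h' i' : ℂ) :
    mat3 a b c d e f g h i + mat3 a' b' c' d' e' f' g' h' i' =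
    mat3 (a + a') (b + b') (c + c') (d + d') (e + e') (f + f') (g + g') (h + h') (i + i') := by
  ext i j
  rcases i with i | i <;> rcases j with j | j <;> fin_cases i <;> fin_cases j <;> simp [mat3]

theorem mat3_sub (a b c d e f g h i a' b' c' d' e' f' g' h' i' : ℂ) :
    mat3 a b c d e f g h i - mat3 a' b' c' d' e' f' g' h' i' =
    mat3 (a - a') (b - b') (c - c') (d - d') (e - e') (f - f') (g - g') (h - h') (i - i') := by
  ext i j
  rcases i with i | i <;> rcases j with j | j <;> fin_cases i <;> fin_cases j <;> simp [mat3]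

theorem mat3_neg (a b c d e f g h i : ℂ) :
    -mat3 a b c d e f g h i = mat3 (-a) (-b) (-c) (-d) (-e) (-f) (-g) (-h) (-i) := by
  ext i j
  rcases i with i | i <;> rcases j with j | j <;> fin_cases i <;> fin_cases j <;> simp [mat3]

theorem mat3_smul (r : ℝ) (a b c d e f g h i : ℂ) : r • mat3 a b c d e f g h i =
    mat3 (r * a) (r * b) (r * c) (r * d) (r * e) (r * f) (r * g) (r * h) (r * i) := by
  ext i j
  change (r • (_ : ℂ)) = _
  rcases i with i | i <;> rcases j with j | j <;> fin_cases i <;> fin_cases j <;> simp [mat3]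

theorem mat3_csmul (r a b c d e f g h i : ℂ) : r • mat3 a b c d e f g h i =
    mat3 (r * a) (r * b) (r * c) (r * d) (r * e) (r * f) (r * g) (r * h) (r * i) := by
  ext i j
  rcases i with i | i <;> rcases j with j | j <;> fin_cases i <;> fin_cases j <;> simp [mat3]

theorem mat3_conjTranspose (a b c d e f g h i : ℂ) : (mat3 a b c d e f g h i)ᴴ =
    mat3 (starRingEnd ℂ a) (starRingEnd ℂ d) (starRingEnd ℂ g) (starRingEnd ℂ b) (starRingEnd ℂ e)
      (starRingEnd ℂ h) (starRingEnd ℂ c) (starRingEnd ℂ f) (starRingEnd ℂ i) := by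
  ext i j
  rcases i with i | i <;> rcases j with j | j <;> fin_cases i <;> fin_cases j <;> simp [mat3]

theorem mat3_transpose (a b c d e f g h i : ℂ) : (mat3 a b c d e f g h i)ᵀ =
    mat3 a d g b e h c f i := by
  ext i j
  rcases i with i | i <;> rcases j with j | j <;> fin_cases i <;> fin_cases j <;> simp [mat3]

theorem mat3_map (φ : ℂ → ℂ) (a b c d e f g h i : ℂ) : (mat3 a b c d e f g h i).map φ =
    mat3 (φ a) (φ b) (φ c) (φ d) (φ e) (φ f) (φ g) (φ h) (φ i) := by
  ext i j
  rcases i with i | i <;> rcases j with j | j <;> fin_cases i <;> fin_cases j <;> simp [mat3]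

theorem mat3_trace (a b c d e f g h i : ℂ) : (mat3 a b c d e f g h i).trace = a + e + i := by
  simp [mat3, Matrix.trace]

theorem mat3_det (a b c d e f g h i : ℂ) : (mat3 a b c d e f g h i).det =
    a * e * i - a * f * h - b * d * i + b * f * g + c * d * h - c * e * g := by
  have : mat3 a b c d e f g h i = (!![a, b, c; d, e, f; g, h, i]).submatrix
      (finSumFinEquiv (m := 2) (n := 1)) (finSumFinEquiv (m := 2) (n := 1)) := by
    ext i j
    rcases i with i | i <;> rcases j with j | j <;> fin_cases i <;> fin_cases j <;> rfl
  rw [this, Matrix.det_submatrix_equiv_self, Matrix.det_fin_three]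
  rfl

theorem one_eq_mat3 : (1 : Matrix (Fin 2 ⊕ Fin 1) (Fin 2 ⊕ Fin 1) ℂ) = mat3 1 0 0 0 1 0 0 0 1 := by
  ext i j
  rcases i with i | i <;> rcases j with j | j <;> fin_cases i <;> fin_cases j <;> simp [mat3]

theorem zero_eq_mat3 : (0 : Matrix (Fin 2 ⊕ Fin 1) (Fin 2 ⊕ Fin 1) ℂ) = mat3 0 0 0 0 0 0 0 0 0 := by
  ext i j
  rcases i with i | i <;> rcases j with j | j <;> fin_cases i <;> fin_cases j <;> simp [mat3]

theorem quarterTurn_eq : quarterTurn = mat3 0 1 0 (-1) 0 0 0 0 1 := by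
  ext i j
  rcases i with i | i <;> rcases j with j | j <;> fin_cases i <;> fin_cases j <;>
    simp [mat3, quarterTurn]

theorem tauTranspose_mat3 (a b c d e f g h i : ℂ) : tauTranspose (mat3 a b c d e f g h i) =
    mat3 (-e) b (-h) d (-a) g (-f) c (-i) := by
  change -(quarterTurn * (mat3 a b c d e f g h i)ᵀ * quarterTurnᵀ) = _
  rw [quarterTurn_eq, mat3_transpose, mat3_transpose, mat3_mul, mat3_mul, mat3_neg, mat3_inj]
  simp

theorem tauConj_mat3 (a b c d e f g h i : ℂ) : tauConj (mat3 a b c d e f g h i) =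
    mat3 (starRingEnd ℂ e) (-starRingEnd ℂ d) (starRingEnd ℂ f) (-starRingEnd ℂ b) (starRingEnd ℂ a)
      (-starRingEnd ℂ c) (starRingEnd ℂ h) (-starRingEnd ℂ g) (starRingEnd ℂ i) := by
  change quarterTurn * (mat3 a b c d e f g h i).map (starRingEnd ℂ) * quarterTurnᵀ = _
  rw [quarterTurn_eq, mat3_map, mat3_transpose, mat3_mul, mat3_mul, mat3_inj]
  simp

end Mat3

end

noncomputable section

namespace ProjectiveFamily

/-- The Hermitian form of signature `(2, 1)` or `(3, 0)`. -/
def form (κ : ℝ) : Matrix (Fin 2 ⊕ Fin 1) (Fin 2 ⊕ Fin 1) ℂ := mat3 1 0 0 0 1 0 0 0 κ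

/-- The base point. -/
def base : Matrix (Fin 2 ⊕ Fin 1) (Fin 2 ⊕ Fin 1) ℂ :=
  mat3 (I / 3) 0 0 0 (I / 3) 0 0 0 (-(2 * I / 3))

/-- The reference frame. -/
def frame (κ : ℝ) : Fin 2 → Matrix (Fin 2 ⊕ Fin 1) (Fin 2 ⊕ Fin 1) ℂ :=
  ![mat3 0 0 1 0 0 0 (-κ) 0 0, mat3 0 0 0 0 0 κ 0 (-1) 0]

/-- The general element of the Lie algebra. -/
def lieElt (κ x y : ℝ) (b u v : ℂ) : Matrix (Fin 2 ⊕ Fin 1) (Fin 2 ⊕ Fin 1) ℂ :=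
  mat3 (x * I) b u (-starRingEnd ℂ b) (y * I) v (-(κ * starRingEnd ℂ u)) (-(κ * starRingEnd ℂ v))
    (-((x + y) * I))

variable {κ : ℝ}

theorem ofReal_sq_eq_one (hκ : κ ^ 2 = 1) : (κ : ℂ) * κ = 1 := by
  rw [← ofReal_mul, ← sq, hκ, ofReal_one]

theorem lieElt_mem (x y : ℝ) (b u v : ℂ) :
    lieElt κ x y b u v ∈ specialFormLie (form κ) := by
  rw [mem_specialFormLie, lieElt, form, mat3_trace, mat3_conjTranspose, mat3_mul, mat3_mul,
    mat3_add, zero_eq_mat3, mat3_inj]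
  refine ⟨⟨?_, ?_, ?_, ?_, ?_, ?_, ?_, ?_, ?_⟩, ?_⟩ <;> (try simp) <;> try ring

theorem exists_lieElt (hκ : κ ^ 2 = 1) {X : Matrix (Fin 2 ⊕ Fin 1) (Fin 2 ⊕ Fin 1) ℂ}
    (hX : X ∈ specialFormLie (form κ)) : ∃ x y b u v, X = lieElt κ x y b u v := by
  obtain ⟨a, b, c, d, e, f, g, h, i, rfl⟩ := exists_mat3 X
  have hκ' := ofReal_sq_eq_one hκ
  rw [mem_specialFormLie, form, mat3_trace, mat3_conjTranspose, mat3_mul, mat3_mul,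
    mat3_add, zero_eq_mat3, mat3_inj] at hX
  obtain ⟨⟨h1, -, -, h4, h5, -, h7, h8, -⟩, h10⟩ := hX
  simp only [mul_one, mul_zero, add_zero, one_mul, zero_mul, zero_add] at h1 h4 h5 h7 h8
  have key : ∀ a : ℂ, a + starRingEnd ℂ a = 0 → a = a.im * I := fun a ha => by
    have := congrArg re ha
    simp at this
    apply Complex.ext
    · simp; linarith
    · simp
  have ha := key a h1
  have he := key e h5
  refine ⟨a.im, e.im, b, c, f, ?_⟩
  rw [lieElt, mat3_inj]
  refine ⟨ha, rfl, rfl, ?_, he, rfl, ?_, ?_, ?_⟩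
  · linear_combination h4
  · linear_combination h7
  · linear_combination h8
  · linear_combination h10 - ha - he

theorem lieElt_inj {x y x' y' : ℝ} {b u v b' u' v' : ℂ}
    (h : lieElt κ x y b u v = lieElt κ x' y' b' u' v') :
    x = x' ∧ y = y' ∧ b = b' ∧ u = u' ∧ v = v' := by
  rw [lieElt, lieElt, mat3_inj] at h
  obtain ⟨h1, h2, h3, -, h5, h6, -⟩ := h
  exact ⟨by simpa using h1, by simpa using h5, h2, h3, h6⟩

theorem tau_lieElt (hκ : κ ^ 2 = 1) (x y : ℝ) (b u v : ℂ) :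
    tauTranspose (lieElt κ x y b u v)
      = lieElt κ (-y) (-x) b (κ * starRingEnd ℂ v) (-(κ * starRingEnd ℂ u)) := by
  have hκ' := ofReal_sq_eq_one hκ
  rw [lieElt, tauTranspose_mat3, lieElt, mat3_inj]
  refine ⟨?_, rfl, ?_, rfl, ?_, ?_, ?_, ?_, ?_⟩ <;> simp
  · linear_combination -v * hκ'
  · linear_combination -u * hκ'
  · ring

theorem smul_lieElt (r x y : ℝ) (b u v : ℂ) : r • lieElt κ x y b u v
    = lieElt κ (r * x) (r * y) (r * b) (r * u) (r * v) := by
  rw [lieElt, mat3_smul, lieElt, mat3_inj]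
  refine ⟨?_, ?_, ?_, ?_, ?_, ?_, ?_, ?_, ?_⟩ <;> simp <;> ring

theorem add_lieElt (x y : ℝ) (b u v : ℂ) (x' y' : ℝ) (b' u' v' : ℂ) :
    lieElt κ x y b u v + lieElt κ x' y' b' u' v'
      = lieElt κ (x + x') (y + y') (b + b') (u + u') (v + v') := by
  rw [lieElt, lieElt, mat3_add, lieElt, mat3_inj]
  refine ⟨?_, ?_, ?_, ?_, ?_, ?_, ?_, ?_, ?_⟩ <;> simp <;> ring

theorem neg_lieElt (x y : ℝ) (b u v : ℂ) :
    -lieElt κ x y b u v = lieElt κ (-x) (-y) (-b) (-u) (-v) := by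
  rw [lieElt, mat3_neg, lieElt, mat3_inj]
  refine ⟨?_, ?_, ?_, ?_, ?_, ?_, ?_, ?_, ?_⟩ <;> simp; ring

theorem zero_eq_lieElt : (0 : Matrix (Fin 2 ⊕ Fin 1) (Fin 2 ⊕ Fin 1) ℂ) = lieElt κ 0 0 0 0 0 := by
  rw [zero_eq_mat3, lieElt, mat3_inj]; simp

theorem base_eq : base = lieElt κ (1 / 3) (1 / 3) 0 0 0 := by
  rw [base, lieElt, mat3_inj]
  refine ⟨?_, ?_, ?_, ?_, ?_, ?_, ?_, ?_, ?_⟩ <;> simp <;> ring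

theorem base_lie (x y : ℝ) (b u v : ℂ) : base * lieElt κ x y b u v - lieElt κ x y b u v * base
    = lieElt κ 0 0 0 (I * u) (I * v) := by
  rw [base, lieElt, mat3_mul, mat3_mul, mat3_sub, lieElt, mat3_inj]
  refine ⟨?_, ?_, ?_, ?_, ?_, ?_, ?_, ?_, ?_⟩ <;> simp <;> ring

theorem frame_zero : frame κ 0 = lieElt κ 0 0 0 1 0 := by
  rw [lieElt]; simp [frame]

theorem frame_one (hκ : κ ^ 2 = 1) : frame κ 1 = lieElt κ 0 0 0 0 κ := by
  have hκ' := ofReal_sq_eq_one hκ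
  rw [lieElt]; simp [frame, hκ', conj_ofReal]

theorem sum_frame (hκ : κ ^ 2 = 1) (c : Fin 2 → ℂ) :
    ∑ i, ((c i).re • frame κ i + (c i).im • (base * frame κ i - frame κ i * base))
      = lieElt κ 0 0 0 (c 0) (κ * c 1) := by
  rw [Fin.sum_univ_two, frame_zero, frame_one hκ]
  simp only [base_lie, smul_lieElt, add_lieElt]
  congr 1
  · simp
  · simp
  · simp
  · simp [re_add_im]
  · linear_combination (κ : ℂ) * re_add_im (c 1)

theorem traceForm_lieElt (hκ : κ ^ 2 = 1) (u v u' v' : ℂ) :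
    traceForm (-(κ / 2)) (lieElt κ 0 0 0 u v) (lieElt κ 0 0 0 u' v')
      = u.re * u'.re + u.im * u'.im + (v.re * v'.re + v.im * v'.im) := by
  rw [traceForm_apply, lieElt, lieElt, mat3_mul, mat3_trace]
  simp
  linear_combination (u.re * u'.re + u.im * u'.im + (v.re * v'.re + v.im * v'.im)) * hκ

theorem traceForm_lie (u v u' v' u'' v'' : ℂ) :
    Matrix.trace (lieElt κ 0 0 0 u v * (lieElt κ 0 0 0 u' v' * lieElt κ 0 0 0 u'' v''
      - lieElt κ 0 0 0 u'' v'' * lieElt κ 0 0 0 u' v')) = 0 := by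
  simp only [lieElt, mat3_mul, mat3_sub, mat3_trace]
  simp

theorem exists_of_tau_tau (hκ : κ ^ 2 = 1) {X : Matrix (Fin 2 ⊕ Fin 1) (Fin 2 ⊕ Fin 1) ℂ}
    (hX : X ∈ specialFormLie (form κ)) (h : tauTranspose (tauTranspose X) = -X) :
    ∃ u v, X = lieElt κ 0 0 0 u v := by
  obtain ⟨x, y, b, u, v, rfl⟩ := exists_lieElt hκ hX
  rw [tau_lieElt hκ, tau_lieElt hκ, neg_lieElt] at h
  obtain ⟨h1, h2, h3, -⟩ := lieElt_inj h
  have hx : x = 0 := by linarith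
  have hy : y = 0 := by linarith
  have hb : b = 0 := by linear_combination h3 / 2
  exact ⟨u, v, by rw [hx, hy, hb]⟩

/-! ### The local section -/

theorem conjTranspose_form_mul (hκ : κ ^ 2 = 1) {g : Matrix (Fin 2 ⊕ Fin 1) (Fin 2 ⊕ Fin 1) ℂ}
    (hg : g ∈ specialFormGroup (form κ)) :
    g⁻¹ = form κ * gᴴ * form κ ∧ gᴴ * form κ * g = form κ := by
  have hκ' := ofReal_sq_eq_one hκ
  have hKK : form κ * form κ = 1 := by
    rw [form, mat3_mul, one_eq_mat3, mat3_inj]; simp [hκ']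
  have h1 : g * (form κ * gᴴ * form κ) = 1 := by
    rw [← mul_assoc, ← mul_assoc, hg.1, hKK]
  refine ⟨Matrix.inv_eq_right_inv h1, ?_⟩
  have h2 := mul_eq_one_comm.1 h1
  calc gᴴ * form κ * g = form κ * form κ * (gᴴ * form κ * g) := by rw [hKK, one_mul]
    _ = form κ * (form κ * gᴴ * form κ * g) := by simp only [mul_assoc]
    _ = form κ := by rw [h2, mul_one]

theorem orbit_eq (hκ : κ ^ 2 = 1) {a b c d e f g h i : ℂ}
    (hg : mat3 a b c d e f g h i ∈ specialFormGroup (form κ)) :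
    mat3 a b c d e f g h i * base * (mat3 a b c d e f g h i)⁻¹ =
      mat3 (I / 3 - I * κ * (c * starRingEnd ℂ c)) (-(I * κ * (c * starRingEnd ℂ f)))
        (-(I * (c * starRingEnd ℂ i))) (-(I * κ * (f * starRingEnd ℂ c)))
        (I / 3 - I * κ * (f * starRingEnd ℂ f)) (-(I * (f * starRingEnd ℂ i)))
        (-(I * κ * (i * starRingEnd ℂ c))) (-(I * κ * (i * starRingEnd ℂ f)))
        (I / 3 - I * (i * starRingEnd ℂ i)) := by
  have hκ' := ofReal_sq_eq_one hκ
  obtain ⟨h1, h2⟩ := conjTranspose_form_mul hκ hg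
  have hu := (Matrix.isUnit_iff_isUnit_det _).1 (isUnit_of_mem_specialFormGroup hg)
  have e0 : base = (I / 3) • (1 : Matrix (Fin 2 ⊕ Fin 1) (Fin 2 ⊕ Fin 1) ℂ)
      - mat3 0 0 0 0 0 0 0 0 I := by
    rw [one_eq_mat3, mat3_csmul, mat3_sub, base, mat3_inj]
    simp; ring
  have e1 : mat3 a b c d e f g h i * base * (mat3 a b c d e f g h i)⁻¹
      = (I / 3) • 1 - mat3 a b c d e f g h i * mat3 0 0 0 0 0 0 0 0 I
        * (form κ * (mat3 a b c d e f g h i)ᴴ * form κ) := by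
    rw [← h1, e0, mul_sub, sub_mul, Matrix.mul_smul, Matrix.smul_mul, mul_one,
      Matrix.mul_nonsing_inv _ hu]
  rw [e1, form, mat3_conjTranspose, mat3_mul, mat3_mul, mat3_mul, mat3_mul, one_eq_mat3, mat3_csmul,
    mat3_sub, mat3_inj]
  refine ⟨?_, ?_, ?_, ?_, ?_, ?_, ?_, ?_, ?_⟩ <;> simp
  · ring
  · ring
  · linear_combination (I * (c * starRingEnd ℂ i)) * hκ'
  · ring
  · ring
  · linear_combination (I * (f * starRingEnd ℂ i)) * hκ'
  · ring
  · ring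
  · linear_combination (I * (i * starRingEnd ℂ i)) * hκ'

end ProjectiveFamily

end

noncomputable section

theorem contDiffAt_mat3 {E : Type} [NormedAddCommGroup E] [NormedSpace ℝ E]
    {a b c d e f g h i : E → ℂ} {z : E} (ha : ContDiffAt ℝ ∞ a z) (hb : ContDiffAt ℝ ∞ b z)
    (hc : ContDiffAt ℝ ∞ c z) (hd : ContDiffAt ℝ ∞ d z) (he : ContDiffAt ℝ ∞ e z)
    (hf : ContDiffAt ℝ ∞ f z) (hg : ContDiffAt ℝ ∞ g z) (hh : ContDiffAt ℝ ∞ h z)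
    (hi : ContDiffAt ℝ ∞ i z) :
    ContDiffAt ℝ ∞ (fun p => mat3 (a p) (b p) (c p) (d p) (e p) (f p) (g p) (h p) (i p)) z := by
  refine contDiffAt_matrix fun j k => ?_
  rcases j with j | j <;> rcases k with k | k <;> fin_cases j <;> fin_cases k <;> assumption

theorem ContDiffAt.conj {E : Type} [NormedAddCommGroup E] [NormedSpace ℝ E] {f : E → ℂ} {z : E}
    (h : ContDiffAt ℝ ∞ f z) : ContDiffAt ℝ ∞ (fun p => starRingEnd ℂ (f p)) z :=
  Complex.conjCLE.contDiff.contDiffAt.comp z h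

theorem ContDiffAt.complex_ofReal {E : Type} [NormedAddCommGroup E] [NormedSpace ℝ E] {f : E → ℝ}
    {z : E} (h : ContDiffAt ℝ ∞ f z) : ContDiffAt ℝ ∞ (fun p => (f p : ℂ)) z :=
  Complex.ofRealCLM.contDiff.contDiffAt.comp z h

theorem ContDiffAt.complex_div {E : Type} [NormedAddCommGroup E] [NormedSpace ℝ E] {f g : E → ℂ}
    {z : E} (hf : ContDiffAt ℝ ∞ f z) (hg : ContDiffAt ℝ ∞ g z) (h : g z ≠ 0) :
    ContDiffAt ℝ ∞ (fun p => f p / g p) z := by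
  simp only [div_eq_mul_inv]
  exact hf.mul (hg.inv h)

namespace ProjectiveFamily

variable {κ : ℝ}

/-- The transvection with given last column. -/
def transvection (κ : ℝ) (u v : ℂ) (r : ℝ) : Matrix (Fin 2 ⊕ Fin 1) (Fin 2 ⊕ Fin 1) ℂ :=
  mat3 (1 - κ * (1 / (1 + r)) * (u * starRingEnd ℂ u)) (-(κ * (1 / (1 + r)) * (u * starRingEnd ℂ v)))
    u (-(κ * (1 / (1 + r)) * (v * starRingEnd ℂ u)))
    (1 - κ * (1 / (1 + r)) * (v * starRingEnd ℂ v)) v (-(κ * starRingEnd ℂ u))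
    (-(κ * starRingEnd ℂ v)) r

theorem transvection_mem (hκ : κ ^ 2 = 1) {u v : ℂ} {r : ℝ} (hr : 0 < r)
    (h : u * starRingEnd ℂ u + v * starRingEnd ℂ v = κ * (1 - r ^ 2)) :
    transvection κ u v r ∈ specialFormGroup (form κ) := by
  have hκ' := ofReal_sq_eq_one hκ
  have ht : (1 / (1 + r) : ℂ) * (1 + r) = 1 := by
    have : (1 + r : ℂ) ≠ 0 := by exact_mod_cast (by linarith : (1 + r) ≠ 0)
    field_simp
  have htc : starRingEnd ℂ (1 / (1 + r) : ℂ) = 1 / (1 + r) := by simp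
  rw [transvection]
  generalize (1 / (1 + r) : ℂ) = t at ht htc ⊢
  constructor
  · rw [form, mat3_conjTranspose, mat3_mul, mat3_mul, mat3_inj]
    simp only [map_sub, map_mul, map_neg, map_one, htc, conj_ofReal, conj_conj]
    generalize starRingEnd ℂ u = u' at *
    generalize starRingEnd ℂ v = v' at *
    generalize (r : ℂ) = r at *
    generalize (κ : ℂ) = κ at *
    refine ⟨?_, ?_, ?_, ?_, ?_, ?_, ?_, ?_, ?_⟩ <;> clear htc hκ hr <;> grind
  · rw [mat3_det]
    generalize starRingEnd ℂ u = u' at *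
    generalize starRingEnd ℂ v = v' at *
    generalize (r : ℂ) = r at *
    generalize (κ : ℂ) = κ at *
    clear htc hκ hr
    grind

/-- The real number `|g₃₃|` in terms of the point `g Y g⁻¹` of the orbit. -/
def radius (p : Matrix (Fin 2 ⊕ Fin 1) (Fin 2 ⊕ Fin 1) ℂ) : ℝ :=
  √((1 + 3 * I * p (.inr 0) (.inr 0)) / 3).re

/-- A section of `g ↦ g Y g⁻¹`. -/
def localSection (κ : ℝ) (p : Matrix (Fin 2 ⊕ Fin 1) (Fin 2 ⊕ Fin 1) ℂ) :
    Matrix (Fin 2 ⊕ Fin 1) (Fin 2 ⊕ Fin 1) ℂ :=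
  transvection κ (I * p (.inl 0) (.inr 0) / radius p) (I * p (.inl 1) (.inr 0) / radius p)
    (radius p)

theorem contDiffAt_localSection {p : Matrix (Fin 2 ⊕ Fin 1) (Fin 2 ⊕ Fin 1) ℂ}
    (hp : 0 < ((1 + 3 * I * p (.inr 0) (.inr 0)) / 3).re) :
    ContDiffAt ℝ ∞ (localSection κ) p := by
  have hr0 : 0 < radius p := Real.sqrt_pos.2 hp
  have hent : ∀ i j, ContDiffAt ℝ ∞
      (fun p : Matrix (Fin 2 ⊕ Fin 1) (Fin 2 ⊕ Fin 1) ℂ => p i j) p :=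
    fun i j => (contDiff_entry i j).contDiffAt
  have hr : ContDiffAt ℝ ∞ radius p := by
    refine ContDiffAt.sqrt ?_ hp.ne'
    have h1 : ContDiffAt ℝ ∞ (fun p => (1 + 3 * I * p (.inr 0) (.inr 0)) / 3) p :=
      (contDiffAt_const.add (contDiffAt_const.mul (hent _ _))).div_const _
    exact Complex.reCLM.contDiff.contDiffAt.comp p h1
  have hrc := hr.complex_ofReal
  have hne : ((radius p : ℝ) : ℂ) ≠ 0 := by exact_mod_cast hr0.ne'
  have hu : ContDiffAt ℝ ∞ (fun p : Matrix (Fin 2 ⊕ Fin 1) (Fin 2 ⊕ Fin 1) ℂ => I * p (.inl 0) (.inr 0) / radius p) p :=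
    (contDiffAt_const.mul (hent _ _)).complex_div hrc hne
  have hv : ContDiffAt ℝ ∞ (fun p : Matrix (Fin 2 ⊕ Fin 1) (Fin 2 ⊕ Fin 1) ℂ => I * p (.inl 1) (.inr 0) / radius p) p :=
    (contDiffAt_const.mul (hent _ _)).complex_div hrc hne
  have ht : ContDiffAt ℝ ∞ (fun p => (κ * (1 / (1 + radius p)) : ℂ)) p := by
    refine contDiffAt_const.mul (contDiffAt_const.complex_div (contDiffAt_const.add hrc) ?_)
    exact_mod_cast (by linarith : 1 + radius p ≠ 0)
  exact contDiffAt_mat3 (contDiffAt_const.sub (ht.mul (hu.mul hu.conj))) (ht.mul (hu.mul hv.conj)).neg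
    hu (ht.mul (hv.mul hu.conj)).neg (contDiffAt_const.sub (ht.mul (hv.mul hv.conj))) hv
    (contDiffAt_const.mul hu.conj).neg (contDiffAt_const.mul hv.conj).neg hrc

theorem localSection_spec (hκ : κ ^ 2 = 1) {p g : Matrix (Fin 2 ⊕ Fin 1) (Fin 2 ⊕ Fin 1) ℂ}
    (hp : 0 < ((1 + 3 * I * p (.inr 0) (.inr 0)) / 3).re) (hg : g ∈ specialFormGroup (form κ))
    (h : p = g * base * g⁻¹) : localSection κ p ∈ specialFormGroup (form κ) ∧
      localSection κ p * base * (localSection κ p)⁻¹ = p := by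
  have hκ' := ofReal_sq_eq_one hκ
  obtain ⟨a, b, c, d, e, f, g, l, i, rfl⟩ := exists_mat3 g
  have hK := (conjTranspose_form_mul hκ hg).2
  rw [form, mat3_conjTranspose, mat3_mul, mat3_mul, mat3_inj] at hK
  have hn := hK.2.2.2.2.2.2.2.2
  simp only [mul_zero, mul_one, add_zero, zero_add] at hn
  rw [orbit_eq hκ hg] at h
  have hr0 : 0 < radius p := Real.sqrt_pos.2 hp
  have hrad : ((radius p : ℝ) : ℂ) * radius p = i * starRingEnd ℂ i := by
    rw [← ofReal_mul, radius, Real.mul_self_sqrt hp.le, h]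
    change ((((1 + 3 * I * (I / 3 - I * (i * starRingEnd ℂ i))) / 3).re : ℝ) : ℂ) = _
    rw [mul_conj]
    have : (1 + 3 * I * (I / 3 - I * ((normSq i : ℝ) : ℂ))) / 3 = ((normSq i : ℝ) : ℂ) := by
      linear_combination (1 / 3 - ((normSq i : ℝ) : ℂ)) * I_mul_I
    rw [this, ofReal_re]
  have hne : ((radius p : ℝ) : ℂ) ≠ 0 := by exact_mod_cast hr0.ne'
  have hu : I * p (.inl 0) (.inr 0) / radius p = c * starRingEnd ℂ i / radius p := by
    rw [h]
    change I * -(I * (c * starRingEnd ℂ i)) / _ = _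
    rw [show I * -(I * (c * starRingEnd ℂ i)) = c * starRingEnd ℂ i by
      linear_combination (-(c * starRingEnd ℂ i)) * I_mul_I]
  have hv : I * p (.inl 1) (.inr 0) / radius p = f * starRingEnd ℂ i / radius p := by
    rw [h]
    change I * -(I * (f * starRingEnd ℂ i)) / _ = _
    rw [show I * -(I * (f * starRingEnd ℂ i)) = f * starRingEnd ℂ i by
      linear_combination (-(f * starRingEnd ℂ i)) * I_mul_I]
  have key : ∀ x y : ℂ, x * starRingEnd ℂ i / radius p * starRingEnd ℂ (y * starRingEnd ℂ i / radius p)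
      = x * starRingEnd ℂ y := by
    intro x y
    rw [map_div₀, map_mul, conj_conj, conj_ofReal]
    field_simp
    linear_combination (-x * starRingEnd ℂ y) * hrad
  have key2 : ∀ x : ℂ, x * starRingEnd ℂ i / radius p * radius p = x * starRingEnd ℂ i :=
    fun x => div_mul_cancel₀ _ hne
  have hmem : localSection κ p ∈ specialFormGroup (form κ) := by
    refine transvection_mem hκ hr0 ?_
    rw [hu, hv, key, key]
    linear_combination hn + κ * hrad
  refine ⟨hmem, ?_⟩
  conv_rhs => rw [h]
  rw [localSection, transvection] at hmem ⊢
  rw [orbit_eq hκ hmem, hu, hv, mat3_inj]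
  simp only [key, conj_ofReal, hrad, key2, true_and, and_true]
  have key3 : ∀ x : ℂ, (radius p : ℂ) * starRingEnd ℂ (x * starRingEnd ℂ i / radius p) = i * starRingEnd ℂ x := by
    intro x
    rw [map_div₀, map_mul, conj_conj, conj_ofReal, mul_div_cancel₀ _ hne, mul_comm]
  simp only [key3]
  trivial

end ProjectiveFamily

end

noncomputable section

theorem specialFormGroup_one {ι : Type} [Fintype ι] [DecidableEq ι] :
    specialFormGroup (1 : Matrix ι ι ℂ) = {g | g ∈ Matrix.specialUnitaryGroup ι ℂ} := by
  ext g
  rw [mem_ofPred_eq, Matrix.mem_specialUnitaryGroup_iff, Matrix.mem_unitaryGroup_iff,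
    specialFormGroup, mem_ofPred_eq, mul_one, Matrix.star_eq_conjTranspose]

namespace ProjectiveFamily

variable {κ : ℝ}

theorem tauTranspose_four (X : Matrix (Fin 2 ⊕ Fin 1) (Fin 2 ⊕ Fin 1) ℂ) :
    tauTranspose (tauTranspose (tauTranspose (tauTranspose X))) = X := by
  obtain ⟨a, b, c, d, e, f, g, h, i, rfl⟩ := exists_mat3 X
  simp only [tauTranspose_mat3, neg_neg]

theorem tauTranspose_lie (X Z : Matrix (Fin 2 ⊕ Fin 1) (Fin 2 ⊕ Fin 1) ℂ) :
    tauTranspose (X * Z - Z * X)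
      = tauTranspose X * tauTranspose Z - tauTranspose Z * tauTranspose X := by
  obtain ⟨a, b, c, d, e, f, g, h, i, rfl⟩ := exists_mat3 X
  obtain ⟨a', b', c', d', e', f', g', h', i', rfl⟩ := exists_mat3 Z
  simp only [tauTranspose_mat3, mat3_mul, mat3_sub]
  rw [mat3_inj]
  refine ⟨?_, ?_, ?_, ?_, ?_, ?_, ?_, ?_, ?_⟩ <;> ring

/-- The complex projective plane for `κ = 1`, and the complex hyperbolic plane for `κ = -1`. -/
def hermitianModel (hκ : κ ^ 2 = 1) : HermitianModel (Matrix (Fin 2 ⊕ Fin 1) (Fin 2 ⊕ Fin 1) ℂ) where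
  G := specialFormGroup (form κ)
  𝔤 := specialFormLie (form κ)
  τ := LinearMap.toContinuousLinearMap tauTranspose
  Y := base
  ε := frame κ
  metric V W := traceForm (-(κ / 2)) V W
  inv g := g⁻¹
  B := traceForm (-(κ / 2))
  metric_eq _ _ := rfl
  inv_eq g := Matrix.nonsing_inv_eq_ringInverse g
  one_mem := (isMatrixGroup_specialFormGroup _).one_mem
  mul_mem := (isMatrixGroup_specialFormGroup _).mul_mem
  inv_mem := (isMatrixGroup_specialFormGroup _).inv_mem
  isUnit := (isMatrixGroup_specialFormGroup _).isUnit
  lie_mem := (isMatrixGroup_specialFormGroup _).lie_mem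
  mem_of_isParallelAt := (isMatrixGroup_specialFormGroup _).mem_of_isParallelAt
  mem_of_hasDerivAt := (isMatrixGroup_specialFormGroup _).mem_of_hasDerivAt
  τ_four := tauTranspose_four
  τ_lie := tauTranspose_lie
  τ_mem {X} hX := by
    obtain ⟨x, y, b, u, v, rfl⟩ := exists_lieElt hκ hX
    exact (tau_lieElt hκ x y b u v).symm ▸ lieElt_mem _ _ _ _ _
  Y_mem := base_eq (κ := κ) ▸ lieElt_mem _ _ _ _ _
  τ_Y := by
    change tauTranspose base = -base
    rw [base_eq (κ := κ), tau_lieElt hκ, neg_lieElt]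
    simp
  exists_section := by
    refine ⟨localSection κ, ?_⟩
    have hent : ContinuousAt (fun p : Matrix (Fin 2 ⊕ Fin 1) (Fin 2 ⊕ Fin 1) ℂ =>
        p (.inr 0) (.inr 0)) base := (entryL (ι := Fin 2 ⊕ Fin 1) (.inr 0) (.inr 0)).continuous.continuousAt
    have hcont : ContinuousAt (fun p : Matrix (Fin 2 ⊕ Fin 1) (Fin 2 ⊕ Fin 1) ℂ =>
        ((1 + 3 * I * p (.inr 0) (.inr 0)) / 3).re) base :=
      Complex.continuous_re.continuousAt.comp ((continuousAt_const.add (continuousAt_const.mul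
        hent)).div_const _)
    have hpos : 0 < ((1 + 3 * I * base (.inr 0) (.inr 0)) / 3).re := by
      change 0 < ((1 + 3 * I * (-(2 * I / 3))) / 3).re
      rw [show (1 + 3 * I * (-(2 * I / 3))) / 3 = 1 by linear_combination (-2 / 3) * I_mul_I]
      simp
    filter_upwards [hcont.eventually (lt_mem_nhds hpos)] with p hp
    exact ⟨contDiffAt_localSection hp, fun ⟨g, hg, h⟩ => localSection_spec hκ hp hg h⟩
  lie_Y {X} hX h := by
    obtain ⟨x, y, b, u, v, rfl⟩ := exists_lieElt hκ hX
    have h1 := (tau_lieElt hκ x y b u v).symm.trans h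
    have h2 := (tau_lieElt hκ _ _ _ _ _).symm.trans ((congrArg tauTranspose h1).trans h)
    have hκ' := ofReal_sq_eq_one hκ
    obtain ⟨-, -, -, hu, hv⟩ := lieElt_inj h2
    simp only [map_neg, map_mul, conj_conj, conj_ofReal] at hu hv
    have hu0 : u = 0 := by linear_combination -hu / 2 - u / 2 * hκ'
    have hv0 : v = 0 := by linear_combination -hv / 2 - v / 2 * hκ'
    refine (base_lie x y b u v).trans ?_
    rw [hu0, hv0, mul_zero, zero_eq_lieElt]
  eq_smul_Y {X} hX h := by
    obtain ⟨x, y, b, u, v, rfl⟩ := exists_lieElt hκ hX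
    have h1 := (tau_lieElt hκ x y b u v).symm.trans (h.trans (neg_lieElt x y b u v))
    have hκ' := ofReal_sq_eq_one hκ
    obtain ⟨hx, -, hb, hu, hv⟩ := lieElt_inj h1
    have hx' : y = x := by linarith
    have hb0 : b = 0 := by linear_combination hb / 2
    have hv' := congrArg (starRingEnd ℂ) hv
    simp only [map_neg, map_mul, conj_conj, conj_ofReal] at hv'
    have hu0 : u = 0 := by
      linear_combination (hu - κ * hv') / 2 - u / 2 * hκ'
    have hv0 : v = 0 := by
      rw [hu0] at hv; simpa using hv
    refine ⟨3 * x, ?_⟩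
    rw [base_eq (κ := κ), smul_lieElt, hx', hb0, hu0, hv0]
    congr 1
    · ring
    · ring
    · simp
    · simp
    · simp
  eq_frame {X} hX h := by
    obtain ⟨u, v, rfl⟩ := exists_of_tau_tau hκ hX h
    have hκ' := ofReal_sq_eq_one hκ
    refine ⟨![u, κ * v], ?_⟩
    refine Eq.trans ?_ (sum_frame hκ _).symm
    congr 1
    change v = κ * (κ * v)
    linear_combination (-v) * hκ'
  ε_mem i := by
    fin_cases i
    · exact frame_zero (κ := κ) ▸ lieElt_mem _ _ _ _ _
    · exact frame_one hκ ▸ lieElt_mem _ _ _ _ _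
  τ_ε_zero := by
    change tauTranspose (frame κ 0) = -frame κ 1
    rw [frame_zero, frame_one hκ, tau_lieElt hκ, neg_lieElt]
    simp
  τ_ε_one := by
    change tauTranspose (frame κ 1) = frame κ 0
    rw [frame_zero, frame_one hκ, tau_lieElt hκ]
    simp [conj_ofReal, ofReal_sq_eq_one hκ]
  lie_lie_ε i := by
    have key : ∀ u v : ℂ, base * (base * lieElt κ 0 0 0 u v - lieElt κ 0 0 0 u v * base)
        - (base * lieElt κ 0 0 0 u v - lieElt κ 0 0 0 u v * base) * base = -lieElt κ 0 0 0 u v := by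
      intro u v
      rw [base_lie, base_lie, neg_lieElt]
      congr 1
      · simp
      · simp
      · simp
      · linear_combination u * I_mul_I
      · linear_combination v * I_mul_I
    fin_cases i
    · exact frame_zero (κ := κ) ▸ key _ _
    · exact frame_one hκ ▸ key _ _
  metric_symm V W := by rw [traceForm_apply, traceForm_apply, Matrix.trace_mul_comm]
  metric_frame c d := by
    have h1 := sum_frame hκ c
    have h2 := sum_frame hκ d
    refine (congrArg₂ (fun V W => traceForm (-(κ / 2)) V W) h1 h2).trans ?_
    rw [traceForm_lieElt hκ, Fin.sum_univ_two]
    simp only [re_ofReal_mul, im_ofReal_mul]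
    linear_combination ((c 1).re * (d 1).re + (c 1).im * (d 1).im) * hκ
  metric_act {g v w} hg _ _ _ _ := by
    rw [traceForm_apply, traceForm_apply, trace_conj (isUnit_of_mem_specialFormGroup hg)]
  metric_act_lie {g u v w} hg hu hu' hv hv' hw hw' := by
    obtain ⟨_, _, rfl⟩ := exists_of_tau_tau hκ hu hu'
    obtain ⟨_, _, rfl⟩ := exists_of_tau_tau hκ hv hv'
    obtain ⟨_, _, rfl⟩ := exists_of_tau_tau hκ hw hw'
    rw [traceForm_apply, trace_conj (isUnit_of_mem_specialFormGroup hg), traceForm_lie]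
    simp

theorem fromBlocks_eq_base : (I / 3) • Matrix.fromBlocks 1 0 0 (-2) = base := by
  ext i j
  rcases i with i | i <;> rcases j with j | j <;> fin_cases i <;> fin_cases j <;>
    simp [base, mat3, Matrix.ofNat_apply]
  ring

theorem form_one : form 1 = 1 := by rw [form, one_eq_mat3, ofReal_one]

theorem form_neg_one : form (-1) = Matrix.fromBlocks 1 0 0 (-1) := by
  ext i j
  rcases i with i | i <;> rcases j with j | j <;> fin_cases i <;> fin_cases j <;> simp [form, mat3]

theorem isModelledOn_projective :
    projectiveModel.IsModelledOn (hermitianModel (κ := 1) (by norm_num)) where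
  G_eq := by
    change specialFormGroup (form 1) = _
    rw [form_one, specialFormGroup_one]
    rfl
  τ_eq _ := rfl
  Y_eq := fromBlocks_eq_base.symm
  ε_eq := by
    change frame 1 = ![Matrix.fromBlocks 0 !![1; 0] !![-1, 0] 0,
      Matrix.fromBlocks 0 !![0; 1] !![0, -1] 0]
    funext k
    fin_cases k <;> ext i j <;> rcases i with i | i <;> rcases j with j | j <;> fin_cases i <;>
      fin_cases j <;> simp [frame, mat3]
  metric_eq := by
    funext V W
    rfl
  inv_eq := rfl

theorem isModelledOn_hyperbolic :
    hyperbolicModel.IsModelledOn (hermitianModel (κ := -1) (by norm_num)) where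
  G_eq := by
    change specialFormGroup (form (-1)) = _
    rw [form_neg_one]
    rfl
  τ_eq _ := rfl
  Y_eq := fromBlocks_eq_base.symm
  ε_eq := by
    change frame (-1) = ![Matrix.fromBlocks 0 !![1; 0] !![1, 0] 0,
      Matrix.fromBlocks 0 !![0; -1] !![0, -1] 0]
    funext k
    fin_cases k <;> ext i j <;> rcases i with i | i <;> rcases j with j | j <;> fin_cases i <;>
      fin_cases j <;> simp [frame, mat3]
  metric_eq := by
    funext V W
    change -(-1 / 2) * (Matrix.trace (V * W)).re = (1 / 2) * (Matrix.trace (V * W)).re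
    norm_num
  inv_eq := rfl

end ProjectiveFamily

end

noncomputable section

section Products

theorem IsParallelAt.map {E R R' : Type*} [NormedAddCommGroup E] [NormedSpace ℝ E] [NormedRing R]
    [NormedAlgebra ℝ R] [NormedRing R'] [NormedAlgebra ℝ R'] {A : E → E →L[ℝ] R} {F : E → R} {z : E}
    (h : IsParallelAt A F z) (T : R →L[ℝ] R') {A' : E → E →L[ℝ] R'}
    (hT : ∀ v, T (F z * A z v) = T (F z) * A' z v) : IsParallelAt A' (fun z => T (F z)) z := by
  refine (T.hasFDerivAt.comp z h).congr_fderiv ?_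
  ext v
  exact hT v

theorem hasDerivAt_map {R R' : Type*} [NormedAddCommGroup R] [NormedSpace ℝ R]
    [NormedAddCommGroup R'] [NormedSpace ℝ R'] {γ : ℝ → R} {a : R} (h : HasDerivAt γ a 0)
    (T : R →L[ℝ] R') : HasDerivAt (fun t => T (γ t)) (T a) 0 :=
  T.hasFDerivAt.comp_hasDerivAt 0 h

variable {ι : Type} [Fintype ι] [DecidableEq ι]

/-- The blocks of a matrix, as bounded maps. -/
def blockL (i j : Bool) : Matrix (ι ⊕ ι) (ι ⊕ ι) ℂ →L[ℝ] Matrix ι ι ℂ :=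
  LinearMap.toContinuousLinearMap
    { toFun := fun X => X.submatrix (bif i then .inr else .inl) (bif j then .inr else .inl)
      map_add' := fun _ _ => rfl
      map_smul' := fun _ _ => rfl }

omit [DecidableEq ι] in
theorem blockL_fromBlocks (A B C D : Matrix ι ι ℂ) (i j : Bool) :
    blockL i j (Matrix.fromBlocks A B C D) = bif i then bif j then D else C else bif j then B else A := by
  ext k l
  cases i <;> cases j <;> rfl

omit [DecidableEq ι] in
theorem fromBlocks_blockL (X : Matrix (ι ⊕ ι) (ι ⊕ ι) ℂ) :
    X = Matrix.fromBlocks (blockL false false X) (blockL false true X) (blockL true false X)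
      (blockL true true X) := by
  ext k l
  rcases k with k | k <;> rcases l with l | l <;> rfl

theorem blockL_mul (X : Matrix (ι ⊕ ι) (ι ⊕ ι) ℂ) (a d : Matrix ι ι ℂ) (i j : Bool) :
    blockL i j (X * Matrix.fromBlocks a 0 0 d) = blockL i j X * bif j then d else a := by
  conv_lhs => rw [fromBlocks_blockL X, Matrix.fromBlocks_multiply, blockL_fromBlocks]
  cases i <;> cases j <;> simp

/-- The group of block diagonal matrices with blocks in `G`. -/
def prodGroup (G : Set (Matrix ι ι ℂ)) : Set (Matrix (ι ⊕ ι) (ι ⊕ ι) ℂ) :=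
  {g | ∃ A ∈ G, ∃ D ∈ G, g = Matrix.fromBlocks A 0 0 D}

/-- The Lie algebra of `prodGroup`. -/
def prodLie (𝔤 : Submodule ℝ (Matrix ι ι ℂ)) : Submodule ℝ (Matrix (ι ⊕ ι) (ι ⊕ ι) ℂ) where
  carrier := {X | ∃ a ∈ 𝔤, ∃ d ∈ 𝔤, X = Matrix.fromBlocks a 0 0 d}
  add_mem' := by
    rintro _ _ ⟨a, ha, d, hd, rfl⟩ ⟨a', ha', d', hd', rfl⟩
    exact ⟨_, 𝔤.add_mem ha ha', _, 𝔤.add_mem hd hd', by simp [Matrix.fromBlocks_add]⟩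
  zero_mem' := ⟨0, 𝔤.zero_mem, 0, 𝔤.zero_mem, Matrix.fromBlocks_zero.symm⟩
  smul_mem' := by
    rintro r _ ⟨a, ha, d, hd, rfl⟩
    exact ⟨_, 𝔤.smul_mem r ha, _, 𝔤.smul_mem r hd, by simp [Matrix.fromBlocks_smul]⟩

theorem fromBlocks_diag_inv {A D : Matrix ι ι ℂ} (hA : IsUnit A) (hD : IsUnit D) :
    (Matrix.fromBlocks A 0 0 D)⁻¹ = Matrix.fromBlocks A⁻¹ 0 0 D⁻¹ := by
  refine Matrix.inv_eq_right_inv ?_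
  rw [Matrix.fromBlocks_multiply, Matrix.mul_nonsing_inv _ ((Matrix.isUnit_iff_isUnit_det _).1 hA),
    Matrix.mul_nonsing_inv _ ((Matrix.isUnit_iff_isUnit_det _).1 hD)]
  simp

omit [Fintype ι] [DecidableEq ι] in
theorem fromBlocks_diag_sub (A D A' D' : Matrix ι ι ℂ) :
    Matrix.fromBlocks A 0 0 D - Matrix.fromBlocks A' 0 0 D'
      = Matrix.fromBlocks (A - A') 0 0 (D - D') := by
  rw [sub_eq_add_neg, Matrix.fromBlocks_neg, Matrix.fromBlocks_add]
  simp [sub_eq_add_neg]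

theorem IsMatrixGroup.prod {G : Set (Matrix ι ι ℂ)} {𝔤 : Submodule ℝ (Matrix ι ι ℂ)}
    (h : IsMatrixGroup G 𝔤) : IsMatrixGroup (prodGroup G) (prodLie 𝔤) where
  one_mem := ⟨1, h.one_mem, 1, h.one_mem, Matrix.fromBlocks_one.symm⟩
  mul_mem := by
    rintro _ _ ⟨A, hA, D, hD, rfl⟩ ⟨A', hA', D', hD', rfl⟩
    exact ⟨_, h.mul_mem hA hA', _, h.mul_mem hD hD', by simp [Matrix.fromBlocks_multiply]⟩
  inv_mem := by
    rintro _ ⟨A, hA, D, hD, rfl⟩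
    exact ⟨_, h.inv_mem hA, _, h.inv_mem hD, fromBlocks_diag_inv (h.isUnit hA) (h.isUnit hD)⟩
  isUnit := by
    rintro _ ⟨A, hA, D, hD, rfl⟩
    rw [Matrix.isUnit_iff_isUnit_det, Matrix.det_fromBlocks_zero₂₁]
    exact ((Matrix.isUnit_iff_isUnit_det _).1 (h.isUnit hA)).mul
      ((Matrix.isUnit_iff_isUnit_det _).1 (h.isUnit hD))
  lie_mem := by
    rintro _ _ ⟨A, hA, D, hD, rfl⟩ ⟨A', hA', D', hD', rfl⟩
    exact ⟨_, h.lie_mem hA hA', _, h.lie_mem hD hD',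
      by simp [Matrix.fromBlocks_multiply, fromBlocks_diag_sub]⟩
  mem_of_isParallelAt {E _ _ A F U} hU hc hF hA z₀ hz₀ h0 z hz := by
    have hAb : ∀ z ∈ U, ∀ v, A z v = Matrix.fromBlocks (blockL false false (A z v)) 0 0
        (blockL true true (A z v)) := by
      intro z hz v
      obtain ⟨a, -, d, -, had⟩ := hA z hz v
      rw [had, blockL_fromBlocks, blockL_fromBlocks]
      rfl
    have hmem : ∀ j, ∀ z ∈ U, ∀ v, blockL j j (A z v) ∈ 𝔤 := by
      intro j z hz v
      obtain ⟨a, ha, d, hd, had⟩ := hA z hz v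
      rw [had, blockL_fromBlocks]
      cases j
      · exact ha
      · exact hd
    have hpar : ∀ i j, ∀ z ∈ U, IsParallelAt (fun z => (blockL j j).comp (A z))
        (fun z => blockL i j (F z)) z := by
      intro i j z hz
      refine (hF z hz).map (blockL i j) fun v => ?_
      exact (congrArg (fun Y => blockL i j (F z * Y)) (hAb z hz v)).trans
        ((blockL_mul _ _ _ i j).trans (by cases j <;> rfl))
    obtain ⟨a₀, ha₀, d₀, hd₀, h0⟩ := h0
    have hdiag : ∀ j, ∀ z ∈ U, blockL j j (F z) ∈ G := by
      intro j
      refine h.mem_of_isParallelAt hU hc (hpar j j) (hmem j) hz₀ ?_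
      rw [h0, blockL_fromBlocks]
      cases j
      · exact ha₀
      · exact hd₀
    have hoff : ∀ i j, blockL i j (F z₀) = 0 → ∀ z ∈ U, blockL i j (F z) = 0 := by
      intro i j hij z hz
      have hu := fun z hz => h.isUnit (hdiag j z hz)
      have h1 := IsParallelAt.mul_inverse_eqOn hU hc (hpar i j) (hpar j j) hu hz hz₀
      rw [hij, zero_mul] at h1
      calc blockL i j (F z) = blockL i j (F z) * Ring.inverse (blockL j j (F z)) * blockL j j (F z) := by
            rw [mul_assoc, Ring.inverse_mul_cancel _ (hu z hz), mul_one]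
        _ = 0 := by rw [h1, zero_mul]
    refine ⟨_, hdiag false z hz, _, hdiag true z hz, ?_⟩
    conv_lhs => rw [fromBlocks_blockL (F z)]
    rw [hoff false true (by rw [h0, blockL_fromBlocks]; rfl) z hz,
      hoff true false (by rw [h0, blockL_fromBlocks]; rfl) z hz]
  mem_of_hasDerivAt {γ X} hγ hG := by
    obtain ⟨a₀, ha₀, d₀, hd₀, h0⟩ := hG.self_of_nhds
    have hd : ∀ i j, HasDerivAt (fun t => blockL i j (γ t))
        (blockL i i (γ 0) * blockL i j X) 0 := by
      intro i j
      have h1 := hasDerivAt_map hγ (blockL i j)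
      have h2 : blockL i j (γ 0 * X) = blockL i i (γ 0) * blockL i j X := by
        conv_lhs => rw [h0, fromBlocks_blockL X, Matrix.fromBlocks_multiply, blockL_fromBlocks]
        rw [h0, blockL_fromBlocks]
        cases i <;> cases j <;> simp
      exact h1.congr_deriv h2
    have hev : ∀ j, ∀ᶠ t in 𝓝 0, blockL j j (γ t) ∈ G := by
      intro j
      filter_upwards [hG] with t ht
      obtain ⟨a, ha, d, hd, had⟩ := ht
      rw [had, blockL_fromBlocks]
      cases j
      · exact ha
      · exact hd
    have hdiag : ∀ j, blockL j j X ∈ 𝔤 := fun j => h.mem_of_hasDerivAt (hd j j) (hev j)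
    have hoff : ∀ i j, i ≠ j → blockL i j X = 0 := by
      intro i j hij
      have h0 : (fun t => blockL i j (γ t)) =ᶠ[𝓝 0] fun _ => 0 := by
        filter_upwards [hG] with t ht
        obtain ⟨a, ha, d, hd, had⟩ := ht
        rw [had, blockL_fromBlocks]
        cases i <;> cases j <;> first | rfl | exact absurd rfl hij
      have h1 := ((hasDerivAt_const (0 : ℝ) (0 : Matrix ι ι ℂ)).congr_of_eventuallyEq h0).unique
        (hd i j)
      exact ((h.isUnit (hev i).self_of_nhds).mul_right_eq_zero).1 h1.symm
    refine ⟨_, hdiag false, _, hdiag true, ?_⟩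
    conv_lhs => rw [fromBlocks_blockL X]
    rw [hoff false true (by decide), hoff true false (by decide)]

end Products

end

noncomputable section

section Mat2

/-- A matrix of size two. -/
def mat2 (a b c d : ℂ) : Matrix (Fin 2) (Fin 2) ℂ := !![a, b; c, d]

theorem exists_mat2 (X : Matrix (Fin 2) (Fin 2) ℂ) : ∃ a b c d, X = mat2 a b c d :=
  ⟨_, _, _, _, Matrix.eta_fin_two X⟩

theorem mat2_inj {a b c d a' b' c' d' : ℂ} :
    mat2 a b c d = mat2 a' b' c' d' ↔ a = a' ∧ b = b' ∧ c = c' ∧ d = d' := by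
  constructor
  · intro H
    have key := fun i j => congrFun (congrFun H i) j
    exact ⟨key 0 0, key 0 1, key 1 0, key 1 1⟩
  · rintro ⟨rfl, rfl, rfl, rfl⟩; rfl

theorem mat2_mul (a b c d a' b' c' d' : ℂ) : mat2 a b c d * mat2 a' b' c' d' =
    mat2 (a * a' + b * c') (a * b' + b * d') (c * a' + d * c') (c * b' + d * d') := by
  ext i j
  fin_cases i <;> fin_cases j <;> simp [mat2, Matrix.mul_apply, Fin.sum_univ_two]

theorem mat2_add (a b c d a' b' c' d' : ℂ) : mat2 a b c d + mat2 a' b' c' d' =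
    mat2 (a + a') (b + b') (c + c') (d + d') := by
  ext i j
  fin_cases i <;> fin_cases j <;> simp [mat2]

theorem mat2_sub (a b c d a' b' c' d' : ℂ) : mat2 a b c d - mat2 a' b' c' d' =
    mat2 (a - a') (b - b') (c - c') (d - d') := by
  ext i j
  fin_cases i <;> fin_cases j <;> simp [mat2]

theorem mat2_neg (a b c d : ℂ) : -mat2 a b c d = mat2 (-a) (-b) (-c) (-d) := by
  ext i j
  fin_cases i <;> fin_cases j <;> simp [mat2]

theorem mat2_smul (r : ℝ) (a b c d : ℂ) : r • mat2 a b c d =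
    mat2 (r * a) (r * b) (r * c) (r * d) := by
  ext i j
  change (r • (_ : ℂ)) = _
  fin_cases i <;> fin_cases j <;> simp [mat2]

theorem mat2_csmul (r a b c d : ℂ) : r • mat2 a b c d =
    mat2 (r * a) (r * b) (r * c) (r * d) := by
  ext i j
  fin_cases i <;> fin_cases j <;> simp [mat2]

theorem mat2_conjTranspose (a b c d : ℂ) : (mat2 a b c d)ᴴ =
    mat2 (starRingEnd ℂ a) (starRingEnd ℂ c) (starRingEnd ℂ b) (starRingEnd ℂ d) := by
  ext i j
  fin_cases i <;> fin_cases j <;> simp [mat2]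

theorem mat2_transpose (a b c d : ℂ) : (mat2 a b c d)ᵀ = mat2 a c b d := by
  ext i j
  fin_cases i <;> fin_cases j <;> simp [mat2]

theorem mat2_trace (a b c d : ℂ) : (mat2 a b c d).trace = a + d := by
  simp [mat2, Matrix.trace]

theorem mat2_det (a b c d : ℂ) : (mat2 a b c d).det = a * d - b * c := Matrix.det_fin_two_of a b c d

theorem one_eq_mat2 : (1 : Matrix (Fin 2) (Fin 2) ℂ) = mat2 1 0 0 1 := Matrix.one_fin_two

theorem zero_eq_mat2 : (0 : Matrix (Fin 2) (Fin 2) ℂ) = mat2 0 0 0 0 := by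
  ext i j
  fin_cases i <;> fin_cases j <;> simp [mat2]

theorem contDiffAt_mat2 {E : Type} [NormedAddCommGroup E] [NormedSpace ℝ E]
    {a b c d : E → ℂ} {z : E} (ha : ContDiffAt ℝ ∞ a z) (hb : ContDiffAt ℝ ∞ b z)
    (hc : ContDiffAt ℝ ∞ c z) (hd : ContDiffAt ℝ ∞ d z) :
    ContDiffAt ℝ ∞ (fun p => mat2 (a p) (b p) (c p) (d p)) z := by
  refine contDiffAt_matrix fun j k => ?_
  fin_cases j <;> fin_cases k <;> assumption

end Mat2

theorem trace_fromBlocks_diag {ι : Type} [Fintype ι] (A D : Matrix ι ι ℂ) :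
    (Matrix.fromBlocks A 0 0 D).trace = A.trace + D.trace := by
  simp [Matrix.trace]

namespace ProductFamily

/-- The Hermitian form of signature `(2, 0)` or `(1, 1)`. -/
def form (κ : ℝ) : Matrix (Fin 2) (Fin 2) ℂ := mat2 1 0 0 κ

/-- The base point of a factor. -/
def base₁ : Matrix (Fin 2) (Fin 2) ℂ := mat2 (-(I / 2)) 0 0 (I / 2)

/-- The general element of the Lie algebra of a factor. -/
def lieElt₁ (κ x : ℝ) (w : ℂ) : Matrix (Fin 2) (Fin 2) ℂ :=
  mat2 (x * I) w (-(κ * starRingEnd ℂ w)) (-(x * I))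

variable {κ : ℝ}

theorem lieElt₁_mem (x : ℝ) (w : ℂ) : lieElt₁ κ x w ∈ specialFormLie (form κ) := by
  rw [mem_specialFormLie, lieElt₁, form, mat2_trace, mat2_conjTranspose, mat2_mul, mat2_mul,
    mat2_add, zero_eq_mat2, mat2_inj]
  refine ⟨⟨?_, ?_, ?_, ?_⟩, ?_⟩ <;> (try simp) <;> try ring

theorem exists_lieElt₁ {X : Matrix (Fin 2) (Fin 2) ℂ}
    (hX : X ∈ specialFormLie (form κ)) : ∃ x w, X = lieElt₁ κ x w := by
  obtain ⟨a, b, c, d, rfl⟩ := exists_mat2 X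
  rw [mem_specialFormLie, form, mat2_trace, mat2_conjTranspose, mat2_mul, mat2_mul,
    mat2_add, zero_eq_mat2, mat2_inj] at hX
  obtain ⟨⟨h1, -, h3, -⟩, h5⟩ := hX
  simp only [mul_one, mul_zero, add_zero, one_mul, zero_mul, zero_add] at h1 h3
  have ha : a = a.im * I := by
    have := congrArg re h1
    simp at this
    apply Complex.ext
    · simp; linarith
    · simp
  refine ⟨a.im, b, ?_⟩
  rw [lieElt₁, mat2_inj]
  exact ⟨ha, rfl, by linear_combination h3, by linear_combination h5 - ha⟩

theorem lieElt₁_inj {x x' : ℝ} {w w' : ℂ} (h : lieElt₁ κ x w = lieElt₁ κ x' w') :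
    x = x' ∧ w = w' := by
  rw [lieElt₁, lieElt₁, mat2_inj] at h
  exact ⟨by simpa using h.1, h.2.1⟩

theorem smul_lieElt₁ (r x : ℝ) (w : ℂ) : r • lieElt₁ κ x w = lieElt₁ κ (r * x) (r * w) := by
  rw [lieElt₁, mat2_smul, lieElt₁, mat2_inj]
  refine ⟨?_, ?_, ?_, ?_⟩ <;> simp <;> ring

theorem add_lieElt₁ (x x' : ℝ) (w w' : ℂ) :
    lieElt₁ κ x w + lieElt₁ κ x' w' = lieElt₁ κ (x + x') (w + w') := by
  rw [lieElt₁, lieElt₁, mat2_add, lieElt₁, mat2_inj]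
  refine ⟨?_, ?_, ?_, ?_⟩ <;> simp <;> ring

theorem neg_lieElt₁ (x : ℝ) (w : ℂ) : -lieElt₁ κ x w = lieElt₁ κ (-x) (-w) := by
  rw [lieElt₁, mat2_neg, lieElt₁, mat2_inj]
  refine ⟨?_, ?_, ?_, ?_⟩ <;> simp

theorem base₁_lie (x : ℝ) (w : ℂ) : base₁ * lieElt₁ κ x w - lieElt₁ κ x w * base₁
    = lieElt₁ κ 0 (-(I * w)) := by
  rw [base₁, lieElt₁, mat2_mul, mat2_mul, mat2_sub, lieElt₁, mat2_inj]
  refine ⟨?_, ?_, ?_, ?_⟩ <;> simp <;> ring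

/-- The general element of the Lie algebra. -/
def lieElt (κ x : ℝ) (w : ℂ) (x' : ℝ) (w' : ℂ) : Matrix (Fin 2 ⊕ Fin 2) (Fin 2 ⊕ Fin 2) ℂ :=
  Matrix.fromBlocks (lieElt₁ κ x w) 0 0 (lieElt₁ κ x' w')

/-- The base point. -/
def base : Matrix (Fin 2 ⊕ Fin 2) (Fin 2 ⊕ Fin 2) ℂ := Matrix.fromBlocks base₁ 0 0 base₁

/-- The reference frame. -/
def frame (κ : ℝ) : Fin 2 → Matrix (Fin 2 ⊕ Fin 2) (Fin 2 ⊕ Fin 2) ℂ :=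
  ![Matrix.fromBlocks (mat2 0 1 (-κ) 0) 0 0 0, Matrix.fromBlocks 0 0 0 (mat2 0 κ (-1) 0)]

theorem ofReal_sq_eq_one (hκ : κ ^ 2 = 1) : (κ : ℂ) * κ = 1 := by
  rw [← ofReal_mul, ← sq, hκ, ofReal_one]

theorem lieElt_mem (x : ℝ) (w : ℂ) (x' : ℝ) (w' : ℂ) :
    lieElt κ x w x' w' ∈ prodLie (specialFormLie (form κ)) :=
  ⟨_, lieElt₁_mem x w, _, lieElt₁_mem x' w', rfl⟩

theorem exists_lieElt {X : Matrix (Fin 2 ⊕ Fin 2) (Fin 2 ⊕ Fin 2) ℂ}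
    (hX : X ∈ prodLie (specialFormLie (form κ))) : ∃ x w x' w', X = lieElt κ x w x' w' := by
  obtain ⟨a, ha, d, hd, rfl⟩ := hX
  obtain ⟨x, w, rfl⟩ := exists_lieElt₁ ha
  obtain ⟨x', w', rfl⟩ := exists_lieElt₁ hd
  exact ⟨x, w, x', w', rfl⟩

theorem lieElt_inj {x x' y y' : ℝ} {w w' v v' : ℂ} (h : lieElt κ x w x' w' = lieElt κ y v y' v') :
    x = y ∧ w = v ∧ x' = y' ∧ w' = v' := by
  obtain ⟨h1, -, -, h2⟩ := Matrix.fromBlocks_inj.1 h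
  exact ⟨(lieElt₁_inj h1).1, (lieElt₁_inj h1).2, (lieElt₁_inj h2).1, (lieElt₁_inj h2).2⟩

theorem tauSwap_fromBlocks (A D : Matrix (Fin 2) (Fin 2) ℂ) :
    tauSwap (Matrix.fromBlocks A 0 0 D) = Matrix.fromBlocks
      (mat2 0 (-1) 1 0 * D * (mat2 0 (-1) 1 0)ᵀ) 0 0 (mat2 0 1 1 0 * A * (mat2 0 1 1 0)ᵀ) := by
  change blockSwap * Matrix.fromBlocks A 0 0 D * blockSwapᵀ = _
  rw [blockSwap, Matrix.fromBlocks_transpose, Matrix.fromBlocks_multiply,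
    Matrix.fromBlocks_multiply]
  simp [mat2]

theorem tau_lieElt (hκ : κ ^ 2 = 1) (x : ℝ) (w : ℂ) (x' : ℝ) (w' : ℂ) :
    tauSwap (lieElt κ x w x' w')
      = lieElt κ (-x') (κ * starRingEnd ℂ w') (-x) (-(κ * starRingEnd ℂ w)) := by
  have hκ' := ofReal_sq_eq_one hκ
  rw [lieElt, tauSwap_fromBlocks, lieElt]
  simp only [lieElt₁, mat2_transpose, mat2_mul]
  congr 1 <;> rw [mat2_inj]
  · refine ⟨?_, ?_, ?_, ?_⟩ <;> simp
    linear_combination -w' * hκ'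
  · refine ⟨?_, ?_, ?_, ?_⟩ <;> simp
    linear_combination -w * hκ'

theorem smul_lieElt (r x : ℝ) (w : ℂ) (x' : ℝ) (w' : ℂ) : r • lieElt κ x w x' w'
    = lieElt κ (r * x) (r * w) (r * x') (r * w') := by
  rw [lieElt, lieElt, ← smul_lieElt₁, ← smul_lieElt₁]
  ext i j
  rcases i with i | i <;> rcases j with j | j <;> simp [Matrix.fromBlocks]

theorem add_lieElt (x : ℝ) (w : ℂ) (x' : ℝ) (w' : ℂ) (y : ℝ) (v : ℂ) (y' : ℝ) (v' : ℂ) :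
    lieElt κ x w x' w' + lieElt κ y v y' v' = lieElt κ (x + y) (w + v) (x' + y') (w' + v') := by
  rw [lieElt, lieElt, Matrix.fromBlocks_add, add_lieElt₁, add_lieElt₁, add_zero, lieElt]

theorem neg_lieElt (x : ℝ) (w : ℂ) (x' : ℝ) (w' : ℂ) :
    -lieElt κ x w x' w' = lieElt κ (-x) (-w) (-x') (-w') := by
  rw [lieElt, Matrix.fromBlocks_neg, neg_lieElt₁, neg_lieElt₁, neg_zero, lieElt]

theorem base_eq : base = lieElt κ (-1 / 2) 0 (-1 / 2) 0 := by
  have : base₁ = lieElt₁ κ (-1 / 2) 0 := by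
    rw [base₁, lieElt₁, mat2_inj]
    refine ⟨?_, ?_, ?_, ?_⟩ <;> simp <;> ring
  rw [base, this, lieElt]

theorem base_lie (x : ℝ) (w : ℂ) (x' : ℝ) (w' : ℂ) :
    base * lieElt κ x w x' w' - lieElt κ x w x' w' * base
      = lieElt κ 0 (-(I * w)) 0 (-(I * w')) := by
  rw [base, lieElt, Matrix.fromBlocks_multiply, Matrix.fromBlocks_multiply]
  simp only [mul_zero, zero_mul, add_zero, zero_add]
  rw [fromBlocks_diag_sub, base₁_lie, base₁_lie, lieElt]

theorem lieElt₁_zero : lieElt₁ κ 0 0 = 0 := by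
  rw [lieElt₁, zero_eq_mat2, mat2_inj]; simp

theorem lieElt_zero : lieElt κ 0 0 0 0 = 0 := by
  rw [lieElt, lieElt₁_zero, Matrix.fromBlocks_zero]

theorem frame_zero : frame κ 0 = lieElt κ 0 1 0 0 := by
  rw [lieElt, lieElt₁_zero, lieElt₁]; simp [frame]

theorem frame_one (hκ : κ ^ 2 = 1) : frame κ 1 = lieElt κ 0 0 0 κ := by
  have hκ' := ofReal_sq_eq_one hκ
  rw [lieElt, lieElt₁_zero, lieElt₁]; simp [frame, hκ', conj_ofReal]

theorem sum_frame (hκ : κ ^ 2 = 1) (c : Fin 2 → ℂ) :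
    ∑ i, ((c i).re • frame κ i + (c i).im • (base * frame κ i - frame κ i * base))
      = lieElt κ 0 (starRingEnd ℂ (c 0)) 0 (κ * starRingEnd ℂ (c 1)) := by
  have key : ∀ z : ℂ, starRingEnd ℂ z = z.re - z.im * I := fun z => by
    apply Complex.ext <;> simp
  rw [Fin.sum_univ_two, frame_zero, frame_one hκ]
  simp only [base_lie, smul_lieElt, add_lieElt]
  congr 1
  · simp
  · rw [key]; ring
  · simp
  · rw [key]; ring

theorem traceForm_lieElt (hκ : κ ^ 2 = 1) (w v w' v' : ℂ) :
    traceForm (-(κ / 2)) (lieElt κ 0 w 0 v) (lieElt κ 0 w' 0 v')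
      = w.re * w'.re + w.im * w'.im + (v.re * v'.re + v.im * v'.im) := by
  rw [traceForm_apply, lieElt, lieElt, Matrix.fromBlocks_multiply]
  simp only [mul_zero, zero_mul, add_zero, zero_add, trace_fromBlocks_diag, lieElt₁, mat2_mul, mat2_trace]
  simp
  linear_combination (w.re * w'.re + w.im * w'.im + (v.re * v'.re + v.im * v'.im)) * hκ

theorem traceForm_lie (w v w' v' w'' v'' : ℂ) :
    Matrix.trace (lieElt κ 0 w 0 v * (lieElt κ 0 w' 0 v' * lieElt κ 0 w'' 0 v''
      - lieElt κ 0 w'' 0 v'' * lieElt κ 0 w' 0 v')) = 0 := by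
  simp only [lieElt, Matrix.fromBlocks_multiply, mul_zero, zero_mul, add_zero, zero_add,
    fromBlocks_diag_sub, trace_fromBlocks_diag, lieElt₁, mat2_mul, mat2_sub, mat2_trace]
  simp

theorem exists_of_tau_tau (hκ : κ ^ 2 = 1) {X : Matrix (Fin 2 ⊕ Fin 2) (Fin 2 ⊕ Fin 2) ℂ}
    (hX : X ∈ prodLie (specialFormLie (form κ))) (h : tauSwap (tauSwap X) = -X) :
    ∃ w v, X = lieElt κ 0 w 0 v := by
  obtain ⟨x, w, x', w', rfl⟩ := exists_lieElt hX
  rw [tau_lieElt hκ, tau_lieElt hκ, neg_lieElt] at h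
  obtain ⟨h1, -, h3, -⟩ := lieElt_inj h
  have hx : x = 0 := by linarith
  have hx' : x' = 0 := by linarith
  exact ⟨w, w', by rw [hx, hx']⟩

theorem blockSwap_eq : blockSwap = Matrix.fromBlocks 0 (mat2 0 (-1) 1 0) (mat2 0 1 1 0) 0 := rfl

theorem blockSwap_transpose_mul : blockSwapᵀ * blockSwap = 1 := by
  rw [blockSwap_eq, Matrix.fromBlocks_transpose, Matrix.fromBlocks_multiply, ← Matrix.fromBlocks_one]
  simp [mat2_transpose, mat2_mul, one_eq_mat2]

theorem blockSwap_four : blockSwap * (blockSwap * (blockSwap * blockSwap)) = 1 := by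
  rw [blockSwap_eq, Matrix.fromBlocks_multiply, Matrix.fromBlocks_multiply,
    Matrix.fromBlocks_multiply, ← Matrix.fromBlocks_one]
  simp [mat2_mul, one_eq_mat2]

theorem tauSwap_mul (X Z : Matrix (Fin 2 ⊕ Fin 2) (Fin 2 ⊕ Fin 2) ℂ) :
    tauSwap (X * Z) = tauSwap X * tauSwap Z := by
  change blockSwap * (X * Z) * blockSwapᵀ
    = blockSwap * X * blockSwapᵀ * (blockSwap * Z * blockSwapᵀ)
  calc _ = blockSwap * X * (1 * (Z * blockSwapᵀ)) := by simp only [one_mul, mul_assoc]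
    _ = _ := by rw [← blockSwap_transpose_mul]; simp only [mul_assoc]

theorem tauSwap_lie (X Z : Matrix (Fin 2 ⊕ Fin 2) (Fin 2 ⊕ Fin 2) ℂ) :
    tauSwap (X * Z - Z * X) = tauSwap X * tauSwap Z - tauSwap Z * tauSwap X := by
  rw [map_sub, tauSwap_mul, tauSwap_mul]

theorem tauSwap_four (X : Matrix (Fin 2 ⊕ Fin 2) (Fin 2 ⊕ Fin 2) ℂ) :
    tauSwap (tauSwap (tauSwap (tauSwap X))) = X := by
  change blockSwap * (blockSwap * (blockSwap * (blockSwap * X * blockSwapᵀ) * blockSwapᵀ)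
    * blockSwapᵀ) * blockSwapᵀ = X
  have h : ((blockSwapᵀ * blockSwapᵀ) * blockSwapᵀ) * blockSwapᵀ = 1 := by
    have := congrArg Matrix.transpose blockSwap_four
    simpa only [Matrix.transpose_mul, Matrix.transpose_one] using this
  calc _ = blockSwap * (blockSwap * (blockSwap * blockSwap)) * X
        * (((blockSwapᵀ * blockSwapᵀ) * blockSwapᵀ) * blockSwapᵀ) := by simp only [mul_assoc]
    _ = X := by rw [h, blockSwap_four, one_mul, mul_one]

/-! ### The local section -/

theorem conjTranspose_form_mul (hκ : κ ^ 2 = 1) {g : Matrix (Fin 2) (Fin 2) ℂ}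
    (hg : g ∈ specialFormGroup (form κ)) :
    g⁻¹ = form κ * gᴴ * form κ ∧ gᴴ * form κ * g = form κ := by
  have hKK : form κ * form κ = 1 := by
    rw [form, mat2_mul, one_eq_mat2, mat2_inj]; simp [ofReal_sq_eq_one hκ]
  have h1 : g * (form κ * gᴴ * form κ) = 1 := by
    rw [← mul_assoc, ← mul_assoc, hg.1, hKK]
  refine ⟨Matrix.inv_eq_right_inv h1, ?_⟩
  have h2 := mul_eq_one_comm.1 h1
  calc gᴴ * form κ * g = form κ * form κ * (gᴴ * form κ * g) := by rw [hKK, one_mul]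
    _ = form κ * (form κ * gᴴ * form κ * g) := by simp only [mul_assoc]
    _ = form κ := by rw [h2, mul_one]

theorem orbit_eq (hκ : κ ^ 2 = 1) {a b c d : ℂ} (hg : mat2 a b c d ∈ specialFormGroup (form κ)) :
    mat2 a b c d * base₁ * (mat2 a b c d)⁻¹ =
      mat2 (-(I / 2) + I * κ * (b * starRingEnd ℂ b)) (I * (b * starRingEnd ℂ d))
        (I * κ * (d * starRingEnd ℂ b)) (-(I / 2) + I * (d * starRingEnd ℂ d)) := by
  have hκ' := ofReal_sq_eq_one hκ
  obtain ⟨h1, h2⟩ := conjTranspose_form_mul hκ hg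
  have hu := (Matrix.isUnit_iff_isUnit_det _).1 (isUnit_of_mem_specialFormGroup hg)
  have e0 : base₁ = (-(I / 2)) • (1 : Matrix (Fin 2) (Fin 2) ℂ) + mat2 0 0 0 I := by
    rw [one_eq_mat2, mat2_csmul, mat2_add, base₁, mat2_inj]
    simp; ring
  have e1 : mat2 a b c d * base₁ * (mat2 a b c d)⁻¹ = (-(I / 2)) • 1
      + mat2 a b c d * mat2 0 0 0 I * (form κ * (mat2 a b c d)ᴴ * form κ) := by
    rw [← h1, e0, mul_add, add_mul, Matrix.mul_smul, Matrix.smul_mul, mul_one,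
      Matrix.mul_nonsing_inv _ hu]
  rw [e1, form, mat2_conjTranspose, mat2_mul, mat2_mul, mat2_mul, mat2_mul, one_eq_mat2, mat2_csmul,
    mat2_add, mat2_inj]
  refine ⟨?_, ?_, ?_, ?_⟩ <;> simp
  · ring
  · linear_combination (I * (b * starRingEnd ℂ d)) * hκ'
  · ring
  · linear_combination (I * (d * starRingEnd ℂ d)) * hκ'

/-- The modulus of the last entry of `g`, in terms of the point `g Y g⁻¹` of the orbit. -/
def radius (p : Matrix (Fin 2) (Fin 2) ℂ) : ℝ := √(1 / 2 - I * p 1 1).re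

/-- A section of `g ↦ g Y g⁻¹` for a factor. -/
def localSection₁ (κ : ℝ) (p : Matrix (Fin 2) (Fin 2) ℂ) : Matrix (Fin 2) (Fin 2) ℂ :=
  mat2 (radius p) (-(I * p 0 1) / radius p) (-(κ * starRingEnd ℂ (-(I * p 0 1) / radius p)))
    (radius p)

theorem contDiffAt_localSection₁ {p : Matrix (Fin 2) (Fin 2) ℂ} (hp : 0 < (1 / 2 - I * p 1 1).re) :
    ContDiffAt ℝ ∞ (localSection₁ κ) p := by
  have hr0 : 0 < radius p := Real.sqrt_pos.2 hp
  have hent : ∀ i j, ContDiffAt ℝ ∞ (fun p : Matrix (Fin 2) (Fin 2) ℂ => p i j) p :=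
    fun i j => (contDiff_entry i j).contDiffAt
  have hr : ContDiffAt ℝ ∞ radius p := by
    refine ContDiffAt.sqrt ?_ hp.ne'
    have h1 : ContDiffAt ℝ ∞ (fun p => 1 / 2 - I * p 1 1) p :=
      contDiffAt_const.sub (contDiffAt_const.mul (hent _ _))
    exact Complex.reCLM.contDiff.contDiffAt.comp p h1
  have hrc := hr.complex_ofReal
  have hne : ((radius p : ℝ) : ℂ) ≠ 0 := by exact_mod_cast hr0.ne'
  have hu : ContDiffAt ℝ ∞ (fun p : Matrix (Fin 2) (Fin 2) ℂ => -(I * p 0 1) / radius p) p :=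
    (contDiffAt_const.mul (hent _ _)).neg.complex_div hrc hne
  exact contDiffAt_mat2 hrc hu (contDiffAt_const.mul hu.conj).neg hrc

theorem localSection₁_spec (hκ : κ ^ 2 = 1) {p g : Matrix (Fin 2) (Fin 2) ℂ}
    (hp : 0 < (1 / 2 - I * p 1 1).re) (hg : g ∈ specialFormGroup (form κ))
    (h : p = g * base₁ * g⁻¹) : localSection₁ κ p ∈ specialFormGroup (form κ) ∧
      localSection₁ κ p * base₁ * (localSection₁ κ p)⁻¹ = p := by
  have hκ' := ofReal_sq_eq_one hκ
  obtain ⟨a, b, c, d, rfl⟩ := exists_mat2 g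
  have hK := (conjTranspose_form_mul hκ hg).2
  rw [form, mat2_conjTranspose, mat2_mul, mat2_mul, mat2_inj] at hK
  have hn := hK.2.2.2
  simp only [mul_zero, mul_one, add_zero, zero_add] at hn
  rw [orbit_eq hκ hg] at h
  have hr0 : 0 < radius p := Real.sqrt_pos.2 hp
  have hrad : ((radius p : ℝ) : ℂ) * radius p = d * starRingEnd ℂ d := by
    rw [← ofReal_mul, radius, Real.mul_self_sqrt hp.le, h]
    change (((1 / 2 - I * (-(I / 2) + I * (d * starRingEnd ℂ d))).re : ℝ) : ℂ) = _
    rw [mul_conj]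
    have : 1 / 2 - I * (-(I / 2) + I * ((normSq d : ℝ) : ℂ)) = ((normSq d : ℝ) : ℂ) := by
      linear_combination (1 / 2 - ((normSq d : ℝ) : ℂ)) * I_mul_I
    rw [this, ofReal_re]
  have hne : ((radius p : ℝ) : ℂ) ≠ 0 := by exact_mod_cast hr0.ne'
  have hu : -(I * p 0 1) / radius p = b * starRingEnd ℂ d / radius p := by
    rw [h]
    change -(I * (I * (b * starRingEnd ℂ d))) / _ = _
    rw [show -(I * (I * (b * starRingEnd ℂ d))) = b * starRingEnd ℂ d by
      linear_combination (-(b * starRingEnd ℂ d)) * I_mul_I]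
  have huc : starRingEnd ℂ (b * starRingEnd ℂ d / radius p) = d * starRingEnd ℂ b / radius p := by
    rw [map_div₀, map_mul, conj_conj, conj_ofReal, mul_comm]
  have key : b * starRingEnd ℂ d / radius p * (d * starRingEnd ℂ b / radius p)
      = b * starRingEnd ℂ b := by
    field_simp
    linear_combination (-b * starRingEnd ℂ b) * hrad
  have key1 := div_mul_cancel₀ (b * starRingEnd ℂ d) hne
  have key2 := div_mul_cancel₀ (d * starRingEnd ℂ b) hne
  have hs : localSection₁ κ p = mat2 (radius p) (b * starRingEnd ℂ d / radius p)
      (-(κ * (d * starRingEnd ℂ b / radius p))) (radius p) := by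
    rw [localSection₁, hu, huc]
  have hmem : localSection₁ κ p ∈ specialFormGroup (form κ) := by
    rw [hs]
    constructor
    · rw [form, mat2_conjTranspose, mat2_mul, mat2_mul, mat2_inj]
      have hcu : starRingEnd ℂ (d * starRingEnd ℂ b / radius p) = b * starRingEnd ℂ d / radius p := by
        rw [← huc, conj_conj]
      simp only [map_neg, map_mul, huc, hcu, conj_ofReal]
      refine ⟨?_, ?_, ?_, ?_⟩
      · linear_combination κ * key + hrad + κ * hn + (1 - d * starRingEnd ℂ d) * hκ'
      · ring
      · ring
      · linear_combination (κ * κ) * key + κ * hrad + (b * starRingEnd ℂ b) * hκ' + hn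
    · rw [mat2_det]
      linear_combination κ * key + hrad + κ * hn + (1 - d * starRingEnd ℂ d) * hκ'
  refine ⟨hmem, ?_⟩
  conv_rhs => rw [h]
  rw [hs] at hmem ⊢
  rw [orbit_eq hκ hmem, huc, conj_ofReal, key, key1, hrad, mul_comm (radius p : ℂ), key2]

end ProductFamily

end

noncomputable section

namespace ProductFamily

variable {κ : ℝ}

theorem exists_section (hκ : κ ^ 2 = 1) :
    ∃ s : Matrix (Fin 2 ⊕ Fin 2) (Fin 2 ⊕ Fin 2) ℂ → Matrix (Fin 2 ⊕ Fin 2) (Fin 2 ⊕ Fin 2) ℂ,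
      ∀ᶠ p in 𝓝 base, ContDiffAt ℝ ∞ s p ∧
        ((∃ g ∈ prodGroup (specialFormGroup (form κ)), p = g * base * g⁻¹) →
          s p ∈ prodGroup (specialFormGroup (form κ)) ∧ s p * base * (s p)⁻¹ = p) := by
  refine ⟨fun p => Matrix.fromBlocks (localSection₁ κ (blockL false false p)) 0 0
    (localSection₁ κ (blockL true true p)), ?_⟩
  have hev : ∀ j, ∀ᶠ p in 𝓝 base, 0 < (1 / 2 - I * blockL j j p 1 1).re := by
    intro j
    have hent : ContinuousAt (fun p : Matrix (Fin 2 ⊕ Fin 2) (Fin 2 ⊕ Fin 2) ℂ =>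
        blockL j j p 1 1) base :=
      ((entryL (1 : Fin 2) 1).continuous.comp (blockL j j).continuous).continuousAt
    have hcont : ContinuousAt (fun p : Matrix (Fin 2 ⊕ Fin 2) (Fin 2 ⊕ Fin 2) ℂ =>
        (1 / 2 - I * blockL j j p 1 1).re) base :=
      Complex.continuous_re.continuousAt.comp
        (continuousAt_const.sub (continuousAt_const.mul hent))
    have hpos : 0 < (1 / 2 - I * blockL j j base 1 1).re := by
      have : blockL j j base 1 1 = I / 2 := by cases j <;> rfl
      rw [this, show 1 / 2 - I * (I / 2) = 1 by linear_combination (-1 / 2) * I_mul_I]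
      simp
    exact hcont.eventually (lt_mem_nhds hpos)
  filter_upwards [hev false, hev true] with p h0 h1
  constructor
  · have hs : ∀ j, 0 < (1 / 2 - I * blockL j j p 1 1).re →
        ContDiffAt ℝ ∞ (fun p => localSection₁ κ (blockL j j p)) p := fun j hj =>
      (contDiffAt_localSection₁ hj).comp p (blockL (ι := Fin 2) j j).contDiff.contDiffAt
    refine contDiffAt_matrix fun i j => ?_
    rcases i with i | i <;> rcases j with j | j
    · exact (contDiff_entry i j).contDiffAt.comp p (hs false h0)
    · exact contDiffAt_const
    · exact contDiffAt_const
    · exact (contDiff_entry i j).contDiffAt.comp p (hs true h1)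
  · rintro ⟨_, ⟨A, hA, D, hD, rfl⟩, hp⟩
    have hAu := isUnit_of_mem_specialFormGroup hA
    have hDu := isUnit_of_mem_specialFormGroup hD
    rw [fromBlocks_diag_inv hAu hDu, base, Matrix.fromBlocks_multiply,
      Matrix.fromBlocks_multiply] at hp
    simp only [mul_zero, zero_mul, add_zero, zero_add] at hp
    have e0 : blockL false false p = A * base₁ * A⁻¹ := by rw [hp, blockL_fromBlocks]; rfl
    have e1 : blockL true true p = D * base₁ * D⁻¹ := by rw [hp, blockL_fromBlocks]; rfl
    obtain ⟨m0, q0⟩ := localSection₁_spec hκ h0 hA e0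
    obtain ⟨m1, q1⟩ := localSection₁_spec hκ h1 hD e1
    refine ⟨⟨_, m0, _, m1, rfl⟩, ?_⟩
    rw [fromBlocks_diag_inv (isUnit_of_mem_specialFormGroup m0) (isUnit_of_mem_specialFormGroup m1),
      base, Matrix.fromBlocks_multiply, Matrix.fromBlocks_multiply]
    simp only [mul_zero, zero_mul, add_zero, zero_add]
    rw [q0, q1, e0, e1, ← hp]

/-- The square of the projective line for `κ = 1`, and of the hyperbolic line for `κ = -1`. -/
def hermitianModel (hκ : κ ^ 2 = 1) : HermitianModel (Matrix (Fin 2 ⊕ Fin 2) (Fin 2 ⊕ Fin 2) ℂ) where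
  G := prodGroup (specialFormGroup (form κ))
  𝔤 := prodLie (specialFormLie (form κ))
  τ := LinearMap.toContinuousLinearMap tauSwap
  Y := base
  ε := frame κ
  metric V W := traceForm (-(κ / 2)) V W
  inv g := g⁻¹
  B := traceForm (-(κ / 2))
  metric_eq _ _ := rfl
  inv_eq g := Matrix.nonsing_inv_eq_ringInverse g
  one_mem := (isMatrixGroup_specialFormGroup _).prod.one_mem
  mul_mem := (isMatrixGroup_specialFormGroup _).prod.mul_mem
  inv_mem := (isMatrixGroup_specialFormGroup _).prod.inv_mem
  isUnit := (isMatrixGroup_specialFormGroup _).prod.isUnit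
  lie_mem := (isMatrixGroup_specialFormGroup _).prod.lie_mem
  mem_of_isParallelAt := (isMatrixGroup_specialFormGroup _).prod.mem_of_isParallelAt
  mem_of_hasDerivAt := (isMatrixGroup_specialFormGroup _).prod.mem_of_hasDerivAt
  τ_four := tauSwap_four
  τ_lie := tauSwap_lie
  τ_mem {X} hX := by
    obtain ⟨x, w, x', w', rfl⟩ := exists_lieElt hX
    exact (tau_lieElt hκ x w x' w').symm ▸ lieElt_mem _ _ _ _
  Y_mem := base_eq (κ := κ) ▸ lieElt_mem _ _ _ _
  τ_Y := by
    change tauSwap base = -base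
    rw [base_eq (κ := κ), tau_lieElt hκ, neg_lieElt]
    simp
  exists_section := exists_section hκ
  lie_Y {X} hX h := by
    obtain ⟨x, w, x', w', rfl⟩ := exists_lieElt hX
    have h1 := (tau_lieElt hκ x w x' w').symm.trans h
    have hκ' := ofReal_sq_eq_one hκ
    obtain ⟨-, hw, -, hw'⟩ := lieElt_inj h1
    have hc := congrArg (starRingEnd ℂ) hw'
    simp only [map_neg, map_mul, conj_conj, conj_ofReal] at hc
    have hw0 : w = 0 := by linear_combination -(hw + κ * hc) / 2 - w / 2 * hκ'
    have hw0' : w' = 0 := by rw [hw0] at hw'; simpa using hw'.symm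
    refine (base_lie x w x' w').trans ?_
    rw [hw0, hw0', mul_zero, neg_zero, lieElt_zero]
  eq_smul_Y {X} hX h := by
    obtain ⟨x, w, x', w', rfl⟩ := exists_lieElt hX
    have h1 := (tau_lieElt hκ x w x' w').symm.trans (h.trans (neg_lieElt x w x' w'))
    have hκ' := ofReal_sq_eq_one hκ
    obtain ⟨hx, hw, -, hw'⟩ := lieElt_inj h1
    have hx' : x' = x := by linarith
    have hc := congrArg (starRingEnd ℂ) hw'
    simp only [map_neg, map_mul, conj_conj, conj_ofReal] at hc
    have hw0 : w = 0 := by linear_combination (hw - κ * hc) / 2 - w / 2 * hκ'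
    have hw0' : w' = 0 := by rw [hw0] at hw'; simpa using hw'
    refine ⟨-2 * x, ?_⟩
    rw [base_eq (κ := κ), smul_lieElt, hx', hw0, hw0']
    congr 1
    · ring
    · simp
    · ring
    · simp
  eq_frame {X} hX h := by
    obtain ⟨w, v, rfl⟩ := exists_of_tau_tau hκ hX h
    have hκ' := ofReal_sq_eq_one hκ
    refine ⟨![starRingEnd ℂ w, κ * starRingEnd ℂ v], ?_⟩
    refine Eq.trans ?_ (sum_frame hκ _).symm
    congr 1
    · change w = starRingEnd ℂ (starRingEnd ℂ w)
      rw [conj_conj]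
    · change v = κ * starRingEnd ℂ (κ * starRingEnd ℂ v)
      rw [map_mul, conj_conj, conj_ofReal]
      linear_combination (-v) * hκ'
  ε_mem i := by
    fin_cases i
    · exact frame_zero (κ := κ) ▸ lieElt_mem _ _ _ _
    · exact frame_one hκ ▸ lieElt_mem _ _ _ _
  τ_ε_zero := by
    change tauSwap (frame κ 0) = -frame κ 1
    rw [frame_zero, frame_one hκ, tau_lieElt hκ, neg_lieElt]
    simp
  τ_ε_one := by
    change tauSwap (frame κ 1) = frame κ 0
    rw [frame_zero, frame_one hκ, tau_lieElt hκ]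
    simp [conj_ofReal, ofReal_sq_eq_one hκ]
  lie_lie_ε i := by
    have key : ∀ w v : ℂ, base * (base * lieElt κ 0 w 0 v - lieElt κ 0 w 0 v * base)
        - (base * lieElt κ 0 w 0 v - lieElt κ 0 w 0 v * base) * base = -lieElt κ 0 w 0 v := by
      intro w v
      rw [base_lie, base_lie, neg_lieElt]
      congr 1
      · simp
      · linear_combination w * I_mul_I
      · simp
      · linear_combination v * I_mul_I
    fin_cases i
    · exact frame_zero (κ := κ) ▸ key _ _
    · exact frame_one hκ ▸ key _ _
  metric_symm V W := by rw [traceForm_apply, traceForm_apply, Matrix.trace_mul_comm]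
  metric_frame c d := by
    refine (congrArg₂ (fun V W => traceForm (-(κ / 2)) V W) (sum_frame hκ c) (sum_frame hκ d)).trans ?_
    rw [traceForm_lieElt hκ, Fin.sum_univ_two]
    simp only [re_ofReal_mul, im_ofReal_mul, conj_re, conj_im]
    linear_combination ((c 1).re * (d 1).re + (c 1).im * (d 1).im) * hκ
  metric_act {g v w} hg _ _ _ _ := by
    rw [traceForm_apply, traceForm_apply,
      trace_conj ((isMatrixGroup_specialFormGroup _).prod.isUnit hg)]
  metric_act_lie {g u v w} hg hu hu' hv hv' hw hw' := by
    obtain ⟨_, _, rfl⟩ := exists_of_tau_tau hκ hu hu'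
    obtain ⟨_, _, rfl⟩ := exists_of_tau_tau hκ hv hv'
    obtain ⟨_, _, rfl⟩ := exists_of_tau_tau hκ hw hw'
    rw [traceForm_apply, trace_conj ((isMatrixGroup_specialFormGroup _).prod.isUnit hg),
      traceForm_lie]
    simp

theorem fromBlocks_eq_base :
    (1 / 2 : ℂ) • Matrix.fromBlocks !![-I, 0; 0, I] 0 0 !![-I, 0; 0, I] = base := by
  ext i j
  rcases i with i | i <;> rcases j with j | j <;> fin_cases i <;> fin_cases j <;>
    simp [base, base₁, mat2] <;> ring

theorem form_one : form 1 = 1 := by rw [form, one_eq_mat2, ofReal_one]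

theorem form_neg_one : form (-1) = !![1, 0; 0, -1] := by
  rw [form, mat2, ofReal_neg, ofReal_one]

theorem isModelledOn_biProjective :
    biProjectiveModel.IsModelledOn (hermitianModel (κ := 1) (by norm_num)) where
  G_eq := by
    change prodGroup (specialFormGroup (form 1)) = _
    rw [form_one, specialFormGroup_one]
    rfl
  τ_eq _ := rfl
  Y_eq := fromBlocks_eq_base.symm
  ε_eq := by
    change frame 1 = ![Matrix.fromBlocks !![0, 1; -1, 0] 0 0 0,
      Matrix.fromBlocks 0 0 0 !![0, 1; -1, 0]]
    simp [frame, mat2]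
  metric_eq := by
    funext V W
    rfl
  inv_eq := rfl

theorem isModelledOn_biHyperbolic :
    biHyperbolicModel.IsModelledOn (hermitianModel (κ := -1) (by norm_num)) where
  G_eq := by
    change prodGroup (specialFormGroup (form (-1))) = _
    rw [form_neg_one]
    rfl
  τ_eq _ := rfl
  Y_eq := fromBlocks_eq_base.symm
  ε_eq := by
    change frame (-1) = ![Matrix.fromBlocks !![0, 1; 1, 0] 0 0 0,
      Matrix.fromBlocks 0 0 0 !![0, -1; -1, 0]]
    simp [frame, mat2]
  metric_eq := by
    funext V W
    change -(-1 / 2) * (Matrix.trace (V * W)).re = (1 / 2) * (Matrix.trace (V * W)).re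
    norm_num
  inv_eq := rfl

end ProductFamily

end

noncomputable section

namespace EuclideanPlane

/-- The degenerate Hermitian form preserved by the linear parts. -/
def form : Matrix (Fin 2 ⊕ Fin 1) (Fin 2 ⊕ Fin 1) ℂ := mat3 1 0 0 0 1 0 0 0 0

/-- The group of affine isometries. -/
def isomGroup : Set (Matrix (Fin 2 ⊕ Fin 1) (Fin 2 ⊕ Fin 1) ℂ) :=
  {g | g * form * gᴴ = form ∧ g (.inr 0) (.inr 0) = 1}

/-- The Lie algebra of infinitesimal isometries. -/
def isomLie : Submodule ℝ (Matrix (Fin 2 ⊕ Fin 1) (Fin 2 ⊕ Fin 1) ℂ) :=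
  formLie form ⊓ LinearMap.ker (Matrix.entryLinearMap ℝ ℂ (.inr 0) (.inr 0))

/-- The base point. -/
def base : Matrix (Fin 2 ⊕ Fin 1) (Fin 2 ⊕ Fin 1) ℂ := mat3 I 0 0 0 I 0 0 0 0

/-- The reference frame. -/
def frame : Fin 2 → Matrix (Fin 2 ⊕ Fin 1) (Fin 2 ⊕ Fin 1) ℂ :=
  ![mat3 0 0 1 0 0 0 0 0 0, mat3 0 0 0 0 0 1 0 0 0]

/-- The general element of the Lie algebra. -/
def lieElt (x y : ℝ) (b u v : ℂ) : Matrix (Fin 2 ⊕ Fin 1) (Fin 2 ⊕ Fin 1) ℂ :=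
  mat3 (x * I) b u (-starRingEnd ℂ b) (y * I) v 0 0 0

theorem mem_isomLie {X : Matrix (Fin 2 ⊕ Fin 1) (Fin 2 ⊕ Fin 1) ℂ} :
    X ∈ isomLie ↔ X * form + form * Xᴴ = 0 ∧ X (.inr 0) (.inr 0) = 0 := Iff.rfl

theorem form_conj_iff {a b c d e f g h i : ℂ} :
    mat3 a b c d e f g h i * form * (mat3 a b c d e f g h i)ᴴ = form ↔
      (a * starRingEnd ℂ a + b * starRingEnd ℂ b = 1 ∧ a * starRingEnd ℂ d + b * starRingEnd ℂ e = 0 ∧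
        d * starRingEnd ℂ a + e * starRingEnd ℂ b = 0 ∧ d * starRingEnd ℂ d + e * starRingEnd ℂ e = 1) ∧
      g = 0 ∧ h = 0 := by
  rw [form, mat3_conjTranspose, mat3_mul, mat3_mul, mat3_inj]
  simp only [mul_one, mul_zero, add_zero, zero_add, zero_mul]
  constructor
  · rintro ⟨h1, h2, -, h3, h4, -, -, -, h5⟩
    rw [mul_conj, mul_conj, ← ofReal_add, ofReal_eq_zero] at h5
    have hg := normSq_nonneg g
    have hh := normSq_nonneg h
    exact ⟨⟨h1, h2, h3, h4⟩, normSq_eq_zero.1 (by linarith), normSq_eq_zero.1 (by linarith)⟩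
  · rintro ⟨⟨h1, h2, h3, h4⟩, rfl, rfl⟩
    simp [h1, h2, h3, h4]

theorem mem_isomGroup_iff {a b c d e f g h i : ℂ} : mat3 a b c d e f g h i ∈ isomGroup ↔
      (a * starRingEnd ℂ a + b * starRingEnd ℂ b = 1 ∧ a * starRingEnd ℂ d + b * starRingEnd ℂ e = 0 ∧
        d * starRingEnd ℂ a + e * starRingEnd ℂ b = 0 ∧ d * starRingEnd ℂ d + e * starRingEnd ℂ e = 1) ∧
      g = 0 ∧ h = 0 ∧ i = 1 := by
  rw [isomGroup, mem_ofPred_eq, form_conj_iff]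
  simp only [and_assoc]
  rfl

theorem exists_isomGroup {g : Matrix (Fin 2 ⊕ Fin 1) (Fin 2 ⊕ Fin 1) ℂ} (hg : g ∈ isomGroup) :
    ∃ a b c d e f, g = mat3 a b c d e f 0 0 1 := by
  obtain ⟨a, b, c, d, e, f, g, h, i, rfl⟩ := exists_mat3 g
  obtain ⟨-, rfl, rfl, rfl⟩ := mem_isomGroup_iff.1 hg
  exact ⟨a, b, c, d, e, f, rfl⟩

theorem isUnit_of_mem {g : Matrix (Fin 2 ⊕ Fin 1) (Fin 2 ⊕ Fin 1) ℂ} (hg : g ∈ isomGroup) :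
    IsUnit g := by
  obtain ⟨a, b, c, d, e, f, rfl⟩ := exists_isomGroup hg
  obtain ⟨⟨h1, h2, h3, h4⟩, -⟩ := mem_isomGroup_iff.1 hg
  refine IsUnit.of_mul_eq_one (mat3 (starRingEnd ℂ a) (starRingEnd ℂ d)
    (-(starRingEnd ℂ a * c + starRingEnd ℂ d * f)) (starRingEnd ℂ b) (starRingEnd ℂ e)
    (-(starRingEnd ℂ b * c + starRingEnd ℂ e * f)) 0 0 1) ?_
  rw [mat3_mul, one_eq_mat3, mat3_inj]
  refine ⟨?_, ?_, ?_, ?_, ?_, ?_, ?_, ?_, ?_⟩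
  · linear_combination h1
  · linear_combination h2
  · linear_combination -c * h1 - f * h2
  · linear_combination h3
  · linear_combination h4
  · linear_combination -c * h3 - f * h4
  all_goals simp

theorem lieElt_mem (x y : ℝ) (b u v : ℂ) : lieElt x y b u v ∈ isomLie := by
  rw [mem_isomLie]
  refine ⟨?_, rfl⟩
  rw [lieElt, form, mat3_conjTranspose, mat3_mul, mat3_mul, mat3_add, zero_eq_mat3, mat3_inj]
  refine ⟨?_, ?_, ?_, ?_, ?_, ?_, ?_, ?_, ?_⟩ <;> simp

theorem exists_lieElt {X : Matrix (Fin 2 ⊕ Fin 1) (Fin 2 ⊕ Fin 1) ℂ}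
    (hX : X ∈ isomLie) : ∃ x y b u v, X = lieElt x y b u v := by
  obtain ⟨a, b, c, d, e, f, g, h, i, rfl⟩ := exists_mat3 X
  obtain ⟨hX, hi⟩ := mem_isomLie.1 hX
  change i = 0 at hi
  rw [form, mat3_conjTranspose, mat3_mul, mat3_mul, mat3_add, zero_eq_mat3, mat3_inj] at hX
  obtain ⟨h1, -, -, h4, h5, -, h7, h8, -⟩ := hX
  simp only [mul_one, mul_zero, add_zero, one_mul, zero_mul, zero_add] at h1 h4 h5 h7 h8
  have key : ∀ a : ℂ, a + starRingEnd ℂ a = 0 → a = a.im * I := fun a ha => by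
    have := congrArg re ha
    simp at this
    apply Complex.ext
    · simp; linarith
    · simp
  refine ⟨a.im, e.im, b, c, f, ?_⟩
  rw [lieElt, mat3_inj]
  exact ⟨key a h1, rfl, rfl, by linear_combination h4, key e h5, rfl, h7, h8, hi⟩

theorem isMatrixGroup : IsMatrixGroup isomGroup isomLie where
  one_mem := by
    rw [one_eq_mat3, mem_isomGroup_iff]
    simp
  mul_mem {g h} hg hh := by
    obtain ⟨a, b, c, d, e, f, rfl⟩ := exists_isomGroup hg
    obtain ⟨a', b', c', d', e', f', rfl⟩ := exists_isomGroup hh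
    refine ⟨?_, ?_⟩
    · rw [Matrix.conjTranspose_mul]
      calc mat3 a b c d e f 0 0 1 * mat3 a' b' c' d' e' f' 0 0 1 * form *
            ((mat3 a' b' c' d' e' f' 0 0 1)ᴴ * (mat3 a b c d e f 0 0 1)ᴴ)
          = mat3 a b c d e f 0 0 1 * (mat3 a' b' c' d' e' f' 0 0 1 * form *
            (mat3 a' b' c' d' e' f' 0 0 1)ᴴ) * (mat3 a b c d e f 0 0 1)ᴴ := by
            simp only [mul_assoc]
        _ = form := by rw [hh.1, hg.1]
    · rw [mat3_mul]
      change 0 * c' + 0 * f' + 1 * 1 = (1 : ℂ)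
      ring
  inv_mem {g} hg := by
    have hu := (Matrix.isUnit_iff_isUnit_det g).1 (isUnit_of_mem hg)
    have hu' : IsUnit gᴴ.det := by rw [Matrix.det_conjTranspose]; exact hu.star
    have h : g⁻¹ * (g * form * gᴴ) * gᴴ⁻¹ = form := by
      rw [mul_assoc, Matrix.mul_nonsing_inv_cancel_right _ _ hu',
        Matrix.nonsing_inv_mul_cancel_left _ _ hu]
    rw [hg.1, ← Matrix.conjTranspose_nonsing_inv] at h
    refine ⟨h, ?_⟩
    obtain ⟨a, b, c, d, e, f, rfl⟩ := exists_isomGroup hg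
    have h1 := Matrix.nonsing_inv_mul _ hu
    obtain ⟨a', b', c', d', e', f', g', h', i', hi⟩ := exists_mat3 (mat3 a b c d e f 0 0 1)⁻¹
    rw [hi] at h h1 ⊢
    obtain ⟨-, rfl, rfl⟩ := form_conj_iff.1 h
    rw [mat3_mul, one_eq_mat3, mat3_inj] at h1
    change i' = 1
    linear_combination h1.2.2.2.2.2.2.2.2
  isUnit := isUnit_of_mem
  lie_mem {X Z} hX hZ := by
    refine ⟨lie_mem_formLie hX.1 hZ.1, ?_⟩
    obtain ⟨x, y, b, u, v, rfl⟩ := exists_lieElt hX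
    obtain ⟨x', y', b', u', v', rfl⟩ := exists_lieElt hZ
    change (lieElt x y b u v * lieElt x' y' b' u' v' - lieElt x' y' b' u' v' * lieElt x y b u v)
      (.inr 0) (.inr 0) = 0
    rw [lieElt, lieElt, mat3_mul, mat3_mul, mat3_sub]
    change (0 * u' + 0 * v' + 0 * 0) - (0 * u + 0 * v + 0 * 0) = (0 : ℂ)
    ring
  mem_of_isParallelAt {E _ _ A F U} hU hc hF hA z₀ hz₀ h0 z hz := by
    have hform : ∀ z ∈ U, F z * form * (F z)ᴴ = form := fun z hz =>
      (form_eq_of_isParallelAt hU hc hF conjTransposeL Matrix.conjTranspose_mul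
        (fun z hz v => (hA z hz v).1) hz₀ hz).trans h0.1
    have hd : ∀ z ∈ U, HasFDerivAt (fun z => F z (.inr 0) (.inr 0)) (0 : E →L[ℝ] ℂ) z := by
      intro z hz
      refine ((entryL (.inr 0) (.inr 0)).hasFDerivAt.comp z (hF z hz)).congr_fderiv ?_
      ext1 v
      change (F z * A z v) (.inr 0) (.inr 0) = 0
      have hAv := hA z hz v
      have hFz := hform z hz
      generalize F z = g at hFz ⊢
      generalize A z v = X at hAv ⊢
      obtain ⟨x, y, b, u, v, rfl⟩ := exists_lieElt hAv
      obtain ⟨a, b, c, d, e, f, g, h, i, rfl⟩ := exists_mat3 g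
      obtain ⟨-, rfl, rfl⟩ := form_conj_iff.1 hFz
      rw [lieElt, mat3_mul]
      change 0 * u + 0 * v + i * 0 = (0 : ℂ)
      ring
    refine ⟨hform z hz, ?_⟩
    rw [hU.is_const_of_fderiv_eq_zero (𝕜 := ℝ) hc
      (fun z hz => (hd z hz).differentiableAt.differentiableWithinAt)
      (fun z hz => (hd z hz).fderiv) hz hz₀, h0.2]
  mem_of_hasDerivAt {γ X} h hγ := by
    have hγ0 := hγ.self_of_nhds
    have hu := isUnit_of_mem hγ0
    have hX := form_eq_zero_of_hasDerivAt h conjTransposeL Matrix.conjTranspose_mul hu hu.star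
      (hγ.mono fun _ ht => ht.1)
    refine ⟨hX, ?_⟩
    have h1 := hasDerivAt_map h (entryL (.inr 0) (.inr 0))
    have h2 : (fun t => entryL (.inr 0) (.inr 0) (γ t)) =ᶠ[𝓝 0] fun _ => 1 := by
      filter_upwards [hγ] with t ht using ht.2
    have h3 := h1.unique ((hasDerivAt_const (0 : ℝ) (1 : ℂ)).congr_of_eventuallyEq h2)
    change (γ 0 * X) (.inr 0) (.inr 0) = 0 at h3
    change X (.inr 0) (.inr 0) = 0
    obtain ⟨a, b, c, d, e, f, hg⟩ := exists_isomGroup hγ0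
    rw [hg] at h3
    obtain ⟨a', b', c', d', e', f', g', h', i', rfl⟩ := exists_mat3 X
    rw [mat3_mul] at h3
    change 0 * c' + 0 * f' + 1 * i' = 0 at h3
    change i' = 0
    linear_combination h3

theorem lieElt_inj {x y x' y' : ℝ} {b u v b' u' v' : ℂ}
    (h : lieElt x y b u v = lieElt x' y' b' u' v') :
    x = x' ∧ y = y' ∧ b = b' ∧ u = u' ∧ v = v' := by
  rw [lieElt, lieElt, mat3_inj] at h
  obtain ⟨h1, h2, h3, -, h5, h6, -⟩ := h
  exact ⟨by simpa using h1, by simpa using h5, h2, h3, h6⟩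

theorem tau_lieElt (x y : ℝ) (b u v : ℂ) : tauConj (lieElt x y b u v)
      = lieElt (-y) (-x) b (starRingEnd ℂ v) (-(starRingEnd ℂ u)) := by
  rw [lieElt, tauConj_mat3, lieElt, mat3_inj]
  refine ⟨?_, ?_, ?_, ?_, ?_, ?_, ?_, ?_, ?_⟩ <;> simp

theorem smul_lieElt (r x y : ℝ) (b u v : ℂ) : r • lieElt x y b u v
    = lieElt (r * x) (r * y) (r * b) (r * u) (r * v) := by
  rw [lieElt, mat3_smul, lieElt, mat3_inj]
  refine ⟨?_, ?_, ?_, ?_, ?_, ?_, ?_, ?_, ?_⟩ <;> simp <;> ring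

theorem add_lieElt (x y : ℝ) (b u v : ℂ) (x' y' : ℝ) (b' u' v' : ℂ) :
    lieElt x y b u v + lieElt x' y' b' u' v'
      = lieElt (x + x') (y + y') (b + b') (u + u') (v + v') := by
  rw [lieElt, lieElt, mat3_add, lieElt, mat3_inj]
  refine ⟨?_, ?_, ?_, ?_, ?_, ?_, ?_, ?_, ?_⟩ <;> simp <;> ring

theorem neg_lieElt (x y : ℝ) (b u v : ℂ) : -lieElt x y b u v = lieElt (-x) (-y) (-b) (-u) (-v) := by
  rw [lieElt, mat3_neg, lieElt, mat3_inj]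
  refine ⟨?_, ?_, ?_, ?_, ?_, ?_, ?_, ?_, ?_⟩ <;> simp

theorem zero_eq_lieElt : (0 : Matrix (Fin 2 ⊕ Fin 1) (Fin 2 ⊕ Fin 1) ℂ) = lieElt 0 0 0 0 0 := by
  rw [zero_eq_mat3, lieElt, mat3_inj]; simp

theorem base_eq : base = lieElt 1 1 0 0 0 := by
  rw [base, lieElt, mat3_inj]
  refine ⟨?_, ?_, ?_, ?_, ?_, ?_, ?_, ?_, ?_⟩ <;> simp

theorem base_lie (x y : ℝ) (b u v : ℂ) : base * lieElt x y b u v - lieElt x y b u v * base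
    = lieElt 0 0 0 (I * u) (I * v) := by
  rw [base, lieElt, mat3_mul, mat3_mul, mat3_sub, lieElt, mat3_inj]
  refine ⟨?_, ?_, ?_, ?_, ?_, ?_, ?_, ?_, ?_⟩ <;> simp <;> ring

theorem frame_zero : frame 0 = lieElt 0 0 0 1 0 := by
  rw [lieElt]; simp [frame]

theorem frame_one : frame 1 = lieElt 0 0 0 0 1 := by
  rw [lieElt]; simp [frame]

theorem sum_frame (c : Fin 2 → ℂ) :
    ∑ i, ((c i).re • frame i + (c i).im • (base * frame i - frame i * base))
      = lieElt 0 0 0 (c 0) (c 1) := by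
  rw [Fin.sum_univ_two, frame_zero, frame_one]
  simp only [base_lie, smul_lieElt, add_lieElt]
  congr 1
  · simp
  · simp
  · simp
  · simp [re_add_im]
  · simp [re_add_im]

theorem exists_of_tau_tau {X : Matrix (Fin 2 ⊕ Fin 1) (Fin 2 ⊕ Fin 1) ℂ}
    (hX : X ∈ isomLie) (h : tauConj (tauConj X) = -X) : ∃ u v, X = lieElt 0 0 0 u v := by
  obtain ⟨x, y, b, u, v, rfl⟩ := exists_lieElt hX
  rw [tau_lieElt, tau_lieElt, neg_lieElt] at h
  obtain ⟨h1, h2, h3, -⟩ := lieElt_inj h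
  have hx : x = 0 := by linarith
  have hy : y = 0 := by linarith
  have hb : b = 0 := by linear_combination h3 / 2
  exact ⟨u, v, by rw [hx, hy, hb]⟩

theorem tauConj_four (X : Matrix (Fin 2 ⊕ Fin 1) (Fin 2 ⊕ Fin 1) ℂ) :
    tauConj (tauConj (tauConj (tauConj X))) = X := by
  obtain ⟨a, b, c, d, e, f, g, h, i, rfl⟩ := exists_mat3 X
  simp only [tauConj_mat3, map_neg, conj_conj, neg_neg]

theorem tauConj_lie (X Z : Matrix (Fin 2 ⊕ Fin 1) (Fin 2 ⊕ Fin 1) ℂ) :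
    tauConj (X * Z - Z * X) = tauConj X * tauConj Z - tauConj Z * tauConj X := by
  obtain ⟨a, b, c, d, e, f, g, h, i, rfl⟩ := exists_mat3 X
  obtain ⟨a', b', c', d', e', f', g', h', i', rfl⟩ := exists_mat3 Z
  simp only [tauConj_mat3, mat3_mul, mat3_sub]
  rw [mat3_inj]
  simp only [map_sub, map_add, map_mul]
  refine ⟨?_, ?_, ?_, ?_, ?_, ?_, ?_, ?_, ?_⟩ <;> ring

theorem orbit_eq {a b c d e f : ℂ} (hg : mat3 a b c d e f 0 0 1 ∈ isomGroup) :
    mat3 a b c d e f 0 0 1 * base * (mat3 a b c d e f 0 0 1)⁻¹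
      = mat3 I 0 (-(I * c)) 0 I (-(I * f)) 0 0 0 := by
  have hu := (Matrix.isUnit_iff_isUnit_det _).1 (isUnit_of_mem hg)
  have h : mat3 a b c d e f 0 0 1 * base
      = mat3 I 0 (-(I * c)) 0 I (-(I * f)) 0 0 0 * mat3 a b c d e f 0 0 1 := by
    rw [base, mat3_mul, mat3_mul, mat3_inj]
    refine ⟨?_, ?_, ?_, ?_, ?_, ?_, ?_, ?_, ?_⟩ <;> simp [mul_comm]
  rw [h, Matrix.mul_nonsing_inv_cancel_right _ _ hu]

theorem conj_tangent {a b c d e f : ℂ} (hg : mat3 a b c d e f 0 0 1 ∈ isomGroup) (u v : ℂ) :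
    mat3 a b c d e f 0 0 1 * lieElt 0 0 0 u v * (mat3 a b c d e f 0 0 1)⁻¹
      = mat3 0 0 (a * u + b * v) 0 0 (d * u + e * v) 0 0 0 := by
  have hu := (Matrix.isUnit_iff_isUnit_det _).1 (isUnit_of_mem hg)
  have h : mat3 a b c d e f 0 0 1 * lieElt 0 0 0 u v
      = mat3 0 0 (a * u + b * v) 0 0 (d * u + e * v) 0 0 0 * mat3 a b c d e f 0 0 1 := by
    rw [lieElt, mat3_mul, mat3_mul, mat3_inj]
    refine ⟨?_, ?_, ?_, ?_, ?_, ?_, ?_, ?_, ?_⟩ <;> simp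
  rw [h, Matrix.mul_nonsing_inv_cancel_right _ _ hu]

theorem unitary_mul {a b d e : ℂ}
    (h : a * starRingEnd ℂ a + b * starRingEnd ℂ b = 1 ∧ a * starRingEnd ℂ d + b * starRingEnd ℂ e = 0 ∧
      d * starRingEnd ℂ a + e * starRingEnd ℂ b = 0 ∧ d * starRingEnd ℂ d + e * starRingEnd ℂ e = 1) :
    starRingEnd ℂ a * a + starRingEnd ℂ d * d = 1 ∧ starRingEnd ℂ a * b + starRingEnd ℂ d * e = 0 ∧
      starRingEnd ℂ b * a + starRingEnd ℂ e * d = 0 ∧ starRingEnd ℂ b * b + starRingEnd ℂ e * e = 1 := by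
  have h1 : mat2 a b d e * mat2 (starRingEnd ℂ a) (starRingEnd ℂ d) (starRingEnd ℂ b)
      (starRingEnd ℂ e) = 1 := by
    rw [mat2_mul, one_eq_mat2, mat2_inj]
    exact h
  have h2 := mul_eq_one_comm.1 h1
  rwa [mat2_mul, one_eq_mat2, mat2_inj] at h2

end EuclideanPlane

end

noncomputable section

namespace EuclideanPlane

theorem exists_section :
    ∃ s : Matrix (Fin 2 ⊕ Fin 1) (Fin 2 ⊕ Fin 1) ℂ → Matrix (Fin 2 ⊕ Fin 1) (Fin 2 ⊕ Fin 1) ℂ,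
      ∀ᶠ p in 𝓝 base, ContDiffAt ℝ ∞ s p ∧
        ((∃ g ∈ isomGroup, p = g * base * g⁻¹) → s p ∈ isomGroup ∧ s p * base * (s p)⁻¹ = p) := by
  refine ⟨fun p => mat3 1 0 (I * p (.inl 0) (.inr 0)) 0 1 (I * p (.inl 1) (.inr 0)) 0 0 1,
    Eventually.of_forall fun p => ⟨?_, ?_⟩⟩
  · have hent : ∀ i j, ContDiffAt ℝ ∞
        (fun p : Matrix (Fin 2 ⊕ Fin 1) (Fin 2 ⊕ Fin 1) ℂ => I * p i j) p :=
      fun i j => contDiffAt_const.mul (contDiff_entry i j).contDiffAt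
    exact contDiffAt_mat3 contDiffAt_const contDiffAt_const (hent _ _) contDiffAt_const
      contDiffAt_const (hent _ _) contDiffAt_const contDiffAt_const contDiffAt_const
  · rintro ⟨g, hg, hp⟩
    obtain ⟨a, b, c, d, e, f, rfl⟩ := exists_isomGroup hg
    rw [orbit_eq hg] at hp
    have hc : I * p (.inl 0) (.inr 0) = c := by
      rw [hp]
      change I * -(I * c) = c
      linear_combination (-c) * I_mul_I
    have hf : I * p (.inl 1) (.inr 0) = f := by
      rw [hp]
      change I * -(I * f) = f
      linear_combination (-f) * I_mul_I
    have hmem : mat3 1 0 c 0 1 f 0 0 1 ∈ isomGroup := by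
      rw [mem_isomGroup_iff]; simp
    simp only [hc, hf]
    exact ⟨hmem, by rw [orbit_eq hmem, hp]⟩

/-- The Hermitian pairing of matrices. -/
def pairing : Matrix (Fin 2 ⊕ Fin 1) (Fin 2 ⊕ Fin 1) ℂ →L[ℝ]
    Matrix (Fin 2 ⊕ Fin 1) (Fin 2 ⊕ Fin 1) ℂ →L[ℝ] ℝ :=
  (traceForm 1).comp conjTransposeL

theorem pairing_apply (V W : Matrix (Fin 2 ⊕ Fin 1) (Fin 2 ⊕ Fin 1) ℂ) :
    pairing V W = (Matrix.trace (Vᴴ * W)).re := one_mul _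

theorem pairing_mat3 (u v u' v' : ℂ) :
    pairing (mat3 0 0 u 0 0 v 0 0 0) (mat3 0 0 u' 0 0 v' 0 0 0)
      = (starRingEnd ℂ u * u' + starRingEnd ℂ v * v').re := by
  rw [pairing_apply, mat3_conjTranspose, mat3_mul, mat3_trace]
  simp

theorem lieElt_eq (u v : ℂ) : lieElt 0 0 0 u v = mat3 0 0 u 0 0 v 0 0 0 := by
  rw [lieElt]; simp

/-- The Euclidean complex plane. -/
def hermitianModel : HermitianModel (Matrix (Fin 2 ⊕ Fin 1) (Fin 2 ⊕ Fin 1) ℂ) where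
  G := isomGroup
  𝔤 := isomLie
  τ := LinearMap.toContinuousLinearMap tauConj
  Y := base
  ε := frame
  metric V W := pairing V W
  inv g := g⁻¹
  B := pairing
  metric_eq _ _ := rfl
  inv_eq g := Matrix.nonsing_inv_eq_ringInverse g
  one_mem := isMatrixGroup.one_mem
  mul_mem := isMatrixGroup.mul_mem
  inv_mem := isMatrixGroup.inv_mem
  isUnit := isMatrixGroup.isUnit
  lie_mem := isMatrixGroup.lie_mem
  mem_of_isParallelAt := isMatrixGroup.mem_of_isParallelAt
  mem_of_hasDerivAt := isMatrixGroup.mem_of_hasDerivAt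
  τ_four := tauConj_four
  τ_lie := tauConj_lie
  τ_mem {X} hX := by
    obtain ⟨x, y, b, u, v, rfl⟩ := exists_lieElt hX
    exact (tau_lieElt x y b u v).symm ▸ lieElt_mem _ _ _ _ _
  Y_mem := base_eq ▸ lieElt_mem _ _ _ _ _
  τ_Y := by
    change tauConj base = -base
    rw [base_eq, tau_lieElt, neg_lieElt]
    simp
  exists_section := exists_section
  lie_Y {X} hX h := by
    obtain ⟨x, y, b, u, v, rfl⟩ := exists_lieElt hX
    have h1 := (tau_lieElt x y b u v).symm.trans h
    obtain ⟨-, -, -, hu, hv⟩ := lieElt_inj h1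
    have hc := congrArg (starRingEnd ℂ) hv
    simp only [map_neg, conj_conj] at hc
    have hu0 : u = 0 := by linear_combination -(hu + hc) / 2
    have hv0 : v = 0 := by rw [hu0] at hv; simpa using hv.symm
    refine (base_lie x y b u v).trans ?_
    rw [hu0, hv0, mul_zero, zero_eq_lieElt]
  eq_smul_Y {X} hX h := by
    obtain ⟨x, y, b, u, v, rfl⟩ := exists_lieElt hX
    have h1 := (tau_lieElt x y b u v).symm.trans (h.trans (neg_lieElt x y b u v))
    obtain ⟨hx, -, hb, hu, hv⟩ := lieElt_inj h1
    have hx' : y = x := by linarith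
    have hb0 : b = 0 := by linear_combination hb / 2
    have hc := congrArg (starRingEnd ℂ) hv
    simp only [map_neg, conj_conj] at hc
    have hu0 : u = 0 := by linear_combination (hu - hc) / 2
    have hv0 : v = 0 := by rw [hu0] at hv; simpa using hv
    refine ⟨x, ?_⟩
    rw [base_eq, smul_lieElt, hx', hb0, hu0, hv0]
    simp
  eq_frame {X} hX h := by
    obtain ⟨u, v, rfl⟩ := exists_of_tau_tau hX h
    exact ⟨![u, v], (sum_frame ![u, v]).symm⟩
  ε_mem i := by
    fin_cases i
    · exact frame_zero ▸ lieElt_mem _ _ _ _ _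
    · exact frame_one ▸ lieElt_mem _ _ _ _ _
  τ_ε_zero := by
    change tauConj (frame 0) = -frame 1
    rw [frame_zero, frame_one, tau_lieElt, neg_lieElt]
    simp
  τ_ε_one := by
    change tauConj (frame 1) = frame 0
    rw [frame_zero, frame_one, tau_lieElt]
    simp
  lie_lie_ε i := by
    have key : ∀ u v : ℂ, base * (base * lieElt 0 0 0 u v - lieElt 0 0 0 u v * base)
        - (base * lieElt 0 0 0 u v - lieElt 0 0 0 u v * base) * base = -lieElt 0 0 0 u v := by
      intro u v
      rw [base_lie, base_lie, neg_lieElt]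
      congr 1
      · simp
      · simp
      · simp
      · linear_combination u * I_mul_I
      · linear_combination v * I_mul_I
    fin_cases i
    · exact frame_zero ▸ key _ _
    · exact frame_one ▸ key _ _
  metric_symm V W := by
    rw [pairing_apply, pairing_apply, ← Matrix.conjTranspose_conjTranspose W,
      ← Matrix.conjTranspose_mul, Matrix.trace_conjTranspose, Matrix.conjTranspose_conjTranspose]
    exact (conj_re _).symm
  metric_frame c d := by
    refine (congrArg₂ (fun V W => pairing V W) (sum_frame c) (sum_frame d)).trans ?_
    rw [lieElt_eq, lieElt_eq, pairing_mat3, Fin.sum_univ_two]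
    simp
  metric_act {g v w} hg hv hv' hw hw' := by
    obtain ⟨u, v, rfl⟩ := exists_of_tau_tau hv hv'
    obtain ⟨u', v', rfl⟩ := exists_of_tau_tau hw hw'
    obtain ⟨a, b, c, d, e, f, rfl⟩ := exists_isomGroup hg
    obtain ⟨h1, h2, h3, h4⟩ := unitary_mul (mem_isomGroup_iff.1 hg).1
    rw [conj_tangent hg, conj_tangent hg, lieElt_eq, lieElt_eq, pairing_mat3, pairing_mat3]
    congr 1
    simp only [map_add, map_mul]
    linear_combination starRingEnd ℂ u * u' * h1 + starRingEnd ℂ u * v' * h2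
      + starRingEnd ℂ v * u' * h3 + starRingEnd ℂ v * v' * h4
  metric_act_lie {g u v w} hg hu hu' hv hv' hw hw' := by
    obtain ⟨u, u', rfl⟩ := exists_of_tau_tau hu hu'
    obtain ⟨v, v', rfl⟩ := exists_of_tau_tau hv hv'
    obtain ⟨w, w', rfl⟩ := exists_of_tau_tau hw hw'
    have h : lieElt 0 0 0 v v' * lieElt 0 0 0 w w' - lieElt 0 0 0 w w' * lieElt 0 0 0 v v' = 0 := by
      rw [lieElt_eq, lieElt_eq, mat3_mul, mat3_mul, mat3_sub, zero_eq_mat3, mat3_inj]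
      simp
    rw [h, mul_zero, zero_mul]
    exact map_zero _

theorem isModelledOn : euclideanModel.IsModelledOn hermitianModel where
  G_eq := by
    change isomGroup = {g | ∃ A ∈ Matrix.unitaryGroup (Fin 2) ℂ, ∃ u : Matrix (Fin 2) (Fin 1) ℂ,
      g = Matrix.fromBlocks A u 0 1}
    ext g
    rw [mem_ofPred_eq]
    have hone : !![(1 : ℂ)] = 1 := by
      ext i j; fin_cases i; fin_cases j; rfl
    have hzero : !![(0 : ℂ), 0] = 0 := by
      ext i j; fin_cases i; fin_cases j <;> rfl
    constructor
    · intro hg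
      obtain ⟨a, b, c, d, e, f, rfl⟩ := exists_isomGroup hg
      refine ⟨mat2 a b d e, ?_, !![c; f], ?_⟩
      · rw [Matrix.mem_unitaryGroup_iff, Matrix.star_eq_conjTranspose, mat2_conjTranspose, mat2_mul,
          one_eq_mat2, mat2_inj]
        exact (mem_isomGroup_iff.1 hg).1
      · rw [mat3, mat2, hone, hzero]
    · rintro ⟨A, hA, u, rfl⟩
      obtain ⟨a, b, d, e, rfl⟩ := exists_mat2 A
      rw [Matrix.mem_unitaryGroup_iff, Matrix.star_eq_conjTranspose, mat2_conjTranspose, mat2_mul,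
        one_eq_mat2, mat2_inj] at hA
      have hu : u = !![u 0 0; u 1 0] := by
        ext i j; fin_cases i <;> fin_cases j <;> rfl
      have : Matrix.fromBlocks (mat2 a b d e) u 0 1 = mat3 a b (u 0 0) d e (u 1 0) 0 0 1 := by
        conv_lhs => rw [hu]
        rw [mat3, mat2, hone, hzero]
      rw [this, mem_isomGroup_iff]
      exact ⟨hA, rfl, rfl, rfl⟩
  τ_eq _ := rfl
  Y_eq := by
    change base = Matrix.fromBlocks (I • 1) 0 0 0
    ext i j
    rcases i with i | i <;> rcases j with j | j <;> fin_cases i <;> fin_cases j <;>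
      simp [base, mat3]
  ε_eq := by
    change frame = ![Matrix.fromBlocks 0 !![1; 0] 0 0, Matrix.fromBlocks 0 !![0; 1] 0 0]
    funext k
    fin_cases k <;> ext i j <;> rcases i with i | i <;> rcases j with j | j <;> fin_cases i <;>
      fin_cases j <;> simp [frame, mat3]
  metric_eq := by
    funext V W
    exact pairing_apply V W
  inv_eq := rfl

end EuclideanPlane

end

noncomputable section

/-! ### Homogeneous tori -/

section AnalyticZeros

theorem countable_zeros_of_analytic {V : Type*} [NormedAddCommGroup V] [NormedSpace ℝ V]
    {f : ℝ → V} (hf : AnalyticOnNhd ℝ f univ) {x : ℝ} (hx : f x ≠ 0) : {t | f t = 0}.Countable := by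
  have key : ∀ t, ∀ᶠ y in 𝓝[≠] t, f y ≠ 0 := fun t => by
    by_contra h
    have h1 : ∃ᶠ y in 𝓝[≠] t, f y = 0 := by
      simpa only [Filter.not_eventually, not_not] using h
    exact hx (hf.eqOn_zero_of_preconnected_of_frequently_eq_zero isPreconnected_univ (mem_univ t) h1
      (mem_univ x))
  have hd : DiscreteTopology {t | f t = 0} := by
    rw [discreteTopology_subtype_iff]
    intro t _
    refine disjoint_iff.1 (Filter.disjoint_principal_right.2 ?_)
    filter_upwards [key t] with y hy using hy
  have : Countable {t | f t = 0} := countable_of_Lindelof_of_discrete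
  exact this

end AnalyticZeros

section Exponentials

variable {R : Type*} [NormedRing R] [NormedAlgebra ℝ R] [CompleteSpace R]

theorem exp_add_of_commute_real {X Z : R} (h : Commute X Z) :
    NormedSpace.exp (X + Z) = NormedSpace.exp X * NormedSpace.exp Z := by
  let _ : NormedAlgebra ℚ R := NormedAlgebra.restrictScalars ℚ ℝ R
  exact NormedSpace.exp_add_of_commute h

theorem isUnit_exp_real (X : R) : IsUnit (NormedSpace.exp X) := by
  let _ : NormedAlgebra ℚ R := NormedAlgebra.restrictScalars ℚ ℝ R
  exact NormedSpace.isUnit_exp X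

/-- The linear form `x X₁ + y X₂`. -/
def linForm (X₁ X₂ : R) : ℂ →L[ℝ] R := reCLM.smulRight X₁ + imCLM.smulRight X₂

omit [CompleteSpace R] in
theorem linForm_apply (X₁ X₂ : R) (z : ℂ) : linForm X₁ X₂ z = z.re • X₁ + z.im • X₂ := rfl

theorem exp_linForm {X₁ X₂ : R} (h : Commute X₁ X₂) (z : ℂ) : NormedSpace.exp (linForm X₁ X₂ z)
    = NormedSpace.exp (z.re • X₁) * NormedSpace.exp (z.im • X₂) := by
  rw [linForm_apply]
  exact exp_add_of_commute_real ((h.smul_left _).smul_right _)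

theorem isParallelAt_exp_linForm {X₁ X₂ : R} (h : Commute X₁ X₂) (z : ℂ) :
    IsParallelAt (fun _ => linForm X₁ X₂) (fun z => NormedSpace.exp (linForm X₁ X₂ z)) z := by
  have h1 : HasFDerivAt (fun z : ℂ => NormedSpace.exp (z.re • X₁)) _ z :=
    (hasDerivAt_exp_smul_const X₁ z.re).hasFDerivAt.comp z reCLM.hasFDerivAt
  have h2 : HasFDerivAt (fun z : ℂ => NormedSpace.exp (z.im • X₂)) _ z :=
    (hasDerivAt_exp_smul_const X₂ z.im).hasFDerivAt.comp z imCLM.hasFDerivAt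
  have h3 := h1.mul' h2
  have he : (fun z => NormedSpace.exp (linForm X₁ X₂ z))
      = fun z : ℂ => NormedSpace.exp (z.re • X₁) * NormedSpace.exp (z.im • X₂) :=
    funext (exp_linForm h)
  rw [IsParallelAt, he]
  refine h3.congr_fderiv ?_
  ext v
  have hc : X₁ * NormedSpace.exp (z.im • X₂) = NormedSpace.exp (z.im • X₂) * X₁ :=
    (h.smul_right z.im).exp_right.eq
  rw [exp_linForm h]
  simp [linForm_apply, mul_add, mul_assoc, hc, add_comm]

theorem eq_mul_exp_of_hasDerivAt {γ : ℝ → R} {X : R} (h : ∀ t, HasDerivAt γ (γ t * X) t) (t : ℝ) :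
    γ t = γ 0 * NormedSpace.exp (t • X) := by
  have h1 : ∀ s ∈ (univ : Set ℝ), IsParallelAt (fun _ => (1 : ℝ →L[ℝ] ℝ).smulRight X) γ s :=
    fun s _ => (h s).hasFDerivAt.congr_fderiv (by ext; simp)
  have h2 : ∀ s ∈ (univ : Set ℝ), IsParallelAt (fun _ => (1 : ℝ →L[ℝ] ℝ).smulRight X)
      (fun s => NormedSpace.exp (s • X)) s :=
    fun s _ => (hasDerivAt_exp_smul_const X s).hasFDerivAt.congr_fderiv (by ext; simp)
  have hu : ∀ s ∈ (univ : Set ℝ), IsUnit (NormedSpace.exp (s • X)) :=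
    fun s _ => isUnit_exp_real _
  have h3 := IsParallelAt.mul_inverse_eqOn isOpen_univ isPreconnected_univ h1 h2 hu (mem_univ t)
    (mem_univ 0)
  rw [zero_smul, NormedSpace.exp_zero, Ring.inverse_one, mul_one] at h3
  rw [← h3, mul_assoc, Ring.inverse_mul_cancel _ (hu t (mem_univ t)), mul_one]

end Exponentials

namespace HermitianModel

variable {R : Type} [NormedRing R] [NormedAlgebra ℝ R] [CompleteSpace R] {S : HermitianModel R}
  {X₁ X₂ : R}

theorem logFDeriv_exp_linForm (h : Commute X₁ X₂) (z : ℂ) :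
    logFDeriv (fun z => NormedSpace.exp (linForm X₁ X₂ z)) z = linForm X₁ X₂ :=
  (isParallelAt_exp_linForm h z).logFDeriv_eq (isUnit_exp_real _)

theorem isLagrangianLift_exp (h₁ : X₁ ∈ S.𝔤) (h₂ : X₂ ∈ S.𝔤) (h : Commute X₁ X₂)
    (htw : S.projML X₂ = -S.τ (S.projML X₁)) (h0 : S.projML X₁ ≠ 0) :
    S.IsLagrangianLift (fun z => NormedSpace.exp (linForm X₁ X₂ z))
      (S.proj fun z => NormedSpace.exp (linForm X₁ X₂ z)) univ := by
  rw [isLagrangianLift_iff isOpen_univ]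
  refine ⟨⟨(contDiff_exp.comp (linForm X₁ X₂).contDiff).contDiffOn, fun z _ => ?_, fun _ _ => rfl⟩,
    fun z _ => ?_, fun z _ => ?_⟩
  · exact exp_mem (S.𝔤.add_mem (S.𝔤.smul_mem _ h₁) (S.𝔤.smul_mem _ h₂))
  · rw [logFDeriv_exp_linForm h, linForm_apply, linForm_apply]
    simpa using htw
  · rw [logFDeriv_exp_linForm h, linForm_apply]
    simpa using h0

theorem isHSL_exp (h₁ : X₁ ∈ S.𝔤) (h₂ : X₂ ∈ S.𝔤) (h : Commute X₁ X₂)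
    (htw : S.projML X₂ = -S.τ (S.projML X₁)) (h0 : S.projML X₁ ≠ 0) :
    S.IsHSL (S.proj fun z => NormedSpace.exp (linForm X₁ X₂ z)) univ := by
  refine (isLagrangianLift_exp h₁ h₂ h htw h0).isHSL isOpen_univ fun z _ => ?_
  rw [divβ, show logFDeriv (fun z => NormedSpace.exp (linForm X₁ X₂ z)) = fun _ => linForm X₁ X₂ from
    funext (logFDeriv_exp_linForm h)]
  simp

omit [CompleteSpace R] in
theorem act_eq_self_iff {g X : R} (hg : g ∈ S.G) : S.act g X = X ↔ Commute g X := by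
  constructor
  · intro h
    have : g * X * S.inv g * g = X * g := congrArg (· * g) h
    rwa [mul_assoc, S.inv_mul_cancel hg, mul_one] at this
  · intro h
    rw [act, h.eq, mul_assoc, S.mul_inv_cancel hg, mul_one]

theorem proj_exp_add (h₁ : X₁ ∈ S.𝔤) (h₂ : X₂ ∈ S.𝔤) (h : Commute X₁ X₂) {w₀ : ℂ}
    (hw₀ : Commute (NormedSpace.exp (linForm X₁ X₂ w₀)) S.Y) (z : ℂ) :
    S.proj (fun z => NormedSpace.exp (linForm X₁ X₂ z)) (z + w₀)
      = S.proj (fun z => NormedSpace.exp (linForm X₁ X₂ z)) z := by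
  have hm : ∀ z, NormedSpace.exp (linForm X₁ X₂ z) ∈ S.G := fun z =>
    exp_mem (S.𝔤.add_mem (S.𝔤.smul_mem _ h₁) (S.𝔤.smul_mem _ h₂))
  have hc : ∀ z w, Commute (linForm X₁ X₂ z) (linForm X₁ X₂ w) := fun z w => by
    rw [linForm_apply, linForm_apply]
    have e1 := ((Commute.refl X₁).smul_left z.re).smul_right w.re
    have e2 := (h.smul_left z.re).smul_right w.im
    have e3 := (h.symm.smul_left z.im).smul_right w.re
    have e4 := ((Commute.refl X₂).smul_left z.im).smul_right w.im
    exact (e1.add_right e2).add_left (e3.add_right e4)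
  change S.act (NormedSpace.exp (linForm X₁ X₂ (z + w₀))) S.Y = S.act _ S.Y
  rw [map_add, exp_add_of_commute_real (hc z w₀), S.act_mul (hm z) (hm w₀),
    (act_eq_self_iff (hm w₀)).2 hw₀]

theorem IsExtendedSolution.commute_of_periodic (h₁ : X₁ ∈ S.𝔤) (h₂ : X₂ ∈ S.𝔤) (h : Commute X₁ X₂)
    {l : Circle} {Fl : ℂ → R}
    (hl : S.IsExtendedSolution (fun z => NormedSpace.exp (linForm X₁ X₂ z)) l Fl univ) {T : ℝ}
    (hT : S.proj Fl (0 + T) = S.proj Fl 0) :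
    Commute (NormedSpace.exp (T • S.extend (l : ℂ).re (l : ℂ).im X₁ X₂)) S.Y := by
  obtain ⟨-, hm, hp⟩ := (isExtendedSolution_iff isOpen_univ).1 hl
  have hd : ∀ t : ℝ, HasDerivAt (fun t : ℝ => Fl t)
      (Fl t * S.extend (l : ℂ).re (l : ℂ).im X₁ X₂) t := by
    intro t
    have h3 := HasFDerivAt.comp_hasDerivAt t (hp t (mem_univ _)) Complex.ofRealCLM.hasDerivAt
    refine h3.congr_deriv ?_
    change Fl t * S.extendForm (l : ℂ).re (l : ℂ).im
      (logFDeriv (fun z => NormedSpace.exp (linForm X₁ X₂ z)) t) (ofRealCLM 1) = _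
    rw [logFDeriv_exp_linForm h, extendForm_apply]
    simp [linForm_apply]
  have he := eq_mul_exp_of_hasDerivAt hd T
  have hE := exp_mem (S.𝔤.smul_mem T (extend_mem (l : ℂ).re (l : ℂ).im h₁ h₂))
  rw [zero_add, proj, proj, he, ofReal_zero, S.act_mul (hm 0 (mem_univ _)) hE] at hT
  have := congrArg (S.act (S.inv (Fl 0))) hT
  rw [act_inv (hm 0 (mem_univ _)), act_inv (hm 0 (mem_univ _))] at this
  exact (act_eq_self_iff hE).1 this

theorem countable_setOf_commute {T θ : ℝ}
    (hθ : ¬ Commute (NormedSpace.exp (T • S.extend (Real.cos θ) (Real.sin θ) X₁ X₂)) S.Y) :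
    {l : Circle |
      Commute (NormedSpace.exp (T • S.extend (l : ℂ).re (l : ℂ).im X₁ X₂)) S.Y}.Countable := by
  let f : ℝ → R := fun θ => NormedSpace.exp (T • S.extend (Real.cos θ) (Real.sin θ) X₁ X₂) * S.Y
    - S.Y * NormedSpace.exp (T • S.extend (Real.cos θ) (Real.sin θ) X₁ X₂)
  have hcos : ∀ t, AnalyticAt ℝ Real.cos t := fun t => Real.analyticAt_cos
  have hsin : ∀ t, AnalyticAt ℝ Real.sin t := fun t => Real.analyticAt_sin
  have hexp : ∀ t, AnalyticAt ℝ
      (fun θ => NormedSpace.exp (T • S.extend (Real.cos θ) (Real.sin θ) X₁ X₂)) t := by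
    intro t
    have h1 : AnalyticAt ℝ (fun θ => T • S.extend (Real.cos θ) (Real.sin θ) X₁ X₂) t := by
      simp only [extend_eq]
      have hc := hcos t
      have hs := hsin t
      fun_prop
    exact (NormedSpace.exp_analytic _).comp h1
  have hf : AnalyticOnNhd ℝ f univ := fun t _ =>
    ((hexp t).mul analyticAt_const).sub (analyticAt_const.mul (hexp t))
  have h0 : f θ ≠ 0 := fun h => hθ (sub_eq_zero.1 h)
  refine ((countable_zeros_of_analytic hf h0).image Circle.exp).mono fun l hl => ?_
  refine ⟨Complex.arg l, ?_, Circle.exp_arg l⟩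
  have hl' : (l : ℂ) = Complex.exp (Complex.arg l * I) := by
    rw [← Circle.coe_exp, Circle.exp_arg]
  have hre : (l : ℂ).re = Real.cos (Complex.arg l) := by
    conv_lhs => rw [hl', exp_ofReal_mul_I_re]
  have him : (l : ℂ).im = Real.sin (Complex.arg l) := by
    conv_lhs => rw [hl', exp_ofReal_mul_I_im]
  rw [mem_ofPred_eq, hre, him] at hl
  exact sub_eq_zero.2 hl

omit [CompleteSpace R] in
/-- The extended form at `λ = e^{iπ/4}`. -/
theorem extend_pi_div_four {P Q A : R} {p q : ℝ} (hP : S.τ P = P) (hQ : S.τ Q = Q)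
    (hA : S.τ (S.τ A) = -A) :
    S.extend (Real.cos (Real.pi / 4)) (Real.sin (Real.pi / 4)) (P + A + p • S.Y)
      (Q - S.τ A + q • S.Y) = P + (√2 / 2) • (A + S.τ A) - q • S.Y := by
  have hA' : S.τ (S.τ (S.τ A)) = -S.τ A := by rw [hA, map_neg]
  have h1 : S.projZero (P + A + p • S.Y) = P := by
    rw [map_add, map_add, map_smul, projZero_of_fixed hP, projZero_of_mem hA,
      projZero_of_neg S.τ_Y]
    simp
  have h2 : S.projML (P + A + p • S.Y) = A := by
    rw [map_add, map_add, map_smul, projML_of_fixed hP, projML_of_mem hA, projML_of_neg S.τ_Y]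
    simp
  have h3 : S.projML (Q - S.τ A + q • S.Y) = -S.τ A := by
    rw [map_add, map_sub, map_smul, projML_of_fixed hQ, projML_of_mem hA', projML_of_neg S.τ_Y]
    simp
  have h4 : S.β (Q - S.τ A + q • S.Y) = q := by
    rw [map_add, map_sub, map_smul, S.β_Y, S.β_of_projTwo (projTwo_of_fixed hQ),
      S.β_of_projTwo (projTwo_of_mem hA')]
    simp
  have h5 : (√2 / 2) * (√2 / 2) = (1 / 2 : ℝ) := by
    have := Real.mul_self_sqrt (show (0 : ℝ) ≤ 2 by norm_num)
    linarith
  rw [extend_eq, h1, h2, h3, h4, Real.cos_pi_div_four, Real.sin_pi_div_four, mul_assoc 2, h5]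
  module

/-- The data of a homogeneous torus `exp (x X₁ + y X₂)`, with `X₁ = P + ε₁ + p Y`,
`X₂ = Q + ε₂ + q Y` and the periods `T₁` and `i T₂`, the deformation of which with the parameter
`e^{iπ/4}` does not have the period `T₁`. -/
structure TorusData (S : HermitianModel R) where
  /-- the fixed part of `X₁` -/
  P : R
  /-- the fixed part of `X₂` -/
  Q : R
  /-- the coefficient of `Y` in `X₁` -/
  p : ℝ
  /-- the coefficient of `Y` in `X₂` -/
  q : ℝ
  /-- the real period -/
  T₁ : ℝ
  /-- the imaginary period -/
  T₂ : ℝ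
  P_mem : P ∈ S.𝔤
  Q_mem : Q ∈ S.𝔤
  τ_P : S.τ P = P
  τ_Q : S.τ Q = Q
  commute : Commute (P + S.ε 0 + p • S.Y) (Q + S.ε 1 + q • S.Y)
  T₁_ne_zero : T₁ ≠ 0
  T₂_ne_zero : T₂ ≠ 0
  commute_exp₁ : Commute (NormedSpace.exp (T₁ • (P + S.ε 0 + p • S.Y))) S.Y
  commute_exp₂ : Commute (NormedSpace.exp (T₂ • (Q + S.ε 1 + q • S.Y))) S.Y
  not_commute :
    ¬ Commute (NormedSpace.exp (T₁ • (P + (√2 / 2) • (S.ε 0 - S.ε 1) - q • S.Y))) S.Y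

end HermitianModel

namespace SymmetricModel

variable {S : SymmetricModel} {H : HermitianModel S.Mat}

theorem IsModelledOn.exists_torus (h : S.IsModelledOn H) (D : H.TorusData) :
    ∃ (f F : ℂ → S.Mat) (ω₁ ω₂ : ℂ), LinearIndependent ℝ ![ω₁, ω₂] ∧
      S.IsHSL f Set.univ ∧ S.IsBiperiodic f ω₁ ω₂ ∧ S.IsLagrangianLift F f Set.univ ∧
      {l : Circle | ∃ Fl : ℂ → S.Mat, S.IsExtendedSolution F l Fl Set.univ ∧
        S.IsBiperiodic (S.proj Fl) ω₁ ω₂}.Countable := by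
  obtain ⟨P, Q, p, q, T₁, T₂, hP, hQ, hPτ, hQτ, hcomm, hT₁, hT₂, h₁, h₂, hnot⟩ := D
  have hm₁ : P + H.ε 0 + p • H.Y ∈ H.𝔤 :=
    H.𝔤.add_mem (H.𝔤.add_mem hP (H.ε_mem 0)) (H.𝔤.smul_mem p H.Y_mem)
  have hm₂ : Q + H.ε 1 + q • H.Y ∈ H.𝔤 :=
    H.𝔤.add_mem (H.𝔤.add_mem hQ (H.ε_mem 1)) (H.𝔤.smul_mem q H.Y_mem)
  have hε₀ : H.τ (H.τ (H.ε 0)) = -H.ε 0 := by rw [H.τ_ε_zero, map_neg, H.τ_ε_one]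
  have hε₁ : H.τ (H.τ (H.ε 1)) = -H.ε 1 := by rw [H.τ_ε_one, H.τ_ε_zero]
  have hM₁ : H.projML (P + H.ε 0 + p • H.Y) = H.ε 0 := by
    rw [map_add, map_add, map_smul, HermitianModel.projML_of_fixed hPτ,
      HermitianModel.projML_of_mem hε₀, HermitianModel.projML_of_neg H.τ_Y, zero_add, smul_zero,
      add_zero]
  have hM₂ : H.projML (Q + H.ε 1 + q • H.Y) = H.ε 1 := by
    rw [map_add, map_add, map_smul, HermitianModel.projML_of_fixed hQτ,
      HermitianModel.projML_of_mem hε₁, HermitianModel.projML_of_neg H.τ_Y, zero_add, smul_zero,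
      add_zero]
  have htw : H.projML (Q + H.ε 1 + q • H.Y) = -H.τ (H.projML (P + H.ε 0 + p • H.Y)) := by
    rw [hM₁, hM₂, H.τ_ε_zero, neg_neg]
  have h0 : H.projML (P + H.ε 0 + p • H.Y) ≠ 0 := by
    rw [hM₁]; exact H.ε_ne_zero 0
  have hext : H.extend (Real.cos (Real.pi / 4)) (Real.sin (Real.pi / 4)) (P + H.ε 0 + p • H.Y)
      (Q + H.ε 1 + q • H.Y) = P + (√2 / 2) • (H.ε 0 - H.ε 1) - q • H.Y := by
    have := HermitianModel.extend_pi_div_four (p := p) (q := q) hPτ hQτ hε₀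
    rwa [H.τ_ε_zero, sub_neg_eq_add, ← sub_eq_add_neg] at this
  rw [← hext] at hnot
  generalize P + H.ε 0 + p • H.Y = X₁ at *
  generalize Q + H.ε 1 + q • H.Y = X₂ at *
  have hL := HermitianModel.isLagrangianLift_exp hm₁ hm₂ hcomm htw h0
  have hS := h.isLagrangianLift.1 hL
  have hper₁ : Commute (NormedSpace.exp (linForm X₁ X₂ (T₁ : ℂ))) H.Y := by
    rw [linForm_apply]; simp; exact h₁
  have hper₂ : Commute (NormedSpace.exp (linForm X₁ X₂ (T₂ * I : ℂ))) H.Y := by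
    rw [linForm_apply]; simp; exact h₂
  refine ⟨_, _, T₁, T₂ * I, ?_, h.isHSL.1 (HermitianModel.isHSL_exp hm₁ hm₂ hcomm htw h0),
    fun z => ⟨HermitianModel.proj_exp_add hm₁ hm₂ hcomm hper₁ z,
      HermitianModel.proj_exp_add hm₁ hm₂ hcomm hper₂ z⟩, hS, ?_⟩
  · rw [LinearIndependent.pair_iff]
    intro s t hst
    have h1 := congrArg re hst
    have h2 := congrArg im hst
    simp at h1 h2
    exact ⟨h1.resolve_right hT₁, h2.resolve_right hT₂⟩
  · refine (HermitianModel.countable_setOf_commute hnot).mono ?_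
    rintro l ⟨Fl, hFl, hb⟩
    refine HermitianModel.IsExtendedSolution.commute_of_periodic hm₁ hm₂ hcomm
      ((h.isExtendedSolution isOpen_univ hS l).2 hFl) ?_
    rw [h.proj_eq]
    exact (hb 0).1

end SymmetricModel

end

noncomputable section

section ExponentialFormulas

variable {R : Type*} [NormedRing R] [NormedAlgebra ℂ R] [CompleteSpace R]

theorem hasDerivAt_cexp_mul (c : ℂ) (t : ℝ) :
    HasDerivAt (fun t : ℝ => Complex.exp (c * t)) (c * Complex.exp (c * t)) t := by
  have h : HasDerivAt (fun z : ℂ => Complex.exp (c * z)) (Complex.exp (c * t) * (c * 1)) (t : ℂ) :=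
    ((hasDerivAt_id (t : ℂ)).const_mul c).cexp
  exact h.comp_ofReal.congr_deriv (by ring)

theorem hasDerivAt_csin_mul (m : ℂ) (t : ℝ) :
    HasDerivAt (fun t : ℝ => Complex.sin (m * t)) (m * Complex.cos (m * t)) t := by
  have h : HasDerivAt (fun z : ℂ => Complex.sin (m * z)) (Complex.cos (m * t) * (m * 1)) (t : ℂ) :=
    ((hasDerivAt_id (t : ℂ)).const_mul m).csin
  exact h.comp_ofReal.congr_deriv (by ring)

theorem hasDerivAt_ccos_mul (m : ℂ) (t : ℝ) :
    HasDerivAt (fun t : ℝ => Complex.cos (m * t)) (-(m * Complex.sin (m * t))) t := by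
  have h : HasDerivAt (fun z : ℂ => Complex.cos (m * z)) (-Complex.sin (m * t) * (m * 1)) (t : ℂ) :=
    ((hasDerivAt_id (t : ℂ)).const_mul m).ccos
  exact h.comp_ofReal.congr_deriv (by ring)

theorem exp_smul_of_mul_self {Z : R} {c c₀ : ℂ} (hc : c ≠ 0) (hZ : Z * Z = c • Z) (t : ℝ) :
    NormedSpace.exp ((t : ℂ) • (c₀ • 1 + Z))
      = Complex.exp (c₀ * t) • (1 + ((Complex.exp (c * t) - 1) / c) • Z) := by
  have h : ∀ t : ℝ, HasDerivAt
      (fun t : ℝ => Complex.exp (c₀ * t) • (1 + ((Complex.exp (c * t) - 1) / c) • Z))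
      (Complex.exp (c₀ * t) • (1 + ((Complex.exp (c * t) - 1) / c) • Z) * (c₀ • 1 + Z)) t := by
    intro t
    have h1 := ((((hasDerivAt_cexp_mul c t).sub_const 1).div_const c).smul_const Z).const_add 1
    refine ((hasDerivAt_cexp_mul c₀ t).fun_smul h1).congr_deriv ?_
    simp only [smul_mul_assoc, add_mul, mul_add, one_mul, mul_one, mul_smul_comm, hZ]
    match_scalars <;> field_simp <;> ring
  rw [Complex.coe_smul]
  have := eq_mul_exp_of_hasDerivAt h t
  simpa using this.symm

theorem exp_smul_of_cube {X : R} {m : ℂ} (hm : m ≠ 0) (hX : X * X * X = -(m ^ 2) • X) (t : ℝ) :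
    NormedSpace.exp ((t : ℂ) • X) = 1 + (Complex.sin (m * t) / m) • X
      + ((1 - Complex.cos (m * t)) / m ^ 2) • (X * X) := by
  have h : ∀ t : ℝ, HasDerivAt
      (fun t : ℝ => 1 + (Complex.sin (m * t) / m) • X
        + ((1 - Complex.cos (m * t)) / m ^ 2) • (X * X))
      ((1 + (Complex.sin (m * t) / m) • X
        + ((1 - Complex.cos (m * t)) / m ^ 2) • (X * X)) * X) t := by
    intro t
    have h1 := (((hasDerivAt_csin_mul m t).div_const m).smul_const X).const_add 1
    have h2 := (((hasDerivAt_ccos_mul m t).const_sub 1).div_const (m ^ 2)).smul_const (X * X)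
    refine (h1.fun_add h2).congr_deriv ?_
    simp only [smul_mul_assoc, add_mul, one_mul, hX]
    match_scalars <;> field_simp <;> ring
  rw [Complex.coe_smul]
  have := eq_mul_exp_of_hasDerivAt h t
  simpa using this.symm

theorem mul_exp_smul_of_sq {X Z : R} {m : ℂ} (hm : m ≠ 0) (hX : Z * X * X = -(m ^ 2) • Z) (t : ℝ) :
    Z * NormedSpace.exp ((t : ℂ) • X) = Complex.cos (m * t) • Z + (Complex.sin (m * t) / m) • (Z * X) := by
  have h : ∀ t : ℝ, HasDerivAt
      (fun t : ℝ => Complex.cos (m * t) • Z + (Complex.sin (m * t) / m) • (Z * X))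
      ((Complex.cos (m * t) • Z + (Complex.sin (m * t) / m) • (Z * X)) * X) t := by
    intro t
    have h1 := (hasDerivAt_ccos_mul m t).smul_const Z
    have h2 := ((hasDerivAt_csin_mul m t).div_const m).smul_const (Z * X)
    refine (h1.fun_add h2).congr_deriv ?_
    simp only [smul_mul_assoc, add_mul, hX]
    match_scalars <;> field_simp
  rw [Complex.coe_smul]
  have := eq_mul_exp_of_hasDerivAt h t
  simpa using this.symm

theorem mul_exp_smul_of_sq_eq_zero {X Z : R} (hX : Z * X * X = 0) (t : ℝ) :
    Z * NormedSpace.exp ((t : ℂ) • X) = Z + (t : ℂ) • (Z * X) := by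
  have h : ∀ t : ℝ, HasDerivAt (fun t : ℝ => Z + t • (Z * X)) ((Z + t • (Z * X)) * X) t := by
    intro t
    refine (((hasDerivAt_id t).smul_const (Z * X)).const_add Z).congr_deriv ?_
    rw [add_mul, smul_mul_assoc, hX]
    simp
  rw [Complex.coe_smul, Complex.coe_smul]
  have := eq_mul_exp_of_hasDerivAt h t
  simpa using this.symm

theorem sq_sqrt_two_div_two : (√2 / 2 : ℝ) ^ 2 = 1 / 2 := by
  rw [div_pow, Real.sq_sqrt (by norm_num)]
  norm_num

theorem matrix_real_smul {ι : Type} (t : ℝ) (X : Matrix ι ι ℂ) : t • X = (t : ℂ) • X := by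
  ext i j
  simp

variable {ι : Type} [Fintype ι] [DecidableEq ι]

theorem matrix_exp_of_mul_self {Z : Matrix ι ι ℂ} {c c₀ : ℂ} (hc : c ≠ 0) (hZ : Z * Z = c • Z)
    (t : ℝ) : NormedSpace.exp (t • (c₀ • 1 + Z))
      = Complex.exp (c₀ * t) • (1 + ((Complex.exp (c * t) - 1) / c) • Z) := by
  rw [matrix_real_smul]
  exact exp_smul_of_mul_self hc hZ t

theorem matrix_exp_of_cube {X : Matrix ι ι ℂ} {m : ℂ} (hm : m ≠ 0) (hX : X * X * X = -(m ^ 2) • X)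
    (t : ℝ) : NormedSpace.exp (t • X) = 1 + (Complex.sin (m * t) / m) • X
      + ((1 - Complex.cos (m * t)) / m ^ 2) • (X * X) := by
  rw [matrix_real_smul]
  exact exp_smul_of_cube hm hX t

theorem matrix_exp_two_pi_div {X : Matrix ι ι ℂ} {m : ℝ} (hm : m ≠ 0)
    (hX : X * X * X = -((m : ℂ) ^ 2) • X) : NormedSpace.exp ((2 * Real.pi / m) • X) = 1 := by
  have hm' : (m : ℂ) ≠ 0 := by exact_mod_cast hm
  have he : (m : ℂ) * (2 * Real.pi / m : ℝ) = 2 * Real.pi := by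
    rw [ofReal_div, mul_div_cancel₀ _ hm']
    push_cast
    ring
  rw [matrix_exp_of_cube hm' hX, he, Complex.sin_two_pi, Complex.cos_two_pi]
  simp

theorem matrix_mul_exp_of_sq {X Z : Matrix ι ι ℂ} {m : ℂ} (hm : m ≠ 0)
    (hX : Z * X * X = -(m ^ 2) • Z) (t : ℝ) : Z * NormedSpace.exp (t • X)
      = Complex.cos (m * t) • Z + (Complex.sin (m * t) / m) • (Z * X) := by
  rw [matrix_real_smul]
  exact mul_exp_smul_of_sq hm hX t

theorem matrix_mul_exp_of_sq_eq_zero {X Z : Matrix ι ι ℂ} (hX : Z * X * X = 0) (t : ℝ) :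
    Z * NormedSpace.exp (t • X) = Z + (t : ℂ) • (Z * X) := by
  rw [matrix_real_smul]
  exact mul_exp_smul_of_sq_eq_zero hX t

end ExponentialFormulas

namespace ProjectiveFamily

variable {κ : ℝ}

theorem eq_zero_of_commute_base {a b c d e f g h i : ℂ} (H : Commute (mat3 a b c d e f g h i) base) :
    c = 0 ∧ f = 0 := by
  have := H.eq
  rw [base, mat3_mul, mat3_mul, mat3_inj] at this
  obtain ⟨-, -, h1, -, -, h2, -⟩ := this
  constructor
  · linear_combination I * h1 + c * I_mul_I
  · linear_combination I * h2 + f * I_mul_I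

theorem commute_exp_first {x p : ℝ} (hx : 2 * x * (x - p) = κ) (hμ : 3 * x - p ≠ 0) :
    NormedSpace.exp ((2 * Real.pi / (3 * x - p)) • lieElt κ (x + p / 3) (-x + p / 3) 0 1 0)
      ∈ range fun c : ℂ => c • (1 : Matrix (Fin 2 ⊕ Fin 1) (Fin 2 ⊕ Fin 1) ℂ) := by
  have hx' : (2 * x * (x - p) : ℂ) = κ := by exact_mod_cast hx
  have hμ' : ((3 * x - p : ℝ) : ℂ) ≠ 0 := by exact_mod_cast hμ
  have hX : lieElt κ (x + p / 3) (-x + p / 3) 0 1 0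
      = (I * (-x + p / 3) : ℂ) • 1 + mat3 (2 * I * x) 0 1 0 0 0 (-κ) 0 (I * (x - p)) := by
    rw [lieElt, one_eq_mat3, mat3_csmul, mat3_add, mat3_inj]
    refine ⟨?_, ?_, ?_, ?_, ?_, ?_, ?_, ?_, ?_⟩ <;> simp <;> ring
  have hZ : mat3 (2 * I * x) 0 1 0 0 0 (-κ) 0 (I * (x - p))
      * mat3 (2 * I * x) 0 1 0 0 0 (-κ) 0 (I * (x - p))
      = (I * (3 * x - p : ℝ) : ℂ) • mat3 (2 * I * x) 0 1 0 0 0 (-κ) 0 (I * (x - p)) := by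
    rw [mat3_mul, mat3_csmul, mat3_inj]
    push_cast
    refine ⟨?_, by ring, by ring, by ring, by ring, by ring, by ring, by ring, ?_⟩
    · linear_combination hx' - 2 * x * (x - p) * I_mul_I
    · linear_combination hx' - 2 * x * (x - p) * I_mul_I
  have he : Complex.exp (I * (3 * x - p : ℝ) * (2 * Real.pi / (3 * x - p) : ℝ)) = 1 := by
    rw [← Complex.exp_two_pi_mul_I]
    congr 1
    rw [ofReal_div, mul_assoc, mul_div_cancel₀ _ hμ']
    push_cast
    ring
  refine ⟨Complex.exp (I * (-x + p / 3) * (2 * Real.pi / (3 * x - p) : ℝ)), ?_⟩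
  rw [hX, matrix_exp_of_mul_self (mul_ne_zero I_ne_zero hμ') hZ, he]
  simp

theorem exp_second {x p : ℝ} (hκ : κ ^ 2 = 1) (hm : 0 < (x - p) ^ 2 + κ) :
    NormedSpace.exp ((2 * Real.pi / √((x - p) ^ 2 + κ)) •
      lieElt κ 0 0 (-(I * (κ * (x - p)))) 0 κ) = 1 := by
  have hκ' := ofReal_sq_eq_one hκ
  have hs : √((x - p) ^ 2 + κ) ≠ 0 := (Real.sqrt_pos.2 hm).ne'
  have hsq : ((√((x - p) ^ 2 + κ) : ℝ) : ℂ) ^ 2 = (x - p) ^ 2 + κ := by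
    rw [← ofReal_pow, Real.sq_sqrt hm.le]
    push_cast
    ring
  have hX : lieElt κ 0 0 (-(I * (κ * (x - p)))) 0 κ * lieElt κ 0 0 (-(I * (κ * (x - p)))) 0 κ
      * lieElt κ 0 0 (-(I * (κ * (x - p)))) 0 κ
      = -((√((x - p) ^ 2 + κ) : ℝ) : ℂ) ^ 2 • lieElt κ 0 0 (-(I * (κ * (x - p)))) 0 κ := by
    rw [hsq, lieElt, mat3_mul, mat3_mul, mat3_csmul, mat3_inj]
    have hI : I ^ 2 = -1 := I_sq
    simp only [map_neg, map_mul, map_sub, map_zero, conj_I, conj_ofReal, ofReal_zero]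
    clear hκ hm
    generalize (κ : ℂ) = k at *
    refine ⟨?_, ?_, ?_, ?_, ?_, ?_, ?_, ?_, ?_⟩ <;> clear hsq hs <;> grind
  exact matrix_exp_two_pi_div hs hX

theorem not_commute_exp_deformed {x r : ℝ} {μ : ℝ} (hκ : κ ^ 2 = 1) (hr : r ^ 2 = 1 / 2) (hx : x ≠ 0)
    (hμ : μ ≠ 0) (hn : ∀ n : ℤ, x ^ 2 + κ ≠ n ^ 2 * μ ^ 2) :
    ¬ Commute (NormedSpace.exp ((2 * Real.pi / μ) • lieElt κ x (-x) 0 r (-(r * κ)))) base := by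
  intro H
  have hκ' := ofReal_sq_eq_one hκ
  have hr' : (r : ℂ) ^ 2 = 1 / 2 := by rw [← ofReal_pow, hr]; simp
  have hr0 : (r : ℂ) ≠ 0 := by
    intro h; rw [h] at hr'; norm_num at hr'
  have hκ0 : (κ : ℂ) ≠ 0 := by
    intro h; rw [h] at hκ'; norm_num at hκ'
  have hx0 : (x : ℂ) ≠ 0 := by exact_mod_cast hx
  obtain ⟨m, hm⟩ := IsAlgClosed.exists_eq_mul_self ((x : ℂ) ^ 2 + κ)
  have hm0 : m ≠ 0 := by
    rintro rfl
    have h0 := hn 0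
    apply h0
    rw [mul_zero] at hm
    have : x ^ 2 + κ = 0 := by exact_mod_cast hm
    rw [this]; simp
  have hX : lieElt κ x (-x) 0 r (-(r * κ)) * lieElt κ x (-x) 0 r (-(r * κ))
      * lieElt κ x (-x) 0 r (-(r * κ)) = -(m ^ 2) • lieElt κ x (-x) 0 r (-(r * κ)) := by
    rw [sq, ← hm, lieElt, mat3_mul, mat3_mul, mat3_csmul, mat3_inj]
    have hI : I ^ 2 = -1 := I_sq
    simp only [map_neg, map_mul, map_zero, conj_ofReal, ofReal_neg]
    clear hκ hr hr0 hκ0 hx0 hx hn H hm hm0 hμ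
    generalize (κ : ℂ) = k at *
    refine ⟨?_, ?_, ?_, ?_, ?_, ?_, ?_, ?_, ?_⟩ <;> grind
  rw [matrix_exp_of_cube hm0 hX] at H
  generalize hα : Complex.sin (m * (2 * Real.pi / μ : ℝ)) / m = α at H
  generalize hβ : (1 - Complex.cos (m * (2 * Real.pi / μ : ℝ))) / m ^ 2 = β at H
  rw [lieElt, one_eq_mat3, mat3_mul, mat3_csmul, mat3_csmul, mat3_add, mat3_add] at H
  obtain ⟨h1, h2⟩ := eq_zero_of_commute_base H
  simp only [map_zero, ofReal_neg, neg_zero, zero_mul, add_zero, zero_add] at h1 h2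
  have hα0 : α = 0 := by
    have h3 : (r * κ) * (2 * α) = 0 := by linear_combination κ * h1 - h2
    simpa [hr0, hκ0] using h3
  have hβ0 : β = 0 := by
    rw [hα0] at h1
    simpa [hr0, hx0] using h1
  rw [← hα, div_eq_zero_iff, or_iff_left hm0] at hα0
  rw [← hβ, div_eq_zero_iff, or_iff_left (pow_ne_zero 2 hm0), sub_eq_zero] at hβ0
  have he : Complex.exp (m * (2 * Real.pi / μ : ℝ) * I) = 1 := by
    rw [Complex.exp_mul_I, hα0, ← hβ0]; ring
  obtain ⟨n, hn'⟩ := Complex.exp_eq_one_iff.1 he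
  have hpi : (Real.pi : ℂ) ≠ 0 := by exact_mod_cast Real.pi_ne_zero
  have hμ0 : (μ : ℂ) ≠ 0 := by exact_mod_cast hμ
  have h3 : m = n * μ := by
    have h4 : m * (2 * Real.pi / μ) = n * (2 * Real.pi) := by
      apply mul_right_cancel₀ I_ne_zero
      push_cast at hn'
      linear_combination hn'
    field_simp at h4
    linear_combination h4
  apply hn n
  have h5 : ((x : ℂ) ^ 2 + κ) = n ^ 2 * μ ^ 2 := by rw [hm, h3]; ring
  exact_mod_cast h5

/-- A homogeneous torus in the projective or the hyperbolic plane. -/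
def torusData (hκ : κ ^ 2 = 1) {x p : ℝ} (hx : 2 * x * (x - p) = κ) (hμ : 3 * x - p ≠ 0)
    (hm : 0 < (x - p) ^ 2 + κ) (hn : ∀ n : ℤ, x ^ 2 + κ ≠ n ^ 2 * (3 * x - p) ^ 2) :
    (hermitianModel hκ).TorusData :=
  have hκ' := ofReal_sq_eq_one hκ
  have hx' : (2 * x * (x - p) : ℂ) = κ := by exact_mod_cast hx
  have hx0 : x ≠ 0 := by
    rintro rfl
    rw [mul_zero, zero_mul] at hx
    rw [← hx] at hκ
    norm_num at hκ
  have e₁ : lieElt κ x (-x) 0 0 0 + frame κ 0 + p • base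
      = lieElt κ (x + p / 3) (-x + p / 3) 0 1 0 := by
    rw [frame_zero, base_eq (κ := κ), smul_lieElt, add_lieElt, add_lieElt]
    congr 1
    · ring
    · ring
    · simp
    · simp
    · simp
  have e₂ : lieElt κ 0 0 (-(I * (κ * (x - p)))) 0 0 + frame κ 1 + (0 : ℝ) • base
      = lieElt κ 0 0 (-(I * (κ * (x - p)))) 0 κ := by
    rw [frame_one hκ, base_eq (κ := κ), smul_lieElt, add_lieElt, add_lieElt]
    simp
  have e₃ : lieElt κ x (-x) 0 0 0 + (√2 / 2) • (frame κ 0 - frame κ 1) - (0 : ℝ) • base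
      = lieElt κ x (-x) 0 (√2 / 2 : ℝ) (-((√2 / 2 : ℝ) * κ)) := by
    rw [frame_zero, frame_one hκ, zero_smul, sub_zero, sub_eq_add_neg, neg_lieElt, add_lieElt,
      smul_lieElt, add_lieElt]
    simp
  { P := lieElt κ x (-x) 0 0 0
    Q := lieElt κ 0 0 (-(I * (κ * (x - p)))) 0 0
    p := p
    q := 0
    T₁ := 2 * Real.pi / (3 * x - p)
    T₂ := 2 * Real.pi / √((x - p) ^ 2 + κ)
    P_mem := lieElt_mem _ _ _ _ _
    Q_mem := lieElt_mem _ _ _ _ _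
    τ_P := by
      refine (tau_lieElt hκ _ _ _ _ _).trans ?_
      simp
    τ_Q := by
      refine (tau_lieElt hκ _ _ _ _ _).trans ?_
      simp
    commute := by
      refine (congrArg₂ Commute e₁ e₂).mpr ?_
      change lieElt _ _ _ _ _ _ * lieElt _ _ _ _ _ _ = lieElt _ _ _ _ _ _ * lieElt _ _ _ _ _ _
      rw [lieElt, lieElt, mat3_mul, mat3_mul, mat3_inj]
      have hI : I ^ 2 = -1 := I_sq
      simp only [map_neg, map_mul, map_sub, map_zero, map_one, conj_I, conj_ofReal, ofReal_add,
        ofReal_neg, ofReal_zero, ofReal_div, ofReal_ofNat]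
      clear e₁ e₂ e₃ hx hκ hm hn hμ hx0
      generalize (κ : ℂ) = k at *
      refine ⟨?_, ?_, ?_, ?_, ?_, ?_, ?_, ?_, ?_⟩ <;> grind
    T₁_ne_zero := div_ne_zero Real.two_pi_pos.ne' hμ
    T₂_ne_zero := div_ne_zero Real.two_pi_pos.ne' (Real.sqrt_pos.2 hm).ne'
    commute_exp₁ := by
      obtain ⟨c, hc⟩ := commute_exp_first hx hμ
      refine (congrArg₂ Commute ((congrArg (fun X => NormedSpace.exp
        ((2 * Real.pi / (3 * x - p)) • X)) e₁).trans hc.symm) rfl).mpr ?_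
      change c • (1 : Matrix (Fin 2 ⊕ Fin 1) (Fin 2 ⊕ Fin 1) ℂ) * base = base * c • 1
      rw [Matrix.smul_mul, Matrix.mul_smul, one_mul, mul_one]
    commute_exp₂ := by
      refine (congrArg₂ Commute ((congrArg (fun X => NormedSpace.exp
        ((2 * Real.pi / √((x - p) ^ 2 + κ)) • X)) e₂).trans (exp_second hκ hm)) rfl).mpr ?_
      exact Commute.one_left _
    not_commute := by
      intro H
      refine not_commute_exp_deformed hκ sq_sqrt_two_div_two hx0 hμ hn ?_
      exact (congrArg₂ Commute (congrArg (fun X => NormedSpace.exp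
        ((2 * Real.pi / (3 * x - p)) • X)) e₃) rfl).mp H }

end ProjectiveFamily

end

noncomputable section

namespace ProductFamily

variable {κ : ℝ}

theorem four_add_pos (hκ : κ ^ 2 = 1) : 0 < 4 + κ := by nlinarith

theorem ofReal_sqrt_four_add_sq (hκ : κ ^ 2 = 1) : ((√(4 + κ) : ℝ) : ℂ) ^ 2 = 4 + κ := by
  rw [← ofReal_pow, Real.sq_sqrt (four_add_pos hκ).le]
  push_cast
  ring

theorem exp_first (hκ : κ ^ 2 = 1) :
    NormedSpace.exp ((2 * Real.pi / √(4 + κ)) • lieElt κ 2 1 0 0) = 1 := by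
  have h : lieElt₁ κ 2 1 * lieElt₁ κ 2 1 * lieElt₁ κ 2 1 = -(4 + κ : ℂ) • lieElt₁ κ 2 1 := by
    have hI : I ^ 2 = -1 := I_sq
    rw [lieElt₁, mat2_mul, mat2_mul, mat2_csmul, mat2_inj]
    simp only [map_one, ofReal_ofNat]
    refine ⟨?_, ?_, ?_, ?_⟩ <;> grind
  refine matrix_exp_two_pi_div (Real.sqrt_pos.2 (four_add_pos hκ)).ne' ?_
  rw [ofReal_sqrt_four_add_sq hκ, lieElt, lieElt₁_zero, Matrix.fromBlocks_multiply,
    Matrix.fromBlocks_multiply, Matrix.fromBlocks_smul]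
  simp only [mul_zero, zero_mul, add_zero, smul_zero, h]

theorem exp_second (hκ : κ ^ 2 = 1) :
    NormedSpace.exp ((2 * Real.pi / √(4 + κ)) • lieElt κ 0 0 2 κ) = 1 := by
  have h : lieElt₁ κ 2 κ * lieElt₁ κ 2 κ * lieElt₁ κ 2 κ = -(4 + κ : ℂ) • lieElt₁ κ 2 κ := by
    have hI : I ^ 2 = -1 := I_sq
    have hκ' := ofReal_sq_eq_one hκ
    rw [lieElt₁, mat2_mul, mat2_mul, mat2_csmul, mat2_inj]
    simp only [conj_ofReal, ofReal_ofNat]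
    clear hκ
    generalize (κ : ℂ) = k at *
    refine ⟨?_, ?_, ?_, ?_⟩ <;> grind
  refine matrix_exp_two_pi_div (Real.sqrt_pos.2 (four_add_pos hκ)).ne' ?_
  rw [ofReal_sqrt_four_add_sq hκ, lieElt, lieElt₁_zero, Matrix.fromBlocks_multiply,
    Matrix.fromBlocks_multiply, Matrix.fromBlocks_smul]
  simp only [mul_zero, zero_mul, add_zero, zero_add, smul_zero, h]

theorem eq_zero_of_commute_base₁ {a b c d : ℂ} (H : Commute (mat2 a b c d) base₁) : b = 0 := by
  have := H.eq
  rw [base₁, mat2_mul, mat2_mul, mat2_inj] at this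
  linear_combination -I * this.2.1 + b * I_mul_I

theorem not_commute_exp_deformed {r a : ℝ} (hκ : κ ^ 2 = 1) (hr : r ^ 2 = 1 / 2)
    (hn : ∀ n : ℤ, 2 * κ ≠ n ^ 2 * (4 + κ)) :
    ¬ Commute (NormedSpace.exp ((2 * Real.pi / √(4 + κ)) • lieElt κ 0 r a (-(r * κ)))) base := by
  intro H
  have hκ' := ofReal_sq_eq_one hκ
  have hr' : (r : ℂ) ^ 2 = 1 / 2 := by rw [← ofReal_pow, hr]; simp
  have hr0 : (r : ℂ) ≠ 0 := by
    intro h; rw [h] at hr'; norm_num at hr'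
  have hκ0 : (κ : ℂ) ≠ 0 := by
    intro h; rw [h] at hκ'; norm_num at hκ'
  obtain ⟨m, hm⟩ := IsAlgClosed.exists_eq_mul_self ((κ : ℂ) / 2)
  have hm0 : m ≠ 0 := by
    rintro rfl
    apply hκ0
    linear_combination 2 * hm
  set Z : Matrix (Fin 2 ⊕ Fin 2) (Fin 2 ⊕ Fin 2) ℂ := Matrix.fromBlocks 1 0 0 0 with hZ
  have hZX : Z * lieElt κ 0 r a (-(r * κ)) = Matrix.fromBlocks (lieElt₁ κ 0 r) 0 0 0 := by
    rw [hZ, lieElt, Matrix.fromBlocks_multiply]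
    simp
  have hX : Z * lieElt κ 0 r a (-(r * κ)) * lieElt κ 0 r a (-(r * κ)) = -(m ^ 2) • Z := by
    have h : lieElt₁ κ 0 r * lieElt₁ κ 0 r = -(m ^ 2) • 1 := by
      rw [sq, ← hm, lieElt₁, mat2_mul, one_eq_mat2, mat2_csmul, mat2_inj]
      simp only [conj_ofReal, ofReal_zero]
      refine ⟨?_, ?_, ?_, ?_⟩ <;> grind
    rw [hZX, lieElt, Matrix.fromBlocks_multiply, hZ, Matrix.fromBlocks_smul]
    simp only [mul_zero, zero_mul, add_zero, smul_zero, h]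
  have hZb : Commute Z base := by
    change Z * base = base * Z
    rw [hZ, base, Matrix.fromBlocks_multiply, Matrix.fromBlocks_multiply]
    simp
  have H' := hZb.mul_left H
  rw [matrix_mul_exp_of_sq hm0 hX, hZX, hZ] at H'
  generalize hα : Complex.sin (m * (2 * Real.pi / √(4 + κ) : ℝ)) / m = α at H'
  generalize Complex.cos (m * (2 * Real.pi / √(4 + κ) : ℝ)) = β at H'
  have H'' : Commute (β • (1 : Matrix (Fin 2) (Fin 2) ℂ) + α • lieElt₁ κ 0 r) base₁ := by
    have := H'.eq
    rw [Matrix.fromBlocks_smul, Matrix.fromBlocks_smul, Matrix.fromBlocks_add, base,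
      Matrix.fromBlocks_multiply, Matrix.fromBlocks_multiply, Matrix.fromBlocks_inj] at this
    simp only [mul_zero, zero_mul, add_zero, smul_zero] at this
    exact this.1
  rw [lieElt₁, one_eq_mat2, mat2_csmul, mat2_csmul, mat2_add] at H''
  have h1 := eq_zero_of_commute_base₁ H''
  have hα0 : α = 0 := by simpa [hr0] using h1
  rw [← hα, div_eq_zero_iff, or_iff_left hm0, Complex.sin_eq_zero_iff] at hα0
  obtain ⟨n, hn'⟩ := hα0
  have hpi : (Real.pi : ℂ) ≠ 0 := by exact_mod_cast Real.pi_ne_zero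
  have hs := ofReal_sqrt_four_add_sq hκ
  have hs0 : ((√(4 + κ) : ℝ) : ℂ) ≠ 0 := by
    exact_mod_cast (Real.sqrt_pos.2 (four_add_pos hκ)).ne'
  have h3 : 2 * m = n * (√(4 + κ) : ℝ) := by
    push_cast at hn'
    field_simp at hn'
    linear_combination hn'
  apply hn n
  have h5 : 2 * (κ : ℂ) = n ^ 2 * (4 + κ) := by
    linear_combination 4 * hm + (2 * m + n * (√(4 + κ) : ℝ)) * h3 + n ^ 2 * hs
  exact_mod_cast h5

/-- A homogeneous torus in the product of two spheres or of two hyperbolic discs. -/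
def torusData (hκ : κ ^ 2 = 1) (hn : ∀ n : ℤ, 2 * κ ≠ n ^ 2 * (4 + κ)) :
    (hermitianModel hκ).TorusData :=
  have e₁ : lieElt κ 1 0 (-1) 0 + frame κ 0 + (-2 : ℝ) • base = lieElt κ 2 1 0 0 := by
    rw [frame_zero, base_eq (κ := κ), smul_lieElt, add_lieElt, add_lieElt]
    congr 1 <;> norm_num
  have e₂ : lieElt κ (-1) 0 1 0 + frame κ 1 + (-2 : ℝ) • base = lieElt κ 0 0 2 κ := by
    rw [frame_one hκ, base_eq (κ := κ), smul_lieElt, add_lieElt, add_lieElt]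
    congr 1 <;> norm_num
  have e₃ : lieElt κ 1 0 (-1) 0 + (√2 / 2) • (frame κ 0 - frame κ 1) - (-2 : ℝ) • base
      = lieElt κ 0 (√2 / 2 : ℝ) (-2) (-((√2 / 2 : ℝ) * κ)) := by
    rw [frame_zero, frame_one hκ, base_eq (κ := κ), sub_eq_add_neg (lieElt κ 0 1 0 0),
      neg_lieElt, add_lieElt, smul_lieElt, smul_lieElt, add_lieElt, sub_eq_add_neg, neg_lieElt,
      add_lieElt]
    congr 1 <;> norm_num
  { P := lieElt κ 1 0 (-1) 0
    Q := lieElt κ (-1) 0 1 0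
    p := -2
    q := -2
    T₁ := 2 * Real.pi / √(4 + κ)
    T₂ := 2 * Real.pi / √(4 + κ)
    P_mem := lieElt_mem _ _ _ _
    Q_mem := lieElt_mem _ _ _ _
    τ_P := by
      refine (tau_lieElt hκ _ _ _ _).trans ?_
      simp
    τ_Q := by
      refine (tau_lieElt hκ _ _ _ _).trans ?_
      simp
    commute := by
      refine (congrArg₂ Commute e₁ e₂).mpr ?_
      change lieElt _ _ _ _ _ * lieElt _ _ _ _ _ = lieElt _ _ _ _ _ * lieElt _ _ _ _ _
      rw [lieElt, lieElt, lieElt₁_zero, Matrix.fromBlocks_multiply, Matrix.fromBlocks_multiply]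
      simp
    T₁_ne_zero := div_ne_zero Real.two_pi_pos.ne' (Real.sqrt_pos.2 (four_add_pos hκ)).ne'
    T₂_ne_zero := div_ne_zero Real.two_pi_pos.ne' (Real.sqrt_pos.2 (four_add_pos hκ)).ne'
    commute_exp₁ := by
      refine (congrArg₂ Commute ((congrArg (fun X => NormedSpace.exp
        ((2 * Real.pi / √(4 + κ)) • X)) e₁).trans (exp_first hκ)) rfl).mpr ?_
      exact Commute.one_left _
    commute_exp₂ := by
      refine (congrArg₂ Commute ((congrArg (fun X => NormedSpace.exp
        ((2 * Real.pi / √(4 + κ)) • X)) e₂).trans (exp_second hκ)) rfl).mpr ?_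
      exact Commute.one_left _
    not_commute := by
      intro H
      refine not_commute_exp_deformed (a := -2) hκ sq_sqrt_two_div_two hn ?_
      exact (congrArg₂ Commute (congrArg (fun X => NormedSpace.exp
        ((2 * Real.pi / √(4 + κ)) • X)) e₃) rfl).mp H }

end ProductFamily

end

noncomputable section

namespace EuclideanPlane

theorem exp_eq_one {Z : Matrix (Fin 2 ⊕ Fin 1) (Fin 2 ⊕ Fin 1) ℂ} (hZ : Z * Z = I • Z) :
    NormedSpace.exp ((2 * Real.pi) • Z) = 1 := by
  have := matrix_exp_of_mul_self (c₀ := 0) I_ne_zero hZ (2 * Real.pi)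
  rw [zero_smul, zero_add] at this
  rw [this]
  have h : Complex.exp (I * (2 * Real.pi : ℝ)) = 1 := by
    rw [← Complex.exp_two_pi_mul_I]
    congr 1
    push_cast
    ring
  rw [h]
  simp

theorem not_commute_exp_deformed {r y t : ℝ} (hr : r ≠ 0) (ht : t ≠ 0) :
    ¬ Commute (NormedSpace.exp (t • lieElt 0 y 0 r (-r))) base := by
  intro H
  set Z : Matrix (Fin 2 ⊕ Fin 1) (Fin 2 ⊕ Fin 1) ℂ := mat3 1 0 0 0 0 0 0 0 0 with hZ
  have hZX : Z * lieElt 0 y 0 r (-r) = mat3 0 0 r 0 0 0 0 0 0 := by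
    rw [hZ, lieElt, mat3_mul, mat3_inj]
    simp
  have hX : Z * lieElt 0 y 0 r (-r) * lieElt 0 y 0 r (-r) = 0 := by
    rw [hZX, lieElt, mat3_mul, zero_eq_lieElt, lieElt, mat3_inj]
    simp
  have hZb : Commute Z base := by
    change Z * base = base * Z
    rw [hZ, base, mat3_mul, mat3_mul, mat3_inj]
    simp
  have H' := (hZb.mul_left H).eq
  rw [matrix_mul_exp_of_sq_eq_zero hX, hZX, hZ, mat3_csmul, mat3_add, base, mat3_mul, mat3_mul,
    mat3_inj] at H'
  have h1 := H'.2.2.1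
  simp [hr, ht] at h1

/-- A homogeneous torus in the Euclidean plane: the product of two circles. -/
def torusData : hermitianModel.TorusData :=
  have e₁ : lieElt (1 / 2) (-1 / 2) 0 0 0 + frame 0 + (1 / 2 : ℝ) • base = lieElt 1 0 0 1 0 := by
    rw [frame_zero, base_eq, smul_lieElt, add_lieElt, add_lieElt]
    congr 1 <;> norm_num
  have e₂ : lieElt (-1 / 2) (1 / 2) 0 0 0 + frame 1 + (1 / 2 : ℝ) • base = lieElt 0 1 0 0 1 := by
    rw [frame_one, base_eq, smul_lieElt, add_lieElt, add_lieElt]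
    congr 1 <;> norm_num
  have e₃ : lieElt (1 / 2) (-1 / 2) 0 0 0 + (√2 / 2) • (frame 0 - frame 1) - (1 / 2 : ℝ) • base
      = lieElt 0 (-1) 0 (√2 / 2 : ℝ) (-(√2 / 2 : ℝ)) := by
    rw [frame_zero, frame_one, base_eq, sub_eq_add_neg (lieElt 0 0 0 1 0), neg_lieElt,
      add_lieElt, smul_lieElt, smul_lieElt, add_lieElt, sub_eq_add_neg, neg_lieElt, add_lieElt]
    congr 1 <;> norm_num
  { P := lieElt (1 / 2) (-1 / 2) 0 0 0
    Q := lieElt (-1 / 2) (1 / 2) 0 0 0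
    p := 1 / 2
    q := 1 / 2
    T₁ := 2 * Real.pi
    T₂ := 2 * Real.pi
    P_mem := lieElt_mem _ _ _ _ _
    Q_mem := lieElt_mem _ _ _ _ _
    τ_P := by
      refine (tau_lieElt _ _ _ _ _).trans ?_
      congr 1 <;> norm_num
    τ_Q := by
      refine (tau_lieElt _ _ _ _ _).trans ?_
      congr 1 <;> norm_num
    commute := by
      refine (congrArg₂ Commute e₁ e₂).mpr ?_
      change lieElt _ _ _ _ _ * lieElt _ _ _ _ _ = lieElt _ _ _ _ _ * lieElt _ _ _ _ _
      rw [lieElt, lieElt, mat3_mul, mat3_mul, mat3_inj]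
      simp
    T₁_ne_zero := Real.two_pi_pos.ne'
    T₂_ne_zero := Real.two_pi_pos.ne'
    commute_exp₁ := by
      refine (congrArg₂ Commute ((congrArg (fun X => NormedSpace.exp
        ((2 * Real.pi) • X)) e₁).trans (exp_eq_one ?_)) rfl).mpr ?_
      · rw [lieElt, mat3_mul, mat3_csmul, mat3_inj]
        simp
      · exact Commute.one_left _
    commute_exp₂ := by
      refine (congrArg₂ Commute ((congrArg (fun X => NormedSpace.exp
        ((2 * Real.pi) • X)) e₂).trans (exp_eq_one ?_)) rfl).mpr ?_
      · rw [lieElt, mat3_mul, mat3_csmul, mat3_inj]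
        simp
      · exact Commute.one_left _
    not_commute := by
      intro H
      refine not_commute_exp_deformed (r := √2 / 2) (y := -1) (by positivity)
        Real.two_pi_pos.ne' ?_
      exact (congrArg₂ Commute (congrArg (fun X => NormedSpace.exp
        ((2 * Real.pi) • X)) e₃) rfl).mp H }

end EuclideanPlane

end

noncomputable section

namespace ProjectiveFamily

/-- A homogeneous torus in the complex projective plane. -/
def projectiveTorus : (hermitianModel (κ := 1) (by norm_num)).TorusData :=
  torusData _ (x := 1 / 2) (p := -1 / 2) (by norm_num) (by norm_num) (by norm_num) fun n h => by
    have h1 : (16 * n ^ 2 : ℝ) = 5 := by linarith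
    have h2 : 16 * n ^ 2 = 5 := by exact_mod_cast h1
    omega

/-- A homogeneous torus in the complex hyperbolic plane. -/
def hyperbolicTorus : (hermitianModel (κ := -1) (by norm_num)).TorusData :=
  torusData _ (x := 1 / 4) (p := 9 / 4) (by norm_num) (by norm_num) (by norm_num) fun n h => by
    nlinarith [sq_nonneg (n : ℝ)]

end ProjectiveFamily

namespace ProductFamily

/-- A homogeneous torus in the product of two spheres. -/
def biProjectiveTorus : (hermitianModel (κ := 1) (by norm_num)).TorusData :=
  torusData _ fun n h => by
    have h1 : (5 * n ^ 2 : ℝ) = 2 := by linarith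
    have h2 : 5 * n ^ 2 = 2 := by exact_mod_cast h1
    omega

/-- A homogeneous torus in the product of two hyperbolic discs. -/
def biHyperbolicTorus : (hermitianModel (κ := -1) (by norm_num)).TorusData :=
  torusData _ fun n h => by
    nlinarith [sq_nonneg (n : ℝ)]

end ProductFamily

end

theorem mainTheorem3 (X : TargetSpace) :
    (∀ (L : Set ℂ) (f : ℂ → X.model.Mat), IsOpen L → X.model.IsHSL f L →
      (∀ z ∈ L, ∃ U : Set ℂ, IsOpen U ∧ SimplyConnectedSpace U ∧ z ∈ U ∧ U ⊆ L ∧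
        ∃ F : ℂ → X.model.Mat, X.model.IsLagrangianLift F f U) ∧
      (∀ (U : Set ℂ) (F : ℂ → X.model.Mat), IsOpen U → SimplyConnectedSpace U → U ⊆ L →
        X.model.IsLagrangianLift F f U →
        ∀ (l : Circle) (z₀ : ℂ) (g₀ : X.model.Mat), z₀ ∈ U → g₀ ∈ X.model.G →
          ∃ Fl : ℂ → X.model.Mat,
            X.model.IsExtendedSolution F l Fl U ∧ Fl z₀ = g₀ ∧
            (∀ F' : ℂ → X.model.Mat, X.model.IsExtendedSolution F l F' U → F' z₀ = g₀ →
              Set.EqOn F' Fl U) ∧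
            X.model.IsLagrangianLift Fl (X.model.proj Fl) U ∧
            X.model.IsHSL (X.model.proj Fl) U ∧
            (l = 1 → g₀ = F z₀ → Set.EqOn Fl F U))) ∧
    (∃ (f F : ℂ → X.model.Mat) (ω₁ ω₂ : ℂ),
      LinearIndependent ℝ ![ω₁, ω₂] ∧
      X.model.IsHSL f Set.univ ∧ X.model.IsBiperiodic f ω₁ ω₂ ∧
      X.model.IsLagrangianLift F f Set.univ ∧
      {l : Circle | ∃ Fl : ℂ → X.model.Mat, X.model.IsExtendedSolution F l Fl Set.univ ∧
        X.model.IsBiperiodic (X.model.proj Fl) ω₁ ω₂}.Countable) := by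
  cases X with
  | euclidean =>
    exact ⟨fun L f hL hf => EuclideanPlane.isModelledOn.local_families hL hf, EuclideanPlane.isModelledOn.exists_torus EuclideanPlane.torusData⟩
  | projective =>
    exact ⟨fun L f hL hf => ProjectiveFamily.isModelledOn_projective.local_families hL hf, ProjectiveFamily.isModelledOn_projective.exists_torus ProjectiveFamily.projectiveTorus⟩
  | hyperbolic =>
    exact ⟨fun L f hL hf => ProjectiveFamily.isModelledOn_hyperbolic.local_families hL hf, ProjectiveFamily.isModelledOn_hyperbolic.exists_torus ProjectiveFamily.hyperbolicTorus⟩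
  | biProjective =>
    exact ⟨fun L f hL hf => ProductFamily.isModelledOn_biProjective.local_families hL hf, ProductFamily.isModelledOn_biProjective.exists_torus ProductFamily.biProjectiveTorus⟩
  | biHyperbolic =>
    exact ⟨fun L f hL hf => ProductFamily.isModelledOn_biHyperbolic.local_families hL hf, ProductFamily.isModelledOn_biHyperbolic.exists_torus ProductFamily.biHyperbolicTorus⟩
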